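/- Let $\mathbb S=\{z\in\mathbb C:0<\operatorname{Re}z<1\}$. Let $(X_0,X_1)$ be a couple of complex Banach spaces (both continuously, linearly and injectively embedded in a Banach space $\Sigma$) which is regular: $\Delta=X_0\cap X_1$, normed by $\max(\|x\|_0,\|x\|_1)$, is dense in $X_0$ and in $X_1$. Then $X_0^*$ and $X_1^*$ embed into $\Delta^*$ by restriction and form a Banach couple. For a Banach couple $(Y_0,Y_1)$ with containing space $\Sigma_Y$, let $\mathscr C(Y_0,Y_1)$ be the space of bounded analytic functions $f:\mathbb S\to\Sigma_Y$ that extend continuously to $\overline{\mathbb S}$ and such that $t\in\mathbb R\mapsto f(j+it)\in Y_j$ is continuous and bounded for $j=0,1$, with the norm $\|f\|=\sup\{\|f(j+it)\|_{Y_j}:t\in\mathbb R,\ j=0,1\}$, and let $\mathscr C_0(Y_0,Y_1)$ be the subspace of those $f$ with $\|f(j+it)\|_{Y_j}\to0$ as $|t|\to\infty$, $j=0,1$. For $\mathscr F=\mathscr C(Y_0,Y_1)$ or $\mathscr C_0(Y_0,Y_1)$, $n\ge1$ and $z\in\mathbb S$, let $$\mathscr F^{(n)}_z=\{(w_{n-1},\dots,w_0)\in\Sigma_Y^n:\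 \exists f\in\mathscr F,\ w_i=f^{(i)}(z)/i!\ \text{for } 0\le i<n\}$$ with the quotient norm $\|w\|=\inf\|f\|$ over all such $f$. Write $X_\zeta=\mathscr C(X_0,X_1)^{(1)}_\zeta$ for $\zeta\in\mathbb S$. For every $n\ge 1$ and $z\in\mathbb S$ there are constants $c,C>0$, depending only on $n$ and $z$, such that for every regular couple $(X_0,X_1)$ the following holds. Every $(x_{n-1},\dots,x_0)\in\Delta^n$ belongs to $\mathscr C_0(X_0,X_1)^{(n)}_z$, and there is exactly one bounded linear operator $$T_n:\mathscr C(X_0^*,X_1^*)^{(n)}_z\longrightarrow\big(\mathscr C_0(X_0,X_1)^{(n)}_z\big)^*$$ such that $$T_n(\xi_{n-1},\dots,\xi_0)(x_{n-1},\dots,x_0)=\sum_{j=0}^{n-1}\langle\xi_j,x_{n-j-1}\rangle$$ for all $(\xi_{n-1},\dots,\xi_0)\in\mathscr C(X_0^*,X_1^*)^{(n)}_z$ and all $x_j\in\Delta$. It satisfies $$\|T_n\|\le\operatorname{dist}(z,\partial\mathbb S)^{1-n},$$ and, for all $x\in\mathscr C_0(X_0,X_1)^{(n)}_z$, $$c\,\|x\|\le\sup\{|T_n(\xi)(x)|:\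 \xi\in\mathscr C(X_0^*,X_1^*)^{(n)}_z,\ \|\xi\|\le1\}\le C\,\|x\|.$$ If $X_\zeta$ is reflexive for some $\zeta\in\mathbb S$, which is always the case if $X_0$ or $X_1$ is reflexive, then $T_n$ is an isomorphism (a linear homeomorphism onto) for every $n$ and $z$. The same holds if $X_0$ or $X_1$ is an Asplund space. -/

import Mathlib

open Complex Set Filter Topology BoundedContinuousFunction

noncomputable section

/-- The open unit strip `{z | 0 < re z < 1}`. -/
abbrev unitStrip : Set ℂ := re ⁻¹' Ioo 0 1

/-- The closed unit strip `{z | 0 ≤ re z ≤ 1}`. -/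
abbrev closedUnitStrip : Set ℂ := re ⁻¹' Icc 0 1

/-- A Banach space is reflexive if its canonical map into the bidual is onto. -/
def IsReflexiveSpace (X : Type*) [NormedAddCommGroup X] [NormedSpace ℂ X] : Prop :=
  Function.Surjective (NormedSpace.inclusionInDoubleDual ℂ X)

/-- Asplund spaces: every continuous convex real function on an open convex set is Fréchet
differentiable at the points of a dense `Gδ` subset of that set. -/
def IsAsplund (X : Type*) [NormedAddCommGroup X] [NormedSpace ℂ X] : Prop :=
  ∀ (U : Set X) (φ : X → ℝ), IsOpen U → ConvexOn ℝ U φ → ContinuousOn φ U →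
    ∃ G : Set X, G ⊆ U ∧ IsGδ G ∧ U ⊆ closure G ∧ ∀ x ∈ G, DifferentiableAt ℝ φ x

/-- A couple: `X₀` and `X₁` continuously and linearly embedded into a third space `E`. -/
structure BanachCouple (X₀ X₁ E : Type*)
    [NormedAddCommGroup X₀] [NormedSpace ℂ X₀] [NormedAddCommGroup X₁] [NormedSpace ℂ X₁]
    [NormedAddCommGroup E] [NormedSpace ℂ E] where
  i₀ : X₀ →L[ℂ] E
  i₁ : X₁ →L[ℂ] E
  injective₀ : Function.Injective i₀
  injective₁ : Function.Injective i₁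

namespace BanachCouple

variable {X₀ X₁ E : Type*}
  [NormedAddCommGroup X₀] [NormedSpace ℂ X₀] [NormedAddCommGroup X₁] [NormedSpace ℂ X₁]
  [NormedAddCommGroup E] [NormedSpace ℂ E]

/-- The intersection `Δ = X₀ ∩ X₁`: the pairs `(x₀, x₁)` with the same image in `E`. As a subspace
of `X₀ × X₁` it carries the norm `max (‖x‖₀, ‖x‖₁)`. -/
def inter (c : BanachCouple X₀ X₁ E) : Submodule ℂ (X₀ × X₁) where
  carrier := {p | c.i₀ p.1 = c.i₁ p.2}
  add_mem' := by
    intro p q hp hq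
    simp only [mem_ofPred_eq] at hp hq
    simp [hp, hq]
  zero_mem' := by simp
  smul_mem' := by
    intro a p hp
    simp only [mem_ofPred_eq] at hp
    simp [hp]

/-- The inclusion `Δ → X₀`. -/
def interTo₀ (c : BanachCouple X₀ X₁ E) : c.inter →L[ℂ] X₀ :=
  (ContinuousLinearMap.fst ℂ X₀ X₁).comp c.inter.subtypeL

/-- The inclusion `Δ → X₁`. -/
def interTo₁ (c : BanachCouple X₀ X₁ E) : c.inter →L[ℂ] X₁ :=
  (ContinuousLinearMap.snd ℂ X₀ X₁).comp c.inter.subtypeL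

/-- The inclusion `Δ → E`. -/
def interTo (c : BanachCouple X₀ X₁ E) : c.inter →L[ℂ] E := c.i₀.comp c.interTo₀

/-- A couple is regular if the intersection is dense in each of the two spaces. -/
def IsRegular (c : BanachCouple X₀ X₁ E) : Prop :=
  DenseRange c.interTo₀ ∧ DenseRange c.interTo₁

/-- The couple `(X₀*, X₁*)` of a regular couple, both spaces being embedded into `Δ*` by restriction
of functionals. -/
def dual (c : BanachCouple X₀ X₁ E) (hc : c.IsRegular) :
    BanachCouple (StrongDual ℂ X₀) (StrongDual ℂ X₁) (StrongDual ℂ c.inter) where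
  i₀ := (ContinuousLinearMap.compL ℂ c.inter X₀ ℂ).flip c.interTo₀
  i₁ := (ContinuousLinearMap.compL ℂ c.inter X₁ ℂ).flip c.interTo₁
  injective₀ := by
    intro ξ η h
    have h' : ⇑ξ ∘ c.interTo₀ = ⇑η ∘ c.interTo₀ := funext fun x => DFunLike.congr_fun h x
    exact DFunLike.coe_injective (hc.1.equalizer ξ.continuous η.continuous h')
  injective₁ := by
    intro ξ η h
    have h' : ⇑ξ ∘ c.interTo₁ = ⇑η ∘ c.interTo₁ := funext fun x => DFunLike.congr_fun h x
    exact DFunLike.coe_injective (hc.2.equalizer ξ.continuous η.continuous h')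

/-- The linear space underlying the Calderón space. A member is a function `f` on the closed strip
with values in `E` (represented as a function on `ℂ` by setting it to be `0` off the closed strip)
that is bounded and analytic in the open strip and continuous on the closed strip, together with
the (unique) bounded continuous functions `b₀ : ℝ → X₀`, `b₁ : ℝ → X₁` such that
`f (it) = b₀ t` and `f (1 + it) = b₁ t` in `E`. -/
def calderonSubmodule (c : BanachCouple X₀ X₁ E) :
    Submodule ℂ ((ℂ → E) × (ℝ →ᵇ X₀) × (ℝ →ᵇ X₁)) where
  carrier := {p | DiffContOnCl ℂ p.1 unitStrip ∧ (∃ K : ℝ, ∀ w ∈ unitStrip, ‖p.1 w‖ ≤ K) ∧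
    (∀ w ∉ closedUnitStrip, p.1 w = 0) ∧
    (∀ t : ℝ, p.1 (t * I) = c.i₀ (p.2.1 t)) ∧ (∀ t : ℝ, p.1 (1 + t * I) = c.i₁ (p.2.2 t))}
  add_mem' := by
    rintro p q ⟨hp1, ⟨K, hK⟩, hp2, hp3, hp4⟩ ⟨hq1, ⟨L, hL⟩, hq2, hq3, hq4⟩
    refine ⟨hp1.add hq1, ⟨K + L, fun w hw => ?_⟩, fun w hw => ?_, fun t => ?_, fun t => ?_⟩
    · exact (norm_add_le _ _).trans (add_le_add (hK w hw) (hL w hw))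
    · simp [hp2 w hw, hq2 w hw]
    · simp [hp3 t, hq3 t]
    · simp [hp4 t, hq4 t]
  zero_mem' := by
    refine ⟨diffContOnCl_const, ⟨0, fun w _ => ?_⟩, fun w _ => ?_, fun t => ?_, fun t => ?_⟩ <;>
      simp
  smul_mem' := by
    rintro a p ⟨hp1, ⟨K, hK⟩, hp2, hp3, hp4⟩
    refine ⟨hp1.const_smul a, ⟨‖a‖ * K, fun w hw => ?_⟩, fun w hw => ?_, fun t => ?_, fun t => ?_⟩
    · simpa [norm_smul] using mul_le_mul_of_nonneg_left (hK w hw) (norm_nonneg a)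
    · simp [hp2 w hw]
    · simp [hp3 t]
    · simp [hp4 t]

/-- The maximum principle on the strip. -/
theorem norm_le_of_mem_calderon (c : BanachCouple X₀ X₁ E)
    {p : (ℂ → E) × (ℝ →ᵇ X₀) × (ℝ →ᵇ X₁)} (hp : p ∈ c.calderonSubmodule) (w : ℂ) :
    ‖p.1 w‖ ≤ max ‖c.i₀‖ ‖c.i₁‖ * ‖p.2‖ := by
  obtain ⟨h1, ⟨K, hK⟩, h2, h3, h4⟩ := hp
  by_cases hw : w ∈ closedUnitStrip
  · refine PhragmenLindelof.vertical_strip h1 ?_ ?_ ?_ hw.1 hw.2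
    · refine ⟨0, by simp [Real.pi_pos], 0, ?_⟩
      refine Asymptotics.IsBigO.of_bound K ?_
      refine mem_inf_of_right ?_
      intro z hz
      simpa using hK z hz
    · intro z hz
      have hz' : z = z.im * I := by apply Complex.ext <;> simp [hz]
      rw [hz', h3]
      refine (c.i₀.le_opNorm _).trans ?_
      exact mul_le_mul (le_max_left _ _) ((p.2.1.norm_coe_le_norm _).trans (le_max_left _ _))
        (norm_nonneg _) ((norm_nonneg _).trans (le_max_left _ _))
    · intro z hz
      have hz' : z = 1 + z.im * I := by apply Complex.ext <;> simp [hz]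
      rw [hz', h4]
      refine (c.i₁.le_opNorm _).trans ?_
      exact mul_le_mul (le_max_right _ _) ((p.2.2.norm_coe_le_norm _).trans (le_max_right _ _))
        (norm_nonneg _) ((norm_nonneg _).trans (le_max_left _ _))
  · rw [h2 w hw, norm_zero]
    exact mul_nonneg ((norm_nonneg _).trans (le_max_left _ _)) (norm_nonneg _)

/-- The Calderón space `𝒞(X₀, X₁)`. -/
def Calderon (c : BanachCouple X₀ X₁ E) : Type _ := c.calderonSubmodule

namespace Calderon

variable {c : BanachCouple X₀ X₁ E}

instance : AddCommGroup c.Calderon := inferInstanceAs (AddCommGroup c.calderonSubmodule)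

instance : Module ℂ c.Calderon := inferInstanceAs (Module ℂ c.calderonSubmodule)

/-- The function on the strip. -/
def toFun (f : c.Calderon) : ℂ → E := f.1.1

/-- The boundary function `t ↦ f (it) ∈ X₀`. -/
def bdry₀ (f : c.Calderon) : ℝ →ᵇ X₀ := f.1.2.1

/-- The boundary function `t ↦ f (1 + it) ∈ X₁`. -/
def bdry₁ (f : c.Calderon) : ℝ →ᵇ X₁ := f.1.2.2

/-- The pair of boundary functions. -/
def bdry (c : BanachCouple X₀ X₁ E) : c.Calderon →ₗ[ℂ] (ℝ →ᵇ X₀) × (ℝ →ᵇ X₁) :=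
  (LinearMap.snd ℂ (ℂ → E) ((ℝ →ᵇ X₀) × (ℝ →ᵇ X₁))).comp c.calderonSubmodule.subtype

theorem bdry_injective (c : BanachCouple X₀ X₁ E) : Function.Injective (bdry c) := by
  refine (injective_iff_map_eq_zero _).2 fun f hf => ?_
  have hf' : f.1.2 = 0 := hf
  refine Subtype.ext (Prod.ext (funext fun w => ?_) hf')
  have := c.norm_le_of_mem_calderon f.2 w
  rw [hf', norm_zero, mul_zero] at this
  exact norm_le_zero_iff.1 this

/-- The norm of the Calderón space, `‖f‖ = sup {‖f (j + it)‖_j : t ∈ ℝ, j = 0, 1}`. -/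
instance : NormedAddCommGroup c.Calderon :=
  NormedAddCommGroup.induced c.Calderon ((ℝ →ᵇ X₀) × (ℝ →ᵇ X₁)) (bdry c) (bdry_injective c)

instance : NormedSpace ℂ c.Calderon :=
  NormedSpace.induced ℂ c.Calderon ((ℝ →ᵇ X₀) × (ℝ →ᵇ X₁)) (bdry c)

theorem norm_def (f : c.Calderon) : ‖f‖ = max ‖f.bdry₀‖ ‖f.bdry₁‖ := rfl

end Calderon

/-- The closed subspace `𝒞₀(X₀, X₁)` of those `f ∈ 𝒞(X₀, X₁)` such that `‖f (j + it)‖_j → 0` as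
`|t| → ∞`, for `j = 0, 1`. -/
def calderonZero (c : BanachCouple X₀ X₁ E) : Submodule ℂ c.Calderon where
  carrier := {f | Tendsto f.bdry₀ (cocompact ℝ) (𝓝 0) ∧ Tendsto f.bdry₁ (cocompact ℝ) (𝓝 0)}
  add_mem' := by
    rintro f g ⟨hf0, hf1⟩ ⟨hg0, hg1⟩
    exact ⟨by simpa using! hf0.add hg0, by simpa using! hf1.add hg1⟩
  zero_mem' := ⟨tendsto_const_nhds, tendsto_const_nhds⟩
  smul_mem' := by
    rintro a f ⟨hf0, hf1⟩
    exact ⟨by simpa using! hf0.const_smul a, by simpa using! hf1.const_smul a⟩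

section Rochberg

variable [CompleteSpace E] (c : BanachCouple X₀ X₁ E) (n : ℕ) (z : unitStrip)

theorem contDiffAt_toFun {c : BanachCouple X₀ X₁ E} (f : c.Calderon) (k : ℕ) :
    ContDiffAt ℂ k f.toFun z := by
  have hopen : IsOpen unitStrip := isOpen_Ioo.preimage continuous_re
  have h : DifferentiableOn ℂ f.toFun unitStrip := f.2.1.differentiableOn
  exact (h.analyticAt (hopen.mem_nhds z.2)).contDiffAt

/-- The list of Taylor coefficients of `f` at `z`; its `i`-th entry is `f⁽ⁱ⁾(z) / i!`, `0 ≤ i < n`. -/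
def taylor : c.Calderon →ₗ[ℂ] (Fin n → E) where
  toFun f i := ((i : ℕ).factorial : ℂ)⁻¹ • iteratedDeriv i f.toFun z
  map_add' f g := by
    funext i
    have : iteratedDeriv i (f + g).toFun (z : ℂ) =
        iteratedDeriv i f.toFun z + iteratedDeriv i g.toFun z :=
      iteratedDeriv_add (contDiffAt_toFun z f i) (contDiffAt_toFun z g i)
    simp [this]
  map_smul' a f := by
    funext i
    have : iteratedDeriv i (a • f).toFun (z : ℂ) = a • iteratedDeriv i f.toFun z :=
      iteratedDeriv_const_smul (contDiffAt_toFun z f i) a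
    simp [this, smul_comm a]

theorem continuous_taylor : Continuous (c.taylor n z) := by
  have hopen : IsOpen unitStrip := isOpen_Ioo.preimage continuous_re
  obtain ⟨R, hR, hball⟩ := Metric.nhds_basis_closedBall.mem_iff.1 (hopen.mem_nhds z.2)
  refine continuous_pi fun i => ?_
  set A : ℝ := max ‖c.i₀‖ ‖c.i₁‖
  let L : c.Calderon →ₗ[ℂ] E := (LinearMap.proj i).comp (c.taylor n z)
  refine (L.mkContinuous (A / R ^ (i : ℕ)) fun f => ?_).continuous
  have hd : DiffContOnCl ℂ f.toFun (Metric.ball (z : ℂ) R) :=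
    f.2.1.mono (Metric.ball_subset_closedBall.trans hball)
  have h := Complex.norm_iteratedDeriv_le_of_forall_mem_sphere_norm_le (i : ℕ) hR hd
    (fun w _ => c.norm_le_of_mem_calderon f.2 w)
  have hfac : (0 : ℝ) < ((i : ℕ).factorial : ℝ) := by positivity
  calc ‖L f‖ = ((i : ℕ).factorial : ℝ)⁻¹ * ‖iteratedDeriv i f.toFun z‖ := by
        simp [L, taylor, norm_smul]
    _ ≤ ((i : ℕ).factorial : ℝ)⁻¹ * ((i : ℕ).factorial * (A * ‖f‖) / R ^ (i : ℕ)) :=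
        mul_le_mul_of_nonneg_left h (by positivity)
    _ = A / R ^ (i : ℕ) * ‖f‖ := by field_simp

variable {c}

/-- The Rochberg space `ℱ_z⁽ⁿ⁾` of a subspace `ℱ` of `𝒞(X₀, X₁)`: the set of all
`(w_{n-1}, …, w₀)` in `Eⁿ` such that `w_i = f⁽ⁱ⁾(z) / i!` (`0 ≤ i < n`) for some `f ∈ ℱ`. -/
def Rochberg (ℱ : Submodule ℂ c.Calderon) (n : ℕ) (z : unitStrip) : Type _ :=
  LinearMap.range ((c.taylor n z).comp ℱ.subtype)

namespace Rochberg

variable {n z} {ℱ : Submodule ℂ c.Calderon}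

instance : AddCommGroup (Rochberg ℱ n z) :=
  inferInstanceAs (AddCommGroup (LinearMap.range ((c.taylor n z).comp ℱ.subtype)))

instance : Module ℂ (Rochberg ℱ n z) :=
  inferInstanceAs (Module ℂ (LinearMap.range ((c.taylor n z).comp ℱ.subtype)))

/-- The entries `w_i` of an element of the Rochberg space. -/
def coord (w : Rochberg ℱ n z) : Fin n → E := w.1

instance isClosed_ker :
    IsClosed (LinearMap.ker ((c.taylor n z).comp ℱ.subtype) : Set ℱ) :=
  isClosed_singleton.preimage ((c.continuous_taylor n z).comp continuous_subtype_val)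

/-- The identification of the Rochberg space with the quotient of `ℱ` by the subspace of those
functions whose Taylor coefficients of order less than `n` at `z` vanish. -/
def equivQuot (ℱ : Submodule ℂ c.Calderon) (n : ℕ) (z : unitStrip) :
    Rochberg ℱ n z ≃ₗ[ℂ] ℱ ⧸ LinearMap.ker ((c.taylor n z).comp ℱ.subtype) :=
  (LinearMap.quotKerEquivRange ((c.taylor n z).comp ℱ.subtype)).symm

/-- The quotient norm. -/
instance : NormedAddCommGroup (Rochberg ℱ n z) :=
  NormedAddCommGroup.induced (Rochberg ℱ n z)
    (ℱ ⧸ LinearMap.ker ((c.taylor n z).comp ℱ.subtype)) (equivQuot ℱ n z)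
    (equivQuot ℱ n z).injective

instance : NormedSpace ℂ (Rochberg ℱ n z) :=
  NormedSpace.induced ℂ (Rochberg ℱ n z)
    (ℱ ⧸ LinearMap.ker ((c.taylor n z).comp ℱ.subtype)) (equivQuot ℱ n z)

/-- The norm is the infimum of the norms of the functions of `ℱ` fitting in the definition. -/
theorem norm_eq (w : Rochberg ℱ n z) :
    ‖w‖ = sInf {r : ℝ | ∃ f ∈ ℱ, c.taylor n z f = w.coord ∧ r = ‖f‖} := by
  have key : ∀ f : ℱ, c.taylor n z f = w.coord ↔ Submodule.Quotient.mk f = equivQuot ℱ n z w := by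
    intro f
    let e := LinearMap.quotKerEquivRange ((c.taylor n z).comp ℱ.subtype)
    constructor
    · intro h
      have h' : e (Submodule.Quotient.mk f) = w := Subtype.ext h
      exact (e.symm_apply_apply _).symm.trans (congrArg e.symm h')
    · intro h
      have h' : e (Submodule.Quotient.mk f) = w :=
        (congrArg e h).trans (e.apply_symm_apply w)
      exact congrArg Subtype.val h'
  have hw : ‖w‖ = ‖equivQuot ℱ n z w‖ := rfl
  obtain ⟨f₀, hf₀⟩ := Submodule.Quotient.mk_surjective _ (equivQuot ℱ n z w)
  refine le_antisymm (le_csInf ⟨_, f₀, f₀.2, (key f₀).2 hf₀, rfl⟩ ?_)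
    (le_of_forall_pos_lt_add fun ε hε => ?_)
  · rintro r ⟨f, hf, hfw, rfl⟩
    rw [hw, ← (key ⟨f, hf⟩).1 hfw]
    exact Submodule.Quotient.norm_mk_le _ _
  · obtain ⟨f, hf, hfε⟩ := Submodule.Quotient.norm_mk_lt (equivQuot ℱ n z w) hε
    rw [hw]
    exact lt_of_le_of_lt (csInf_le ⟨0, by rintro r ⟨_, _, _, rfl⟩; exact norm_nonneg _⟩
      ⟨f.1, f.2, (key f).2 hf, rfl⟩) hfε

end Rochberg

/-- The intermediate space `X_ζ = 𝒞(X₀, X₁)_ζ`, the Rochberg space of order one. -/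
abbrev Intermediate (c : BanachCouple X₀ X₁ E) (ζ : unitStrip) : Type _ :=
  Rochberg (⊤ : Submodule ℂ c.Calderon) 1 ζ

end Rochberg

/-- `T` is the operator `T_n : 𝒞(X₀*, X₁*)_z⁽ⁿ⁾ → (𝒞₀(X₀, X₁)_z⁽ⁿ⁾)*`, that is,
`T (ξ_{n-1}, …, ξ₀) (x_{n-1}, …, x₀) = ∑_{0 ≤ j < n} ⟨ξ_j, x_{n-j-1}⟩` for all `x_j ∈ Δ`, the
brackets being the duality between `Δ*` and `Δ`. It is part of the condition that the tuples of
elements of `Δ` belong to `𝒞₀(X₀, X₁)_z⁽ⁿ⁾`. -/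
def IsRochbergPairing [CompleteSpace E] (c : BanachCouple X₀ X₁ E) (hc : c.IsRegular)
    (n : ℕ) (z : unitStrip)
    (T : Rochberg (c := c.dual hc) ⊤ n z →L[ℂ] StrongDual ℂ (Rochberg c.calderonZero n z)) :
    Prop :=
  ∀ d : Fin n → c.inter, ∃ x : Rochberg c.calderonZero n z,
    (∀ j, x.coord j = c.interTo (d j)) ∧
    ∀ ξ : Rochberg (c := c.dual hc) ⊤ n z, T ξ x = ∑ j, ξ.coord j (d j.rev)

end BanachCouple

end

/-! Pairing. Let `g` belong to the Calderón space of the dual couple, and let `f ∈ 𝒞₀` be given by a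
bounded analytic function `F` with values in `Δ`. Then `w ↦ ⟨g(w), F(w)⟩` is analytic, and the
maximum principle bounds it by `‖g‖ ‖f‖`, because on the boundary lines it is the duality of `X_j*`
and `X_j`. By Leibniz's rule its Taylor coefficient of order `n - 1` at `z` is the required sum, and
Cauchy's estimate produces `dist(z, ∂𝕊)^(1-n)`. Tuples from `Δ` have `Δ`-valued representatives of
almost optimal norm (`exists_isInterLift_of_taylor_eq`): divide out the zero left after subtracting
an explicit lift, mollify the quotient by a Gaussian, multiply back. Such tuples are dense, so `T_n`
exists and is unique.

Weighted estimate. The norm of the jet of `f` is at most a constant times the sum of the integrals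
of `(1 + t²)⁻ⁿ ‖f(j + it)‖` over the two lines (`norm_mk_le_integral`). Take an analytic `Ψ` without
zeros whose modulus dominates the suitably cut off boundary norms (a sum of Poisson potentials), and
let `P` be a decaying function with the same jet as `Ψ`. Multiplying `f` by `P / Ψ` and a cut-off
keeps the jet, and the new boundary norms are bounded by `|P|`, hence by the Taylor coefficients of
`Ψ`, hence by the integrals. An extra factor `exp(-a(w - z))` shifts the burden to one line, so that
the other contributes only `ε ‖f‖`.

Norming. By this estimate and Hahn-Banach a functional `l` on the Rochberg space is a functional on
`L¹(X₀) × L¹(X₁)`, that is, a pair of operators `S_j : L¹ → X_j*`. Apply them to Gaussian kernels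
with a zero of order `n` at `z`. Since `l` kills functions with zero jet, `-S₀` and `S₁` agree on
these kernels and together define an element of the dual Calderón space, with norm at most a
constant times `‖l‖` whatever the width of the Gaussian. By Cauchy's formula on the strip its
pairings converge to `l` as the width tends to `0` (`exists_tendsto_rochbergPairing`). So the image
of a ball under `T_n` is weak* sequentially dense enough to norm the Rochberg space, which is the
lower estimate.

Isomorphism. Injectivity of `T_n` is immediate from tuples with one nonzero entry, so only
surjectivity matters. If `X_j` is Asplund, `S_j` has a bounded density with values in `X_j*`, its
Gaussian averages converge in weighted `L¹` on one line, and the one-line estimate makes the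
approximating jets a Cauchy sequence. If `X_ζ` is reflexive, the norming property and a Taylor
coefficient estimate along the line through `ζ` bound the Rochberg norm by `ε ‖f‖` plus a multiple
of an `L¹` norm of `X_ζ`-valued functions. This forces the Rochberg space to be reflexive
(`isReflexiveSpace_of_norm_le`); weak* limits are then weak limits, convex combinations converge in
norm, and an iteration gives surjectivity. The same criterion, with boundary values in `X_j`, shows
that `X_ζ` is reflexive if `X₀` or `X₁` is. -/

open MeasureTheory

noncomputable section

set_option linter.unusedSectionVars false

/-! ### Calculus of Taylor coefficients. -/

section TaylorCoeff

variable {V W U : Type*} [NormedAddCommGroup V] [NormedSpace ℂ V]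
  [NormedAddCommGroup W] [NormedSpace ℂ W] [NormedAddCommGroup U] [NormedSpace ℂ U]
  [CompleteSpace V] [CompleteSpace W] [CompleteSpace U]

/-- The Taylor coefficient `f⁽ᵏ⁾(z) / k!`. -/
def taylorCoeff (k : ℕ) (f : ℂ → V) (z : ℂ) : V := (k.factorial : ℂ)⁻¹ • iteratedDeriv k f z

@[simp] theorem taylorCoeff_zero (f : ℂ → V) (z : ℂ) : taylorCoeff 0 f z = f z := by
  simp [taylorCoeff]

theorem taylorCoeff_congr {f g : ℂ → V} {z : ℂ} (h : f =ᶠ[𝓝 z] g) (k : ℕ) :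
    taylorCoeff k f z = taylorCoeff k g z := by
  simp [taylorCoeff, h.iteratedDeriv_eq]

theorem taylorCoeff_add {f g : ℂ → V} {z : ℂ} (hf : AnalyticAt ℂ f z) (hg : AnalyticAt ℂ g z)
    (k : ℕ) : taylorCoeff k (fun w => f w + g w) z = taylorCoeff k f z + taylorCoeff k g z := by
  have := iteratedDeriv_add (n := k) hf.contDiffAt hg.contDiffAt
  simp only [taylorCoeff, ← smul_add]
  rw [← this]
  rfl

theorem taylorCoeff_const_smul {f : ℂ → V} {z : ℂ} (hf : AnalyticAt ℂ f z) (a : ℂ) (k : ℕ) :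
    taylorCoeff k (fun w => a • f w) z = a • taylorCoeff k f z := by
  have := iteratedDeriv_const_smul (n := k) hf.contDiffAt a
  simp only [taylorCoeff]
  rw [smul_comm a, ← this]
  rfl

theorem taylorCoeff_sub {f g : ℂ → V} {z : ℂ} (hf : AnalyticAt ℂ f z) (hg : AnalyticAt ℂ g z)
    (k : ℕ) : taylorCoeff k (fun w => f w - g w) z = taylorCoeff k f z - taylorCoeff k g z := by
  have := iteratedDeriv_sub (n := k) hf.contDiffAt hg.contDiffAt
  simp only [taylorCoeff, ← smul_sub]
  rw [← this]
  rfl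

theorem taylorCoeff_fun_zero (z : ℂ) (k : ℕ) : taylorCoeff k (fun _ => (0 : V)) z = 0 := by
  simp [taylorCoeff]

theorem taylorCoeff_sum {ι : Type*} (s : Finset ι) {f : ι → ℂ → V} {z : ℂ}
    (hf : ∀ i ∈ s, AnalyticAt ℂ (f i) z) (k : ℕ) :
    taylorCoeff k (fun w => ∑ i ∈ s, f i w) z = ∑ i ∈ s, taylorCoeff k (f i) z := by
  classical
  induction s using Finset.induction_on with
  | empty => simpa using taylorCoeff_fun_zero z k
  | insert a s ha ih =>
    simp only [Finset.sum_insert ha]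
    rw [taylorCoeff_add (hf a (by simp)), ih fun i hi => hf i (by simp [hi])]
    exact Finset.analyticAt_fun_sum s fun i hi => hf i (by simp [hi])

theorem taylorCoeff_clm_comp (L : V →L[ℂ] W) {f : ℂ → V} {z : ℂ} (hf : AnalyticAt ℂ f z) (k : ℕ) :
    taylorCoeff k (fun w => L (f w)) z = L (taylorCoeff k f z) := by
  have := L.iteratedFDeriv_comp_left (f := f) (x := z) (n := ⊤) hf.contDiffAt (i := k) (by simp)
  simp only [taylorCoeff, map_smul]
  congr 1
  simp only [iteratedDeriv]
  exact congrArg (fun m : ContinuousMultilinearMap ℂ (fun _ : Fin k => ℂ) W => m fun _ => 1) this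

/-- Differentiating `(w - z) • u` gives `(w - z) • u' + u`, so the induction runs on `u'`, through
the relation `(j + 1) c_{j+1}(f) = c_j(f')` between the coefficients of `f` and `f'`. -/
theorem taylorCoeff_sub_smul_succ {u : ℂ → V} {z : ℂ} (hu : AnalyticAt ℂ u z) (k : ℕ) :
    taylorCoeff (k + 1) (fun w => (w - z) • u w) z = taylorCoeff k u z := by
  induction k generalizing u with
  | zero =>
    simp only [taylorCoeff, zero_add, iteratedDeriv_one, iteratedDeriv_zero, Nat.factorial_one,
      Nat.factorial_zero]
    have h : HasDerivAt (fun w => (w - z) • u w) ((z - z) • deriv u z + (1 : ℂ) • u z) z :=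
      ((hasDerivAt_id z).sub_const z).smul hu.differentiableAt.hasDerivAt
    rw [h.deriv]
    simp
  | succ k ih =>
    have hd : deriv (fun w => (w - z) • u w) =ᶠ[𝓝 z] fun w => (w - z) • deriv u w + u w := by
      filter_upwards [hu.eventually_analyticAt] with w hw
      have h : HasDerivAt (fun w => (w - z) • u w) ((w - z) • deriv u w + (1 : ℂ) • u w) w :=
        ((hasDerivAt_id w).sub_const z).smul hw.differentiableAt.hasDerivAt
      rw [h.deriv, one_smul]
    have h2 := ih hu.deriv
    have h3 : taylorCoeff (k + 1) (fun w => (w - z) • deriv u w + u w) z =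
        taylorCoeff k (deriv u) z + taylorCoeff (k + 1) u z := by
      rw [taylorCoeff_add _ hu, h2]
      exact ((analyticAt_id.sub analyticAt_const).smul hu.deriv)
    have h4 : ∀ f : ℂ → V, ∀ j : ℕ, ((j : ℂ) + 1) • taylorCoeff (j + 1) f z =
        taylorCoeff j (deriv f) z := by
      intro f j
      simp only [taylorCoeff, iteratedDeriv_succ', smul_smul, Nat.factorial_succ]
      congr 1
      have : (j : ℂ) + 1 ≠ 0 := by exact_mod_cast j.succ_ne_zero
      push_cast
      field_simp
    have hk : ((k : ℂ) + 1 + 1) ≠ 0 := by exact_mod_cast (k + 1).succ_ne_zero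
    have h5 := h4 (fun w => (w - z) • u w) (k + 1)
    rw [taylorCoeff_congr hd, h3, ← h4 u k] at h5
    push_cast at h5
    refine smul_right_injective V hk ?_
    change _ • _ = _ • _
    rw [h5, add_smul ((k : ℂ) + 1) (1 : ℂ), one_smul]

theorem AnalyticAt.dslope_same {f : ℂ → V} {z : ℂ} (hf : AnalyticAt ℂ f z) :
    AnalyticAt ℂ (dslope f z) z := by
  obtain ⟨p, hp⟩ := hf
  exact ⟨_, hp.has_fpower_series_dslope_fslope⟩

/-- Combine `f = (w - z) • dslope f z + f z` with the shift rule. Inductions on the order can then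
pass from `f` to its divided slope, without power series. -/
theorem taylorCoeff_succ_eq_dslope {f : ℂ → V} {z : ℂ} (hf : AnalyticAt ℂ f z) (k : ℕ) :
    taylorCoeff (k + 1) f z = taylorCoeff k (dslope f z) z := by
  have h1 : f = fun w => (w - z) • dslope f z w + f z := by
    funext w
    rw [sub_smul_dslope]
    abel
  have h2 : AnalyticAt ℂ (fun w => (w - z) • dslope f z w) z :=
    (analyticAt_id.sub analyticAt_const).smul hf.dslope_same
  conv_lhs => rw [h1]
  rw [taylorCoeff_add h2 analyticAt_const, taylorCoeff_sub_smul_succ hf.dslope_same]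
  simp [taylorCoeff, iteratedDeriv_const]

/-- The Leibniz formula for Taylor coefficients. -/
theorem taylorCoeff_bilin (B : V →L[ℂ] W →L[ℂ] U) {f : ℂ → V} {g : ℂ → W} {z : ℂ}
    (hf : AnalyticAt ℂ f z) (hg : AnalyticAt ℂ g z) (k : ℕ) :
    taylorCoeff k (fun w => B (f w) (g w)) z =
      ∑ i ∈ Finset.range (k + 1), B (taylorCoeff i f z) (taylorCoeff (k - i) g z) := by
  induction k generalizing f with
  | zero => simp
  | succ k ih =>
    have hB : ∀ {u : ℂ → V}, AnalyticAt ℂ u z → AnalyticAt ℂ (fun w => B (u w) (g w)) z :=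
      fun hu => (B.analyticAt_bilinear _).comp₂ hu hg
    -- Splitting off the constant term of `f` gives the last summand of the formula; the rest is a
    -- shift of the case of `dslope f z`.
    have h1 : (fun w => B (f w) (g w)) =
        fun w => (w - z) • B (dslope f z w) (g w) + B (f z) (g w) := by
      funext w
      have : f w = (w - z) • dslope f z w + f z := by rw [sub_smul_dslope]; abel
      conv_lhs => rw [this]
      rw [map_add, map_smul]
      rfl
    have h2 : AnalyticAt ℂ (fun w => (w - z) • B (dslope f z w) (g w)) z :=
      (analyticAt_id.sub analyticAt_const).smul (hB hf.dslope_same)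
    rw [h1, taylorCoeff_add h2 (hB analyticAt_const), taylorCoeff_sub_smul_succ (hB hf.dslope_same),
      ih hf.dslope_same, taylorCoeff_clm_comp (B (f z)) hg, Finset.sum_range_succ' _ (k + 1)]
    simp only [taylorCoeff_succ_eq_dslope hf, Nat.add_sub_add_right, taylorCoeff_zero, tsub_zero]

theorem taylorCoeff_smul {φ : ℂ → ℂ} {f : ℂ → V} {z : ℂ}
    (hφ : AnalyticAt ℂ φ z) (hf : AnalyticAt ℂ f z) (k : ℕ) :
    taylorCoeff k (fun w => φ w • f w) z =
      ∑ i ∈ Finset.range (k + 1), taylorCoeff i φ z • taylorCoeff (k - i) f z :=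
  taylorCoeff_bilin (ContinuousLinearMap.lsmul ℂ ℂ) hφ hf k

theorem taylorCoeff_sub_pow_smul {u : ℂ → V} {z : ℂ} (hu : AnalyticAt ℂ u z) (n k : ℕ) :
    taylorCoeff k (fun w => (w - z) ^ n • u w) z = if k < n then 0 else taylorCoeff (k - n) u z := by
  induction n generalizing k with
  | zero => simp
  | succ n ih =>
    have h1 : (fun w => (w - z) ^ (n + 1) • u w) = fun w => (w - z) • ((w - z) ^ n • u w) := by
      funext w
      rw [smul_smul, pow_succ']
    have h2 : AnalyticAt ℂ (fun w => (w - z) ^ n • u w) z :=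
      ((analyticAt_id.sub analyticAt_const).pow n).smul hu
    rw [h1]
    cases k with
    | zero => simp
    | succ k => rw [taylorCoeff_sub_smul_succ h2, ih]; simp

/-- A factor congruent to `1` modulo `(w - z) ^ n` is invisible to jets of length `n`; every cut-off
below is of this kind. -/
theorem taylorCoeff_smul_eq_of_eq_one_add {φ χ : ℂ → ℂ} {f : ℂ → V} {z : ℂ} {n : ℕ}
    (hχ : AnalyticAt ℂ χ z) (hφ : ∀ᶠ w in 𝓝 z, φ w = 1 + (w - z) ^ n * χ w)
    (hf : AnalyticAt ℂ f z) {k : ℕ} (hk : k < n) :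
    taylorCoeff k (fun w => φ w • f w) z = taylorCoeff k f z := by
  have h1 : (fun w => φ w • f w) =ᶠ[𝓝 z] fun w => f w + (w - z) ^ n • (χ w • f w) := by
    filter_upwards [hφ] with w hw
    rw [hw, add_smul, one_smul, smul_smul]
  have h2 : AnalyticAt ℂ (fun w => (w - z) ^ n • (χ w • f w)) z :=
    ((analyticAt_id.sub analyticAt_const).pow n).smul (hχ.smul hf)
  rw [taylorCoeff_congr h1, taylorCoeff_add hf h2, taylorCoeff_sub_pow_smul (show AnalyticAt ℂ (fun w => χ w • f w) z from hχ.smul hf),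
    if_pos hk, add_zero]

theorem norm_taylorCoeff_le {f : ℂ → V} {z : ℂ} {R C : ℝ} (hR : 0 < R)
    (hf : DiffContOnCl ℂ f (Metric.ball z R)) (hC : ∀ w ∈ Metric.sphere z R, ‖f w‖ ≤ C) (k : ℕ) :
    ‖taylorCoeff k f z‖ ≤ C / R ^ k := by
  have h := Complex.norm_iteratedDeriv_le_of_forall_mem_sphere_norm_le k hR hf hC
  have hfac : (0 : ℝ) < (k.factorial : ℝ) := by positivity
  calc ‖taylorCoeff k f z‖ = (k.factorial : ℝ)⁻¹ * ‖iteratedDeriv k f z‖ := by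
        simp [taylorCoeff, norm_smul]
    _ ≤ (k.factorial : ℝ)⁻¹ * (k.factorial * C / R ^ k) :=
        mul_le_mul_of_nonneg_left h (by positivity)
    _ = C / R ^ k := by field_simp

end TaylorCoeff

/-! ### Analytic functions and scalar multipliers on the strip. -/

theorem isOpen_unitStrip : IsOpen unitStrip := isOpen_Ioo.preimage continuous_re

theorem closure_unitStrip : closure unitStrip = closedUnitStrip := by
  rw [unitStrip, Complex.closure_preimage_re, closure_Ioo (by norm_num)]

theorem unitStrip_subset : unitStrip ⊆ closedUnitStrip := fun _ hw => ⟨hw.1.le, hw.2.le⟩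

theorem left_mem_closedUnitStrip (t : ℝ) : (t * I : ℂ) ∈ closedUnitStrip := by
  simp [closedUnitStrip]

theorem right_mem_closedUnitStrip (t : ℝ) : (1 + t * I : ℂ) ∈ closedUnitStrip := by
  simp [closedUnitStrip]

theorem DiffContOnCl.congr_closure {V : Type*} [NormedAddCommGroup V] [NormedSpace ℂ V]
    {f g : ℂ → V} {s : Set ℂ} (hf : DiffContOnCl ℂ f s) (h : EqOn g f (closure s)) :
    DiffContOnCl ℂ g s :=
  ⟨hf.1.congr fun _ hw => h (subset_closure hw), hf.2.congr h⟩

theorem DiffContOnCl.continuousOn_closedUnitStrip {V : Type*} [NormedAddCommGroup V]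
    [NormedSpace ℂ V] {f : ℂ → V} (hf : DiffContOnCl ℂ f unitStrip) :
    ContinuousOn f closedUnitStrip := closure_unitStrip ▸ hf.continuousOn

theorem DiffContOnCl.continuous_left {V : Type*} [NormedAddCommGroup V]
    [NormedSpace ℂ V] {f : ℂ → V} (hf : DiffContOnCl ℂ f unitStrip) :
    Continuous fun t : ℝ => f (t * I) :=
  hf.continuousOn_closedUnitStrip.comp_continuous (by fun_prop) left_mem_closedUnitStrip

theorem DiffContOnCl.continuous_right {V : Type*} [NormedAddCommGroup V]
    [NormedSpace ℂ V] {f : ℂ → V} (hf : DiffContOnCl ℂ f unitStrip) :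
    Continuous fun t : ℝ => f (1 + t * I) :=
  hf.continuousOn_closedUnitStrip.comp_continuous (by fun_prop) right_mem_closedUnitStrip

theorem DiffContOnCl.analyticAt_unitStrip {V : Type*} [NormedAddCommGroup V] [CompleteSpace V]
    [NormedSpace ℂ V] {f : ℂ → V} (hf : DiffContOnCl ℂ f unitStrip) {w : ℂ} (hw : w ∈ unitStrip) :
    AnalyticAt ℂ f w :=
  hf.differentiableOn.analyticAt (isOpen_unitStrip.mem_nhds hw)

/-- Scalar functions by which the elements of the Calderón space may be multiplied. -/
def IsStripMultiplier (A : ℝ) (φ : ℂ → ℂ) : Prop :=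
  DiffContOnCl ℂ φ unitStrip ∧ ∀ w ∈ closedUnitStrip, ‖φ w‖ ≤ A

theorem IsStripMultiplier.nonneg {A : ℝ} {φ : ℂ → ℂ} (h : IsStripMultiplier A φ) : 0 ≤ A :=
  (norm_nonneg _).trans (h.2 _ (left_mem_closedUnitStrip 0))

theorem IsStripMultiplier.mul {A B : ℝ} {φ χ : ℂ → ℂ} (hφ : IsStripMultiplier A φ)
    (hχ : IsStripMultiplier B χ) : IsStripMultiplier (A * B) fun w => φ w * χ w :=
  ⟨hφ.1.smul hχ.1, fun w hw => by
    rw [norm_mul]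
    exact mul_le_mul (hφ.2 w hw) (hχ.2 w hw) (norm_nonneg _) hφ.nonneg⟩

theorem IsStripMultiplier.pow {A : ℝ} {φ : ℂ → ℂ} (hφ : IsStripMultiplier A φ) (k : ℕ) :
    IsStripMultiplier (A ^ k) fun w => φ w ^ k := by
  induction k with
  | zero => exact ⟨by simpa using diffContOnCl_const, fun w _ => by simp⟩
  | succ k ih => simpa only [pow_succ] using ih.mul hφ

/-! ### Building members of the Calderón space. -/

namespace BanachCouple

variable {X₀ X₁ E : Type*}
  [NormedAddCommGroup X₀] [NormedSpace ℂ X₀] [NormedAddCommGroup X₁] [NormedSpace ℂ X₁]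
  [NormedAddCommGroup E] [NormedSpace ℂ E]
  {c : BanachCouple X₀ X₁ E}

theorem isClosed_inter (c : BanachCouple X₀ X₁ E) : IsClosed (c.inter : Set (X₀ × X₁)) :=
  isClosed_eq (c.i₀.continuous.comp continuous_fst) (c.i₁.continuous.comp continuous_snd)

instance [CompleteSpace X₀] [CompleteSpace X₁] (c : BanachCouple X₀ X₁ E) :
    CompleteSpace c.inter := c.isClosed_inter.completeSpace_coe

theorem i₁_interTo₁ (x : c.inter) : c.i₁ (c.interTo₁ x) = c.interTo x := x.2.symm

theorem i₀_interTo₀ (x : c.inter) : c.i₀ (c.interTo₀ x) = c.interTo x := rfl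

theorem norm_inter_le {x : c.inter} {K : ℝ} (h0 : ‖c.interTo₀ x‖ ≤ K) (h1 : ‖c.interTo₁ x‖ ≤ K) :
    ‖x‖ ≤ K := max_le h0 h1

theorem norm_interTo₀_le (x : c.inter) : ‖c.interTo₀ x‖ ≤ ‖x‖ := le_max_left _ _

theorem norm_interTo₁_le (x : c.inter) : ‖c.interTo₁ x‖ ≤ ‖x‖ := le_max_right _ _

namespace Calderon

/-- A member of the Calderón space from a function that is defined on the whole plane. -/
def ofBdry (F : ℂ → E) (hF : DiffContOnCl ℂ F unitStrip) (hb : ∃ K : ℝ, ∀ w ∈ unitStrip, ‖F w‖ ≤ K)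
    (b₀ : ℝ →ᵇ X₀) (b₁ : ℝ →ᵇ X₁) (h0 : ∀ t : ℝ, F (t * I) = c.i₀ (b₀ t))
    (h1 : ∀ t : ℝ, F (1 + t * I) = c.i₁ (b₁ t)) : c.Calderon :=
  ⟨(closedUnitStrip.indicator F, b₀, b₁), by
    refine ⟨hF.congr_closure ?_, ?_, fun w hw => indicator_of_notMem hw _, fun t => ?_, fun t => ?_⟩
    · rw [closure_unitStrip]
      exact fun w hw => indicator_of_mem hw F
    · obtain ⟨K, hK⟩ := hb
      refine ⟨K, fun w hw => ?_⟩
      change ‖closedUnitStrip.indicator F w‖ ≤ K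
      rw [indicator_of_mem (unitStrip_subset hw)]
      exact hK w hw
    · change closedUnitStrip.indicator F (t * I) = _
      rw [indicator_of_mem (left_mem_closedUnitStrip t)]
      exact h0 t
    · change closedUnitStrip.indicator F (1 + t * I) = _
      rw [indicator_of_mem (right_mem_closedUnitStrip t)]
      exact h1 t⟩

theorem toFun_ofBdry {F : ℂ → E} {hF : DiffContOnCl ℂ F unitStrip}
    {hb : ∃ K : ℝ, ∀ w ∈ unitStrip, ‖F w‖ ≤ K}
    {b₀ : ℝ →ᵇ X₀} {b₁ : ℝ →ᵇ X₁} {h0 : ∀ t : ℝ, F (t * I) = c.i₀ (b₀ t)}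
    {h1 : ∀ t : ℝ, F (1 + t * I) = c.i₁ (b₁ t)} {w : ℂ} (hw : w ∈ closedUnitStrip) :
    (ofBdry F hF hb b₀ b₁ h0 h1).toFun w = F w := indicator_of_mem hw F

theorem diffContOnCl (f : c.Calderon) : DiffContOnCl ℂ f.toFun unitStrip := f.2.1

theorem toFun_left (f : c.Calderon) (t : ℝ) : f.toFun (t * I) = c.i₀ (f.bdry₀ t) := f.2.2.2.2.1 t

theorem toFun_right (f : c.Calderon) (t : ℝ) : f.toFun (1 + t * I) = c.i₁ (f.bdry₁ t) :=
  f.2.2.2.2.2 t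

theorem toFun_off (f : c.Calderon) {w : ℂ} (hw : w ∉ closedUnitStrip) : f.toFun w = 0 :=
  f.2.2.2.1 w hw

theorem norm_bdry₀_le (f : c.Calderon) (t : ℝ) : ‖f.bdry₀ t‖ ≤ ‖f‖ :=
  (f.bdry₀.norm_coe_le_norm t).trans (le_max_left _ _)

theorem norm_bdry₁_le (f : c.Calderon) (t : ℝ) : ‖f.bdry₁ t‖ ≤ ‖f‖ :=
  (f.bdry₁.norm_coe_le_norm t).trans (le_max_right _ _)

theorem norm_le {f : c.Calderon} {K : ℝ} (hK : 0 ≤ K) (h0 : ∀ t, ‖f.bdry₀ t‖ ≤ K)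
    (h1 : ∀ t, ‖f.bdry₁ t‖ ≤ K) : ‖f‖ ≤ K :=
  max_le ((BoundedContinuousFunction.norm_le hK).2 h0) ((BoundedContinuousFunction.norm_le hK).2 h1)

theorem norm_toFun_le (f : c.Calderon) (w : ℂ) : ‖f.toFun w‖ ≤ max ‖c.i₀‖ ‖c.i₁‖ * ‖f‖ :=
  c.norm_le_of_mem_calderon f.2 w

@[ext] theorem ext {f g : c.Calderon} (h : ∀ w ∈ closedUnitStrip, f.toFun w = g.toFun w) :
    f = g := by
  refine Subtype.ext (Prod.ext (funext fun w => ?_) (Prod.ext ?_ ?_))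
  · by_cases hw : w ∈ closedUnitStrip
    · exact h w hw
    · exact (f.toFun_off hw).trans (g.toFun_off hw).symm
  · refine BoundedContinuousFunction.ext fun t => c.injective₀ ?_
    exact (f.toFun_left t).symm.trans ((h _ (left_mem_closedUnitStrip t)).trans (g.toFun_left t))
  · refine BoundedContinuousFunction.ext fun t => c.injective₁ ?_
    exact (f.toFun_right t).symm.trans ((h _ (right_mem_closedUnitStrip t)).trans (g.toFun_right t))

@[simp] theorem toFun_add (f g : c.Calderon) (w : ℂ) : (f + g).toFun w = f.toFun w + g.toFun w :=
  rfl
@[simp] theorem toFun_sub (f g : c.Calderon) (w : ℂ) : (f - g).toFun w = f.toFun w - g.toFun w :=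
  rfl
@[simp] theorem toFun_smul (a : ℂ) (f : c.Calderon) (w : ℂ) : (a • f).toFun w = a • f.toFun w := rfl
@[simp] theorem toFun_zero (w : ℂ) : (0 : c.Calderon).toFun w = 0 := rfl
@[simp] theorem bdry₀_add (f g : c.Calderon) : (f + g).bdry₀ = f.bdry₀ + g.bdry₀ := rfl
@[simp] theorem bdry₁_add (f g : c.Calderon) : (f + g).bdry₁ = f.bdry₁ + g.bdry₁ := rfl
@[simp] theorem bdry₀_sub (f g : c.Calderon) : (f - g).bdry₀ = f.bdry₀ - g.bdry₀ := rfl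
@[simp] theorem bdry₁_sub (f g : c.Calderon) : (f - g).bdry₁ = f.bdry₁ - g.bdry₁ := rfl
@[simp] theorem bdry₀_smul (a : ℂ) (f : c.Calderon) : (a • f).bdry₀ = a • f.bdry₀ := rfl
@[simp] theorem bdry₁_smul (a : ℂ) (f : c.Calderon) : (a • f).bdry₁ = a • f.bdry₁ := rfl

/-- The product of a scalar multiplier and a function of the Calderón space. -/
def mul (φ : ℂ → ℂ) {A : ℝ} (hφ : IsStripMultiplier A φ) (f : c.Calderon) : c.Calderon :=
  ofBdry (fun w => φ w • f.toFun w) (hφ.1.smul f.diffContOnCl)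
    ⟨A * (max ‖c.i₀‖ ‖c.i₁‖ * ‖f‖), fun w hw => by
      rw [norm_smul]
      exact mul_le_mul (hφ.2 w (unitStrip_subset hw)) (f.norm_toFun_le w) (norm_nonneg _)
        hφ.nonneg⟩
    (BoundedContinuousFunction.ofNormedAddCommGroup (fun t : ℝ => φ (t * I) • f.bdry₀ t)
      (hφ.1.continuous_left.smul f.bdry₀.continuous) (A * ‖f‖) fun t => by
        rw [norm_smul]
        exact mul_le_mul (hφ.2 _ (left_mem_closedUnitStrip t)) (f.norm_bdry₀_le t) (norm_nonneg _)
          hφ.nonneg)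
    (BoundedContinuousFunction.ofNormedAddCommGroup (fun t : ℝ => φ (1 + t * I) • f.bdry₁ t)
      (hφ.1.continuous_right.smul f.bdry₁.continuous) (A * ‖f‖) fun t => by
        rw [norm_smul]
        exact mul_le_mul (hφ.2 _ (right_mem_closedUnitStrip t)) (f.norm_bdry₁_le t) (norm_nonneg _)
          hφ.nonneg)
    (fun t => by simp [f.toFun_left]) (fun t => by simp [f.toFun_right])

variable {A : ℝ} {φ : ℂ → ℂ}

theorem toFun_mul (hφ : IsStripMultiplier A φ) (f : c.Calderon) (w : ℂ) :
    (mul φ hφ f).toFun w = φ w • f.toFun w := by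
  by_cases hw : w ∈ closedUnitStrip
  · exact toFun_ofBdry hw
  · rw [toFun_off _ hw, toFun_off _ hw, smul_zero]

@[simp] theorem bdry₀_mul (hφ : IsStripMultiplier A φ) (f : c.Calderon) (t : ℝ) :
    (mul φ hφ f).bdry₀ t = φ (t * I) • f.bdry₀ t := rfl

@[simp] theorem bdry₁_mul (hφ : IsStripMultiplier A φ) (f : c.Calderon) (t : ℝ) :
    (mul φ hφ f).bdry₁ t = φ (1 + t * I) • f.bdry₁ t := rfl

theorem norm_mul_le (hφ : IsStripMultiplier A φ) (f : c.Calderon) : ‖mul φ hφ f‖ ≤ A * ‖f‖ := by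
  refine norm_le (mul_nonneg hφ.nonneg (norm_nonneg _)) (fun t => ?_) fun t => ?_
  · rw [bdry₀_mul, norm_smul]
    exact mul_le_mul (hφ.2 _ (left_mem_closedUnitStrip t)) (f.norm_bdry₀_le t) (norm_nonneg _)
      hφ.nonneg
  · rw [bdry₁_mul, norm_smul]
    exact mul_le_mul (hφ.2 _ (right_mem_closedUnitStrip t)) (f.norm_bdry₁_le t) (norm_nonneg _)
      hφ.nonneg

theorem mul_mem_calderonZero_of_tendsto (hφ : IsStripMultiplier A φ)
    (h0 : Tendsto (fun t : ℝ => φ (t * I)) (cocompact ℝ) (𝓝 0))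
    (h1 : Tendsto (fun t : ℝ => φ (1 + t * I)) (cocompact ℝ) (𝓝 0)) (f : c.Calderon) :
    mul φ hφ f ∈ c.calderonZero := by
  constructor
  · refine squeeze_zero_norm (a := fun t : ℝ => ‖φ (t * I)‖ * ‖f‖) (fun t => ?_) ?_
    · rw [bdry₀_mul, norm_smul]
      exact mul_le_mul_of_nonneg_left (f.norm_bdry₀_le t) (norm_nonneg _)
    · simpa using h0.norm.mul_const ‖f‖
  · refine squeeze_zero_norm (a := fun t : ℝ => ‖φ (1 + t * I)‖ * ‖f‖) (fun t => ?_) ?_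
    · rw [bdry₁_mul, norm_smul]
      exact mul_le_mul_of_nonneg_left (f.norm_bdry₁_le t) (norm_nonneg _)
    · simpa using h1.norm.mul_const ‖f‖

section Complete

variable [CompleteSpace E]

theorem analyticAt (f : c.Calderon) {w : ℂ} (hw : w ∈ unitStrip) : AnalyticAt ℂ f.toFun w :=
  f.diffContOnCl.analyticAt_unitStrip hw

theorem taylor_apply (f : c.Calderon) (n : ℕ) (z : unitStrip) (i : Fin n) :
    c.taylor n z f i = taylorCoeff i f.toFun z := rfl

/-- By Leibniz's rule only the jet of the multiplier matters. With `χ = 1` this allows replacing a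
representative of a jet by one with better boundary values. -/
theorem taylor_mul_congr {B : ℝ} {χ : ℂ → ℂ} (hφ : IsStripMultiplier A φ)
    (hχ : IsStripMultiplier B χ) (f : c.Calderon) {n : ℕ} {z : unitStrip}
    (h : ∀ i < n, taylorCoeff i φ z = taylorCoeff i χ z) :
    c.taylor n z (mul φ hφ f) = c.taylor n z (mul χ hχ f) := by
  funext i
  have e1 : (mul φ hφ f).toFun = fun w => φ w • f.toFun w := funext (toFun_mul hφ f)
  have e2 : (mul χ hχ f).toFun = fun w => χ w • f.toFun w := funext (toFun_mul hχ f)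
  rw [taylor_apply, taylor_apply, e1, e2,
    taylorCoeff_smul (hφ.1.analyticAt_unitStrip z.2) (f.analyticAt z.2),
    taylorCoeff_smul (hχ.1.analyticAt_unitStrip z.2) (f.analyticAt z.2)]
  refine Finset.sum_congr rfl fun j hj => ?_
  rw [h j (by have := Finset.mem_range.1 hj; omega)]

theorem taylor_mul_of_eq_one_add (hφ : IsStripMultiplier A φ) (f : c.Calderon) {n : ℕ}
    {z : unitStrip} {χ : ℂ → ℂ} (hχ : AnalyticAt ℂ χ z)
    (h : ∀ᶠ w in 𝓝 (z : ℂ), φ w = 1 + (w - z) ^ n * χ w) :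
    c.taylor n z (mul φ hφ f) = c.taylor n z f := by
  funext i
  have e1 : (mul φ hφ f).toFun = fun w => φ w • f.toFun w := funext (toFun_mul hφ f)
  rw [taylor_apply, taylor_apply, e1]
  exact taylorCoeff_smul_eq_of_eq_one_add hχ h (f.analyticAt z.2) i.2

end Complete

end Calderon

/-- A function with values in the intersection gives a member of the Calderón space. -/
def ofInter (F : ℂ → c.inter) (hF : DiffContOnCl ℂ F unitStrip)
    (hb : ∃ K : ℝ, ∀ w ∈ closedUnitStrip, ‖F w‖ ≤ K) : c.Calderon :=
  Calderon.ofBdry (fun w => c.interTo (F w)) (c.interTo.differentiable.comp_diffContOnCl hF)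
    (by
      obtain ⟨K, hK⟩ := hb
      refine ⟨‖c.interTo‖ * K, fun w hw => (c.interTo.le_opNorm _).trans ?_⟩
      exact mul_le_mul_of_nonneg_left (hK w (unitStrip_subset hw)) (norm_nonneg _))
    (BoundedContinuousFunction.ofNormedAddCommGroup (fun t : ℝ => c.interTo₀ (F (t * I)))
      (c.interTo₀.continuous.comp hF.continuous_left) hb.choose fun t =>
        (norm_interTo₀_le _).trans (hb.choose_spec _ (left_mem_closedUnitStrip t)))
    (BoundedContinuousFunction.ofNormedAddCommGroup (fun t : ℝ => c.interTo₁ (F (1 + t * I)))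
      (c.interTo₁.continuous.comp hF.continuous_right) hb.choose fun t =>
        (norm_interTo₁_le _).trans (hb.choose_spec _ (right_mem_closedUnitStrip t)))
    (fun _ => rfl) (fun _ => (i₁_interTo₁ _).symm)

section OfInter

variable {F : ℂ → c.inter} (hF : DiffContOnCl ℂ F unitStrip)
  (hb : ∃ K : ℝ, ∀ w ∈ closedUnitStrip, ‖F w‖ ≤ K)

theorem toFun_ofInter {w : ℂ} (hw : w ∈ closedUnitStrip) :
    (ofInter F hF hb).toFun w = c.interTo (F w) := Calderon.toFun_ofBdry hw

@[simp] theorem bdry₀_ofInter (t : ℝ) : (ofInter F hF hb).bdry₀ t = c.interTo₀ (F (t * I)) := rfl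

@[simp] theorem bdry₁_ofInter (t : ℝ) : (ofInter F hF hb).bdry₁ t = c.interTo₁ (F (1 + t * I)) :=
  rfl

end OfInter

end BanachCouple

/-! ### Completeness of the function spaces and of their quotients. -/

namespace BanachCouple

variable {X₀ X₁ E : Type*}
  [NormedAddCommGroup X₀] [NormedSpace ℂ X₀] [NormedAddCommGroup X₁] [NormedSpace ℂ X₁]
  [NormedAddCommGroup E] [NormedSpace ℂ E]
  {c : BanachCouple X₀ X₁ E}

/-- By the maximum principle a sequence that is Cauchy on the boundary converges uniformly on the
strip, and uniform limits keep analyticity inside and continuity up to the boundary. -/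
instance Calderon.instCompleteSpace [CompleteSpace X₀] [CompleteSpace X₁] [CompleteSpace E] :
    CompleteSpace c.Calderon := by
  refine Metric.complete_of_cauchySeq_tendsto fun u hu => ?_
  -- The summand `1` makes `A` positive even if both embeddings have norm zero, so that `ε / A` is
  -- meaningful.
  set A := max ‖c.i₀‖ ‖c.i₁‖ + 1 with hA
  have hA0 : 0 < A := by
    have := (norm_nonneg c.i₀).trans (le_max_left _ ‖c.i₁‖)
    positivity
  have hdist : ∀ f g : c.Calderon, ∀ w, dist (f.toFun w) (g.toFun w) ≤ A * dist f g := by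
    intro f g w
    rw [dist_eq_norm, dist_eq_norm]
    refine ((f - g).norm_toFun_le w).trans ?_
    exact mul_le_mul_of_nonneg_right (by simp [hA]) (norm_nonneg _)
  have h0 : CauchySeq fun k => (u k).bdry₀ := by
    rw [Metric.cauchySeq_iff] at hu ⊢
    refine fun ε hε => (hu ε hε).imp fun N hN m hm k hk => lt_of_le_of_lt ?_ (hN m hm k hk)
    rw [dist_eq_norm, dist_eq_norm]
    exact le_max_left _ _
  have h1 : CauchySeq fun k => (u k).bdry₁ := by
    rw [Metric.cauchySeq_iff] at hu ⊢
    refine fun ε hε => (hu ε hε).imp fun N hN m hm k hk => lt_of_le_of_lt ?_ (hN m hm k hk)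
    rw [dist_eq_norm, dist_eq_norm]
    exact le_max_right _ _
  obtain ⟨b₀, hb₀⟩ := cauchySeq_tendsto_of_complete h0
  obtain ⟨b₁, hb₁⟩ := cauchySeq_tendsto_of_complete h1
  have hw : ∀ w, CauchySeq fun k => (u k).toFun w := by
    intro w
    rw [Metric.cauchySeq_iff] at hu ⊢
    refine fun ε hε => (hu (ε / A) (by positivity)).imp fun N hN m hm k hk => ?_
    refine (hdist _ _ w).trans_lt ?_
    have := hN m hm k hk
    rwa [lt_div_iff₀' hA0] at this
  choose F hF using fun w => cauchySeq_tendsto_of_complete (hw w)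
  have hunif : TendstoUniformly (fun k => (u k).toFun) F atTop := by
    rw [Metric.tendstoUniformly_iff]
    intro ε hε
    rw [Metric.cauchySeq_iff] at hu
    obtain ⟨N, hN⟩ := hu (ε / 2 / A) (by positivity)
    filter_upwards [eventually_ge_atTop N] with k hk w
    have : dist (F w) ((u k).toFun w) ≤ ε / 2 := by
      refine le_of_tendsto ((hF w).dist tendsto_const_nhds) ?_
      filter_upwards [eventually_ge_atTop N] with m hm
      have := (hN m hm k hk).le
      rw [le_div_iff₀' hA0] at this
      exact (hdist _ _ w).trans this
    linarith
  have hFd : DiffContOnCl ℂ F unitStrip := by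
    refine ⟨?_, ?_⟩
    · exact (hunif.tendstoUniformlyOn.tendstoLocallyUniformlyOn).differentiableOn
        (Eventually.of_forall fun k => (u k).diffContOnCl.differentiableOn) isOpen_unitStrip
    · exact hunif.tendstoUniformlyOn.continuousOn
        (Eventually.of_forall fun k => (u k).diffContOnCl.continuousOn).frequently
  have e0 : ∀ t : ℝ, F (t * I) = c.i₀ (b₀ t) := fun t => by
    refine tendsto_nhds_unique (hF _) ?_
    simp only [Calderon.toFun_left]
    exact (c.i₀.continuous.tendsto _).comp
      (((BoundedContinuousFunction.evalCLM ℂ t).continuous.tendsto b₀).comp hb₀)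
  have e1 : ∀ t : ℝ, F (1 + t * I) = c.i₁ (b₁ t) := fun t => by
    refine tendsto_nhds_unique (hF _) ?_
    simp only [Calderon.toFun_right]
    exact (c.i₁.continuous.tendsto _).comp
      (((BoundedContinuousFunction.evalCLM ℂ t).continuous.tendsto b₁).comp hb₁)
  obtain ⟨M, hM⟩ := hu.norm_bddAbove
  have hFb : ∃ K : ℝ, ∀ w ∈ unitStrip, ‖F w‖ ≤ K := by
    refine ⟨A * M, fun w _ => le_of_tendsto (hF w).norm (Eventually.of_forall fun k => ?_)⟩
    refine ((u k).norm_toFun_le w).trans ?_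
    exact mul_le_mul (by simp [hA]) (hM ⟨k, rfl⟩) (norm_nonneg _) hA0.le
  refine ⟨Calderon.ofBdry F hFd hFb b₀ b₁ e0 e1, ?_⟩
  rw [tendsto_iff_norm_sub_tendsto_zero] at hb₀ hb₁ ⊢
  have := hb₀.max hb₁
  rwa [max_self] at this

theorem isClosed_setOf_tendsto_zero {X : Type*} [NormedAddCommGroup X] :
    IsClosed {b : ℝ →ᵇ X | Tendsto b (cocompact ℝ) (𝓝 0)} := by
  refine isClosed_of_closure_subset fun b hb => ?_
  rw [mem_ofPred_eq, tendsto_zero_iff_norm_tendsto_zero, Metric.tendsto_nhds]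
  intro ε hε
  obtain ⟨b', hb', hd⟩ := Metric.mem_closure_iff.1 hb (ε / 2) (by positivity)
  have h := (Metric.tendsto_nhds.1 hb') (ε / 2) (by positivity)
  filter_upwards [h] with t ht
  have h2 := (BoundedContinuousFunction.dist_coe_le_dist (f := b) (g := b') t)
  have h3 := dist_triangle (b t) (b' t) 0
  rw [dist_zero_right, norm_norm]
  rw [dist_zero_right (b t)] at h3
  linarith

theorem isClosed_calderonZero (c : BanachCouple X₀ X₁ E) :
    IsClosed (c.calderonZero : Set c.Calderon) := by
  have c0 : Continuous fun f : c.Calderon => f.bdry₀ := by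
    refine (LipschitzWith.of_dist_le_mul (K := 1) fun f g => ?_).continuous
    rw [dist_eq_norm, dist_eq_norm, NNReal.coe_one, one_mul]
    exact le_max_left _ _
  have c1 : Continuous fun f : c.Calderon => f.bdry₁ := by
    refine (LipschitzWith.of_dist_le_mul (K := 1) fun f g => ?_).continuous
    rw [dist_eq_norm, dist_eq_norm, NNReal.coe_one, one_mul]
    exact le_max_right _ _
  exact IsClosed.inter (isClosed_setOf_tendsto_zero.preimage c0)
    (isClosed_setOf_tendsto_zero.preimage c1)

instance [CompleteSpace X₀] [CompleteSpace X₁] [CompleteSpace E] :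
    CompleteSpace c.calderonZero := c.isClosed_calderonZero.completeSpace_coe

instance [CompleteSpace X₀] [CompleteSpace X₁] [CompleteSpace E] :
    CompleteSpace (⊤ : Submodule ℂ c.Calderon) :=
  (isClosed_univ : IsClosed ((⊤ : Submodule ℂ c.Calderon) : Set c.Calderon)).completeSpace_coe

namespace Rochberg

variable [CompleteSpace E] {n : ℕ} {z : unitStrip} {ℱ : Submodule ℂ c.Calderon}

instance [CompleteSpace ℱ] : CompleteSpace (Rochberg ℱ n z) := by
  let e : Rochberg ℱ n z ≃ₗᵢ[ℂ] ℱ ⧸ LinearMap.ker ((c.taylor n z).comp ℱ.subtype) :=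
    ⟨equivQuot ℱ n z, fun _ => rfl⟩
  exact (completeSpace_congr (e := e.toEquiv) e.isometry.isUniformEmbedding).2 inferInstance

theorem coord_injective : Function.Injective (coord : Rochberg ℱ n z → Fin n → E) :=
  Subtype.coe_injective

@[simp] theorem coord_add (v w : Rochberg ℱ n z) : (v + w).coord = v.coord + w.coord := rfl
@[simp] theorem coord_sub (v w : Rochberg ℱ n z) : (v - w).coord = v.coord - w.coord := rfl
@[simp] theorem coord_smul (a : ℂ) (w : Rochberg ℱ n z) : (a • w).coord = a • w.coord := rfl

/-- The quotient map. -/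
def mkₗ (ℱ : Submodule ℂ c.Calderon) (n : ℕ) (z : unitStrip) : ℱ →ₗ[ℂ] Rochberg ℱ n z := ((c.taylor n z).comp ℱ.subtype).rangeRestrict

theorem norm_mkₗ_le (f : ℱ) : ‖mkₗ ℱ n z f‖ ≤ ‖f‖ := by
  rw [norm_eq]
  exact csInf_le ⟨0, by rintro r ⟨_, _, _, rfl⟩; exact norm_nonneg _⟩ ⟨f, f.2, rfl, rfl⟩

/-- The quotient map. -/
def mk (ℱ : Submodule ℂ c.Calderon) (n : ℕ) (z : unitStrip) : ℱ →L[ℂ] Rochberg ℱ n z :=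
  (mkₗ ℱ n z).mkContinuous 1 fun f => by simpa using norm_mkₗ_le f

@[simp] theorem coord_mk (f : ℱ) : (mk ℱ n z f).coord = c.taylor n z f := rfl

theorem norm_mk_le (f : ℱ) : ‖mk ℱ n z f‖ ≤ ‖f‖ := norm_mkₗ_le f

theorem exists_mk_eq (w : Rochberg ℱ n z) {ε : ℝ} (hε : 0 < ε) :
    ∃ f : ℱ, mk ℱ n z f = w ∧ ‖f‖ < ‖w‖ + ε := by
  have hne : {r : ℝ | ∃ f ∈ ℱ, c.taylor n z f = w.coord ∧ r = ‖f‖}.Nonempty := by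
    obtain ⟨f, hf⟩ := w.2
    exact ⟨_, f, f.2, hf, rfl⟩
  obtain ⟨r, ⟨f, hf, hfw, rfl⟩, hr⟩ := exists_lt_of_csInf_lt hne
    (show _ < ‖w‖ + ε by rw [← norm_eq]; linarith)
  exact ⟨⟨f, hf⟩, coord_injective hfw, hr⟩

theorem mk_surjective : Function.Surjective (mk ℱ n z) := fun w =>
  let ⟨f, hf, _⟩ := exists_mk_eq w one_pos
  ⟨f, hf⟩

end Rochberg

end BanachCouple

/-! ### Cut-off functions and decaying monomials. -/

/-- A rational function with its only zero in the closed strip at `z`. -/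
def stripZero (z w : ℂ) : ℂ := (w - z) / (w + 1)

/-- A function that vanishes at infinity and equals `1` up to the order `n` at `z`. -/
def stripCut (n : ℕ) (z w : ℂ) : ℂ := 1 - stripZero z w ^ n

theorem one_le_norm_add_one {w : ℂ} (hw : w ∈ closedUnitStrip) : 1 ≤ ‖w + 1‖ := by
  refine le_trans ?_ (Complex.re_le_norm _)
  have := hw.1
  simp
  exact this

theorem add_one_ne_zero_of_mem {w : ℂ} (hw : w ∈ closedUnitStrip) : w + 1 ≠ 0 :=
  norm_pos_iff.1 (one_pos.trans_le (one_le_norm_add_one hw))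

theorem diffContOnCl_of_differentiableAt {f : ℂ → ℂ}
    (h : ∀ w ∈ closedUnitStrip, DifferentiableAt ℂ f w) : DiffContOnCl ℂ f unitStrip :=
  ⟨fun w hw => (h w (unitStrip_subset hw)).differentiableWithinAt, by
    rw [closure_unitStrip]
    exact fun w hw => (h w hw).continuousAt.continuousWithinAt⟩

theorem differentiableAt_stripZero (z : ℂ) {w : ℂ} (hw : w ∈ closedUnitStrip) :
    DifferentiableAt ℂ (stripZero z) w :=
  (differentiableAt_id.sub_const z).div (differentiableAt_id.add_const 1)
    (add_one_ne_zero_of_mem hw)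

theorem norm_stripZero_le (z : ℂ) {w : ℂ} (hw : w ∈ closedUnitStrip) :
    ‖stripZero z w‖ ≤ 1 + ‖z + 1‖ := by
  have h1 := one_le_norm_add_one hw
  rw [stripZero, norm_div, div_le_iff₀ (by linarith)]
  have : w - z = (w + 1) - (z + 1) := by ring
  rw [this]
  have h2 := norm_sub_le (w + 1) (z + 1)
  nlinarith [norm_nonneg (z + 1)]

theorem isStripMultiplier_stripZero (z : ℂ) :
    IsStripMultiplier (1 + ‖z + 1‖) (stripZero z) :=
  ⟨diffContOnCl_of_differentiableAt fun _ => differentiableAt_stripZero z,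
    fun _ => norm_stripZero_le z⟩

/-- Since `1 - stripZero z w = (z + 1) / (w + 1)`, the geometric sum exhibits one order of decay.
The final `+ 1` keeps the constant positive when `n = 0`. -/
theorem exists_norm_stripCut_le (n : ℕ) (z : ℂ) :
    ∃ C : ℝ, 0 < C ∧ ∀ w ∈ closedUnitStrip, ‖stripCut n z w‖ ≤ C / ‖w + 1‖ := by
  refine ⟨‖z + 1‖ * ∑ i ∈ Finset.range n, (1 + ‖z + 1‖) ^ i + 1, by positivity, fun w hw => ?_⟩
  have h1 := one_le_norm_add_one hw
  have h0 := add_one_ne_zero_of_mem hw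
  have e : stripCut n z w = (z + 1) / (w + 1) * ∑ i ∈ Finset.range n, stripZero z w ^ i := by
    rw [stripCut, ← mul_neg_geom_sum]
    congr 1
    rw [stripZero]
    field_simp
    ring
  rw [e, norm_mul, norm_div, div_mul_eq_mul_div]
  refine div_le_div_of_nonneg_right ?_ (norm_nonneg _)
  refine le_trans ?_ (le_add_of_nonneg_right zero_le_one)
  refine mul_le_mul_of_nonneg_left ?_ (norm_nonneg _)
  refine (norm_sum_le _ _).trans (Finset.sum_le_sum fun i _ => ?_)
  rw [norm_pow]
  exact pow_le_pow_left₀ (norm_nonneg _) (norm_stripZero_le z hw) i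

theorem differentiableAt_stripCut (n : ℕ) (z : ℂ) {w : ℂ} (hw : w ∈ closedUnitStrip) :
    DifferentiableAt ℂ (stripCut n z) w :=
  ((differentiableAt_stripZero z hw).pow n).const_sub 1

/-- Functions congruent to `1` modulo `(w - z) ^ n` are closed under products, and `stripCut` is one
of them because `1 / (w + 1)` is analytic at `z`. -/
theorem exists_stripCut_pow_eq (n m : ℕ) {z : ℂ} (hz : z ∈ unitStrip) :
    ∃ χ : ℂ → ℂ, AnalyticAt ℂ χ z ∧
      ∀ᶠ w in 𝓝 z, stripCut n z w ^ m = 1 + (w - z) ^ n * χ w := by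
  have hop : AnalyticAt ℂ (stripCut n z) z :=
    (diffContOnCl_of_differentiableAt fun _ => differentiableAt_stripCut n z).analyticAt_unitStrip hz
  have hinv : AnalyticAt ℂ (fun w : ℂ => -((w + 1) ^ n)⁻¹) z :=
    (((analyticAt_id.add analyticAt_const).pow n).inv
      (pow_ne_zero _ (add_one_ne_zero_of_mem (unitStrip_subset hz)))).neg
  induction m with
  | zero => exact ⟨fun _ => 0, analyticAt_const, by simp⟩
  | succ m ih =>
    obtain ⟨χ, hχ, h⟩ := ih
    refine ⟨fun w => χ w * stripCut n z w + -((w + 1) ^ n)⁻¹, (hχ.mul hop).add hinv, ?_⟩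
    filter_upwards [h] with w hw
    have e : stripZero z w ^ n = (w - z) ^ n * ((w + 1) ^ n)⁻¹ := by
      rw [stripZero, div_pow, div_eq_mul_inv]
    rw [pow_succ, hw, stripCut, e]
    ring

theorem isStripMultiplier_of_norm_le_div {φ : ℂ → ℂ} {C : ℝ}
    (hφ : ∀ w ∈ closedUnitStrip, DifferentiableAt ℂ φ w) (hC : 0 ≤ C)
    (h : ∀ w ∈ closedUnitStrip, ‖φ w‖ ≤ C / ‖w + 1‖) : IsStripMultiplier C φ :=
  ⟨diffContOnCl_of_differentiableAt hφ, fun w hw =>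
    (h w hw).trans (div_le_self hC (one_le_norm_add_one hw))⟩

theorem tendsto_left_of_norm_le_div {φ : ℂ → ℂ} {C : ℝ}
    (h : ∀ w ∈ closedUnitStrip, ‖φ w‖ ≤ C / ‖w + 1‖) :
    Tendsto (fun t : ℝ => φ (t * I)) (cocompact ℝ) (𝓝 0) := by
  have h1 : Tendsto (fun t : ℝ => ‖(t * I + 1 : ℂ)‖) (cocompact ℝ) atTop :=
    tendsto_atTop_mono (fun t => by simpa using Complex.abs_im_le_norm (t * I + 1 : ℂ))
      tendsto_norm_cocompact_atTop
  exact squeeze_zero_norm (fun t => h _ (left_mem_closedUnitStrip t)) (h1.const_div_atTop C)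

theorem tendsto_right_of_norm_le_div {φ : ℂ → ℂ} {C : ℝ}
    (h : ∀ w ∈ closedUnitStrip, ‖φ w‖ ≤ C / ‖w + 1‖) :
    Tendsto (fun t : ℝ => φ (1 + t * I)) (cocompact ℝ) (𝓝 0) := by
  have h1 : Tendsto (fun t : ℝ => ‖(1 + t * I + 1 : ℂ)‖) (cocompact ℝ) atTop :=
    tendsto_atTop_mono (fun t => by simpa using Complex.abs_im_le_norm (1 + t * I + 1 : ℂ))
      tendsto_norm_cocompact_atTop
  exact squeeze_zero_norm (fun t => h _ (right_mem_closedUnitStrip t)) (h1.const_div_atTop C)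

/-- A function with the Taylor coefficients of `(w - z) ^ k` up to the order `n` at `z`. -/
def stripMonomial (n : ℕ) (z : ℂ) (k : ℕ) (w : ℂ) : ℂ := (w - z) ^ k * stripCut n z w ^ n

theorem differentiableAt_stripMonomial (n : ℕ) (z : ℂ) (k : ℕ) {w : ℂ}
    (hw : w ∈ closedUnitStrip) : DifferentiableAt ℂ (stripMonomial n z k) w :=
  ((differentiableAt_id.sub_const z).pow k).mul ((differentiableAt_stripCut n z hw).pow n)

/-- The power `stripCut ^ n` decays like `‖w + 1‖⁻ⁿ` and `(w - z) ^ k` grows like `‖w + 1‖ ^ k`, so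
`k < n` leaves one order of decay. -/
theorem exists_norm_stripMonomial_le (n : ℕ) (z : ℂ) :
    ∃ C : ℝ, 0 < C ∧ ∀ k < n, ∀ w ∈ closedUnitStrip, ‖stripMonomial n z k w‖ ≤ C / ‖w + 1‖ := by
  obtain ⟨C, hC, h⟩ := exists_norm_stripCut_le n z
  set D : ℝ := 1 + ‖z + 1‖
  have hD : 1 ≤ D := by simp [D]
  refine ⟨D ^ n * C ^ n, by positivity, fun k hk w hw => ?_⟩
  have h1 := one_le_norm_add_one hw
  have h0 : 0 < ‖w + 1‖ := by linarith
  have h2 : ‖w - z‖ ≤ D * ‖w + 1‖ := by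
    have := norm_stripZero_le z hw
    rwa [stripZero, norm_div, div_le_iff₀ h0] at this
  rw [stripMonomial, norm_mul, norm_pow, norm_pow, le_div_iff₀ h0]
  calc ‖w - z‖ ^ k * ‖stripCut n z w‖ ^ n * ‖w + 1‖
      ≤ (D * ‖w + 1‖) ^ k * (C / ‖w + 1‖) ^ n * ‖w + 1‖ := by gcongr; exact h w hw
    _ = D ^ k * C ^ n * (‖w + 1‖ ^ (k + 1) / ‖w + 1‖ ^ n) := by
        rw [mul_pow, div_pow, pow_succ]; ring
    _ ≤ D ^ n * C ^ n * 1 := by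
        have : ‖w + 1‖ ^ (k + 1) / ‖w + 1‖ ^ n ≤ 1 :=
          div_le_one_of_le₀ (pow_le_pow_right₀ h1 hk) (by positivity)
        have h3 : D ^ k ≤ D ^ n := pow_le_pow_right₀ hD hk.le
        gcongr
    _ = D ^ n * C ^ n := mul_one _

theorem taylorCoeff_stripMonomial {n : ℕ} {z : ℂ} (hz : z ∈ unitStrip) (k : ℕ) {i : ℕ}
    (hi : i < n) : taylorCoeff i (stripMonomial n z k) z = if i = k then 1 else 0 := by
  obtain ⟨χ, hχ, h⟩ := exists_stripCut_pow_eq n n hz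
  have e : stripMonomial n z k = fun w => stripCut n z w ^ n • ((w - z) ^ k • (1 : ℂ)) := by
    funext w
    simp [stripMonomial, mul_comm]
  have h1 : AnalyticAt ℂ (fun w : ℂ => (w - z) ^ k • (1 : ℂ)) z :=
    ((analyticAt_id.sub analyticAt_const).pow k).smul analyticAt_const
  rw [e, taylorCoeff_smul_eq_of_eq_one_add hχ h h1 hi,
    taylorCoeff_sub_pow_smul analyticAt_const]
  have hc : ∀ j : ℕ, taylorCoeff j (fun _ : ℂ => (1 : ℂ)) z = if j = 0 then 1 else 0 := by
    intro j
    by_cases hj : j = 0 <;> simp [taylorCoeff, iteratedDeriv_const, hj]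
  rw [hc]
  split_ifs <;> first | rfl | omega

theorem exists_closedBall_subset_unitStrip (z : unitStrip) :
    ∃ r : ℝ, 0 < r ∧ Metric.closedBall (z : ℂ) r ⊆ unitStrip :=
  Metric.nhds_basis_closedBall.mem_iff.1 (isOpen_unitStrip.mem_nhds z.2)

/-! ### Division by zeros and jets with entries in the intersection. -/

namespace BanachCouple

variable {X₀ X₁ E : Type*}
  [NormedAddCommGroup X₀] [NormedSpace ℂ X₀] [NormedAddCommGroup X₁] [NormedSpace ℂ X₁]
  [NormedAddCommGroup E] [NormedSpace ℂ E]
  {c : BanachCouple X₀ X₁ E}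

section Division

variable [CompleteSpace E]

/-- The quotient is `(w + 1) • dslope f z w`. It is bounded near `z` by compactness, and away from
`z` because `(w + 1) / (w - z)` is bounded there; the latter bound also serves the boundary
functions and their limits at infinity. -/
theorem exists_eq_stripZero_smul (f : c.Calderon) {z : unitStrip} (hz : f.toFun z = 0) :
    ∃ g : c.Calderon, (∀ w ∈ closedUnitStrip, f.toFun w = stripZero z w • g.toFun w) ∧
      (f ∈ c.calderonZero → g ∈ c.calderonZero) := by
  obtain ⟨r, hr, hball⟩ := exists_closedBall_subset_unitStrip z
  have hnz : (closedUnitStrip : Set ℂ) ∈ 𝓝 (z : ℂ) :=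
    mem_of_superset (isOpen_unitStrip.mem_nhds z.2) unitStrip_subset
  set D : ℝ := 1 + ‖(z : ℂ) + 1‖ / r with hD
  have hD0 : 0 ≤ D := by positivity
  have hfar : ∀ w : ℂ, w ∉ Metric.closedBall (z : ℂ) r → ‖(w + 1) / (w - z)‖ ≤ D := by
    intro w hw
    rw [Metric.mem_closedBall, not_le, dist_eq_norm] at hw
    have h0 : 0 < ‖w - z‖ := hr.trans hw
    rw [norm_div, div_le_iff₀ h0, hD, add_mul, one_mul]
    calc ‖w + 1‖ = ‖(w - z) + (z + 1)‖ := by ring_nf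
      _ ≤ ‖w - z‖ + ‖(z : ℂ) + 1‖ := norm_add_le _ _
      _ ≤ ‖w - z‖ + ‖(z : ℂ) + 1‖ / r * ‖w - z‖ := by
        gcongr
        rw [div_mul_eq_mul_div, le_div_iff₀ hr]
        exact mul_le_mul_of_nonneg_left hw.le (norm_nonneg _)
  have hleft : ∀ t : ℝ, (t * I : ℂ) ∉ Metric.closedBall (z : ℂ) r := fun t ht => by
    have := (hball ht).1
    simp at this
  have hright : ∀ t : ℝ, (1 + t * I : ℂ) ∉ Metric.closedBall (z : ℂ) r := fun t ht => by
    have := (hball ht).2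
    simp at this
  have hne : ∀ w : ℂ, w ∉ Metric.closedBall (z : ℂ) r → w - z ≠ 0 := fun w hw h0 =>
    hw (by rw [sub_eq_zero.1 h0]; exact Metric.mem_closedBall_self hr.le)
  let F : ℂ → E := fun w => (w + 1) • dslope f.toFun z w
  have hFne : ∀ w : ℂ, w ∉ Metric.closedBall (z : ℂ) r →
      F w = ((w + 1) / (w - z)) • f.toFun w := fun w hw => by
    have : w ≠ z := sub_ne_zero.1 (hne w hw)
    simp only [F]
    rw [dslope_of_ne _ this, slope_def_module, hz, sub_zero, smul_smul, div_eq_mul_inv]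
  have hcont : ContinuousOn (dslope f.toFun z) closedUnitStrip :=
    (continuousOn_dslope hnz).2
      ⟨f.diffContOnCl.continuousOn_closedUnitStrip, (f.analyticAt z.2).differentiableAt⟩
  have hFc : ContinuousOn F closedUnitStrip :=
    ((continuous_id.add continuous_const).continuousOn).smul hcont
  have hFd : DiffContOnCl ℂ F unitStrip := by
    refine ⟨DifferentiableOn.fun_smul (by fun_prop) ?_, closure_unitStrip ▸ hFc⟩
    exact (Complex.differentiableOn_dslope (isOpen_unitStrip.mem_nhds z.2)).2
      f.diffContOnCl.differentiableOn
  have hFb : ∃ K : ℝ, ∀ w ∈ unitStrip, ‖F w‖ ≤ K := by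
    obtain ⟨K, hK⟩ := (isCompact_closedBall (z : ℂ) r).exists_bound_of_continuousOn
      (hFc.mono (hball.trans unitStrip_subset))
    refine ⟨max K (D * (max ‖c.i₀‖ ‖c.i₁‖ * ‖f‖)), fun w _ => ?_⟩
    by_cases hw : w ∈ Metric.closedBall (z : ℂ) r
    · exact (hK w hw).trans (le_max_left _ _)
    · refine le_trans ?_ (le_max_right _ _)
      rw [hFne w hw, norm_smul]
      exact mul_le_mul (hfar w hw) (f.norm_toFun_le w) (norm_nonneg _) hD0
  let b₀ : ℝ →ᵇ X₀ := BoundedContinuousFunction.ofNormedAddCommGroup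
    (fun t : ℝ => ((t * I + 1) / (t * I - z : ℂ)) • f.bdry₀ t)
    (Continuous.smul (Continuous.div (by fun_prop) (by fun_prop) fun t => hne _ (hleft t))
      f.bdry₀.continuous) (D * ‖f‖) fun t => by
        rw [norm_smul]
        exact mul_le_mul (hfar _ (hleft t)) (f.norm_bdry₀_le t) (norm_nonneg _) hD0
  let b₁ : ℝ →ᵇ X₁ := BoundedContinuousFunction.ofNormedAddCommGroup
    (fun t : ℝ => ((1 + t * I + 1) / (1 + t * I - z : ℂ)) • f.bdry₁ t)
    (Continuous.smul (Continuous.div (by fun_prop) (by fun_prop) fun t => hne _ (hright t))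
      f.bdry₁.continuous) (D * ‖f‖) fun t => by
        rw [norm_smul]
        exact mul_le_mul (hfar _ (hright t)) (f.norm_bdry₁_le t) (norm_nonneg _) hD0
  refine ⟨Calderon.ofBdry F hFd hFb b₀ b₁ (fun t => ?_) (fun t => ?_), fun w hw => ?_, fun hf => ⟨?_, ?_⟩⟩
  · rw [hFne _ (hleft t), f.toFun_left, ← map_smul]
    rfl
  · rw [hFne _ (hright t), f.toFun_right, ← map_smul]
    rfl
  · rw [Calderon.toFun_ofBdry hw, stripZero, smul_smul,
      div_mul_cancel₀ _ (add_one_ne_zero_of_mem hw), sub_smul_dslope, hz, sub_zero]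
  · refine squeeze_zero_norm (a := fun t => D * ‖f.bdry₀ t‖) (fun t => ?_) ?_
    · change ‖((t * I + 1) / (t * I - z : ℂ)) • f.bdry₀ t‖ ≤ _
      rw [norm_smul]
      exact mul_le_mul_of_nonneg_right (hfar _ (hleft t)) (norm_nonneg _)
    · simpa using hf.1.norm.const_mul D
  · refine squeeze_zero_norm (a := fun t => D * ‖f.bdry₁ t‖) (fun t => ?_) ?_
    · change ‖((1 + t * I + 1) / (1 + t * I - z : ℂ)) • f.bdry₁ t‖ ≤ _
      rw [norm_smul]
      exact mul_le_mul_of_nonneg_right (hfar _ (hright t)) (norm_nonneg _)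
    · simpa using hf.2.norm.const_mul D

theorem exists_eq_stripZero_pow_smul {n : ℕ} (f : c.Calderon) {z : unitStrip}
    (hz : c.taylor n z f = 0) :
    ∃ g : c.Calderon, (∀ w ∈ closedUnitStrip, f.toFun w = stripZero z w ^ n • g.toFun w) ∧
      (f ∈ c.calderonZero → g ∈ c.calderonZero) := by
  induction n generalizing f with
  | zero => exact ⟨f, by simp, id⟩
  | succ n ih =>
    have h0 : f.toFun z = 0 := by
      have := congrFun hz 0
      rwa [Calderon.taylor_apply, Fin.val_zero, taylorCoeff_zero] at this
    obtain ⟨g, hg, hg0⟩ := exists_eq_stripZero_smul f h0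
    have hga := g.analyticAt z.2
    have hinv : AnalyticAt ℂ (fun w : ℂ => (w + 1)⁻¹) z :=
      (analyticAt_id.add analyticAt_const).inv (add_one_ne_zero_of_mem (unitStrip_subset z.2))
    have hu : AnalyticAt ℂ (fun w : ℂ => (w + 1)⁻¹ • g.toFun w) z := hinv.smul hga
    -- Near `z` one has `f = (w - z) • ((w + 1)⁻¹ • g)`, so the jet of `(w + 1)⁻¹ • g` is the
    -- shifted jet of `f`. Leibniz's rule for the factor `w + 1` carries its vanishing over to `g`.
    have h1 : ∀ k < n, taylorCoeff k (fun w : ℂ => (w + 1)⁻¹ • g.toFun w) (z : ℂ) = 0 := by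
      intro k hk
      have h2 := congrFun hz ⟨k + 1, by omega⟩
      rw [Calderon.taylor_apply] at h2
      rw [← taylorCoeff_sub_smul_succ hu]
      refine (taylorCoeff_congr ?_ _).trans h2
      filter_upwards [isOpen_unitStrip.mem_nhds z.2] with w hw
      rw [hg w (unitStrip_subset hw), stripZero, smul_smul, div_eq_mul_inv]
    have h3 : c.taylor n z g = 0 := by
      funext i
      rw [Calderon.taylor_apply]
      have e : g.toFun =ᶠ[𝓝 (z : ℂ)] fun w => (w + 1) • ((w + 1)⁻¹ • g.toFun w) := by
        filter_upwards [isOpen_unitStrip.mem_nhds z.2] with w hw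
        rw [smul_inv_smul₀ (add_one_ne_zero_of_mem (unitStrip_subset hw))]
      rw [taylorCoeff_congr e, taylorCoeff_smul
        (show AnalyticAt ℂ (fun w : ℂ => w + 1) z from analyticAt_id.add analyticAt_const) hu]
      refine Finset.sum_eq_zero fun j _ => ?_
      rw [h1 _ (by omega), smul_zero]
    obtain ⟨g', hg', hg0'⟩ := ih g h3
    refine ⟨g', fun w hw => ?_, fun hf => hg0' (hg0 hf)⟩
    rw [hg w hw, hg' w hw, smul_smul, pow_succ']

end Division

/-- `F` is a bounded analytic function with values in the intersection representing `f`. -/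
structure IsInterLift (f : c.Calderon) (F : ℂ → c.inter) : Prop where
  diffContOnCl : DiffContOnCl ℂ F unitStrip
  bounded : ∃ K : ℝ, ∀ w ∈ closedUnitStrip, ‖F w‖ ≤ K
  toFun_eq : ∀ w ∈ closedUnitStrip, f.toFun w = c.interTo (F w)

namespace IsInterLift

variable {f g : c.Calderon} {F G : ℂ → c.inter}

theorem bdry₀ (h : IsInterLift f F) (t : ℝ) : f.bdry₀ t = c.interTo₀ (F (t * I)) :=
  c.injective₀ (by
    rw [← f.toFun_left, h.toFun_eq _ (left_mem_closedUnitStrip t), i₀_interTo₀])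

theorem bdry₁ (h : IsInterLift f F) (t : ℝ) : f.bdry₁ t = c.interTo₁ (F (1 + t * I)) :=
  c.injective₁ (by
    rw [← f.toFun_right, h.toFun_eq _ (right_mem_closedUnitStrip t), i₁_interTo₁])

theorem add (hf : IsInterLift f F) (hg : IsInterLift g G) :
    IsInterLift (f + g) fun w => F w + G w where
  diffContOnCl := hf.1.add hg.1
  bounded := by
    obtain ⟨K, hK⟩ := hf.2
    obtain ⟨L, hL⟩ := hg.2
    exact ⟨K + L, fun w hw => (norm_add_le _ _).trans (add_le_add (hK w hw) (hL w hw))⟩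
  toFun_eq w hw := by rw [Calderon.toFun_add, hf.3 w hw, hg.3 w hw, map_add]

theorem mul (hf : IsInterLift f F) {A : ℝ} {φ : ℂ → ℂ} (hφ : IsStripMultiplier A φ) :
    IsInterLift (Calderon.mul φ hφ f) fun w => φ w • F w where
  diffContOnCl := hφ.1.smul hf.1
  bounded := by
    obtain ⟨K, hK⟩ := hf.2
    refine ⟨A * K, fun w hw => ?_⟩
    rw [norm_smul]
    exact mul_le_mul (hφ.2 w hw) (hK w hw) (norm_nonneg _) hφ.nonneg
  toFun_eq w hw := by rw [Calderon.toFun_mul, hf.3 w hw, map_smul]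

theorem taylor [CompleteSpace X₀] [CompleteSpace X₁] [CompleteSpace E] (hf : IsInterLift f F)
    {n : ℕ} {z : unitStrip} (i : Fin n) : c.taylor n z f i = c.interTo (taylorCoeff i F z) := by
  rw [Calderon.taylor_apply, ← taylorCoeff_clm_comp _ (hf.1.analyticAt_unitStrip z.2)]
  refine taylorCoeff_congr ?_ _
  filter_upwards [isOpen_unitStrip.mem_nhds z.2] with w hw
  exact hf.3 w (unitStrip_subset hw)

end IsInterLift

theorem isInterLift_ofInter {F : ℂ → c.inter} (hF : DiffContOnCl ℂ F unitStrip)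
    (hb : ∃ K : ℝ, ∀ w ∈ closedUnitStrip, ‖F w‖ ≤ K) : IsInterLift (ofInter F hF hb) F :=
  ⟨hF, hb, fun _ hw => toFun_ofInter hF hb hw⟩

/-- The function with values in the intersection with prescribed Taylor coefficients at `z`. -/
def interPoly {n : ℕ} (z : ℂ) (d : Fin n → c.inter) (w : ℂ) : c.inter :=
  ∑ k : Fin n, stripMonomial n z k w • d k

theorem exists_norm_interPoly_le {n : ℕ} (z : ℂ) (d : Fin n → c.inter) :
    ∃ C : ℝ, 0 < C ∧ ∀ w ∈ closedUnitStrip, ‖interPoly z d w‖ ≤ C / ‖w + 1‖ := by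
  obtain ⟨C, hC, h⟩ := exists_norm_stripMonomial_le n z
  refine ⟨C * (∑ k, ‖d k‖ + 1), by positivity, fun w hw => ?_⟩
  refine (norm_sum_le _ _).trans ?_
  rw [mul_div_right_comm]
  have h0 : 0 ≤ C / ‖w + 1‖ := by positivity
  refine le_trans ?_ (mul_le_mul_of_nonneg_left (le_add_of_nonneg_right zero_le_one) h0)
  rw [Finset.mul_sum]
  refine Finset.sum_le_sum fun k _ => ?_
  rw [norm_smul]
  exact mul_le_mul_of_nonneg_right (h k k.2 w hw) (norm_nonneg _)

theorem differentiableAt_interPoly {n : ℕ} (z : ℂ) (d : Fin n → c.inter) {w : ℂ}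
    (hw : w ∈ closedUnitStrip) : DifferentiableAt ℂ (interPoly z d) w := by
  unfold interPoly
  exact DifferentiableAt.fun_sum fun k _ =>
    (differentiableAt_stripMonomial n z k hw).smul_const (d k)

theorem diffContOnCl_interPoly {n : ℕ} (z : ℂ) (d : Fin n → c.inter) :
    DiffContOnCl ℂ (interPoly z d) unitStrip :=
  ⟨fun w hw => (differentiableAt_interPoly z d (unitStrip_subset hw)).differentiableWithinAt, by
    rw [closure_unitStrip]
    exact fun w hw => (differentiableAt_interPoly z d hw).continuousAt.continuousWithinAt⟩

theorem bounded_interPoly {n : ℕ} (z : ℂ) (d : Fin n → c.inter) :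
    ∃ K : ℝ, ∀ w ∈ closedUnitStrip, ‖interPoly z d w‖ ≤ K := by
  obtain ⟨C, hC, h⟩ := exists_norm_interPoly_le z d
  exact ⟨C, fun w hw => (h w hw).trans (div_le_self hC.le (one_le_norm_add_one hw))⟩

theorem taylorCoeff_interPoly [CompleteSpace X₀] [CompleteSpace X₁] {n : ℕ} {z : ℂ}
    (hz : z ∈ unitStrip) (d : Fin n → c.inter) (i : Fin n) :
    taylorCoeff i (interPoly z d) z = d i := by
  have h1 : ∀ k : Fin n, AnalyticAt ℂ (stripMonomial n z k) z := fun k =>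
    (diffContOnCl_of_differentiableAt
      fun _ => differentiableAt_stripMonomial n z k).analyticAt_unitStrip hz
  have h2 : ∀ k : Fin n, taylorCoeff i (fun w => stripMonomial n z k w • d k) z =
      if i = k then d k else 0 := by
    intro k
    have := taylorCoeff_clm_comp ((ContinuousLinearMap.id ℂ ℂ).smulRight (d k)) (h1 k) i
    simp only [ContinuousLinearMap.smulRight_apply, ContinuousLinearMap.id_apply] at this
    rw [this, taylorCoeff_stripMonomial hz k i.2]
    by_cases h : i = k
    · simp [h]
    · rw [if_neg (fun h' => h (Fin.ext h')), if_neg h, zero_smul]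
  unfold interPoly
  rw [taylorCoeff_sum (f := fun (k : Fin n) w => stripMonomial n z k w • d k) _
    fun k _ => (h1 k).smul analyticAt_const]
  simp [h2]

/-- The element of the Calderón space given by `interPoly`. -/
def polyLift {n : ℕ} (z : ℂ) (d : Fin n → c.inter) : c.Calderon :=
  ofInter (interPoly z d) (diffContOnCl_interPoly z d) (bounded_interPoly z d)

theorem isInterLift_polyLift {n : ℕ} (z : ℂ) (d : Fin n → c.inter) :
    IsInterLift (polyLift z d) (interPoly z d) := isInterLift_ofInter _ _

theorem polyLift_mem {n : ℕ} (z : ℂ) (d : Fin n → c.inter) : polyLift z d ∈ c.calderonZero := by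
  obtain ⟨C, hC, h⟩ := exists_norm_interPoly_le z d
  -- The norm is regarded as a complex valued function, so that the decay lemmas for scalar
  -- functions apply to it.
  have hn : ∀ w ∈ closedUnitStrip, ‖((‖interPoly z d w‖ : ℝ) : ℂ)‖ ≤ C / ‖w + 1‖ := fun w hw => by
    simpa using h w hw
  constructor
  · refine squeeze_zero_norm (fun t => norm_interTo₀_le _) ?_
    simpa using (tendsto_left_of_norm_le_div hn).norm
  · refine squeeze_zero_norm (fun t => norm_interTo₁_le _) ?_
    simpa using (tendsto_right_of_norm_le_div hn).norm

theorem taylor_polyLift [CompleteSpace X₀] [CompleteSpace X₁] [CompleteSpace E] {n : ℕ}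
    (z : unitStrip) (d : Fin n → c.inter) (i : Fin n) :
    c.taylor n z (polyLift z d) i = c.interTo (d i) := by
  rw [(isInterLift_polyLift (z : ℂ) d).taylor, taylorCoeff_interPoly z.2]

end BanachCouple

/-! ### Analyticity criteria and Cauchy's theorem on the strip. -/

section Analytic

variable {V W : Type*} [NormedAddCommGroup V] [NormedSpace ℂ V] [CompleteSpace V]
  [NormedAddCommGroup W] [NormedSpace ℂ W] [CompleteSpace W]

/-- A continuous function is analytic if it is so after composition with the members of a
separating family of operators. -/
theorem differentiableOn_of_forall_clm {ι : Type*} (L : ι → V →L[ℂ] W)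
    (hL : ∀ v, (∀ i, L i v = 0) → v = 0) {U : Set ℂ} (hU : IsOpen U) {F : ℂ → V}
    (hc : ContinuousOn F U) (h : ∀ i, DifferentiableOn ℂ (fun w => L i (F w)) U) :
    DifferentiableOn ℂ F U := by
  intro w hw
  obtain ⟨R, hR, hball⟩ := Metric.nhds_basis_closedBall.mem_iff.1 (hU.mem_nhds hw)
  lift R to NNReal using hR.le
  have hsph : ContinuousOn F (Metric.sphere w R) :=
    hc.mono (Metric.sphere_subset_closedBall.trans hball)
  -- The Cauchy integral of the continuous function `F` is analytic, and every `L i` maps it to the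
  -- Cauchy integral of `L i ∘ F`, which is `L i ∘ F`; as the family separates points, it equals
  -- `F`.
  have hG := hasFPowerSeriesOn_cauchy_integral (hsph.circleIntegrable R.2) (by exact_mod_cast hR)
  have heq : ∀ v ∈ Metric.ball w R, (2 * Real.pi * I : ℂ)⁻¹ • (∮ ζ in C(w, R), (ζ - v)⁻¹ • F ζ)
      = F v := by
    intro v hv
    have hint : ContinuousOn (fun ζ => (ζ - v)⁻¹ • F ζ) (Metric.sphere w R) := by
      refine ContinuousOn.smul (ContinuousOn.inv₀ (by fun_prop) fun ζ hζ h0 => ?_) hsph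
      rw [sub_eq_zero.1 h0] at hζ
      exact (Metric.mem_ball.1 hv).ne (Metric.mem_sphere.1 hζ)
    refine sub_eq_zero.1 (hL _ fun i => ?_)
    have h2 := DiffContOnCl.two_pi_i_inv_smul_circleIntegral_sub_inv_smul
      (f := fun w => L i (F w)) (c := w) (R := R) (w := v)
      ((h i).diffContOnCl_ball hball) hv
    rw [map_sub, map_smul, sub_eq_zero, ← h2]
    congr 1
    simp only [circleIntegral]
    rw [← (L i).intervalIntegral_comp_comm]
    · simp
    · exact (hint.circleIntegrable R.2).out
  have hd := (hG.analyticAt).differentiableAt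
  refine (hd.congr_of_eventuallyEq ?_).differentiableWithinAt
  filter_upwards [Metric.ball_mem_nhds w hR] with v hv
  exact (heq v hv).symm

/-- No bound on the derivative is needed for analytic integrands: Cauchy's estimate on balls of
radius `r / 4` dominates it by `g / (r / 4)`. -/
theorem differentiableAt_integral_of_dominated {α : Type*} [MeasurableSpace α] {μ : Measure α}
    {F : ℂ → α → V} {w₀ : ℂ} {r : ℝ} (hr : 0 < r) {g : α → ℝ} (hg : Integrable g μ)
    (hF : ∀ w ∈ Metric.ball w₀ r, AEStronglyMeasurable (F w) μ)
    (hd : ∀ x, DifferentiableOn ℂ (fun w => F w x) (Metric.ball w₀ r))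
    (hb : ∀ w ∈ Metric.ball w₀ r, ∀ x, ‖F w x‖ ≤ g x) :
    DifferentiableAt ℂ (fun w => ∫ x, F w x ∂μ) w₀ := by
  have hr2 : 0 < r / 2 := by positivity
  have hr4 : 0 < r / 4 := by positivity
  have h0 : w₀ ∈ Metric.ball w₀ r := Metric.mem_ball_self hr
  have hda : ∀ x, ∀ w ∈ Metric.ball w₀ r, DifferentiableAt ℂ (fun w => F w x) w := fun x w hw =>
    (hd x).differentiableAt (Metric.isOpen_ball.mem_nhds hw)
  -- The derivative is measurable in `x` as a pointwise limit of difference quotients along the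
  -- increments `r / 2 / (k + 1)`, which stay inside the ball.
  have hmeas : AEStronglyMeasurable (fun x => deriv (fun w => F w x) w₀) μ := by
    let u : ℕ → ℂ := fun k => ((r / 2 / (k + 1) : ℝ) : ℂ)
    have hu0 : ∀ k, u k ≠ 0 := fun k => by
      simp only [u, ne_eq, ofReal_eq_zero]
      positivity
    have hu : Tendsto u atTop (𝓝[≠] 0) := by
      refine tendsto_nhdsWithin_iff.2 ⟨?_, Eventually.of_forall hu0⟩
      have : Tendsto (fun k : ℕ => r / 2 / ((k : ℝ) + 1)) atTop (𝓝 0) :=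
        tendsto_const_nhds.div_atTop (tendsto_natCast_atTop_atTop.atTop_add tendsto_const_nhds)
      have h := (Complex.continuous_ofReal.tendsto 0).comp this
      rw [ofReal_zero] at h
      exact h
    refine aestronglyMeasurable_of_tendsto_ae atTop
      (f := fun k x => (u k)⁻¹ • (F (w₀ + u k) x - F w₀ x)) (fun k => ?_) ?_
    · refine ((hF _ ?_).sub (hF _ h0)).const_smul _
      rw [Metric.mem_ball, dist_eq_norm, add_sub_cancel_left]
      simp only [u, norm_real, Real.norm_eq_abs]
      rw [abs_of_nonneg (by positivity), div_lt_iff₀ (by positivity)]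
      have : (0 : ℝ) ≤ k := Nat.cast_nonneg k
      nlinarith
    · refine Eventually.of_forall fun x => ?_
      exact (hasDerivAt_iff_tendsto_slope_zero.1 (hda x w₀ h0).hasDerivAt).comp hu
  have hsub : Metric.ball w₀ (r / 2) ⊆ Metric.ball w₀ r :=
    Metric.ball_subset_ball (by linarith)
  refine (hasDerivAt_integral_of_dominated_loc_of_deriv_le (bound := fun x => g x / (r / 4))
    (F' := fun w x => deriv (fun w => F w x) w) (Metric.ball_mem_nhds w₀ hr2) ?_ ?_ hmeas ?_
    (hg.div_const _) ?_).2.differentiableAt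
  · filter_upwards [Metric.ball_mem_nhds w₀ hr] with w hw using hF w hw
  · exact hg.mono' (hF w₀ h0) (Eventually.of_forall (hb w₀ h0))
  · refine Eventually.of_forall fun x w hw => ?_
    have hcb : Metric.closedBall w (r / 4) ⊆ Metric.ball w₀ r := by
      intro v hv
      rw [Metric.mem_closedBall] at hv
      rw [Metric.mem_ball] at hw ⊢
      linarith [dist_triangle v w w₀]
    exact Complex.norm_deriv_le_of_forall_mem_sphere_norm_le hr4
      ((hd x).diffContOnCl_ball hcb)
      fun v hv => hb v (hcb (Metric.sphere_subset_closedBall hv)) x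
  · exact Eventually.of_forall fun x w hw => (hda x w (hsub hw)).hasDerivAt

/-- The integrals of a decaying analytic function along the two boundary lines of the strip agree. -/
theorem integral_left_eq_integral_right {H : ℂ → V} (hH : DiffContOnCl ℂ H unitStrip) {C : ℝ}
    (hC : ∀ w ∈ closedUnitStrip, ‖H w‖ ≤ C / (1 + w.im ^ 2)) :
    ∫ t : ℝ, H (t * I) = ∫ t : ℝ, H (1 + t * I) := by
  have hint : ∀ {φ : ℝ → V}, Continuous φ → (∀ t, ‖φ t‖ ≤ C / (1 + t ^ 2)) → Integrable φ :=
    fun hφ hb => Integrable.mono' (integrable_inv_one_add_sq.const_mul C)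
      hφ.aestronglyMeasurable (Eventually.of_forall fun t => by simpa [div_eq_mul_inv] using hb t)
  have i0 := hint hH.continuous_left fun t => by simpa using hC _ (left_mem_closedUnitStrip t)
  have i1 := hint hH.continuous_right fun t => by simpa using hC _ (right_mem_closedUnitStrip t)
  have hT : Tendsto (fun T : ℝ => -T) atTop atBot := tendsto_neg_atTop_atBot
  have l0 := intervalIntegral_tendsto_integral i0 hT tendsto_id
  have l1 := intervalIntegral_tendsto_integral i1 hT tendsto_id
  -- Cauchy's theorem on the rectangle `[0, 1] × [-T, T]`; the horizontal sides contribute at most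
  -- `C / (1 + T²)` each.
  have hrect : ∀ T : ℝ, 0 < T → (∫ x in (0 : ℝ)..1, H (x + (-T : ℝ) * I)) -
      (∫ x in (0 : ℝ)..1, H (x + T * I)) + I • (∫ y in (-T)..T, H (1 + y * I)) -
      I • (∫ y in (-T)..T, H (y * I)) = 0 := by
    intro T hT
    have := Complex.integral_boundary_rect_eq_zero_of_continuousOn_of_differentiableOn H
      ((-T : ℝ) * I) (1 + T * I) ?_ ?_
    · simpa using this
    · refine hH.continuousOn_closedUnitStrip.mono fun w hw => ?_
      have := hw.1
      simpa using this
    · refine hH.differentiableOn.mono fun w hw => ?_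
      have := hw.1
      simpa using this
  have hC0 : 0 ≤ C := by
    have := (norm_nonneg _).trans (hC _ (left_mem_closedUnitStrip 0))
    simpa using this
  have hside : ∀ s : ℝ → ℝ, (∀ T, s T ^ 2 = T ^ 2) →
      Tendsto (fun T : ℝ => ∫ x in (0 : ℝ)..1, H (x + s T * I)) atTop (𝓝 0) := by
    intro s hs
    refine squeeze_zero_norm (a := fun T : ℝ => C / (1 + T ^ 2)) (fun T => ?_) ?_
    · have := intervalIntegral.norm_integral_le_of_norm_le_const (a := (0 : ℝ)) (b := 1)
        (f := fun x : ℝ => H (x + s T * I)) (C := C / (1 + T ^ 2)) fun x hx => by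
          rw [uIoc_of_le zero_le_one] at hx
          have := hC (x + s T * I) (by simp [closedUnitStrip, hx.1.le, hx.2])
          simpa [hs] using this
      simpa using this
    · exact tendsto_const_nhds.div_atTop
        (tendsto_atTop_add_const_left _ _ (tendsto_pow_atTop two_ne_zero))
  have hlim := (((hside (fun T => -T) (fun T => by ring)).sub (hside (fun T => T) fun T => rfl)).add
    (l1.const_smul I)).sub (l0.const_smul I)
  have h0 : Tendsto (fun _ : ℝ => (0 : V)) atTop
      (𝓝 (0 - 0 + I • (∫ t : ℝ, H (1 + t * I)) - I • ∫ t : ℝ, H (t * I))) := by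
    refine hlim.congr' ?_
    filter_upwards [eventually_gt_atTop 0] with T hT
    exact hrect T hT
  have := tendsto_nhds_unique h0 tendsto_const_nhds
  rw [sub_zero, zero_add, ← smul_sub, smul_eq_zero] at this
  rcases this with h | h
  · exact absurd h I_ne_zero
  · exact (sub_eq_zero.1 h).symm

end Analytic

/-! ### Approximate identities and Gaussian mollification. -/

/-- Approximate identities converge uniformly on bounded uniformly continuous functions. -/
theorem exists_norm_integral_smul_sub_le {V : Type*} [NormedAddCommGroup V] [NormedSpace ℝ V]
    [CompleteSpace V] {k : ℝ → ℝ} (hk0 : ∀ u, 0 ≤ k u) (hki : Integrable k) (hk1 : ∫ u, k u = 1)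
    {b : ℝ → V} (hb : UniformContinuous b) {M : ℝ} (hM : ∀ t, ‖b t‖ ≤ M) {ε : ℝ} (hε : 0 < ε) :
    ∃ δ₀ : ℝ, 0 < δ₀ ∧ ∀ δ, 0 < δ → δ < δ₀ → ∀ t, ‖(∫ u, k u • b (t + δ * u)) - b t‖ ≤ ε := by
  classical
  have hM0 : 0 ≤ M := (norm_nonneg _).trans (hM 0)
  obtain ⟨η, hη, hη'⟩ := Metric.uniformContinuous_iff.1 hb (ε / 2) (by positivity)
  have htail : Tendsto (fun R : ℕ => ∫ u, (Metric.closedBall (0 : ℝ) R)ᶜ.indicator k u) atTop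
      (𝓝 (∫ _u : ℝ, (0 : ℝ))) := by
    refine tendsto_integral_of_dominated_convergence k (fun R => ?_) hki (fun R => ?_) ?_
    · exact hki.aestronglyMeasurable.indicator measurableSet_closedBall.compl
    · exact Eventually.of_forall fun u => by
        rw [Set.indicator_apply]
        split_ifs
        · rw [Real.norm_of_nonneg (hk0 u)]
        · simpa using hk0 u
    · refine Eventually.of_forall fun u => tendsto_const_nhds.congr' ?_
      obtain ⟨N, hN⟩ := exists_nat_ge |u|
      filter_upwards [eventually_ge_atTop N] with R hR
      rw [indicator_of_notMem]
      simp only [mem_compl_iff, Metric.mem_closedBall, not_not, dist_zero_right, Real.norm_eq_abs]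
      exact hN.trans (by exact_mod_cast hR)
  rw [integral_zero] at htail
  have hM1 : 0 < ε / (4 * (M + 1)) := by positivity
  obtain ⟨R, hR⟩ := ((htail.eventually (gt_mem_nhds hM1)).and (eventually_ge_atTop 1)).exists
  obtain ⟨hR, hR1⟩ := hR
  have hR0 : (0 : ℝ) < R := by exact_mod_cast hR1
  -- For `δ < η / R` the points `|u| ≤ R` are displaced by less than `η`, which costs at most `ε /
  -- 2`. The mass of `k` outside costs at most `2 M ε / (4 (M + 1)) ≤ ε / 2`.
  refine ⟨η / R, by positivity, fun δ hδ hδ' t => ?_⟩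
  have hbm : AEStronglyMeasurable (fun u => b (t + δ * u)) volume :=
    (hb.continuous.comp (by fun_prop : Continuous fun u : ℝ => t + δ * u)).aestronglyMeasurable
  have hi1 : Integrable fun u => k u • b (t + δ * u) := by
    refine Integrable.mono' (hki.mul_const M) (hki.aestronglyMeasurable.smul hbm) ?_
    refine Eventually.of_forall fun u => ?_
    rw [norm_smul, Real.norm_of_nonneg (hk0 u)]
    exact mul_le_mul_of_nonneg_left (hM _) (hk0 u)
  have e1 : b t = ∫ u, k u • b t := by rw [integral_smul_const, hk1, one_smul]
  have hi2 : Integrable fun u => k u • b t := hki.smul_const _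
  conv_lhs => rw [e1]
  rw [← integral_sub hi1 hi2]
  have hi3 : Integrable fun u => (ε / 2) * k u +
      2 * M * (Metric.closedBall (0 : ℝ) R)ᶜ.indicator k u :=
    (hki.const_mul _).add ((hki.indicator measurableSet_closedBall.compl).const_mul _)
  refine (norm_integral_le_of_norm_le hi3 (Eventually.of_forall fun u => ?_)).trans ?_
  · rw [← smul_sub, norm_smul, Real.norm_of_nonneg (hk0 u), Set.indicator_apply]
    split_ifs with hu
    · have : ‖b (t + δ * u) - b t‖ ≤ 2 * M :=
        (norm_sub_le _ _).trans (by linarith [hM (t + δ * u), hM t])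
      nlinarith [hk0 u]
    · simp only [mem_compl_iff, Metric.mem_closedBall, not_not, dist_zero_right,
        Real.norm_eq_abs] at hu
      have h1 : dist (t + δ * u) t < η := by
        rw [dist_eq_norm, add_sub_cancel_left, Real.norm_eq_abs, abs_mul, abs_of_pos hδ]
        rw [lt_div_iff₀ hR0] at hδ'
        exact (mul_le_mul_of_nonneg_left hu hδ.le).trans_lt hδ'
      have h2 := (hη' h1).le
      rw [dist_eq_norm] at h2
      nlinarith [hk0 u]
  · rw [integral_add (hki.const_mul _)
      ((hki.indicator measurableSet_closedBall.compl).const_mul _), integral_const_mul,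
      integral_const_mul, hk1]
    have : 2 * M * (ε / (4 * (M + 1))) ≤ ε / 2 := by
      rw [mul_div_assoc', div_le_div_iff₀ (by positivity) (by positivity)]
      nlinarith
    nlinarith

/-- The Gaussian probability density `π^(-1/2) exp (-u²)`. -/
def gaussDensity (u : ℝ) : ℝ := (√Real.pi)⁻¹ * Real.exp (-u ^ 2)

theorem gaussDensity_nonneg (u : ℝ) : 0 ≤ gaussDensity u := by unfold gaussDensity; positivity

theorem continuous_gaussDensity : Continuous gaussDensity := by unfold gaussDensity; fun_prop

theorem integrable_gaussDensity : Integrable gaussDensity := by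
  have := (integrable_exp_neg_mul_sq (b := 1) one_pos).const_mul (√Real.pi)⁻¹
  simpa [gaussDensity, neg_mul] using! this

theorem integral_gaussDensity : ∫ u, gaussDensity u = 1 := by
  have := integral_gaussian 1
  simp only [neg_mul, one_mul, div_one] at this
  simp only [gaussDensity]
  rw [integral_const_mul, this, inv_mul_cancel₀]
  positivity

/-- The Gaussian kernel. -/
def gaussKer (δ : ℝ) (u : ℂ) : ℂ := ((δ * √Real.pi : ℝ) : ℂ)⁻¹ * exp (u ^ 2 / (δ : ℂ) ^ 2)

@[fun_prop]
theorem differentiable_gaussKer (δ : ℝ) : Differentiable ℂ (gaussKer δ) := by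
  unfold gaussKer
  fun_prop

@[fun_prop]
theorem continuous_gaussKer (δ : ℝ) : Continuous (gaussKer δ) :=
  (differentiable_gaussKer δ).continuous

/-- In the vertical direction the modulus is a Gaussian density of width `δ`; a horizontal
displacement only contributes the factor `exp (re² / δ²)`, bounded on the strip. -/
theorem norm_gaussKer {δ : ℝ} (hδ : 0 < δ) (u : ℂ) :
    ‖gaussKer δ u‖ = Real.exp (u.re ^ 2 / δ ^ 2) * (δ⁻¹ * gaussDensity (u.im / δ)) := by
  have h : (u ^ 2 / (δ : ℂ) ^ 2).re = u.re ^ 2 / δ ^ 2 + -(u.im / δ) ^ 2 := by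
    have e : (u ^ 2 / (δ : ℂ) ^ 2) = u ^ 2 / ((δ ^ 2 : ℝ) : ℂ) := by push_cast; rfl
    rw [e, div_ofReal_re, sq u, mul_re]
    ring
  rw [gaussKer, norm_mul, norm_exp, h, Real.exp_add, norm_inv, norm_real, Real.norm_eq_abs,
    abs_of_pos (by positivity), gaussDensity, mul_inv]
  ring

theorem gaussKer_mul_I {δ : ℝ} (s : ℝ) :
    gaussKer δ (s * I) = ((δ⁻¹ * gaussDensity (s / δ) : ℝ) : ℂ) := by
  simp only [gaussKer, gaussDensity]
  push_cast
  rw [mul_pow, I_sq]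
  rw [mul_inv, mul_assoc]
  congr 3
  ring

/-- With `x = ((ζ - w).im / δ)²` one has `1 + ζ.im² ≤ D (1 + x / (N + 1))` and `(1 + x / (N + 1)) ^
N ≤ exp x`, so the Gaussian beats any power. Dividing by `N + 1` avoids a separate case `N = 0`.
Uniformity in `w` is what allows analytic dependence on `w` under the integral. -/
theorem exists_norm_gaussKer_le {δ : ℝ} (hδ : 0 < δ) (N : ℕ) (B : ℝ) :
    ∃ C : ℝ, 0 < C ∧ ∀ ζ w : ℂ, |(ζ - w).re| ≤ B → |w.im| ≤ B →
      ‖gaussKer δ (ζ - w)‖ ≤ C / (1 + ζ.im ^ 2) ^ N := by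
  set D : ℝ := (1 + 2 * B ^ 2) * (1 + 2 * δ ^ 2 * (N + 1)) with hD
  have hD0 : 0 < D := by positivity
  refine ⟨Real.exp (B ^ 2 / δ ^ 2) * (δ⁻¹ * (√Real.pi)⁻¹) * D ^ N, by positivity,
    fun ζ w h1 h2 => ?_⟩
  rw [norm_gaussKer hδ, gaussDensity, le_div_iff₀ (by positivity)]
  set x : ℝ := ((ζ - w).im / δ) ^ 2 with hx
  have hx0 : 0 ≤ x := by positivity
  have hre : (ζ - w).re ^ 2 ≤ B ^ 2 := sq_le_sq' (abs_le.1 h1).1 (abs_le.1 h1).2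
  have him : w.im ^ 2 ≤ B ^ 2 := sq_le_sq' (abs_le.1 h2).1 (abs_le.1 h2).2
  have hN : (0 : ℝ) < N + 1 := by positivity
  have hxe : (ζ.im - w.im) ^ 2 = δ ^ 2 * x := by
    rw [hx, sub_im]
    field_simp
  have key : 1 + ζ.im ^ 2 ≤ D * (1 + x / (N + 1)) := by
    have a1 : 1 + ζ.im ^ 2 ≤ 1 + 2 * B ^ 2 + 2 * (δ ^ 2 * x) := by
      rw [← hxe]
      nlinarith [sq_nonneg (ζ.im - 2 * w.im)]
    refine a1.trans ?_
    have a2 : D * (1 + x / (N + 1)) = (1 + 2 * B ^ 2) * (1 + x / (N + 1)) +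
        (1 + 2 * B ^ 2) * (2 * δ ^ 2) * (N + 1) + (1 + 2 * B ^ 2) * (2 * (δ ^ 2 * x)) := by
      rw [hD]
      field_simp
      ring
    rw [a2]
    have a3 : 0 ≤ x / (N + 1) := by positivity
    have a4 : 0 ≤ B ^ 2 * (δ ^ 2 * x) := by positivity
    have a5 : 0 ≤ (1 + 2 * B ^ 2) * (2 * δ ^ 2) * (N + 1) := by positivity
    have a6 : 0 ≤ B ^ 2 * (x / (N + 1)) := by positivity
    nlinarith
  have key2 : (1 + x / (N + 1)) ^ N ≤ Real.exp x := by
    calc (1 + x / (N + 1)) ^ N ≤ (Real.exp (x / (N + 1))) ^ N := by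
          gcongr
          rw [add_comm]
          exact Real.add_one_le_exp _
      _ = Real.exp (N * (x / (N + 1))) := by rw [← Real.exp_nat_mul]
      _ ≤ Real.exp x := by
          refine Real.exp_le_exp.2 ?_
          rw [mul_div_assoc', div_le_iff₀ hN]
          nlinarith
  calc Real.exp ((ζ - w).re ^ 2 / δ ^ 2) * (δ⁻¹ * ((√Real.pi)⁻¹ * Real.exp (-x))) *
        (1 + ζ.im ^ 2) ^ N
      ≤ Real.exp (B ^ 2 / δ ^ 2) * (δ⁻¹ * ((√Real.pi)⁻¹ * Real.exp (-x))) *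
        (D ^ N * Real.exp x) := by
        gcongr
        calc (1 + ζ.im ^ 2) ^ N ≤ (D * (1 + x / (N + 1))) ^ N := by gcongr
          _ = D ^ N * (1 + x / (N + 1)) ^ N := mul_pow _ _ _
          _ ≤ D ^ N * Real.exp x := by gcongr
    _ = Real.exp (B ^ 2 / δ ^ 2) * (δ⁻¹ * (√Real.pi)⁻¹) * D ^ N *
        (Real.exp (-x) * Real.exp x) := by ring
    _ = _ := by rw [← Real.exp_add, neg_add_cancel, Real.exp_zero, mul_one]

section Mollify

variable {V : Type*} [NormedAddCommGroup V] [NormedSpace ℂ V] [CompleteSpace V]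

/-- The substitution `s = t + δ u` shows that on its own line the analytic mollification is an
ordinary convolution, to which the results on approximate identities apply. -/
theorem integral_gaussKer_smul {δ : ℝ} (hδ : 0 < δ) (b : ℝ → V) (t : ℝ) :
    ∫ s : ℝ, gaussKer δ (s * I - t * I) • b s = ∫ u : ℝ, gaussDensity u • b (t + δ * u) := by
  have h1 : ∫ s : ℝ, gaussKer δ (s * I - t * I) • b s =
      ∫ s : ℝ, (δ⁻¹ * gaussDensity (s / δ)) • b (t + s) := by
    rw [← integral_add_left_eq_self _ t]
    refine integral_congr_ae (Eventually.of_forall fun s => ?_)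
    have : (((t + s : ℝ) : ℂ) * I - t * I) = s * I := by push_cast; ring
    simp only [this]
    rw [gaussKer_mul_I, Complex.coe_smul]
  have h2 : (fun u : ℝ => gaussDensity u • b (t + δ * u)) =
      fun u : ℝ => (fun s : ℝ => gaussDensity (s / δ) • b (t + s)) (δ * u) := by
    funext u
    simp only
    rw [mul_div_cancel_left₀ _ hδ.ne']
  rw [h1, h2, Measure.integral_comp_mul_left (fun s : ℝ => gaussDensity (s / δ) • b (t + s)) δ,
    ← integral_smul]
  simp only [smul_smul, abs_of_pos (inv_pos.2 hδ)]

theorem integrable_gaussKer_smul {δ : ℝ} (hδ : 0 < δ) {b : ℝ → V} (hb : Continuous b) {M : ℝ}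
    (hM : ∀ t, ‖b t‖ ≤ M) {p : ℝ → ℂ} (hp : Continuous p) (hre : ∃ B, ∀ s, |(p s).re| ≤ B)
    (him : ∀ s, (p s).im = s) (w : ℂ) : Integrable fun s => gaussKer δ (p s - w) • b s := by
  obtain ⟨B, hB⟩ := hre
  obtain ⟨C, hC, h⟩ := exists_norm_gaussKer_le hδ 1 (|B| + ‖w‖)
  refine Integrable.mono' (integrable_inv_one_add_sq.const_mul (C * M))
    (Continuous.aestronglyMeasurable (by fun_prop)) (Eventually.of_forall fun s => ?_)
  have h1 : |(p s - w).re| ≤ |B| + ‖w‖ := by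
    rw [sub_re]
    exact (abs_sub _ _).trans (add_le_add ((hB s).trans (le_abs_self B)) (abs_re_le_norm w))
  have h2 := h (p s) w h1 ((abs_im_le_norm w).trans (le_add_of_nonneg_left (abs_nonneg B)))
  rw [norm_smul]
  rw [him, pow_one] at h2
  calc ‖gaussKer δ (p s - w)‖ * ‖b s‖ ≤ C / (1 + s ^ 2) * M := by
        gcongr
        exact hM s
    _ = C * M * (1 + s ^ 2)⁻¹ := by ring

theorem differentiable_integral_gaussKer_smul {δ : ℝ} (hδ : 0 < δ) {b : ℝ → V} (hb : Continuous b)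
    {M : ℝ} (hM : ∀ t, ‖b t‖ ≤ M) {p : ℝ → ℂ} (hp : Continuous p) (hre : ∃ B, ∀ s, |(p s).re| ≤ B)
    (him : ∀ s, (p s).im = s) :
    Differentiable ℂ fun w => ∫ s, gaussKer δ (p s - w) • b s := by
  intro w
  obtain ⟨B, hB⟩ := hre
  obtain ⟨C, hC, h⟩ := exists_norm_gaussKer_le hδ 1 (|B| + (‖w‖ + 1))
  refine differentiableAt_integral_of_dominated one_pos
    (integrable_inv_one_add_sq.const_mul (C * M)) (fun v _ => ?_) (fun s => ?_) fun v hv s => ?_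
  · exact Continuous.aestronglyMeasurable (by fun_prop)
  · fun_prop
  · have hv' : ‖v‖ ≤ ‖w‖ + 1 := by
      rw [Metric.mem_ball, dist_eq_norm] at hv
      have := norm_add_le w (v - w)
      rw [add_sub_cancel] at this
      linarith
    have h1 : |(p s - v).re| ≤ |B| + (‖w‖ + 1) := by
      rw [sub_re]
      exact (abs_sub _ _).trans (add_le_add ((hB s).trans (le_abs_self B))
        ((abs_re_le_norm v).trans hv'))
    have h2 := h (p s) v h1
      (((abs_im_le_norm v).trans hv').trans (le_add_of_nonneg_left (abs_nonneg B)))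
    rw [norm_smul]
    rw [him, pow_one] at h2
    calc ‖gaussKer δ (p s - v)‖ * ‖b s‖ ≤ C / (1 + s ^ 2) * M := by
          gcongr
          exact hM s
      _ = C * M * (1 + s ^ 2)⁻¹ := by ring

theorem integrable_gaussDensity_shift {δ : ℝ} (hδ : 0 < δ) (y : ℝ) :
    Integrable fun s => δ⁻¹ * gaussDensity ((s - y) / δ) :=
  ((integrable_gaussDensity.comp_div hδ.ne').comp_sub_right y).const_mul _

theorem integral_gaussDensity_shift {δ : ℝ} (hδ : 0 < δ) (y : ℝ) :
    ∫ s, δ⁻¹ * gaussDensity ((s - y) / δ) = 1 := by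
  rw [integral_const_mul, integral_sub_right_eq_self (fun s => gaussDensity (s / δ)) y,
    Measure.integral_comp_div, integral_gaussDensity, abs_of_pos hδ, smul_eq_mul, mul_one,
    inv_mul_cancel₀ hδ.ne']

theorem norm_integral_gaussKer_smul_le {δ : ℝ} (hδ : 0 < δ) {b : ℝ → V}
    {M : ℝ} (hM : ∀ t, ‖b t‖ ≤ M) {p : ℝ → ℂ} (him : ∀ s, (p s).im = s) {w : ℂ}
    (hre : ∀ s, |(p s - w).re| ≤ 1) :
    ‖∫ s, gaussKer δ (p s - w) • b s‖ ≤ Real.exp (1 / δ ^ 2) * M := by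
  have hM0 : 0 ≤ M := (norm_nonneg _).trans (hM 0)
  refine (norm_integral_le_of_norm_le
    ((integrable_gaussDensity_shift hδ w.im).const_mul (Real.exp (1 / δ ^ 2) * M))
    (Eventually.of_forall fun s => ?_)).trans ?_
  · rw [norm_smul, norm_gaussKer hδ, sub_im, him]
    have h1 : (p s - w).re ^ 2 ≤ 1 := by
      have := sq_le_sq' (abs_le.1 (hre s)).1 (abs_le.1 (hre s)).2
      simpa using this
    have h2 := gaussDensity_nonneg ((s - w.im) / δ)
    calc _ ≤ Real.exp (1 / δ ^ 2) * (δ⁻¹ * gaussDensity ((s - w.im) / δ)) * M := by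
          gcongr
          exact hM s
      _ = _ := by ring
  · rw [integral_const_mul, integral_gaussDensity_shift hδ, mul_one]

theorem tendsto_integral_gaussDensity_smul (δ : ℝ) {b : ℝ →ᵇ V}
    (hb : Tendsto b (cocompact ℝ) (𝓝 0)) :
    Tendsto (fun t : ℝ => ∫ u : ℝ, gaussDensity u • b (t + δ * u)) (cocompact ℝ) (𝓝 0) := by
  have : (cocompact ℝ).IsCountablyGenerated := by
    rw [cocompact_eq_atBot_atTop]
    infer_instance
  have h : Tendsto (fun t : ℝ => ∫ u : ℝ, gaussDensity u • b (t + δ * u)) (cocompact ℝ)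
      (𝓝 (∫ _u : ℝ, (0 : V))) := by
    refine tendsto_integral_filter_of_dominated_convergence (fun u => gaussDensity u * ‖b‖)
      (Eventually.of_forall fun t => ?_) (Eventually.of_forall fun t =>
        Eventually.of_forall fun u => ?_) (integrable_gaussDensity.mul_const _)
      (Eventually.of_forall fun u => ?_)
    · exact (continuous_gaussDensity.smul
        (b.continuous.comp (by fun_prop : Continuous fun u : ℝ => t + δ * u))).aestronglyMeasurable
    · rw [norm_smul, Real.norm_of_nonneg (gaussDensity_nonneg u)]
      exact mul_le_mul_of_nonneg_left (b.norm_coe_le_norm _) (gaussDensity_nonneg u)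
    · have h1 : Tendsto (fun t : ℝ => t + δ * u) (cocompact ℝ) (cocompact ℝ) :=
        (Homeomorph.addRight (δ * u)).isClosedEmbedding.tendsto_cocompact
      simpa using (hb.comp h1).const_smul (gaussDensity u)
  simpa using h

end Mollify

/-! ### Density of functions with values in the intersection. -/

namespace BanachCouple

variable {X₀ X₁ E : Type*}
  [NormedAddCommGroup X₀] [NormedSpace ℂ X₀] [NormedAddCommGroup X₁] [NormedSpace ℂ X₁]
  [NormedAddCommGroup E] [NormedSpace ℂ E] [CompleteSpace X₀] [CompleteSpace X₁] [CompleteSpace E]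
  {c : BanachCouple X₀ X₁ E}

/-- In `E` these are the integrals of the decaying analytic function `gaussKer δ (ζ - w) • f ζ`
along the two boundary lines, which agree by Cauchy's theorem. Hence the mollification of `f` takes
values in the intersection. -/
theorem integral_gaussKer_bdry_eq {δ : ℝ} (hδ : 0 < δ) (f : c.Calderon) (w : ℂ) :
    c.i₀ (∫ s : ℝ, gaussKer δ (s * I - w) • f.bdry₀ s) =
      c.i₁ (∫ s : ℝ, gaussKer δ (1 + s * I - w) • f.bdry₁ s) := by
  have h0 := integrable_gaussKer_smul hδ f.bdry₀.continuous f.norm_bdry₀_le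
    (p := fun s : ℝ => (s * I : ℂ)) (by fun_prop) ⟨0, by simp⟩ (by simp) w
  have h1 := integrable_gaussKer_smul hδ f.bdry₁.continuous f.norm_bdry₁_le
    (p := fun s : ℝ => (1 + s * I : ℂ)) (by fun_prop) ⟨1, by simp⟩ (by simp) w
  rw [← c.i₀.integral_comp_comm h0, ← c.i₁.integral_comp_comm h1]
  simp only [map_smul, ← f.toFun_left, ← f.toFun_right]
  obtain ⟨C, hC, h⟩ := exists_norm_gaussKer_le hδ 1 (1 + ‖w‖)
  refine integral_left_eq_integral_right (H := fun ζ => gaussKer δ (ζ - w) • f.toFun ζ)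
    (C := C * (max ‖c.i₀‖ ‖c.i₁‖ * ‖f‖)) ?_ fun ζ hζ => ?_
  · exact DiffContOnCl.smul (Differentiable.diffContOnCl (by fun_prop)) f.diffContOnCl
  · have h1 : |(ζ - w).re| ≤ 1 + ‖w‖ := by
      rw [sub_re]
      refine (abs_sub _ _).trans (add_le_add ?_ (abs_re_le_norm w))
      rw [abs_of_nonneg hζ.1]
      exact hζ.2
    have h2 := h ζ w h1 ((abs_im_le_norm w).trans (by linarith))
    rw [norm_smul]
    rw [pow_one] at h2
    calc _ ≤ C / (1 + ζ.im ^ 2) * (max ‖c.i₀‖ ‖c.i₁‖ * ‖f‖) := by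
          gcongr
          exact f.norm_toFun_le ζ
      _ = _ := by ring

/-- The functions with values in the intersection are dense. -/
theorem exists_isInterLift_norm_sub_le {f : c.Calderon} (hf : f ∈ c.calderonZero) {ε : ℝ}
    (hε : 0 < ε) :
    ∃ (g : c.Calderon) (G : ℂ → c.inter), IsInterLift g G ∧ g ∈ c.calderonZero ∧ ‖f - g‖ ≤ ε := by
  -- The vanishing at infinity is needed here: it makes the boundary functions uniformly continuous,
  -- so that their Gaussian convolutions converge uniformly.
  have u0 : UniformContinuous f.bdry₀ :=
    f.bdry₀.continuous.uniformContinuous_of_tendsto_cocompact hf.1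
  have u1 : UniformContinuous f.bdry₁ :=
    f.bdry₁.continuous.uniformContinuous_of_tendsto_cocompact hf.2
  obtain ⟨δ₀, hδ₀, h0⟩ := exists_norm_integral_smul_sub_le gaussDensity_nonneg
    integrable_gaussDensity integral_gaussDensity u0 f.norm_bdry₀_le hε
  obtain ⟨δ₁, hδ₁, h1⟩ := exists_norm_integral_smul_sub_le gaussDensity_nonneg
    integrable_gaussDensity integral_gaussDensity u1 f.norm_bdry₁_le hε
  set δ : ℝ := min δ₀ δ₁ / 2 with hδd
  have hδ : 0 < δ := by positivity
  have hδ0 : δ < δ₀ := by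
    have := min_le_left δ₀ δ₁
    have : 0 < min δ₀ δ₁ := by positivity
    linarith
  have hδ1 : δ < δ₁ := by
    have := min_le_right δ₀ δ₁
    have : 0 < min δ₀ δ₁ := by positivity
    linarith
  let F₀ : ℂ → X₀ := fun w => ∫ s : ℝ, gaussKer δ (s * I - w) • f.bdry₀ s
  let F₁ : ℂ → X₁ := fun w => ∫ s : ℝ, gaussKer δ (1 + s * I - w) • f.bdry₁ s
  have hF₀ : Differentiable ℂ F₀ :=
    differentiable_integral_gaussKer_smul hδ f.bdry₀.continuous f.norm_bdry₀_le
      (p := fun s : ℝ => (s * I : ℂ)) (by fun_prop) ⟨0, by simp⟩ (by simp)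
  have hF₁ : Differentiable ℂ F₁ :=
    differentiable_integral_gaussKer_smul hδ f.bdry₁.continuous f.norm_bdry₁_le
      (p := fun s : ℝ => (1 + s * I : ℂ)) (by fun_prop) ⟨1, by simp⟩ (by simp)
  let G : ℂ → c.inter := fun w => ⟨(F₀ w, F₁ w), integral_gaussKer_bdry_eq hδ f w⟩
  have hGc : Continuous G :=
    Continuous.subtype_mk (hF₀.continuous.prodMk hF₁.continuous) _
  have hG : Differentiable ℂ G := by
    rw [← differentiableOn_univ]
    -- Analyticity in the product descends to the closed subspace by testing with its single
    -- injective inclusion.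
    refine differentiableOn_of_forall_clm (ι := Unit) (fun _ => c.inter.subtypeL)
      (fun v hv => Subtype.ext (hv ())) isOpen_univ hGc.continuousOn fun _ => ?_
    exact (hF₀.prodMk hF₁).differentiableOn
  have hGb : ∃ K : ℝ, ∀ w ∈ closedUnitStrip, ‖G w‖ ≤ K := by
    refine ⟨Real.exp (1 / δ ^ 2) * ‖f‖, fun w hw => norm_inter_le ?_ ?_⟩
    · refine norm_integral_gaussKer_smul_le hδ f.norm_bdry₀_le (p := fun s : ℝ => (s * I : ℂ))
        (by simp) fun s => ?_
      simp only [sub_re, mul_re, ofReal_re, I_re, mul_zero, ofReal_im, I_im, mul_one, sub_self,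
        zero_sub, abs_neg, abs_of_nonneg hw.1]
      exact hw.2
    · refine norm_integral_gaussKer_smul_le hδ f.norm_bdry₁_le (p := fun s : ℝ => (1 + s * I : ℂ))
        (by simp) fun s => ?_
      have h1 := hw.1
      have h2 := hw.2
      simp only [sub_re, add_re, one_re, mul_re, ofReal_re, I_re, mul_zero, ofReal_im, I_im,
        mul_one, sub_self, add_zero]
      rw [abs_of_nonneg (by linarith)]
      linarith
  have e0 : ∀ t : ℝ, c.interTo₀ (G (t * I)) = ∫ u : ℝ, gaussDensity u • f.bdry₀ (t + δ * u) :=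
    fun t => integral_gaussKer_smul hδ f.bdry₀ t
  have e1 : ∀ t : ℝ, c.interTo₁ (G (1 + t * I)) =
      ∫ u : ℝ, gaussDensity u • f.bdry₁ (t + δ * u) := fun t => by
    rw [← integral_gaussKer_smul hδ f.bdry₁ t]
    refine integral_congr_ae (Eventually.of_forall fun s => ?_)
    simp only [add_sub_add_left_eq_sub]
  refine ⟨ofInter G hG.diffContOnCl hGb, G, isInterLift_ofInter _ _, ⟨?_, ?_⟩, ?_⟩
  · exact (tendsto_integral_gaussDensity_smul δ hf.1).congr fun t => (e0 t).symm
  · exact (tendsto_integral_gaussDensity_smul δ hf.2).congr fun t => (e1 t).symm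
  · refine Calderon.norm_le hε.le (fun t => ?_) fun t => ?_
    · rw [Calderon.bdry₀_sub, BoundedContinuousFunction.sub_apply, norm_sub_rev, bdry₀_ofInter, e0]
      exact h0 δ hδ hδ0 t
    · rw [Calderon.bdry₁_sub, BoundedContinuousFunction.sub_apply, norm_sub_rev, bdry₁_ofInter, e1]
      exact h1 δ hδ hδ1 t

end BanachCouple

/-! ### Maximum principle and Cauchy estimates up to the boundary distance. -/

/-- The maximum principle for bounded functions on the strip. -/
theorem norm_le_of_norm_bdry_le {V : Type*} [NormedAddCommGroup V] [NormedSpace ℂ V] {h : ℂ → V}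
    (hd : DiffContOnCl ℂ h unitStrip) {K C : ℝ} (hK : ∀ w ∈ unitStrip, ‖h w‖ ≤ K)
    (h0 : ∀ t : ℝ, ‖h (t * I)‖ ≤ C) (h1 : ∀ t : ℝ, ‖h (1 + t * I)‖ ≤ C) {w : ℂ}
    (hw : w ∈ closedUnitStrip) : ‖h w‖ ≤ C := by
  refine PhragmenLindelof.vertical_strip hd ?_ ?_ ?_ hw.1 hw.2
  · refine ⟨0, by simp [Real.pi_pos], 0, ?_⟩
    refine Asymptotics.IsBigO.of_bound K ?_
    refine mem_inf_of_right ?_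
    intro z hz
    simpa using hK z hz
  · intro z hz
    have hz' : z = z.im * I := by apply Complex.ext <;> simp [hz]
    rw [hz']
    exact h0 _
  · intro z hz
    have hz' : z = 1 + z.im * I := by apply Complex.ext <;> simp [hz]
    rw [hz']
    exact h1 _

theorem frontier_unitStrip : frontier unitStrip = re ⁻¹' {0, 1} := by
  rw [unitStrip, Complex.frontier_preimage_re, frontier_Ioo (by norm_num)]

theorem infDist_frontier_le (z : unitStrip) :
    Metric.infDist (z : ℂ) (frontier unitStrip) ≤ min (z : ℂ).re (1 - (z : ℂ).re) := by
  rw [frontier_unitStrip]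
  refine le_min ?_ ?_
  · refine (Metric.infDist_le_dist_of_mem (y := ((z : ℂ).im * I : ℂ)) (by simp)).trans ?_
    have : (z : ℂ) - (z : ℂ).im * I = ((z : ℂ).re : ℂ) := by apply Complex.ext <;> simp
    rw [dist_eq_norm, this, norm_real, Real.norm_of_nonneg z.2.1.le]
  · refine (Metric.infDist_le_dist_of_mem (y := (1 + (z : ℂ).im * I : ℂ)) (by simp)).trans ?_
    have : (z : ℂ) - (1 + (z : ℂ).im * I) = -((1 - (z : ℂ).re : ℝ) : ℂ) := by
      apply Complex.ext <;> simp
    rw [dist_eq_norm, this, norm_neg, norm_real, Real.norm_of_nonneg (by linarith [z.2.2])]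

theorem infDist_frontier_pos (z : unitStrip) :
    0 < Metric.infDist (z : ℂ) (frontier unitStrip) := by
  refine (isClosed_frontier.notMem_iff_infDist_pos ⟨0, ?_⟩).1 ?_
  · rw [frontier_unitStrip]; simp
  · rw [isOpen_unitStrip.frontier_eq]
    exact fun h => h.2 z.2

theorem closedBall_subset_unitStrip (z : unitStrip) {r : ℝ}
    (hr : r < Metric.infDist (z : ℂ) (frontier unitStrip)) :
    Metric.closedBall (z : ℂ) r ⊆ unitStrip := by
  intro w hw
  have h := infDist_frontier_le z
  have h1 := h.trans (min_le_left _ _)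
  have h2 := h.trans (min_le_right _ _)
  rw [Metric.mem_closedBall, dist_eq_norm] at hw
  have h3 := (abs_re_le_norm (w - z)).trans hw
  rw [sub_re, abs_le] at h3
  exact ⟨by linarith [h3.1], by linarith [h3.2]⟩

/-- Cauchy's estimate holds on every closed disk of radius `r` below the distance, since it lies in
the open strip; let `r` increase to the distance. -/
theorem norm_taylorCoeff_le_div_infDist_pow {V : Type*} [NormedAddCommGroup V] [NormedSpace ℂ V]
    [CompleteSpace V] {h : ℂ → V} (hd : DiffContOnCl ℂ h unitStrip) {C : ℝ}
    (hC : ∀ w ∈ closedUnitStrip, ‖h w‖ ≤ C) (z : unitStrip) (k : ℕ) :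
    ‖taylorCoeff k h z‖ ≤ C / Metric.infDist (z : ℂ) (frontier unitStrip) ^ k := by
  set R := Metric.infDist (z : ℂ) (frontier unitStrip) with hR
  have hR0 : 0 < R := infDist_frontier_pos z
  have ht : Tendsto (fun r : ℝ => C / r ^ k) (𝓝[<] R) (𝓝 (C / R ^ k)) := by
    refine Tendsto.mono_left ?_ nhdsWithin_le_nhds
    exact tendsto_const_nhds.div (tendsto_id.pow k) (pow_ne_zero _ hR0.ne')
  refine ge_of_tendsto ht ?_
  filter_upwards [Ioo_mem_nhdsLT hR0] with r hr
  have hb := closedBall_subset_unitStrip z hr.2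
  exact norm_taylorCoeff_le hr.1 (hd.mono (Metric.ball_subset_closedBall.trans hb))
    (fun w hw => hC w (unitStrip_subset (hb (Metric.sphere_subset_closedBall hw)))) k

/-- A linear map that is bounded in terms of a linear map with dense range factors through it. -/
theorem exists_clm_of_norm_le {V A B : Type*} [AddCommGroup V] [Module ℂ V]
    [NormedAddCommGroup A] [NormedSpace ℂ A] [NormedAddCommGroup B] [NormedSpace ℂ B]
    [CompleteSpace B] {e : V →ₗ[ℂ] A} (he : DenseRange e) {f : V →ₗ[ℂ] B} {C : ℝ} (hC : 0 ≤ C)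
    (hf : ∀ v, ‖f v‖ ≤ C * ‖e v‖) : ∃ g : A →L[ℂ] B, (∀ v, g (e v) = f v) ∧ ‖g‖ ≤ C :=
  ⟨f.extendOfNorm e, LinearMap.extendOfNorm_eq he ⟨C, hf⟩,
    LinearMap.opNorm_extendOfNorm_le he hC hf⟩

/-! ### The pairing and the operator `T_n`. -/

namespace BanachCouple

variable {X₀ X₁ E : Type*}
  [NormedAddCommGroup X₀] [NormedSpace ℂ X₀] [NormedAddCommGroup X₁] [NormedSpace ℂ X₁]
  [NormedAddCommGroup E] [NormedSpace ℂ E]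
  {c : BanachCouple X₀ X₁ E} {hc : c.IsRegular}

section Pairing

variable {f : c.Calderon} {F : ℂ → c.inter} (g : (c.dual hc).Calderon)

theorem diffContOnCl_pairing (hF : IsInterLift f F) :
    DiffContOnCl ℂ (fun w => g.toFun w (F w)) unitStrip :=
  ⟨g.diffContOnCl.differentiableOn.clm_apply hF.1.differentiableOn,
    g.diffContOnCl.continuousOn.clm_apply hF.1.continuousOn⟩

theorem pairing_left (hF : IsInterLift f F) (t : ℝ) :
    g.toFun (t * I) (F (t * I)) = g.bdry₀ t (f.bdry₀ t) := by
  rw [g.toFun_left, hF.bdry₀]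
  rfl

theorem pairing_right (hF : IsInterLift f F) (t : ℝ) :
    g.toFun (1 + t * I) (F (1 + t * I)) = g.bdry₁ t (f.bdry₁ t) := by
  rw [g.toFun_right, hF.bdry₁]
  rfl

/-- The bound of `F` in the intersection, possibly much larger than `‖f‖`, only supplies the a
priori boundedness required by the maximum principle. On the boundary lines the pairing is the
duality of `X_j*` and `X_j`, so it disappears from the result. -/
theorem norm_pairing_le (hF : IsInterLift f F) {w : ℂ} (hw : w ∈ closedUnitStrip) :
    ‖g.toFun w (F w)‖ ≤ ‖g‖ * ‖f‖ := by
  obtain ⟨K, hK⟩ := hF.2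
  refine norm_le_of_norm_bdry_le (h := fun w => g.toFun w (F w)) (diffContOnCl_pairing g hF)
    (K := max ‖(c.dual hc).i₀‖ ‖(c.dual hc).i₁‖ * ‖g‖ * K) (fun w hw => ?_) (fun t => ?_)
    (fun t => ?_) hw
  · refine ((g.toFun w).le_opNorm _).trans ?_
    exact mul_le_mul (g.norm_toFun_le w) (hK w (unitStrip_subset hw)) (norm_nonneg _)
      (mul_nonneg ((norm_nonneg _).trans (le_max_left _ _)) (norm_nonneg _))
  · rw [pairing_left g hF]
    exact ((g.bdry₀ t).le_opNorm _).trans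
      (mul_le_mul (g.norm_bdry₀_le t) (f.norm_bdry₀_le t) (norm_nonneg _) (norm_nonneg _))
  · rw [pairing_right g hF]
    exact ((g.bdry₁ t).le_opNorm _).trans
      (mul_le_mul (g.norm_bdry₁_le t) (f.norm_bdry₁_le t) (norm_nonneg _) (norm_nonneg _))

end Pairing

variable [CompleteSpace X₀] [CompleteSpace X₁] [CompleteSpace E]

/-- Leibniz's rule at order `n - 1`, where `j.rev` is `n - 1 - j`. The order `n - 1` is the source
of the exponent in the bound for `T_n`. -/
theorem taylorCoeff_pairing {n : ℕ} (hn : 1 ≤ n) {z : unitStrip} (g : (c.dual hc).Calderon)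
    {F : ℂ → c.inter} (hF : DiffContOnCl ℂ F unitStrip) :
    taylorCoeff (n - 1) (fun w => g.toFun w (F w)) (z : ℂ) =
      ∑ j : Fin n, (c.dual hc).taylor n z g j (taylorCoeff (j.rev : ℕ) F z) := by
  have h := taylorCoeff_bilin (ContinuousLinearMap.id ℂ (StrongDual ℂ c.inter))
    (g.analyticAt z.2) (hF.analyticAt_unitStrip z.2) (n - 1)
  rw [Nat.sub_add_cancel hn, Finset.sum_range] at h
  refine h.trans ?_
  refine Finset.sum_congr rfl fun j _ => ?_
  have : n - 1 - (j : ℕ) = n - (j + 1) := by omega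
  rw [Calderon.taylor_apply, Fin.val_rev, this]
  rfl

/-- Tuples in the intersection are jets of functions with values in the intersection, with almost
optimal norms. -/
theorem exists_isInterLift_of_taylor_eq {n : ℕ} {z : unitStrip} {f : c.Calderon}
    (hf : f ∈ c.calderonZero) {d : Fin n → c.inter}
    (hd : ∀ j, c.taylor n z f j = c.interTo (d j)) {ε : ℝ} (hε : 0 < ε) :
    ∃ (f' : c.Calderon) (F : ℂ → c.inter), IsInterLift f' F ∧ (∀ j : Fin n, taylorCoeff j F z = d j) ∧
      ‖f'‖ ≤ ‖f‖ + ε := by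
  have h0 : c.taylor n z (f - polyLift (z : ℂ) d) = 0 := by
    rw [map_sub]
    funext j
    rw [Pi.sub_apply, hd, taylor_polyLift, sub_self, Pi.zero_apply]
  -- Write `f = polyLift + stripZero ^ n • g`, and approximate `g` by an intersection-valued `k` up
  -- to `ε / A`. Then `polyLift + stripZero ^ n • k` has exactly the jet `d` and differs from `f` by
  -- `stripZero ^ n • (g - k)`, of norm at most `ε`.
  obtain ⟨g, hg, hg0⟩ := exists_eq_stripZero_pow_smul _ h0
  have hm := (isStripMultiplier_stripZero (z : ℂ)).pow n
  set A : ℝ := (1 + ‖(z : ℂ) + 1‖) ^ n with hA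
  have hA0 : 0 < A := by positivity
  obtain ⟨k, K, hK, hk, hgk⟩ := exists_isInterLift_norm_sub_le
    (hg0 (Submodule.sub_mem _ hf (polyLift_mem _ d))) (show 0 < ε / A by positivity)
  have hl := (isInterLift_polyLift (z : ℂ) d).add (hK.mul hm)
  refine ⟨_, _, hl, fun j => ?_, ?_⟩
  · have hKa := hK.1.analyticAt_unitStrip z.2
    have hma := hm.1.analyticAt_unitStrip z.2
    rw [taylorCoeff_add ((diffContOnCl_interPoly (z : ℂ) d).analyticAt_unitStrip z.2)
      (show AnalyticAt ℂ (fun w => stripZero z w ^ n • K w) z from hma.smul hKa),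
      taylorCoeff_interPoly z.2]
    have hinv : AnalyticAt ℂ (fun w : ℂ => ((w + 1) ^ n)⁻¹) z :=
      ((analyticAt_id.add analyticAt_const).pow n).inv
        (pow_ne_zero _ (add_one_ne_zero_of_mem (unitStrip_subset z.2)))
    have e : (fun w : ℂ => stripZero (z : ℂ) w ^ n • K w) =
        fun w : ℂ => (w - (z : ℂ)) ^ n • (((w + 1) ^ n)⁻¹ • K w) := by
      funext w
      rw [smul_smul, stripZero, div_pow, div_eq_mul_inv]
    rw [e, taylorCoeff_sub_pow_smul (show AnalyticAt ℂ (fun w : ℂ => ((w + 1) ^ n)⁻¹ • K w) z from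
      hinv.smul hKa), if_pos j.2, add_zero]
  · have e : polyLift (z : ℂ) d + Calderon.mul _ hm k = f - Calderon.mul _ hm (g - k) := by
      ext w hw
      have := hg w hw
      rw [Calderon.toFun_sub] at this
      rw [Calderon.toFun_add, Calderon.toFun_sub, Calderon.toFun_mul, Calderon.toFun_mul,
        Calderon.toFun_sub, smul_sub, ← this]
      abel
    rw [e]
    refine (norm_sub_le _ _).trans (add_le_add le_rfl ?_)
    refine (Calderon.norm_mul_le hm _).trans ?_
    calc A * ‖g - k‖ ≤ A * (ε / A) := mul_le_mul_of_nonneg_left hgk hA0.le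
      _ = ε := by field_simp

/-- The sum is a Taylor coefficient of the pairing with any intersection-valued representative.
Choosing one of norm at most `‖f‖ + ε R ^ (n - 1) / (‖g‖ + 1)` makes the loss in Cauchy's estimate
at most `ε`. -/
theorem norm_sum_pairing_le {n : ℕ} (hn : 1 ≤ n) {z : unitStrip} (g : (c.dual hc).Calderon)
    {f : c.Calderon} (hf : f ∈ c.calderonZero) {d : Fin n → c.inter}
    (hd : ∀ j, c.taylor n z f j = c.interTo (d j)) :
    ‖∑ j : Fin n, (c.dual hc).taylor n z g j (d j.rev)‖ ≤
      ‖g‖ * ‖f‖ / Metric.infDist (z : ℂ) (frontier unitStrip) ^ (n - 1) := by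
  have hR := infDist_frontier_pos z
  refine le_of_forall_pos_le_add fun ε hε => ?_
  set R := Metric.infDist (z : ℂ) (frontier unitStrip)
  obtain ⟨f', F, hF, hFd, hf'⟩ := exists_isInterLift_of_taylor_eq hf hd
    (show 0 < ε * R ^ (n - 1) / (‖g‖ + 1) by positivity)
  have h1 := norm_taylorCoeff_le_div_infDist_pow (diffContOnCl_pairing g hF)
    (fun w hw => norm_pairing_le g hF hw) z (n - 1)
  rw [taylorCoeff_pairing hn g hF.1] at h1
  simp only [hFd] at h1
  refine h1.trans ?_
  have h2 : ‖g‖ * (ε * R ^ (n - 1) / (‖g‖ + 1)) ≤ ε * R ^ (n - 1) := by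
    rw [mul_div_assoc', div_le_iff₀ (by positivity)]
    have : 0 ≤ ε * R ^ (n - 1) := by positivity
    nlinarith [norm_nonneg g]
  rw [div_add' _ _ _ (by positivity)]
  refine div_le_div_of_nonneg_right ?_ (by positivity)
  nlinarith [norm_nonneg g]

/-- The inclusion of the tuples in the intersection into the Rochberg space. -/
def interJet (c : BanachCouple X₀ X₁ E) (n : ℕ) (z : unitStrip) :
    (Fin n → c.inter) →ₗ[ℂ] Rochberg c.calderonZero n z where
  toFun d := Rochberg.mk _ n z ⟨polyLift (z : ℂ) d, polyLift_mem _ d⟩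
  map_add' d e := Rochberg.coord_injective (funext fun j => by
    simp [taylor_polyLift])
  map_smul' a d := Rochberg.coord_injective (funext fun j => by
    simp [taylor_polyLift])

@[simp] theorem coord_interJet {n : ℕ} {z : unitStrip} (d : Fin n → c.inter) (j : Fin n) :
    (c.interJet n z d).coord j = c.interTo (d j) := taylor_polyLift z d j

theorem IsInterLift.mk_eq_interJet {n : ℕ} {z : unitStrip} {f : c.Calderon} {F : ℂ → c.inter}
    (hF : IsInterLift f F) (hf : f ∈ c.calderonZero) :
    Rochberg.mk c.calderonZero n z ⟨f, hf⟩ = c.interJet n z fun j => taylorCoeff j F z :=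
  Rochberg.coord_injective (funext fun j => by
    rw [coord_interJet, Rochberg.coord_mk]
    exact hF.taylor j)

theorem denseRange_interJet (n : ℕ) (z : unitStrip) : DenseRange (c.interJet n z) := by
  intro w
  rw [Metric.mem_closure_iff]
  intro ε hε
  obtain ⟨f, rfl⟩ := Rochberg.mk_surjective w
  obtain ⟨g, G, hG, hg, hfg⟩ := exists_isInterLift_norm_sub_le f.2 (half_pos hε)
  refine ⟨_, ⟨_, (hG.mk_eq_interJet hg).symm⟩, ?_⟩
  rw [dist_eq_norm, ← map_sub]
  refine (Rochberg.norm_mk_le _).trans_lt (lt_of_le_of_lt hfg (half_lt_self hε))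

theorem norm_sum_coord_le {n : ℕ} (hn : 1 ≤ n) {z : unitStrip}
    (ξ : Rochberg (c := c.dual hc) ⊤ n z) (d : Fin n → c.inter) :
    ‖∑ j : Fin n, ξ.coord j (d j.rev)‖ ≤
      1 / Metric.infDist (z : ℂ) (frontier unitStrip) ^ (n - 1) * ‖c.interJet n z d‖ * ‖ξ‖ := by
  have hR := infDist_frontier_pos z
  set R := Metric.infDist (z : ℂ) (frontier unitStrip)
  have key : ∀ ε : ℝ, 0 < ε → ‖∑ j : Fin n, ξ.coord j (d j.rev)‖ ≤
      1 / R ^ (n - 1) * (‖c.interJet n z d‖ + ε) * (‖ξ‖ + ε) := by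
    intro ε hε
    obtain ⟨g, hg, hg'⟩ := Rochberg.exists_mk_eq ξ hε
    obtain ⟨f, hf, hf'⟩ := Rochberg.exists_mk_eq (c.interJet n z d) hε
    have h1 := norm_sum_pairing_le hn (z := z) g.1 f.2 (d := d) fun j => by
      rw [← coord_interJet (z := z), ← hf]
      rfl
    have e : ∀ j, (c.dual hc).taylor n z g.1 j = ξ.coord j := fun j => by rw [← hg]; rfl
    simp only [e] at h1
    refine h1.trans ?_
    have h2 : ‖g.1‖ * ‖f.1‖ ≤ (‖ξ‖ + ε) * (‖c.interJet n z d‖ + ε) :=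
      mul_le_mul hg'.le hf'.le (norm_nonneg _) (by positivity)
    calc _ ≤ (‖ξ‖ + ε) * (‖c.interJet n z d‖ + ε) / R ^ (n - 1) :=
          div_le_div_of_nonneg_right h2 (by positivity)
      _ = _ := by ring
  have ht : Tendsto (fun ε : ℝ => 1 / R ^ (n - 1) * (‖c.interJet n z d‖ + ε) * (‖ξ‖ + ε))
      (𝓝[>] 0) (𝓝 (1 / R ^ (n - 1) * (‖c.interJet n z d‖ + 0) * (‖ξ‖ + 0))) := by
    refine Tendsto.mono_left (Continuous.tendsto ?_ 0) nhdsWithin_le_nhds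
    fun_prop
  rw [add_zero, add_zero] at ht
  refine ge_of_tendsto ht ?_
  filter_upwards [self_mem_nhdsWithin] with ε hε using key ε hε

/-- The pairing with a tuple of elements of the intersection. -/
def jetEval (hc : c.IsRegular) {n : ℕ} (hn : 1 ≤ n) (z : unitStrip) :
    (Fin n → c.inter) →ₗ[ℂ] StrongDual ℂ (Rochberg (c := c.dual hc) ⊤ n z) where
  toFun d := LinearMap.mkContinuous
    { toFun := fun ξ => ∑ j : Fin n, ξ.coord j (d j.rev)
      map_add' := fun ξ η => by simp [Finset.sum_add_distrib]
      map_smul' := fun a ξ => by simp [Finset.mul_sum] }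
    (1 / Metric.infDist (z : ℂ) (frontier unitStrip) ^ (n - 1) * ‖c.interJet n z d‖)
    fun ξ => norm_sum_coord_le hn ξ d
  map_add' d e := by
    ext ξ
    simp [Finset.sum_add_distrib]
  map_smul' a d := by
    ext ξ
    simp [Finset.mul_sum]

theorem norm_jetEval_le {n : ℕ} (hn : 1 ≤ n) (z : unitStrip) (d : Fin n → c.inter) :
    ‖jetEval hc hn z d‖ ≤
      1 / Metric.infDist (z : ℂ) (frontier unitStrip) ^ (n - 1) * ‖c.interJet n z d‖ :=
  LinearMap.mkContinuous_norm_le _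
    (by have := infDist_frontier_pos z; positivity) fun ξ => norm_sum_coord_le hn ξ d

/-- The bilinear form is extended in the variable `x`, where tuples from the intersection are dense;
`T_n` is then the flip of the extension, with the same norm. -/
theorem exists_rochbergEval (hc : c.IsRegular) {n : ℕ} (hn : 1 ≤ n) (z : unitStrip) :
    ∃ S : Rochberg c.calderonZero n z →L[ℂ] StrongDual ℂ (Rochberg (c := c.dual hc) ⊤ n z),
      (∀ d, S (c.interJet n z d) = jetEval hc hn z d) ∧
      ‖S‖ ≤ 1 / Metric.infDist (z : ℂ) (frontier unitStrip) ^ (n - 1) :=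
  exists_clm_of_norm_le (A := Rochberg c.calderonZero n z)
    (B := StrongDual ℂ (Rochberg (c := c.dual hc) ⊤ n z)) (e := c.interJet n z)
    (denseRange_interJet n z) (f := jetEval hc hn z)
    (by have := infDist_frontier_pos z; positivity) (norm_jetEval_le hn z)

/-- The operator adjoint to `T_n`. -/
def rochbergEval (hc : c.IsRegular) {n : ℕ} (hn : 1 ≤ n) (z : unitStrip) :
    Rochberg c.calderonZero n z →L[ℂ] StrongDual ℂ (Rochberg (c := c.dual hc) ⊤ n z) :=
  (exists_rochbergEval hc hn z).choose

theorem rochbergEval_interJet {n : ℕ} (hn : 1 ≤ n) (z : unitStrip) (d : Fin n → c.inter) :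
    rochbergEval hc hn z (c.interJet n z d) = jetEval hc hn z d :=
  (exists_rochbergEval hc hn z).choose_spec.1 d

theorem norm_rochbergEval_le {n : ℕ} (hn : 1 ≤ n) (z : unitStrip) :
    ‖rochbergEval hc hn z‖ ≤ 1 / Metric.infDist (z : ℂ) (frontier unitStrip) ^ (n - 1) :=
  (exists_rochbergEval hc hn z).choose_spec.2

/-- The operator `T_n`. -/
def rochbergPairing (hc : c.IsRegular) {n : ℕ} (hn : 1 ≤ n) (z : unitStrip) :
    Rochberg (c := c.dual hc) ⊤ n z →L[ℂ] StrongDual ℂ (Rochberg c.calderonZero n z) :=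
  (rochbergEval hc hn z).flip

theorem rochbergPairing_interJet {n : ℕ} (hn : 1 ≤ n) (z : unitStrip)
    (ξ : Rochberg (c := c.dual hc) ⊤ n z) (d : Fin n → c.inter) :
    rochbergPairing hc hn z ξ (c.interJet n z d) = ∑ j : Fin n, ξ.coord j (d j.rev) := by
  have h := DFunLike.congr_fun (rochbergEval_interJet (hc := hc) hn z d) ξ
  exact h

theorem norm_rochbergPairing_le {n : ℕ} (hn : 1 ≤ n) (z : unitStrip) :
    ‖rochbergPairing hc hn z‖ ≤ 1 / Metric.infDist (z : ℂ) (frontier unitStrip) ^ (n - 1) := by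
  exact (ContinuousLinearMap.opNorm_flip (rochbergEval hc hn z)).trans_le
    (norm_rochbergEval_le hn z)

theorem isRochbergPairing_rochbergPairing {n : ℕ} (hn : 1 ≤ n) (z : unitStrip) :
    c.IsRochbergPairing hc n z (rochbergPairing hc hn z) := fun d =>
  ⟨c.interJet n z d, coord_interJet d, fun ξ => rochbergPairing_interJet hn z ξ d⟩

theorem IsRochbergPairing.eq_rochbergPairing {n : ℕ} (hn : 1 ≤ n) {z : unitStrip}
    {T : Rochberg (c := c.dual hc) ⊤ n z →L[ℂ] StrongDual ℂ (Rochberg c.calderonZero n z)}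
    (hT : c.IsRochbergPairing hc n z T) : T = rochbergPairing hc hn z := by
  ext ξ x
  refine congrFun ((denseRange_interJet n z).equalizer (T ξ).continuous
    (rochbergPairing hc hn z ξ).continuous (funext fun d => ?_)) x
  obtain ⟨y, hy, hy'⟩ := hT d
  have : y = c.interJet n z d :=
    Rochberg.coord_injective (funext fun j => by rw [hy, coord_interJet])
  rw [Function.comp_apply, Function.comp_apply, rochbergPairing_interJet, ← this, hy']

/-- Testing on tuples with a single entry `x` at the place `j.rev` recovers the entry `ξ_j` as a
functional on the intersection. -/
theorem rochbergPairing_injective {n : ℕ} (hn : 1 ≤ n) (z : unitStrip) :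
    Function.Injective (rochbergPairing hc hn z) := by
  refine (injective_iff_map_eq_zero _).2 fun ξ hξ => ?_
  refine Rochberg.coord_injective (funext fun j => ?_)
  ext x
  have h := rochbergPairing_interJet hn z ξ (Pi.single j.rev x)
  rw [hξ, Finset.sum_eq_single j] at h
  · simpa using! h.symm
  · intro i _ hi
    rw [Pi.single_eq_of_ne (fun h => hi (Fin.rev_injective h)), map_zero]
  · simp

end BanachCouple

/-! ### Poisson potentials and analytic majorants. -/

/-- The potential in the half plane `-δ < re w` of the density `u` on the line `re w = -δ`. -/
def halfPlanePotential (δ : ℝ) (u : ℝ → ℝ) (w : ℂ) : ℂ :=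
  ∫ s : ℝ, (Real.pi : ℂ)⁻¹ * ((u s : ℂ) / (w + δ - s * I))

section HalfPlane

variable {δ : ℝ} {u : ℝ → ℝ}

theorem add_re_le_norm (δ s : ℝ) (w : ℂ) : w.re + δ ≤ ‖w + δ - s * I‖ := by
  have := re_le_norm (w + δ - s * I)
  simpa using this

theorem norm_halfPlanePotential_integrand_le (hu0 : ∀ s, 0 ≤ u s) {w : ℂ} {ρ : ℝ} (hρ : 0 < ρ)
    (hw : ρ ≤ w.re + δ) (s : ℝ) :
    ‖(Real.pi : ℂ)⁻¹ * ((u s : ℂ) / (w + δ - s * I))‖ ≤ u s / ρ := by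
  have h1 := hw.trans (add_re_le_norm δ s w)
  rw [norm_mul, norm_div, norm_inv, norm_real, norm_real, Real.norm_of_nonneg (hu0 s),
    Real.norm_of_nonneg Real.pi_pos.le]
  have h2 : u s / ‖w + δ - s * I‖ ≤ u s / ρ := div_le_div_of_nonneg_left (hu0 s) hρ h1
  have h3 : Real.pi⁻¹ ≤ 1 := inv_le_one_of_one_le₀ (by linarith [Real.pi_gt_three])
  have h4 : 0 ≤ u s / ‖w + δ - s * I‖ := div_nonneg (hu0 s) (norm_nonneg _)
  nlinarith

theorem continuous_halfPlanePotential_integrand (hu : Continuous u) {w : ℂ} (hw : 0 < w.re + δ) :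
    Continuous fun s : ℝ => (Real.pi : ℂ)⁻¹ * ((u s : ℂ) / (w + δ - s * I)) := by
  have : ∀ s : ℝ, w + δ - s * I ≠ 0 := fun s h => by
    have := hw.trans_le (add_re_le_norm δ s w)
    rw [h, norm_zero] at this
    exact lt_irrefl _ this
  fun_prop (disch := exact this _)

theorem integrable_halfPlanePotential (hu : Continuous u) (hu0 : ∀ s, 0 ≤ u s)
    (hui : Integrable u) {w : ℂ} (hw : 0 < w.re + δ) :
    Integrable fun s : ℝ => (Real.pi : ℂ)⁻¹ * ((u s : ℂ) / (w + δ - s * I)) :=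
  (hui.div_const (w.re + δ)).mono' (continuous_halfPlanePotential_integrand hu hw).aestronglyMeasurable
    (ae_of_all _ fun s => norm_halfPlanePotential_integrand_le hu0 hw le_rfl s)

theorem norm_halfPlanePotential_le (hu0 : ∀ s, 0 ≤ u s)
    (hui : Integrable u) {w : ℂ} {ρ : ℝ} (hρ : 0 < ρ) (hw : ρ ≤ w.re + δ) :
    ‖halfPlanePotential δ u w‖ ≤ (∫ s, u s) / ρ := by
  rw [← integral_div]
  exact norm_integral_le_of_norm_le (hui.div_const ρ)
    (ae_of_all _ fun s => norm_halfPlanePotential_integrand_le hu0 hρ hw s)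

theorem differentiableAt_halfPlanePotential (hu : Continuous u) (hu0 : ∀ s, 0 ≤ u s)
    (hui : Integrable u) {w : ℂ} (hw : 0 < w.re + δ) :
    DifferentiableAt ℂ (halfPlanePotential δ u) w := by
  have key : ∀ v ∈ Metric.ball w ((w.re + δ) / 2), (w.re + δ) / 2 ≤ v.re + δ := by
    intro v hv
    rw [Metric.mem_ball, dist_eq_norm] at hv
    have := (abs_le.1 ((abs_re_le_norm (v - w)).trans hv.le)).1
    rw [sub_re] at this
    linarith
  refine differentiableAt_integral_of_dominated (half_pos hw) (hui.div_const ((w.re + δ) / 2))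
    (fun v hv => (continuous_halfPlanePotential_integrand hu
      ((half_pos hw).trans_le (key v hv))).aestronglyMeasurable) (fun s v hv => ?_)
    (fun v hv s => norm_halfPlanePotential_integrand_le hu0 (half_pos hw) (key v hv) s)
  have : v + δ - s * I ≠ 0 := fun h => by
    have := ((half_pos hw).trans_le (key v hv)).trans_le (add_re_le_norm δ s v)
    rw [h, norm_zero] at this
    exact lt_irrefl _ this
  have h : DifferentiableAt ℂ (fun v : ℂ => (Real.pi : ℂ)⁻¹ * ((u s : ℂ) / (v + δ - s * I))) v := by
    fun_prop (disch := exact this)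
  exact h.differentiableWithinAt

theorem re_halfPlanePotential_integrand (s : ℝ) (w : ℂ) :
    ((Real.pi : ℂ)⁻¹ * ((u s : ℂ) / (w + δ - s * I))).re =
      Real.pi⁻¹ * (u s * ((w.re + δ) / ‖w + δ - s * I‖ ^ 2)) := by
  rw [← ofReal_inv, re_ofReal_mul, div_eq_mul_inv, re_ofReal_mul, inv_re, normSq_eq_norm_sq]
  simp

theorem re_halfPlanePotential (hu : Continuous u) (hu0 : ∀ s, 0 ≤ u s)
    (hui : Integrable u) {w : ℂ} (hw : 0 < w.re + δ) :
    (halfPlanePotential δ u w).re =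
      ∫ s : ℝ, Real.pi⁻¹ * (u s * ((w.re + δ) / ‖w + δ - s * I‖ ^ 2)) := by
  simp only [← re_halfPlanePotential_integrand]
  exact (integral_re (integrable_halfPlanePotential hu hu0 hui hw)).symm

theorem re_halfPlanePotential_nonneg (hu : Continuous u) (hu0 : ∀ s, 0 ≤ u s)
    (hui : Integrable u) {w : ℂ} (hw : 0 < w.re + δ) : 0 ≤ (halfPlanePotential δ u w).re := by
  rw [re_halfPlanePotential hu hu0 hui hw]
  exact integral_nonneg fun s => by
    have := hu0 s
    positivity

/-- Substituting `s = t + δ v` turns the real part into the convolution of `u` with the Cauchy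
density of width `δ`, an approximate identity. -/
theorem re_halfPlanePotential_mul_I (hu : Continuous u) (hu0 : ∀ s, 0 ≤ u s)
    (hui : Integrable u) (hδ : 0 < δ) (t : ℝ) :
    (halfPlanePotential δ u (t * I)).re =
      ∫ v : ℝ, (Real.pi⁻¹ * (1 + v ^ 2)⁻¹) • u (t + δ * v) := by
  rw [re_halfPlanePotential hu hu0 hui (by simpa using hδ)]
  have h1 := integral_add_left_eq_self (μ := volume)
    (fun s : ℝ => Real.pi⁻¹ * (u s * (((t * I : ℂ).re + δ) / ‖(t * I : ℂ) + δ - s * I‖ ^ 2))) t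
  rw [← h1]
  have h2 := Measure.integral_comp_mul_left
    (fun s : ℝ => Real.pi⁻¹ * (u (t + s) * (((t * I : ℂ).re + δ) /
      ‖(t * I : ℂ) + δ - (t + s : ℝ) * I‖ ^ 2))) δ
  rw [abs_of_pos (inv_pos.2 hδ), smul_eq_mul] at h2
  have h3 := congrArg (fun x => δ * x) h2
  simp only [mul_inv_cancel_left₀ hδ.ne'] at h3
  rw [← h3, ← integral_const_mul]
  refine integral_congr_ae (ae_of_all _ fun v => ?_)
  have h4 : ‖(t * I : ℂ) + δ - (t + δ * v : ℝ) * I‖ ^ 2 = δ ^ 2 * (1 + v ^ 2) := by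
    rw [← normSq_eq_norm_sq, normSq_apply]
    simp
    ring
  have h5 : (t * I : ℂ).re = 0 := by simp
  simp only [h4, h5, smul_eq_mul]
  have : (0 : ℝ) < 1 + v ^ 2 := by positivity
  field_simp
  rw [zero_add, mul_comm]

/-- The Cauchy densities converge uniformly on uniformly continuous functions. Only the lower bound
is kept, because the potential serves as a majorant. -/
theorem exists_sub_le_re_halfPlanePotential (hu : UniformContinuous u) {M : ℝ}
    (hM : ∀ s, u s ≤ M) (hu0 : ∀ s, 0 ≤ u s) (hui : Integrable u) {ε : ℝ} (hε : 0 < ε) :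
    ∃ δ₀ : ℝ, 0 < δ₀ ∧ ∀ δ, 0 < δ → δ < δ₀ → ∀ t : ℝ,
      u t - ε ≤ (halfPlanePotential δ u (t * I)).re := by
  obtain ⟨δ₀, h0, h⟩ := exists_norm_integral_smul_sub_le
    (k := fun v => Real.pi⁻¹ * (1 + v ^ 2)⁻¹) (fun v => by positivity)
    (integrable_inv_one_add_sq.const_mul _)
    (by rw [integral_const_mul, integral_univ_inv_one_add_sq, inv_mul_cancel₀ Real.pi_ne_zero])
    hu (M := M) (fun t => by rw [Real.norm_of_nonneg (hu0 t)]; exact hM t) hε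
  refine ⟨δ₀, h0, fun δ h1 h2 t => ?_⟩
  have := h δ h1 h2 t
  rw [← re_halfPlanePotential_mul_I hu.continuous hu0 hui h1] at this
  linarith [(abs_le.1 this).1]

end HalfPlane

/-- Half of the distance of `z` from the boundary of the strip. -/
def stripRadius (z : unitStrip) : ℝ := min (z : ℂ).re (1 - (z : ℂ).re) / 2

theorem stripRadius_pos (z : unitStrip) : 0 < stripRadius z :=
  half_pos (lt_min z.2.1 (sub_pos.2 z.2.2))

theorem stripRadius_le_one (z : unitStrip) : stripRadius z ≤ 1 := by
  have := min_le_left (z : ℂ).re (1 - (z : ℂ).re)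
  have := z.2.2
  unfold stripRadius
  linarith

theorem re_mem_of_mem_closedBall_stripRadius {z : unitStrip} {w : ℂ}
    (hw : w ∈ Metric.closedBall (z : ℂ) (stripRadius z)) :
    stripRadius z ≤ w.re ∧ stripRadius z ≤ 1 - w.re := by
  rw [Metric.mem_closedBall, dist_eq_norm] at hw
  have h := abs_le.1 ((abs_re_le_norm (w - z)).trans hw)
  rw [sub_re] at h
  have h1 : 2 * stripRadius z ≤ (z : ℂ).re := by
    have := min_le_left (z : ℂ).re (1 - (z : ℂ).re)
    unfold stripRadius
    linarith
  have h2 : 2 * stripRadius z ≤ 1 - (z : ℂ).re := by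
    have := min_le_right (z : ℂ).re (1 - (z : ℂ).re)
    unfold stripRadius
    linarith
  exact ⟨by linarith [h.1], by linarith [h.2]⟩

theorem closedBall_stripRadius_subset (z : unitStrip) :
    Metric.closedBall (z : ℂ) (stripRadius z) ⊆ unitStrip := fun w hw => by
  have h := re_mem_of_mem_closedBall_stripRadius hw
  have := stripRadius_pos z
  exact ⟨by linarith [h.1], by linarith [h.2]⟩

theorem norm_exp_ofReal_mul (a : ℝ) (w : ℂ) : ‖exp (a * w)‖ = Real.exp (a * w.re) := by
  rw [norm_exp, re_ofReal_mul]

/-- An analytic function on the strip whose absolute value dominates given functions on the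
boundary, with Taylor coefficients controlled by weighted integrals. -/
theorem exists_strip_majorant (n : ℕ) (z : unitStrip) :
    ∃ C : ℝ, 0 < C ∧ ∀ (a : ℝ) (u₀ u₁ : ℝ → ℝ), UniformContinuous u₀ → UniformContinuous u₁ →
      (∀ t, 0 ≤ u₀ t) → (∀ t, 0 ≤ u₁ t) → Integrable u₀ → Integrable u₁ →
      ∀ M : ℝ, (∀ t, u₀ t ≤ M) → (∀ t, u₁ t ≤ M) → ∀ η : ℝ, 0 < η →
      ∃ (Ψ : ℂ → ℂ) (A : ℝ), 0 < A ∧ (∀ w ∈ closedUnitStrip, DifferentiableAt ℂ Ψ w) ∧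
        (∀ w ∈ closedUnitStrip, A ≤ ‖Ψ w‖) ∧ (∀ t : ℝ, u₀ t ≤ ‖Ψ (t * I)‖) ∧
        (∀ t : ℝ, u₁ t ≤ ‖Ψ (1 + t * I)‖) ∧
        ∀ k < n, ‖taylorCoeff k Ψ z‖ ≤ C * (Real.exp (|a| * stripRadius z) *
          (η + Real.exp (-(a * (z : ℂ).re)) * (∫ t, u₀ t) +
            Real.exp (a * (1 - (z : ℂ).re)) * ∫ t, u₁ t)) := by
  set R := stripRadius z with hR
  have hR0 : 0 < R := stripRadius_pos z
  have hR1 : R ≤ 1 := stripRadius_le_one z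
  refine ⟨R⁻¹ / R ^ n, by positivity, ?_⟩
  intro a u₀ u₁ hu₀ hu₁ h₀ h₁ hi₀ hi₁ M hM₀ hM₁ η hη
  set e₀ := Real.exp (-(a * (z : ℂ).re)) with he₀
  set e₁ := Real.exp (a * (1 - (z : ℂ).re)) with he₁
  have he₀' : 0 < e₀ := Real.exp_pos _
  have he₁' : 0 < e₁ := Real.exp_pos _
  set v₀ : ℝ → ℝ := fun t => e₀ * u₀ t with hv₀
  -- The right line is treated through `w ↦ 1 - w`, which sends `1 + it` to `-it`; hence the
  -- reflection.
  set v₁ : ℝ → ℝ := fun t => e₁ * u₁ (-t) with hv₁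
  have c₀ : UniformContinuous v₀ := hu₀.const_mul' e₀
  have c₁ : UniformContinuous v₁ := (hu₁.comp uniformContinuous_neg).const_mul' e₁
  have p₀ : ∀ t, 0 ≤ v₀ t := fun t => mul_nonneg he₀'.le (h₀ t)
  have p₁ : ∀ t, 0 ≤ v₁ t := fun t => mul_nonneg he₁'.le (h₁ _)
  have i₀ : Integrable v₀ := hi₀.const_mul _
  have i₁ : Integrable v₁ := (hi₁.comp_neg).const_mul _
  obtain ⟨δ₀, hδ₀, hδ₀'⟩ := exists_sub_le_re_halfPlanePotential c₀ (M := e₀ * M)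
    (fun s => mul_le_mul_of_nonneg_left (hM₀ s) he₀'.le) p₀ i₀ hη
  obtain ⟨δ₁, hδ₁, hδ₁'⟩ := exists_sub_le_re_halfPlanePotential c₁ (M := e₁ * M)
    (fun s => mul_le_mul_of_nonneg_left (hM₁ _) he₁'.le) p₁ i₁ hη
  obtain ⟨δ, hδ, hδm⟩ := exists_between (lt_min hδ₀ hδ₁)
  have hm0 := hδm.trans_le (min_le_left _ _)
  have hm1 := hδm.trans_le (min_le_right _ _)
  -- The constant `η` absorbs the error of the potentials on the boundary and keeps `re Φ ≥ η`. The
  -- majorant is `exp (-a (w - z)) Φ w`: the exponential has modulus `e₀⁻¹` on the left line and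
  -- `e₁⁻¹` on the right one, which undoes the factors in `v₀` and `v₁`.
  set Φ : ℂ → ℂ := fun w => η + halfPlanePotential δ v₀ w + halfPlanePotential δ v₁ (1 - w) with hΦ
  have r₀ : ∀ w ∈ closedUnitStrip, 0 ≤ (halfPlanePotential δ v₀ w).re := fun w hw =>
    re_halfPlanePotential_nonneg c₀.continuous p₀ i₀ (by linarith [hw.1])
  have r₁ : ∀ w ∈ closedUnitStrip, 0 ≤ (halfPlanePotential δ v₁ (1 - w)).re := fun w hw =>
    re_halfPlanePotential_nonneg c₁.continuous p₁ i₁ (by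
      rw [sub_re, one_re]; linarith [hw.2])
  have hre : ∀ w, (Φ w).re = η + (halfPlanePotential δ v₀ w).re +
      (halfPlanePotential δ v₁ (1 - w)).re := fun w => by simp [hΦ]
  have hd : ∀ w ∈ closedUnitStrip, DifferentiableAt ℂ Φ w := by
    intro w hw
    have d₀ := differentiableAt_halfPlanePotential (δ := δ) (w := w) c₀.continuous p₀ i₀
      (by linarith [hw.1])
    have d₁ := differentiableAt_halfPlanePotential (δ := δ) (w := 1 - w) c₁.continuous p₁ i₁
      (by rw [sub_re, one_re]; linarith [hw.2])
    exact ((differentiableAt_const _).add d₀).add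
      (DifferentiableAt.fun_comp' w d₁ (differentiableAt_id.const_sub 1))
  have hexp : ∀ w : ℂ, ‖exp (((-a : ℝ) : ℂ) * (w - z))‖ = Real.exp (-a * (w.re - (z : ℂ).re)) := by
    intro w
    rw [norm_exp_ofReal_mul, sub_re]
  refine ⟨fun w => exp (((-a : ℝ) : ℂ) * (w - z)) * Φ w, Real.exp (-|a|) * η, by positivity,
    fun w hw => ?_, fun w hw => ?_, fun t => ?_, fun t => ?_, fun k hk => ?_⟩
  · exact ((differentiableAt_id.sub_const _).const_mul _).cexp.mul (hd w hw)
  · rw [norm_mul, hexp]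
    refine mul_le_mul ?_ ?_ hη.le (Real.exp_pos _).le
    · rw [Real.exp_le_exp]
      have h1 : |w.re - (z : ℂ).re| ≤ 1 := by
        rw [abs_le]
        exact ⟨by linarith [hw.1, z.2.2], by linarith [hw.2, z.2.1]⟩
      have h2 : |a * (w.re - (z : ℂ).re)| ≤ |a| := by
        rw [abs_mul]
        exact mul_le_of_le_one_right (abs_nonneg _) h1
      linarith [(abs_le.1 h2).2]
    · refine le_trans ?_ (re_le_norm _)
      rw [hre]
      linarith [r₀ w hw, r₁ w hw]
  · rw [norm_mul, hexp]
    have h1 := hδ₀' δ hδ hm0 t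
    have h2 := r₁ _ (left_mem_closedUnitStrip t)
    have h3 : e₀ * u₀ t ≤ ‖Φ (t * I)‖ := by
      refine le_trans ?_ (re_le_norm _)
      rw [hre]
      simp only [hv₀] at h1
      linarith
    have h4 : Real.exp (-a * ((t * I : ℂ).re - (z : ℂ).re)) * e₀ = 1 := by
      rw [he₀, ← Real.exp_add, Real.exp_eq_one_iff]
      simp
    calc u₀ t = Real.exp (-a * ((t * I : ℂ).re - (z : ℂ).re)) * (e₀ * u₀ t) := by
          rw [← mul_assoc, h4, one_mul]
      _ ≤ _ := mul_le_mul_of_nonneg_left h3 (Real.exp_pos _).le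
  · rw [norm_mul, hexp]
    have h1 := hδ₁' δ hδ hm1 (-t)
    have h2 := r₀ _ (right_mem_closedUnitStrip t)
    have h3 : e₁ * u₁ t ≤ ‖Φ (1 + t * I)‖ := by
      refine le_trans ?_ (re_le_norm _)
      have h5 : (1 : ℂ) - (1 + t * I) = ((-t : ℝ) : ℂ) * I := by push_cast; ring
      rw [hre, h5]
      simp only [hv₁, neg_neg] at h1
      linarith
    have h4 : Real.exp (-a * ((1 + t * I : ℂ).re - (z : ℂ).re)) * e₁ = 1 := by
      rw [he₁, ← Real.exp_add, Real.exp_eq_one_iff]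
      simp
    calc u₁ t = Real.exp (-a * ((1 + t * I : ℂ).re - (z : ℂ).re)) * (e₁ * u₁ t) := by
          rw [← mul_assoc, h4, one_mul]
      _ ≤ _ := mul_le_mul_of_nonneg_left h3 (Real.exp_pos _).le
  · set J := η + e₀ * (∫ t, u₀ t) + e₁ * ∫ t, u₁ t with hJ
    have hJ0 : 0 ≤ J := by
      have := integral_nonneg (μ := volume) (f := u₀) h₀
      have := integral_nonneg (μ := volume) (f := u₁) h₁
      positivity
    have hb := closedBall_stripRadius_subset z
    -- On the circle of radius `R` both lines are at distance at least `R`, so each potential is at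
    -- most its mass over `R`; `R ≤ 1` gives `η ≤ η / R` and allows replacing `R⁻ᵏ` by `R⁻ⁿ`.
    refine (norm_taylorCoeff_le hR0 (C := Real.exp (|a| * R) * (R⁻¹ * J)) ?_ ?_ k).trans ?_
    · refine DifferentiableOn.diffContOnCl fun w hw => ?_
      rw [closure_ball _ hR0.ne'] at hw
      exact (((differentiableAt_id.sub_const _).const_mul _).cexp.mul
        (hd w (unitStrip_subset (hb hw)))).differentiableWithinAt
    · intro w hw
      have hw' := Metric.sphere_subset_closedBall hw
      have hwr := re_mem_of_mem_closedBall_stripRadius hw'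
      rw [norm_mul, hexp]
      refine mul_le_mul ?_ ?_ (norm_nonneg _) (Real.exp_pos _).le
      · rw [Real.exp_le_exp]
        rw [mem_sphere_iff_norm] at hw
        have h1 := abs_re_le_norm (w - z)
        rw [hw, sub_re] at h1
        have h2 : |a * (w.re - (z : ℂ).re)| ≤ |a| * R := by
          rw [abs_mul]
          exact mul_le_mul_of_nonneg_left h1 (abs_nonneg _)
        linarith [(abs_le.1 h2).1]
      · have n₀ := norm_halfPlanePotential_le (δ := δ) (w := w) p₀ i₀ hR0 (by linarith [hwr.1])
        have n₁ := norm_halfPlanePotential_le (δ := δ) (w := 1 - w) p₁ i₁ hR0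
          (by rw [sub_re, one_re]; linarith [hwr.2])
        have k₀ : ∫ s, v₀ s = e₀ * ∫ t, u₀ t := integral_const_mul _ _
        have k₁ : ∫ s, v₁ s = e₁ * ∫ t, u₁ t := by
          rw [hv₁, integral_const_mul, integral_neg_eq_self (fun s => u₁ s) volume]
        rw [k₀] at n₀
        rw [k₁] at n₁
        have n₂ : ‖(η : ℂ)‖ ≤ η / R := by
          rw [norm_real, Real.norm_of_nonneg hη.le, le_div_iff₀ hR0]
          exact mul_le_of_le_one_right hη.le hR1
        refine ((norm_add_le _ _).trans (add_le_add (norm_add_le _ _) le_rfl)).trans ?_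
        refine (add_le_add (add_le_add n₂ n₀) n₁).trans (le_of_eq ?_)
        rw [hJ]
        ring
    · have h1 : (R ^ k)⁻¹ ≤ (R ^ n)⁻¹ :=
        inv_anti₀ (by positivity) (pow_le_pow_of_le_one hR0.le hR1 hk.le)
      calc Real.exp (|a| * R) * (R⁻¹ * J) / R ^ k
          = Real.exp (|a| * R) * (R⁻¹ * J) * (R ^ k)⁻¹ := div_eq_mul_inv _ _
        _ ≤ Real.exp (|a| * R) * (R⁻¹ * J) * (R ^ n)⁻¹ :=
          mul_le_mul_of_nonneg_left h1 (by positivity)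
        _ = _ := by ring

/-! ### The weighted `L¹` estimate for jets. -/

/-- The integrable weight `(1 + t²)⁻ⁿ`. -/
def stripWeight (n : ℕ) (t : ℝ) : ℝ := ((1 + t ^ 2) ^ n)⁻¹

theorem stripWeight_pos (n : ℕ) (t : ℝ) : 0 < stripWeight n t := by unfold stripWeight; positivity

theorem continuous_stripWeight (n : ℕ) : Continuous (stripWeight n) := by
  unfold stripWeight
  exact Continuous.inv₀ (by fun_prop) fun t => by positivity

theorem integrable_stripWeight {n : ℕ} (hn : 1 ≤ n) : Integrable (stripWeight n) := by
  refine integrable_inv_one_add_sq.mono' (continuous_stripWeight n).aestronglyMeasurable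
    (ae_of_all _ fun t => ?_)
  rw [Real.norm_of_nonneg (stripWeight_pos n t).le]
  exact inv_anti₀ (by positivity) (le_self_pow₀ (by nlinarith [sq_nonneg t]) (by omega))

theorem integrable_stripWeight_mul {n : ℕ} (hn : 1 ≤ n) {u : ℝ → ℝ} (hu : Continuous u) {M : ℝ}
    (h0 : ∀ t, 0 ≤ u t) (hM : ∀ t, u t ≤ M) : Integrable fun t => stripWeight n t * u t := by
  refine ((integrable_stripWeight hn).mul_const M).mono'
    ((continuous_stripWeight n).mul hu).aestronglyMeasurable (ae_of_all _ fun t => ?_)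
  rw [Real.norm_of_nonneg (mul_nonneg (stripWeight_pos n t).le (h0 t))]
  exact mul_le_mul_of_nonneg_left (hM t) (stripWeight_pos n t).le

/-- Since `stripCut` is of order `‖w + 1‖⁻¹` and `1 + t² ≤ ‖w + 1‖²` on the boundary lines, the
power `2 n` is what the weight `(1 + t²)⁻ⁿ` requires. -/
theorem exists_norm_stripCut_pow_le (n : ℕ) (z : ℂ) :
    ∃ C : ℝ, 0 < C ∧ (∀ w ∈ closedUnitStrip, ‖stripCut n z w ^ (2 * n)‖ ≤ C) ∧
      (∀ t : ℝ, ‖stripCut n z (t * I) ^ (2 * n)‖ ≤ C * stripWeight n t) ∧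
      (∀ t : ℝ, ‖stripCut n z (1 + t * I) ^ (2 * n)‖ ≤ C * stripWeight n t) ∧
      (1 ≤ n → ∀ w ∈ closedUnitStrip, ‖stripCut n z w ^ (2 * n)‖ ≤ C / ‖w + 1‖) := by
  obtain ⟨C, hC, h⟩ := exists_norm_stripCut_le n z
  have key : ∀ w ∈ closedUnitStrip, ‖stripCut n z w ^ (2 * n)‖ ≤ C ^ (2 * n) / (‖w + 1‖ ^ 2) ^ n := by
    intro w hw
    rw [norm_pow, ← pow_mul, ← div_pow]
    exact pow_le_pow_left₀ (norm_nonneg _) (h w hw) _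
  have key' : ∀ w ∈ closedUnitStrip, ∀ t : ℝ, 1 + t ^ 2 ≤ ‖w + 1‖ ^ 2 →
      ‖stripCut n z w ^ (2 * n)‖ ≤ C ^ (2 * n) * stripWeight n t := by
    intro w hw t ht
    refine (key w hw).trans ?_
    rw [div_eq_mul_inv]
    exact mul_le_mul_of_nonneg_left (inv_anti₀ (by positivity)
      (pow_le_pow_left₀ (by positivity) ht n)) (by positivity)
  refine ⟨C ^ (2 * n), by positivity, fun w hw => ?_, fun t => key' _ (left_mem_closedUnitStrip t) t ?_,
    fun t => key' _ (right_mem_closedUnitStrip t) t ?_, fun hn w hw => ?_⟩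
  · exact (key w hw).trans (div_le_self (by positivity)
      (one_le_pow₀ (one_le_pow₀ (one_le_norm_add_one hw))))
  · rw [← normSq_eq_norm_sq, normSq_apply]
    simp
    nlinarith
  · rw [← normSq_eq_norm_sq, normSq_apply]
    simp
    nlinarith
  · refine (key w hw).trans (div_le_div_of_nonneg_left (by positivity)
      (one_pos.trans_le (one_le_norm_add_one hw)) ?_)
    rw [← pow_mul]
    exact le_self_pow₀ (one_le_norm_add_one hw) (by omega)

/-- A multiplier with the jet of the constant function `1` that makes given functions on the
boundary small in the sup norm if they are small in weighted `L¹`. -/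
theorem exists_jet_multiplier {n : ℕ} (hn : 1 ≤ n) (z : unitStrip) :
    ∃ C : ℝ, 0 < C ∧ ∀ (a : ℝ) (u₀ u₁ : ℝ → ℝ), Continuous u₀ → Continuous u₁ →
      (∀ t, 0 ≤ u₀ t) → (∀ t, 0 ≤ u₁ t) → ∀ M : ℝ, (∀ t, u₀ t ≤ M) → (∀ t, u₁ t ≤ M) →
      ∀ η : ℝ, 0 < η →
      ∃ (φ : ℂ → ℂ) (A : ℝ), IsStripMultiplier A φ ∧
        Tendsto (fun t : ℝ => φ (t * I)) (cocompact ℝ) (𝓝 0) ∧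
        Tendsto (fun t : ℝ => φ (1 + t * I)) (cocompact ℝ) (𝓝 0) ∧
        (∀ i < n, taylorCoeff i φ z = taylorCoeff i (fun _ => (1 : ℂ)) z) ∧
        ∀ t : ℝ,
          ‖φ (t * I)‖ * u₀ t ≤ C * (Real.exp (|a| * stripRadius z) *
            (η + Real.exp (-(a * (z : ℂ).re)) * (∫ t, stripWeight n t * u₀ t) +
            Real.exp (a * (1 - (z : ℂ).re)) * ∫ t, stripWeight n t * u₁ t)) ∧
          ‖φ (1 + t * I)‖ * u₁ t ≤ C * (Real.exp (|a| * stripRadius z) *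
            (η + Real.exp (-(a * (z : ℂ).re)) * (∫ t, stripWeight n t * u₀ t) +
            Real.exp (a * (1 - (z : ℂ).re)) * ∫ t, stripWeight n t * u₁ t)) := by
  obtain ⟨C₁, hC₁, hcut, hcutl, hcutr, hcutd⟩ := exists_norm_stripCut_pow_le n (z : ℂ)
  obtain ⟨C₂, hC₂, hmon⟩ := exists_norm_stripMonomial_le n (z : ℂ)
  obtain ⟨C₃, hC₃, hmaj⟩ := exists_strip_majorant n z
  refine ⟨n * C₂ * C₃ * (1 + C₁), by positivity, ?_⟩
  intro a u₀ u₁ hu₀ hu₁ h₀ h₁ M hM₀ hM₁ η hη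
  -- Cutting off by `χ` makes the functions to be majorized integrable and vanishing at infinity,
  -- hence uniformly continuous.
  set χ : ℂ → ℂ := fun w => stripCut n (z : ℂ) w ^ (2 * n) with hχ
  have hχd : ∀ w ∈ closedUnitStrip, DifferentiableAt ℂ χ w := fun w hw =>
    (differentiableAt_stripCut n z hw).pow _
  have hχm : IsStripMultiplier C₁ χ := isStripMultiplier_of_norm_le_div hχd hC₁.le (hcutd hn)
  set v₀ : ℝ → ℝ := fun t => ‖χ (t * I)‖ * u₀ t with hv₀
  set v₁ : ℝ → ℝ := fun t => ‖χ (1 + t * I)‖ * u₁ t with hv₁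
  have hM0 : 0 ≤ M := (h₀ 0).trans (hM₀ 0)
  have t₀ : Tendsto v₀ (cocompact ℝ) (𝓝 0) := by
    have h := (tendsto_left_of_norm_le_div (hcutd hn)).norm.mul_const M
    rw [norm_zero, zero_mul] at h
    exact squeeze_zero (fun t => mul_nonneg (norm_nonneg _) (h₀ t))
      (fun t => mul_le_mul_of_nonneg_left (hM₀ t) (norm_nonneg _)) h
  have t₁ : Tendsto v₁ (cocompact ℝ) (𝓝 0) := by
    have h := (tendsto_right_of_norm_le_div (hcutd hn)).norm.mul_const M
    rw [norm_zero, zero_mul] at h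
    exact squeeze_zero (fun t => mul_nonneg (norm_nonneg _) (h₁ t))
      (fun t => mul_le_mul_of_nonneg_left (hM₁ t) (norm_nonneg _)) h
  have c₀ : Continuous v₀ := (hχm.1.continuous_left.norm).mul hu₀
  have c₁ : Continuous v₁ := (hχm.1.continuous_right.norm).mul hu₁
  have q₀ : ∀ t, v₀ t ≤ C₁ * (stripWeight n t * u₀ t) := fun t => by
    rw [← mul_assoc]
    exact mul_le_mul_of_nonneg_right (hcutl t) (h₀ t)
  have q₁ : ∀ t, v₁ t ≤ C₁ * (stripWeight n t * u₁ t) := fun t => by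
    rw [← mul_assoc]
    exact mul_le_mul_of_nonneg_right (hcutr t) (h₁ t)
  have w₀ := integrable_stripWeight_mul hn hu₀ h₀ hM₀
  have w₁ := integrable_stripWeight_mul hn hu₁ h₁ hM₁
  have p₀ : ∀ t, 0 ≤ v₀ t := fun t => mul_nonneg (norm_nonneg _) (h₀ t)
  have p₁ : ∀ t, 0 ≤ v₁ t := fun t => mul_nonneg (norm_nonneg _) (h₁ t)
  have i₀ : Integrable v₀ := (w₀.const_mul C₁).mono' c₀.aestronglyMeasurable
    (ae_of_all _ fun t => by rw [Real.norm_of_nonneg (p₀ t)]; exact q₀ t)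
  have i₁ : Integrable v₁ := (w₁.const_mul C₁).mono' c₁.aestronglyMeasurable
    (ae_of_all _ fun t => by rw [Real.norm_of_nonneg (p₁ t)]; exact q₁ t)
  obtain ⟨Ψ, A, hA, hΨd, hΨA, hΨ₀, hΨ₁, hΨt⟩ := hmaj a v₀ v₁
    (c₀.uniformContinuous_of_tendsto_cocompact t₀) (c₁.uniformContinuous_of_tendsto_cocompact t₁)
    p₀ p₁ i₀ i₁ (C₁ * M)
    (fun t => mul_le_mul (hcut _ (left_mem_closedUnitStrip t)) (hM₀ t) (h₀ t) hC₁.le)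
    (fun t => mul_le_mul (hcut _ (right_mem_closedUnitStrip t)) (hM₁ t) (h₁ t) hC₁.le) η hη
  -- `P` has the jet of `Ψ`, so the multiplier `χ P / Ψ` has the jet of `1`. On the boundary `|χ| u
  -- ≤ |Ψ|`, so `|χ P / Ψ| u ≤ |P|`, and `P` is controlled by the Taylor coefficients of `Ψ`.
  set P : ℂ → ℂ := fun w => ∑ k ∈ Finset.range n, taylorCoeff k Ψ z * stripMonomial n z k w with hP
  set B := Real.exp (|a| * stripRadius z) *
    (η + Real.exp (-(a * (z : ℂ).re)) * (∫ t, v₀ t) + Real.exp (a * (1 - (z : ℂ).re)) * ∫ t, v₁ t)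
    with hB
  have hB0 : 0 ≤ B := by
    have := integral_nonneg (μ := volume) (f := v₀) p₀
    have := integral_nonneg (μ := volume) (f := v₁) p₁
    positivity
  have hPd : ∀ w ∈ closedUnitStrip, DifferentiableAt ℂ P w := fun w hw =>
    DifferentiableAt.fun_sum fun k _ => (differentiableAt_stripMonomial n z k hw).const_mul _
  have hPb : ∀ w ∈ closedUnitStrip, ‖P w‖ ≤ n * C₂ * C₃ * B := by
    intro w hw
    refine (norm_sum_le _ _).trans ?_
    have : ∀ k ∈ Finset.range n, ‖taylorCoeff k Ψ z * stripMonomial n z k w‖ ≤ C₃ * B * C₂ := by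
      intro k hk
      rw [norm_mul]
      have hk' := Finset.mem_range.1 hk
      refine mul_le_mul (hΨt k hk') ((hmon k hk' w hw).trans ?_) (norm_nonneg _) (by positivity)
      exact div_le_self hC₂.le (one_le_norm_add_one hw)
    refine (Finset.sum_le_card_nsmul _ _ _ this).trans (le_of_eq ?_)
    rw [Finset.card_range, nsmul_eq_mul]
    ring
  have hΨ0 : ∀ w ∈ closedUnitStrip, Ψ w ≠ 0 := fun w hw h => by
    have := hA.trans_le (hΨA w hw)
    rw [h, norm_zero] at this
    exact lt_irrefl _ this
  have hz := unitStrip_subset z.2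
  have hmul : IsStripMultiplier (n * C₂ * C₃ * B * A⁻¹) fun w => P w * (Ψ w)⁻¹ := by
    refine ⟨diffContOnCl_of_differentiableAt fun w hw =>
      (hPd w hw).mul ((hΨd w hw).inv (hΨ0 w hw)), fun w hw => ?_⟩
    rw [norm_mul, norm_inv]
    exact mul_le_mul (hPb w hw) (inv_anti₀ hA (hΨA w hw)) (inv_nonneg.2 (norm_nonneg _))
      (by positivity)
  have hmul' := hχm.mul hmul
  have hfin : n * C₂ * C₃ * B ≤ n * C₂ * C₃ * (1 + C₁) * (Real.exp (|a| * stripRadius z) *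
      (η + Real.exp (-(a * (z : ℂ).re)) * (∫ t, stripWeight n t * u₀ t) +
      Real.exp (a * (1 - (z : ℂ).re)) * ∫ t, stripWeight n t * u₁ t)) := by
    rw [mul_assoc (n * C₂ * C₃)]
    refine mul_le_mul_of_nonneg_left ?_ (by positivity)
    have j₀ : ∫ t, v₀ t ≤ C₁ * ∫ t, stripWeight n t * u₀ t := by
      rw [← integral_const_mul]
      exact integral_mono i₀ (w₀.const_mul _) q₀
    have j₁ : ∫ t, v₁ t ≤ C₁ * ∫ t, stripWeight n t * u₁ t := by
      rw [← integral_const_mul]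
      exact integral_mono i₁ (w₁.const_mul _) q₁
    have k₀ : 0 ≤ ∫ t, stripWeight n t * u₀ t :=
      integral_nonneg fun t => mul_nonneg (stripWeight_pos n t).le (h₀ t)
    have k₁ : 0 ≤ ∫ t, stripWeight n t * u₁ t :=
      integral_nonneg fun t => mul_nonneg (stripWeight_pos n t).le (h₁ t)
    rw [hB, mul_left_comm]
    refine mul_le_mul_of_nonneg_left ?_ (Real.exp_pos _).le
    rw [mul_add, mul_add, mul_left_comm, mul_left_comm (1 + C₁)]
    refine add_le_add (add_le_add ?_ (mul_le_mul_of_nonneg_left ?_ (Real.exp_pos _).le))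
      (mul_le_mul_of_nonneg_left ?_ (Real.exp_pos _).le)
    · nlinarith
    · nlinarith
    · nlinarith
  have hside : ∀ (w : ℂ), w ∈ closedUnitStrip → ∀ x : ℝ, 0 ≤ x → ‖χ w‖ * x ≤ ‖Ψ w‖ →
      ‖χ w * (P w * (Ψ w)⁻¹)‖ * x ≤ n * C₂ * C₃ * B := by
    intro w hw x hx h
    have hpos : 0 < ‖Ψ w‖ := hA.trans_le (hΨA w hw)
    rw [norm_mul, norm_mul, norm_inv]
    calc ‖χ w‖ * (‖P w‖ * ‖Ψ w‖⁻¹) * x = ‖P w‖ * ((‖χ w‖ * x) * ‖Ψ w‖⁻¹) := by ring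
      _ ≤ ‖P w‖ * (‖Ψ w‖ * ‖Ψ w‖⁻¹) := by gcongr
      _ = ‖P w‖ := by rw [mul_inv_cancel₀ hpos.ne', mul_one]
      _ ≤ _ := hPb w hw
  refine ⟨fun w => χ w * (P w * (Ψ w)⁻¹), _, hmul', ?_, ?_, fun i hi => ?_, fun t =>
    ⟨(hside _ (left_mem_closedUnitStrip t) _ (h₀ t) (hΨ₀ t)).trans hfin,
     (hside _ (right_mem_closedUnitStrip t) _ (h₁ t) (hΨ₁ t)).trans hfin⟩⟩
  · have h := (tendsto_left_of_norm_le_div (hcutd hn)).norm.mul_const (n * C₂ * C₃ * B * A⁻¹)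
    rw [norm_zero, zero_mul] at h
    refine squeeze_zero_norm (fun t => ?_) h
    rw [norm_mul]
    exact mul_le_mul_of_nonneg_left (hmul.2 _ (left_mem_closedUnitStrip t)) (norm_nonneg _)
  · have h := (tendsto_right_of_norm_le_div (hcutd hn)).norm.mul_const (n * C₂ * C₃ * B * A⁻¹)
    rw [norm_zero, zero_mul] at h
    refine squeeze_zero_norm (fun t => ?_) h
    rw [norm_mul]
    exact mul_le_mul_of_nonneg_left (hmul.2 _ (right_mem_closedUnitStrip t)) (norm_nonneg _)
  · have hPa : AnalyticAt ℂ P z := (diffContOnCl_of_differentiableAt hPd).analyticAt_unitStrip z.2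
    have hΨa : AnalyticAt ℂ Ψ z := (diffContOnCl_of_differentiableAt hΨd).analyticAt_unitStrip z.2
    have hIa : AnalyticAt ℂ (fun w => (Ψ w)⁻¹) z := hΨa.inv (hΨ0 _ hz)
    have hPt : ∀ k < n, taylorCoeff k P z = taylorCoeff k Ψ z := by
      intro k hk
      have ha : ∀ j, AnalyticAt ℂ (stripMonomial n (z : ℂ) j) z := fun j =>
        (diffContOnCl_of_differentiableAt fun w hw =>
          differentiableAt_stripMonomial n z j hw).analyticAt_unitStrip z.2
      have hs : taylorCoeff k P z = ∑ j ∈ Finset.range n,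
          taylorCoeff k (fun w => taylorCoeff j Ψ z * stripMonomial n z j w) (z : ℂ) :=
        taylorCoeff_sum _ (fun j _ => analyticAt_const.mul (ha j)) k
      have : ∀ j, taylorCoeff k (fun w => taylorCoeff j Ψ z * stripMonomial n z j w) (z : ℂ) =
          taylorCoeff j Ψ z * if k = j then 1 else 0 := fun j => by
        have := taylorCoeff_const_smul (ha j) (taylorCoeff j Ψ z) k
        rw [taylorCoeff_stripMonomial z.2 j hk] at this
        exact this
      rw [hs]
      simp [this, hk]
    obtain ⟨κ, hκ, hκ'⟩ := exists_stripCut_pow_eq n (2 * n) z.2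
    have e1 := taylorCoeff_smul_eq_of_eq_one_add hκ hκ' (hPa.mul hIa) hi
    refine e1.trans ?_
    have e2 := taylorCoeff_smul hPa hIa i
    have e3 := taylorCoeff_smul hΨa hIa i
    refine e2.trans (Eq.trans ?_ (e3.symm.trans (taylorCoeff_congr ?_ i)))
    · refine Finset.sum_congr rfl fun j hj => ?_
      rw [hPt j (lt_of_lt_of_le (Finset.mem_range.1 hj) hi)]
    · filter_upwards [isOpen_unitStrip.mem_nhds z.2] with w hw
      exact mul_inv_cancel₀ (hΨ0 w (unitStrip_subset hw))

/-- The constant in the estimate of the norm of a jet by weighted integrals. -/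
def jetConst {n : ℕ} (hn : 1 ≤ n) (z : unitStrip) : ℝ := (exists_jet_multiplier hn z).choose

theorem jetConst_pos {n : ℕ} (hn : 1 ≤ n) (z : unitStrip) : 0 < jetConst hn z :=
  (exists_jet_multiplier hn z).choose_spec.1

namespace BanachCouple

variable {X₀ X₁ E : Type*}
  [NormedAddCommGroup X₀] [NormedSpace ℂ X₀] [NormedAddCommGroup X₁] [NormedSpace ℂ X₁]
  [NormedAddCommGroup E] [NormedSpace ℂ E] [CompleteSpace E]
  {c : BanachCouple X₀ X₁ E}

/-- Multiplication of `f` by the multiplier built from its own boundary norms keeps the jet and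
lands in `calderonZero`; so the same bound holds for the quotients of `𝒞` and of `𝒞₀`. -/
theorem norm_mk_le_integral_of_pos {n : ℕ} (hn : 1 ≤ n) (z : unitStrip) {ℱ : Submodule ℂ c.Calderon}
    (hℱ : c.calderonZero ≤ ℱ) (f : ℱ) (a : ℝ) {η : ℝ} (hη : 0 < η) :
    ‖Rochberg.mk ℱ n z f‖ ≤ jetConst hn z * (Real.exp (|a| * stripRadius z) *
      (η + Real.exp (-(a * (z : ℂ).re)) * (∫ t, stripWeight n t * ‖f.1.bdry₀ t‖) +
        Real.exp (a * (1 - (z : ℂ).re)) * ∫ t, stripWeight n t * ‖f.1.bdry₁ t‖)) := by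
  obtain ⟨φ, A, hφ, h0, h1, ht, hb⟩ := (exists_jet_multiplier hn z).choose_spec.2 a
    (fun t => ‖f.1.bdry₀ t‖) (fun t => ‖f.1.bdry₁ t‖) f.1.bdry₀.continuous.norm
    f.1.bdry₁.continuous.norm (fun t => norm_nonneg _) (fun t => norm_nonneg _) ‖f.1‖
    f.1.norm_bdry₀_le f.1.norm_bdry₁_le η hη
  have hmem := hℱ (Calderon.mul_mem_calderonZero_of_tendsto hφ h0 h1 f.1)
  have h1m : IsStripMultiplier 1 fun _ => (1 : ℂ) :=
    ⟨diffContOnCl_const, fun w _ => by simp⟩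
  have e : Rochberg.mk ℱ n z f = Rochberg.mk ℱ n z ⟨_, hmem⟩ := by
    refine Rochberg.coord_injective ?_
    rw [Rochberg.coord_mk, Rochberg.coord_mk]
    refine Eq.trans ?_ (Calderon.taylor_mul_congr hφ h1m f.1 ht).symm
    congr 1
    ext w _
    rw [Calderon.toFun_mul, one_smul]
  rw [e]
  refine (Rochberg.norm_mk_le _).trans (Calderon.norm_le ((mul_nonneg (norm_nonneg _)
    (norm_nonneg _)).trans (hb 0).1) (fun t => ?_) (fun t => ?_))
  · refine le_trans (le_of_eq ?_) (hb t).1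
    exact norm_smul _ _
  · refine le_trans (le_of_eq ?_) (hb t).2
    exact norm_smul _ _

/-- The norm of a jet is controlled by weighted integrals over the boundary. -/
theorem norm_mk_le_integral {n : ℕ} (hn : 1 ≤ n) (z : unitStrip) {ℱ : Submodule ℂ c.Calderon}
    (hℱ : c.calderonZero ≤ ℱ) (f : ℱ) (a : ℝ) :
    ‖Rochberg.mk ℱ n z f‖ ≤ jetConst hn z * (Real.exp (|a| * stripRadius z) *
      (Real.exp (-(a * (z : ℂ).re)) * (∫ t, stripWeight n t * ‖f.1.bdry₀ t‖) +
        Real.exp (a * (1 - (z : ℂ).re)) * ∫ t, stripWeight n t * ‖f.1.bdry₁ t‖)) := by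
  have ht : Tendsto (fun η : ℝ => jetConst hn z * (Real.exp (|a| * stripRadius z) *
      (η + Real.exp (-(a * (z : ℂ).re)) * (∫ t, stripWeight n t * ‖f.1.bdry₀ t‖) +
        Real.exp (a * (1 - (z : ℂ).re)) * ∫ t, stripWeight n t * ‖f.1.bdry₁ t‖)))
      (𝓝[>] 0) (𝓝 (jetConst hn z * (Real.exp (|a| * stripRadius z) *
      (0 + Real.exp (-(a * (z : ℂ).re)) * (∫ t, stripWeight n t * ‖f.1.bdry₀ t‖) +
        Real.exp (a * (1 - (z : ℂ).re)) * ∫ t, stripWeight n t * ‖f.1.bdry₁ t‖)))) := by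
    refine Tendsto.mono_left (Continuous.tendsto ?_ 0) nhdsWithin_le_nhds
    fun_prop
  rw [zero_add] at ht
  refine ge_of_tendsto ht ?_
  filter_upwards [self_mem_nhdsWithin] with η hη using norm_mk_le_integral_of_pos hn z hℱ f a hη

theorem integral_stripWeight_mul_norm_le {X : Type*} [NormedAddCommGroup X] {n : ℕ} (hn : 1 ≤ n)
    (b : ℝ →ᵇ X) {M : ℝ} (hM : ∀ t, ‖b t‖ ≤ M) :
    ∫ t, stripWeight n t * ‖b t‖ ≤ (∫ t, stripWeight n t) * M := by
  rw [← integral_mul_const]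
  exact integral_mono (integrable_stripWeight_mul hn b.continuous.norm (fun t => norm_nonneg _) hM)
    ((integrable_stripWeight hn).mul_const M)
    fun t => mul_le_mul_of_nonneg_left (hM t) (stripWeight_pos n t).le

/-- With `r = stripRadius z`, both lines are at distance at least `2 r` from `z`. The disfavoured
line therefore gets the factor `exp (a r) exp (-2 a r) = exp (-a r)`, which tends to `0`. -/
theorem exists_jet_exp_le {n : ℕ} (hn : 1 ≤ n) (z : unitStrip) {ε : ℝ} (hε : 0 < ε) :
    ∃ a : ℝ, 0 ≤ a ∧ jetConst hn z * (∫ t, stripWeight n t) * (Real.exp (|a| * stripRadius z) *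
      Real.exp (-(a * (2 * stripRadius z)))) ≤ ε := by
  have h1 : Tendsto (fun a : ℝ => jetConst hn z * (∫ t, stripWeight n t) *
      Real.exp (-(a * stripRadius z))) atTop
      (𝓝 (jetConst hn z * (∫ t, stripWeight n t) * 0)) :=
    (Real.tendsto_exp_neg_atTop_nhds_zero.comp
      (tendsto_id.atTop_mul_const (stripRadius_pos z))).const_mul _
  rw [mul_zero] at h1
  obtain ⟨a, ha, ha'⟩ := ((h1.eventually_le_const hε).and (eventually_ge_atTop 0)).exists
  refine ⟨a, ha', le_trans (le_of_eq ?_) ha⟩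
  rw [← Real.exp_add, abs_of_nonneg ha']
  congr 2
  ring

theorem two_mul_stripRadius_le (z : unitStrip) :
    2 * stripRadius z ≤ (z : ℂ).re ∧ 2 * stripRadius z ≤ 1 - (z : ℂ).re := by
  have h1 := min_le_left (z : ℂ).re (1 - (z : ℂ).re)
  have h2 := min_le_right (z : ℂ).re (1 - (z : ℂ).re)
  unfold stripRadius
  constructor <;> linarith

/-- The norm of a jet is essentially controlled by a weighted integral over the left line. -/
theorem exists_norm_mk_le_left {n : ℕ} (hn : 1 ≤ n) (z : unitStrip) {ε : ℝ} (hε : 0 < ε) :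
    ∃ C : ℝ, 0 ≤ C ∧ ∀ {ℱ : Submodule ℂ c.Calderon}, c.calderonZero ≤ ℱ → ∀ f : ℱ,
      ‖Rochberg.mk ℱ n z f‖ ≤ ε * ‖f‖ + C * ∫ t, stripWeight n t * ‖f.1.bdry₀ t‖ := by
  obtain ⟨a, ha, h⟩ := exists_jet_exp_le hn z hε
  have hJ := jetConst_pos hn z
  refine ⟨jetConst hn z * (Real.exp (|-a| * stripRadius z) * Real.exp (-(-a * (z : ℂ).re))),
    by positivity, fun hℱ f => ?_⟩
  -- The sign of the parameter decides which line becomes negligible; `-a` discards the right one.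
  refine (norm_mk_le_integral hn z hℱ f (-a)).trans ?_
  have h1 := integral_stripWeight_mul_norm_le hn f.1.bdry₁ f.1.norm_bdry₁_le
  have h2 : Real.exp (-a * (1 - (z : ℂ).re)) ≤ Real.exp (-(a * (2 * stripRadius z))) := by
    rw [Real.exp_le_exp]
    nlinarith [(two_mul_stripRadius_le z).2]
  have hw : 0 ≤ ∫ t, stripWeight n t := integral_nonneg fun t => (stripWeight_pos n t).le
  have h3 : jetConst hn z * (Real.exp (|-a| * stripRadius z) * (Real.exp (-a * (1 - (z : ℂ).re)) *
      ∫ t, stripWeight n t * ‖f.1.bdry₁ t‖)) ≤ ε * ‖f‖ := by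
    have hf : ‖f‖ = ‖f.1‖ := rfl
    rw [hf]
    calc _ ≤ jetConst hn z * (Real.exp (|-a| * stripRadius z) *
          (Real.exp (-(a * (2 * stripRadius z))) * ((∫ t, stripWeight n t) * ‖f.1‖))) := by
          gcongr
          exact integral_nonneg fun t => mul_nonneg (stripWeight_pos n t).le (norm_nonneg _)
      _ = jetConst hn z * (∫ t, stripWeight n t) * (Real.exp (|a| * stripRadius z) *
          Real.exp (-(a * (2 * stripRadius z)))) * ‖f.1‖ := by rw [abs_neg]; ring
      _ ≤ _ := mul_le_mul_of_nonneg_right h (norm_nonneg _)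
  refine le_trans (le_of_eq ?_) (add_le_add_left h3 _)
  ring

/-- The norm of a jet is essentially controlled by a weighted integral over the right line. -/
theorem exists_norm_mk_le_right {n : ℕ} (hn : 1 ≤ n) (z : unitStrip) {ε : ℝ} (hε : 0 < ε) :
    ∃ C : ℝ, 0 ≤ C ∧ ∀ {ℱ : Submodule ℂ c.Calderon}, c.calderonZero ≤ ℱ → ∀ f : ℱ,
      ‖Rochberg.mk ℱ n z f‖ ≤ ε * ‖f‖ + C * ∫ t, stripWeight n t * ‖f.1.bdry₁ t‖ := by
  obtain ⟨a, ha, h⟩ := exists_jet_exp_le hn z hε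
  have hJ := jetConst_pos hn z
  refine ⟨jetConst hn z * (Real.exp (|a| * stripRadius z) * Real.exp (a * (1 - (z : ℂ).re))),
    by positivity, fun hℱ f => ?_⟩
  refine (norm_mk_le_integral hn z hℱ f a).trans ?_
  have h1 := integral_stripWeight_mul_norm_le hn f.1.bdry₀ f.1.norm_bdry₀_le
  have h2 : Real.exp (-(a * (z : ℂ).re)) ≤ Real.exp (-(a * (2 * stripRadius z))) := by
    rw [Real.exp_le_exp]
    nlinarith [(two_mul_stripRadius_le z).1]
  have hw : 0 ≤ ∫ t, stripWeight n t := integral_nonneg fun t => (stripWeight_pos n t).le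
  have h3 : jetConst hn z * (Real.exp (|a| * stripRadius z) * (Real.exp (-(a * (z : ℂ).re)) *
      ∫ t, stripWeight n t * ‖f.1.bdry₀ t‖)) ≤ ε * ‖f‖ := by
    have hf : ‖f‖ = ‖f.1‖ := rfl
    rw [hf]
    calc _ ≤ jetConst hn z * (Real.exp (|a| * stripRadius z) *
          (Real.exp (-(a * (2 * stripRadius z))) * ((∫ t, stripWeight n t) * ‖f.1‖))) := by
          gcongr
          exact integral_nonneg fun t => mul_nonneg (stripWeight_pos n t).le (norm_nonneg _)
      _ = jetConst hn z * (∫ t, stripWeight n t) * (Real.exp (|a| * stripRadius z) *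
          Real.exp (-(a * (2 * stripRadius z)))) * ‖f.1‖ := by ring
      _ ≤ _ := mul_le_mul_of_nonneg_right h (norm_nonneg _)
  refine le_trans (le_of_eq ?_) (add_le_add_left h3 _)
  ring

end BanachCouple

/-! ### Operators on `L¹` with densities. -/

section Representable

variable {μ : Measure ℝ} [IsFiniteMeasure μ]
  {Y : Type*} [NormedAddCommGroup Y] [NormedSpace ℂ Y] [CompleteSpace Y]

/-- A function with bounded averages is bounded. -/
theorem ae_norm_le_of_norm_setIntegral_le {f : ℝ → Y} (hf : Integrable f μ) {K : ℝ}
    (h : ∀ C, MeasurableSet C → ‖∫ t in C, f t ∂μ‖ ≤ K * μ.real C) : ∀ᵐ t ∂μ, ‖f t‖ ≤ K := by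
  filter_upwards [(Besicovitch.vitaliFamily μ).ae_tendsto_average hf.locallyIntegrable,
    (Besicovitch.vitaliFamily μ).ae_eventually_measure_pos] with t ht hp
  have h1 := (ht.comp (Besicovitch.tendsto_filterAt μ t)).norm
  refine le_of_tendsto h1 ?_
  filter_upwards [(Besicovitch.tendsto_filterAt μ t).eventually hp] with r hr
  have hr' : 0 < μ.real (Metric.closedBall t r) :=
    ENNReal.toReal_pos hr.ne' (measure_ne_top _ _)
  rw [Function.comp_apply, setAverage_eq, norm_smul, norm_inv, Real.norm_of_nonneg hr'.le,
    inv_mul_le_iff₀ hr', mul_comm]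
  exact h _ Metric.isClosed_closedBall.measurableSet

theorem ae_norm_le_of_norm_setIntegral_le_of_subset {f : ℝ → Y} (hf : Integrable f μ) {K : ℝ}
    {A : Set ℝ} (hA : MeasurableSet A) (hK : 0 ≤ K)
    (h : ∀ C, MeasurableSet C → C ⊆ A → ‖∫ t in C, f t ∂μ‖ ≤ K * μ.real C) :
    ∀ᵐ t ∂μ, t ∈ A → ‖f t‖ ≤ K := by
  have := ae_norm_le_of_norm_setIntegral_le (hf.indicator hA) (K := K) fun C hC => by
    rw [setIntegral_indicator hA]
    refine (h _ (hC.inter hA) inter_subset_right).trans ?_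
    exact mul_le_mul_of_nonneg_left (measureReal_mono inter_subset_left) hK
  filter_upwards [this] with t ht hA
  rwa [indicator_of_mem hA] at ht

/-- The indicator function of a measurable set as an element of `L¹`. -/
def indicatorL1 (μ : Measure ℝ) [IsFiniteMeasure μ] {C : Set ℝ} (hC : MeasurableSet C) :
    Lp ℂ 1 μ := indicatorConstLp 1 hC (measure_ne_top μ C) 1

theorem norm_indicatorL1 {C : Set ℝ} (hC : MeasurableSet C) :
    ‖indicatorL1 μ hC‖ = μ.real C := by
  rw [indicatorL1, norm_indicatorConstLp one_ne_zero ENNReal.one_ne_top]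
  simp

theorem indicatorL1_union {A B : Set ℝ} (hA : MeasurableSet A) (hB : MeasurableSet B)
    (h : Disjoint A B) :
    indicatorL1 μ (hA.union hB) = indicatorL1 μ hA + indicatorL1 μ hB :=
  indicatorConstLp_disjoint_union hA hB (measure_ne_top _ _) (measure_ne_top _ _) h 1

theorem clm_ext_indicatorL1 {S T : Lp ℂ 1 μ →L[ℂ] Y}
    (h : ∀ C (hC : MeasurableSet C), S (indicatorL1 μ hC) = T (indicatorL1 μ hC)) : S = T := by
  ext u
  induction u using Lp.induction ENNReal.one_ne_top with
  | @indicatorConst a s hs hμs =>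
    have e : (Lp.simpleFunc.indicatorConst 1 hs hμs.ne a : Lp ℂ 1 μ) = a • indicatorL1 μ hs := by
      rw [Lp.simpleFunc.coe_indicatorConst, indicatorL1]
      ext1
      filter_upwards [Lp.coeFn_smul a (indicatorConstLp 1 hs (measure_ne_top μ _) (1 : ℂ)),
        indicatorConstLp_coeFn (p := 1) (hs := hs) (hμs := measure_ne_top μ _) (c := (1 : ℂ)),
        indicatorConstLp_coeFn (p := 1) (hs := hs) (hμs := hμs.ne) (c := a)] with t h1 h2 h3
      rw [h1, h3, Pi.smul_apply, h2]
      by_cases ht : t ∈ s <;> simp [ht]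
    rw [e, map_smul, map_smul, h]
  | add hf hg _ h1 h2 => rw [map_add, map_add, h1, h2]
  | isClosed => exact isClosed_eq S.continuous T.continuous

theorem integrable_smul_of_bounded {l : ℝ → Y} (hl : StronglyMeasurable l) {M : ℝ}
    (hM : ∀ t, ‖l t‖ ≤ M) (u : Lp ℂ 1 μ) : Integrable (fun t => u t • l t) μ := by
  refine ((L1.integrable_coeFn u).norm.mul_const M).mono'
    ((Lp.aestronglyMeasurable u).smul hl.aestronglyMeasurable) (ae_of_all _ fun t => ?_)
  rw [norm_smul]
  exact mul_le_mul_of_nonneg_left (hM t) (norm_nonneg _)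

/-- The operator on `L¹` with a given bounded density. -/
def densityCLM (μ : Measure ℝ) [IsFiniteMeasure μ] {l : ℝ → Y} (hl : StronglyMeasurable l) {M : ℝ}
    (hM : ∀ t, ‖l t‖ ≤ M) : Lp ℂ 1 μ →L[ℂ] Y :=
  LinearMap.mkContinuous
    { toFun := fun u => ∫ t, u t • l t ∂μ
      map_add' := fun u v => by
        rw [← integral_add (integrable_smul_of_bounded hl hM u) (integrable_smul_of_bounded hl hM v)]
        refine integral_congr_ae ?_
        filter_upwards [Lp.coeFn_add u v] with t ht
        rw [ht, Pi.add_apply, add_smul]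
      map_smul' := fun a u => by
        rw [RingHom.id_apply, ← integral_smul]
        refine integral_congr_ae ?_
        filter_upwards [Lp.coeFn_smul a u] with t ht
        rw [ht, Pi.smul_apply, smul_assoc] } M fun u => by
    rw [L1.norm_eq_integral_norm, mul_comm, ← integral_mul_const]
    refine norm_integral_le_of_norm_le ((L1.integrable_coeFn u).norm.mul_const M)
      (ae_of_all _ fun t => ?_)
    rw [norm_smul]
    exact mul_le_mul_of_nonneg_left (hM t) (norm_nonneg _)

theorem densityCLM_apply {l : ℝ → Y} (hl : StronglyMeasurable l) {M : ℝ}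
    (hM : ∀ t, ‖l t‖ ≤ M) (u : Lp ℂ 1 μ) : densityCLM μ hl hM u = ∫ t, u t • l t ∂μ := rfl

theorem integral_indicatorL1_smul {C : Set ℝ} (hC : MeasurableSet C) (l : ℝ → Y) :
    ∫ t, (indicatorL1 μ hC) t • l t ∂μ = ∫ t in C, l t ∂μ := by
  rw [← integral_indicator hC]
  refine integral_congr_ae ?_
  filter_upwards [indicatorConstLp_coeFn (p := 1) (hs := hC) (hμs := measure_ne_top μ C) (c := (1 : ℂ))]
    with t ht
  rw [indicatorL1, ht]
  by_cases h : t ∈ C <;> simp [h]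

theorem norm_apply_indicatorL1_le (S : Lp ℂ 1 μ →L[ℂ] Y) {C : Set ℝ} (hC : MeasurableSet C) :
    ‖S (indicatorL1 μ hC)‖ ≤ ‖S‖ * μ.real C := by
  rw [← norm_indicatorL1 (μ := μ) hC]
  exact S.le_opNorm _

/-- An operator on `L¹` is given by a bounded density as soon as it is given by an integrable
density on indicator functions. -/
theorem exists_density_of_setIntegral_eq (S : Lp ℂ 1 μ →L[ℂ] Y) {l : ℝ → Y} (hl : Integrable l μ)
    (h : ∀ C (hC : MeasurableSet C), S (indicatorL1 μ hC) = ∫ t in C, l t ∂μ) :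
    ∃ l' : ℝ → Y, StronglyMeasurable l' ∧ (∀ t, ‖l' t‖ ≤ ‖S‖) ∧
      ∀ u : Lp ℂ 1 μ, S u = ∫ t, u t • l' t ∂μ := by
  have hb : ∀ᵐ t ∂μ, ‖l t‖ ≤ ‖S‖ := ae_norm_le_of_norm_setIntegral_le hl fun C hC => by
    rw [← h C hC]
    exact norm_apply_indicatorL1_le S hC
  set l₁ := hl.1.mk l with hl₁
  have hm : StronglyMeasurable l₁ := hl.1.stronglyMeasurable_mk
  have hset : MeasurableSet {t | ‖l₁ t‖ ≤ ‖S‖} := hm.norm.measurable measurableSet_Iic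
  -- Truncation changes the density only on a null set and makes the bound by `‖S‖` hold everywhere.
  refine ⟨{t | ‖l₁ t‖ ≤ ‖S‖}.indicator l₁, hm.indicator hset, fun t => ?_, ?_⟩
  · by_cases ht : t ∈ {t | ‖l₁ t‖ ≤ ‖S‖}
    · rw [indicator_of_mem ht]; exact ht
    · rw [indicator_of_notMem ht, norm_zero]; exact norm_nonneg _
  have hbd : ∀ t, ‖{t | ‖l₁ t‖ ≤ ‖S‖}.indicator l₁ t‖ ≤ ‖S‖ := fun t => by
    by_cases ht : t ∈ {t | ‖l₁ t‖ ≤ ‖S‖}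
    · rw [indicator_of_mem ht]; exact ht
    · rw [indicator_of_notMem ht, norm_zero]; exact norm_nonneg _
  have e : S = densityCLM μ (hm.indicator hset) hbd := by
    refine clm_ext_indicatorL1 fun C hC => ?_
    rw [densityCLM_apply, integral_indicatorL1_smul, h C hC]
    refine setIntegral_congr_ae hC ?_
    filter_upwards [hb, hl.1.ae_eq_mk] with t ht ht' _
    have ht' : l t = l₁ t := ht'
    rw [indicator_of_mem (show t ∈ {t | ‖l₁ t‖ ≤ ‖S‖} from show ‖l₁ t‖ ≤ ‖S‖ from ht' ▸ ht)]
    exact ht'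
  intro u
  conv_lhs => rw [e]
  rfl

/-- The dual of `L¹` is `L^∞`. -/
theorem exists_density_scalar (S : Lp ℂ 1 μ →L[ℂ] ℂ) :
    ∃ l : ℝ → ℂ, StronglyMeasurable l ∧ (∀ t, ‖l t‖ ≤ ‖S‖) ∧
      ∀ u : Lp ℂ 1 μ, S u = ∫ t, u t • l t ∂μ := by
  have h21 : (1 : ENNReal) ≤ 2 := by norm_num
  -- For a finite measure `L²` maps boundedly into `L¹`, so `S` becomes a functional on a Hilbert
  -- space and Riesz's theorem supplies an integrable density.
  let J : Lp ℂ 2 μ →ₗ[ℂ] Lp ℂ 1 μ :=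
    { toFun := fun f => ((Lp.memLp f).mono_exponent h21).toLp f
      map_add' := fun f g => by
        rw [← MemLp.toLp_add]
        exact MemLp.toLp_congr _ _ (Lp.coeFn_add f g)
      map_smul' := fun a f => by
        rw [RingHom.id_apply, ← MemLp.toLp_const_smul]
        exact MemLp.toLp_congr _ _ (Lp.coeFn_smul a f) }
  obtain ⟨D, hD⟩ : ∃ D : ℝ, ∀ f, ‖J f‖ ≤ D * ‖f‖ := by
    refine ⟨(μ univ ^ ((1 : ℝ) / 1 - 1 / 2)).toReal, fun f => ?_⟩
    have h1 := eLpNorm_le_eLpNorm_mul_rpow_measure_univ h21 (Lp.aestronglyMeasurable f)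
    have h2 : ‖J f‖ = (eLpNorm f 1 μ).toReal :=
      Lp.norm_toLp _ ((Lp.memLp f).mono_exponent h21)
    rw [h2, Lp.norm_def, mul_comm, ← ENNReal.toReal_mul]
    refine ENNReal.toReal_mono (ENNReal.mul_ne_top (Lp.memLp f).2.ne ?_) (by simpa using h1)
    exact (ENNReal.rpow_lt_top_of_nonneg (by norm_num) (measure_ne_top _ _)).ne
  let T : StrongDual ℂ (Lp ℂ 2 μ) := (S.toLinearMap.comp J).mkContinuous (‖S‖ * D) fun f =>
    (S.le_opNorm _).trans (by
      rw [mul_assoc]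
      exact mul_le_mul_of_nonneg_left (hD f) (norm_nonneg _))
  set g := (InnerProductSpace.toDual ℂ (Lp ℂ 2 μ)).symm T with hg
  have hgi : Integrable g μ := memLp_one_iff_integrable.1 ((Lp.memLp g).mono_exponent h21)
  -- The inner product is conjugate linear in its first argument; hence the conjugate of `g`.
  refine exists_density_of_setIntegral_eq S (l := fun t => star (g t)) ?_ fun C hC => ?_
  · exact (Complex.conjCLE : ℂ →L[ℝ] ℂ).integrable_comp hgi
  have h1 : T (indicatorConstLp 2 hC (measure_ne_top μ C) 1) = S (indicatorL1 μ hC) := by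
    change S (J _) = _
    congr 1
    ext1
    filter_upwards [MemLp.coeFn_toLp ((Lp.memLp (indicatorConstLp 2 hC (measure_ne_top μ C)
        (1 : ℂ))).mono_exponent h21),
      indicatorConstLp_coeFn (p := 2) (hs := hC) (hμs := measure_ne_top μ C) (c := (1 : ℂ)),
      indicatorConstLp_coeFn (p := 1) (hs := hC) (hμs := measure_ne_top μ C) (c := (1 : ℂ))]
      with t h1 h2 h3
    exact h1.trans (h2.trans h3.symm)
  rw [← h1, ← InnerProductSpace.toDual_symm_apply, ← hg, ← integral_indicator hC]
  rw [L2.inner_def]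
  refine integral_congr_ae ?_
  filter_upwards [indicatorConstLp_coeFn (p := 2) (hs := hC) (hμs := measure_ne_top μ C) (c := (1 : ℂ))]
    with t ht
  rw [ht]
  by_cases h : t ∈ C <;> simp [h]

end Representable

/-! ### From locally almost constant averages to a density. -/

section Exhaustion

variable {μ : Measure ℝ} [IsFiniteMeasure μ]
  {Y : Type*} [NormedAddCommGroup Y] [NormedSpace ℂ Y] [CompleteSpace Y]

/-- On `A` the operator `S` has a density up to `ε`. -/
def HasApproxDensity (S : Lp ℂ 1 μ →L[ℂ] Y) (ε : ℝ) (A : Set ℝ) : Prop :=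
  MeasurableSet A ∧ ∃ l : ℝ → Y, StronglyMeasurable l ∧ (∀ t, ‖l t‖ ≤ ‖S‖ + ε) ∧
    ∀ C (hC : MeasurableSet C), C ⊆ A → ‖S (indicatorL1 μ hC) - ∫ t in C, l t ∂μ‖ ≤ ε * μ.real C

theorem integrable_of_stronglyMeasurable_of_norm_le {l : ℝ → Y} (hl : StronglyMeasurable l) {M : ℝ}
    (hM : ∀ t, ‖l t‖ ≤ M) : Integrable l μ :=
  (integrable_const M).mono' hl.aestronglyMeasurable (ae_of_all _ hM)

theorem HasApproxDensity.union {S : Lp ℂ 1 μ →L[ℂ] Y} {ε : ℝ} {A B : Set ℝ}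
    (hA : HasApproxDensity S ε A) (hB : HasApproxDensity S ε B) :
    HasApproxDensity S ε (A ∪ B) := by
  classical
  obtain ⟨hAm, l, l1, l2, l3⟩ := hA
  obtain ⟨hBm, k, k1, k2, k3⟩ := hB
  have hm : StronglyMeasurable (A.piecewise l k) := l1.piecewise hAm k1
  have hbd : ∀ t, ‖A.piecewise l k t‖ ≤ ‖S‖ + ε := fun t => by
    by_cases ht : t ∈ A
    · rw [piecewise_eq_of_mem _ _ _ ht]; exact l2 t
    · rw [piecewise_eq_of_notMem _ _ _ ht]; exact k2 t
  refine ⟨hAm.union hBm, A.piecewise l k, hm, hbd, fun C hC hCA => ?_⟩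
  have hi := integrable_of_stronglyMeasurable_of_norm_le (μ := μ) hm hbd
  have hdis : Disjoint (C ∩ A) (C \ A) := disjoint_sdiff_right.mono_left inter_subset_right
  have e1 : indicatorL1 μ hC = indicatorL1 μ (hC.inter hAm) + indicatorL1 μ (hC.diff hAm) := by
    rw [← indicatorL1_union _ _ hdis]
    simp only [inter_union_sdiff]
  have e2 : ∫ t in C, A.piecewise l k t ∂μ = (∫ t in C ∩ A, l t ∂μ) + ∫ t in C \ A, k t ∂μ := by
    rw [← integral_inter_add_sdiff hAm hi.integrableOn]
    congr 1
    · exact setIntegral_congr_fun (hC.inter hAm) fun t ht => piecewise_eq_of_mem _ _ _ ht.2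
    · exact setIntegral_congr_fun (hC.diff hAm) fun t ht => piecewise_eq_of_notMem _ _ _ ht.2
  have e3 : μ.real C = μ.real (C ∩ A) + μ.real (C \ A) :=
    (measureReal_inter_add_sdiff hAm).symm
  rw [e1, e2, e3, map_add, add_sub_add_comm, mul_add]
  refine (norm_add_le _ _).trans (add_le_add (l3 _ _ inter_subset_right) (k3 _ _ ?_))
  exact fun t ht => (hCA ht.1).resolve_left ht.2

theorem hasApproxDensity_empty (S : Lp ℂ 1 μ →L[ℂ] Y) {ε : ℝ} (hε : 0 ≤ ε) :
    HasApproxDensity S ε ∅ :=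
  ⟨MeasurableSet.empty, fun _ => 0, stronglyMeasurable_const,
    fun t => by rw [norm_zero]; positivity, fun C hC hCA => by
      have h := norm_apply_indicatorL1_le S hC
      rw [subset_empty_iff] at hCA
      subst hCA
      simpa using h⟩

/-- The constant density `y` works; testing with `C = B` itself, which has positive measure, bounds
its norm by `‖S‖ + ε`. -/
theorem hasApproxDensity_of_average {S : Lp ℂ 1 μ →L[ℂ] Y} {ε : ℝ} {B : Set ℝ}
    (hB : MeasurableSet B) (hμB : 0 < μ B) {y : Y} (h : ∀ C (hC : MeasurableSet C), C ⊆ B →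
      ‖S (indicatorL1 μ hC) - (μ.real C : ℂ) • y‖ ≤ ε * μ.real C) : HasApproxDensity S ε B := by
  have hpos : 0 < μ.real B := ENNReal.toReal_pos hμB.ne' (measure_ne_top _ _)
  refine ⟨hB, fun _ => y, stronglyMeasurable_const, fun _ => ?_, fun C hC hCB => ?_⟩
  · have h1 := h B hB Subset.rfl
    have h2 := norm_apply_indicatorL1_le S hB
    have h3 := norm_sub_norm_le ((μ.real B : ℂ) • y) (S (indicatorL1 μ hB))
    rw [norm_smul, norm_real, Real.norm_of_nonneg hpos.le, norm_sub_rev] at h3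
    nlinarith
  · rw [setIntegral_const, ← Complex.coe_smul]
    exact h C hC hCB

/-- Exhaustion: finite unions of good sets are good. A sequence of good sets with measures tending
to the supremum covers almost everything, since otherwise a good set of positive measure in the
complement could be added to one of them and exceed the supremum. -/
theorem exists_hasApproxDensity {S : Lp ℂ 1 μ →L[ℂ] Y} {ε : ℝ} (hε : 0 ≤ ε)
    (hloc : ∀ A, MeasurableSet A → 0 < μ A → ∃ B ⊆ A, MeasurableSet B ∧ 0 < μ B ∧ ∃ y : Y,
      ∀ C (hC : MeasurableSet C), C ⊆ B →
        ‖S (indicatorL1 μ hC) - (μ.real C : ℂ) • y‖ ≤ ε * μ.real C) {η : ℝ} (hη : 0 < η) :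
    ∃ A, HasApproxDensity S ε A ∧ μ.real Aᶜ ≤ η := by
  set T : Set ℝ := {r | ∃ A, HasApproxDensity S ε A ∧ r = μ.real A} with hT
  have hTne : T.Nonempty := ⟨_, ∅, hasApproxDensity_empty S hε, rfl⟩
  have hTb : BddAbove T := ⟨μ.real univ, by
    rintro r ⟨A, _, rfl⟩
    exact measureReal_mono (subset_univ _)⟩
  have hex : ∀ k : ℕ, ∃ A, HasApproxDensity S ε A ∧ sSup T - 1 / (k + 1) < μ.real A := by
    intro k
    obtain ⟨r, ⟨A, hA, rfl⟩, hr⟩ := exists_lt_of_lt_csSup hTne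
      (show sSup T - 1 / (k + 1 : ℝ) < sSup T by
        have : (0 : ℝ) < 1 / (k + 1) := by positivity
        linarith)
    exact ⟨A, hA, hr⟩
  choose A hA hAs using hex
  have hU : μ (⋃ k, A k)ᶜ = 0 := by
    by_contra hne
    obtain ⟨B, hBU, hB, hμB, y, hy⟩ := hloc _ (MeasurableSet.iUnion fun k => (hA k).1).compl
      (pos_iff_ne_zero.2 hne)
    have hBg := hasApproxDensity_of_average hB hμB hy
    have hpos : 0 < μ.real B := ENNReal.toReal_pos hμB.ne' (measure_ne_top _ _)
    obtain ⟨k, hk⟩ := exists_nat_one_div_lt hpos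
    have hd : Disjoint (A k) B := by
      refine Disjoint.mono_left (subset_iUnion A k) ?_
      exact (disjoint_compl_left.mono_left hBU).symm
    have h1 : μ.real (A k ∪ B) ≤ sSup T := le_csSup hTb ⟨_, (hA k).union hBg, rfl⟩
    rw [measureReal_union hd hB] at h1
    linarith [hAs k]
  have hacc : ∀ N, HasApproxDensity S ε (accumulate A N) := by
    intro N
    induction N with
    | zero => simpa [accumulate] using hA 0
    | succ N ih =>
      rw [accumulate_succ]
      exact ih.union (hA _)
  have ht : Tendsto (fun N => μ.real (accumulate A N)) atTop (𝓝 (μ.real univ)) := by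
    have h1 := tendsto_measure_iUnion_accumulate (μ := μ) (f := A)
    have h2 : μ (⋃ k, A k) = μ univ :=
      measure_congr (eventuallyEq_univ.2 (mem_ae_iff.2 hU))
    rw [h2] at h1
    exact (ENNReal.tendsto_toReal (measure_ne_top _ _)).comp h1
  obtain ⟨N, hN⟩ := (ht.eventually (lt_mem_nhds (show μ.real univ - η < μ.real univ by linarith))).exists
  refine ⟨_, hacc N, ?_⟩
  rw [measureReal_compl (hacc N).1]
  linarith

/-- An operator on `L¹` whose averages are locally almost constant is given by a bounded density. -/
theorem exists_density_of_local_approx (S : Lp ℂ 1 μ →L[ℂ] Y)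
    (hloc : ∀ ε : ℝ, 0 < ε → ∀ A, MeasurableSet A → 0 < μ A →
      ∃ B ⊆ A, MeasurableSet B ∧ 0 < μ B ∧ ∃ y : Y, ∀ C (hC : MeasurableSet C), C ⊆ B →
        ‖S (indicatorL1 μ hC) - (μ.real C : ℂ) • y‖ ≤ ε * μ.real C) :
    ∃ l : ℝ → Y, StronglyMeasurable l ∧ (∀ t, ‖l t‖ ≤ ‖S‖) ∧
      ∀ u : Lp ℂ 1 μ, S u = ∫ t, u t • l t ∂μ := by
  have hε : ∀ k : ℕ, (0 : ℝ) < (1 / 2) ^ k := fun k => by positivity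
  have hε1 : ∀ k : ℕ, ((1 : ℝ) / 2) ^ k ≤ 1 := fun k => pow_le_one₀ (by norm_num) (by norm_num)
  -- The `k`th density has precision `(1 / 2) ^ k` off a set of measure at most `(1 / 2) ^ k`. These
  -- densities form a Cauchy sequence in `L¹`, and the limit represents `S` on indicator functions.
  choose A hA hAc using fun k : ℕ => exists_hasApproxDensity (hε k).le (hloc _ (hε k)) (hε k)
  choose hAm l hlm hlb hl using hA
  set m := μ.real univ with hm
  have hlb' : ∀ k t, ‖l k t‖ ≤ ‖S‖ + 1 := fun k t => (hlb k t).trans (by linarith [hε1 k])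
  have hli : ∀ k, Integrable (l k) μ := fun k =>
    integrable_of_stronglyMeasurable_of_norm_le (hlm k) (hlb k)
  have hcl : ∀ k C (hC : MeasurableSet C), ‖S (indicatorL1 μ hC) - ∫ t in C, l k t ∂μ‖ ≤
      (1 / 2) ^ k * (m + (2 * ‖S‖ + 1)) := by
    intro k C hC
    have hdis : Disjoint (C ∩ A k) (C \ A k) := disjoint_sdiff_right.mono_left inter_subset_right
    have e1 : indicatorL1 μ hC =
        indicatorL1 μ (hC.inter (hAm k)) + indicatorL1 μ (hC.diff (hAm k)) := by
      rw [← indicatorL1_union _ _ hdis]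
      simp only [inter_union_sdiff]
    rw [e1, ← integral_inter_add_sdiff (hAm k) (hli k).integrableOn, map_add, add_sub_add_comm]
    have h1 := hl k _ (hC.inter (hAm k)) inter_subset_right
    have h2 := norm_apply_indicatorL1_le S (hC.diff (hAm k))
    have h3 : ‖∫ t in C \ A k, l k t ∂μ‖ ≤ (‖S‖ + 1) * μ.real (C \ A k) :=
      norm_setIntegral_le_of_norm_le_const (measure_lt_top _ _) fun t _ => hlb' k t
    have h4 : μ.real (C \ A k) ≤ (1 / 2) ^ k :=
      (measureReal_mono (fun t ht => ht.2)).trans (hAc k)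
    have h5 : μ.real (C ∩ A k) ≤ m := measureReal_mono (subset_univ _)
    have h6 := norm_nonneg S
    have h7 := hε k
    calc _ ≤ (1 / 2) ^ k * m + (‖S‖ * (1 / 2) ^ k + (‖S‖ + 1) * (1 / 2) ^ k) := by
          refine (norm_add_le _ _).trans (add_le_add (h1.trans ?_)
            ((norm_sub_le _ _).trans (add_le_add (h2.trans ?_) (h3.trans ?_)))) <;> gcongr
      _ = _ := by ring
  -- On `A j ∩ A k` both densities represent `S` approximately, so all integrals of their difference
  -- are small; differentiation makes this a pointwise bound.
  have hae : ∀ j k, ∀ᵐ t ∂μ, t ∈ A j ∩ A k → ‖l j t - l k t‖ ≤ (1 / 2) ^ j + (1 / 2) ^ k := by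
    intro j k
    refine ae_norm_le_of_norm_setIntegral_le_of_subset ((hli j).sub (hli k))
      ((hAm j).inter (hAm k)) (add_pos (hε j) (hε k)).le fun C hC hCA => ?_
    have e : ∫ t in C, (l j - l k) t ∂μ = (S (indicatorL1 μ hC) - ∫ t in C, l k t ∂μ) -
        (S (indicatorL1 μ hC) - ∫ t in C, l j t ∂μ) := by
      rw [sub_sub_sub_cancel_left]
      exact integral_sub (hli j).integrableOn (hli k).integrableOn
    rw [e, add_mul, add_comm]
    exact (norm_sub_le _ _).trans (add_le_add (hl k C hC fun t ht => (hCA ht).2)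
      (hl j C hC fun t ht => (hCA ht).1))
  have hd : ∀ j k, ∫ t, ‖l j t - l k t‖ ∂μ ≤
      ((1 / 2) ^ j + (1 / 2) ^ k) * (m + 2 * (‖S‖ + 1)) := by
    intro j k
    have hmm := (hAm j).inter (hAm k)
    have hi : Integrable (fun t => ‖l j t - l k t‖) μ := ((hli j).sub (hli k)).norm
    rw [← integral_add_compl hmm hi, mul_add]
    refine add_le_add ?_ ?_
    · have h1 : ∫ t in A j ∩ A k, ‖l j t - l k t‖ ∂μ ≤ ∫ t in A j ∩ A k, ((1 / 2) ^ j + (1 / 2) ^ k) ∂μ :=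
        setIntegral_mono_on_ae hi.integrableOn (integrable_const _).integrableOn hmm (hae j k)
      refine h1.trans ?_
      rw [setIntegral_const, smul_eq_mul, mul_comm]
      exact mul_le_mul_of_nonneg_left (measureReal_mono (subset_univ _))
        (add_pos (hε j) (hε k)).le
    · have h1 : ∫ t in (A j ∩ A k)ᶜ, ‖l j t - l k t‖ ∂μ ≤ ∫ t in (A j ∩ A k)ᶜ, 2 * (‖S‖ + 1) ∂μ :=
        setIntegral_mono hi.integrableOn (integrable_const _).integrableOn fun t =>
          (norm_sub_le _ _).trans (by linarith [hlb' j t, hlb' k t])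
      refine h1.trans ?_
      rw [setIntegral_const, smul_eq_mul]
      refine mul_le_mul_of_nonneg_right ?_ (by positivity)
      rw [compl_inter]
      exact (measureReal_union_le _ _).trans (add_le_add (hAc j) (hAc k))
  have hpow : Tendsto (fun k : ℕ => ((1 : ℝ) / 2) ^ k) atTop (𝓝 0) :=
    tendsto_pow_atTop_nhds_zero_of_lt_one (by norm_num) (by norm_num)
  have hC : CauchySeq fun k => (hli k).toL1 (l k) := by
    refine cauchySeq_of_le_tendsto_0 (fun N => 2 * (1 / 2) ^ N * (m + 2 * (‖S‖ + 1)))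
      (fun j k N hj hk => ?_) ?_
    · rw [dist_eq_norm, ← Integrable.toL1_sub, L1.norm_of_fun_eq_integral_norm]
      refine (hd j k).trans (mul_le_mul_of_nonneg_right ?_ (by positivity))
      have h1 := pow_le_pow_of_le_one (by norm_num) (by norm_num : (1 / 2 : ℝ) ≤ 1) hj
      have h2 := pow_le_pow_of_le_one (by norm_num) (by norm_num : (1 / 2 : ℝ) ≤ 1) hk
      linarith
    · simpa using (hpow.const_mul 2).mul_const (m + 2 * (‖S‖ + 1))
  obtain ⟨L, hL⟩ := cauchySeq_tendsto_of_complete hC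
  refine exists_density_of_setIntegral_eq S (L1.integrable_coeFn L) fun C hC => ?_
  have h1 : Tendsto (fun k => ∫ t in C, l k t ∂μ) atTop (𝓝 (∫ t in C, L t ∂μ)) := by
    have := ((continuous_setIntegral C).tendsto L).comp hL
    refine this.congr fun k => ?_
    exact setIntegral_congr_ae hC ((hli k).coeFn_toL1.mono fun t ht _ => ht)
  have h2 : Tendsto (fun k => ∫ t in C, l k t ∂μ) atTop (𝓝 (S (indicatorL1 μ hC))) := by
    rw [tendsto_iff_norm_sub_tendsto_zero]
    have h0 := hpow.mul_const (m + (2 * ‖S‖ + 1))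
    rw [zero_mul] at h0
    refine squeeze_zero (fun k => norm_nonneg _) (fun k => ?_) h0
    exact (norm_sub_rev _ _).trans_le (hcl k C hC)
  exact tendsto_nhds_unique h2 h1

end Exhaustion

/-! ### The Radon-Nikodym property of duals of Asplund spaces and of reflexive spaces. -/

section RadonNikodym

variable {μ : Measure ℝ} [IsFiniteMeasure μ]

theorem integrable_density {l : ℝ → ℂ} (hl : StronglyMeasurable l) {M : ℝ}
    (hM : ∀ t, ‖l t‖ ≤ M) : Integrable l μ := integrable_of_stronglyMeasurable_of_norm_le hl hM

/-- The set of points where a functional on `L¹` is large. -/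
theorem exists_subset_forall_le_re (f : Lp ℂ 1 μ →L[ℂ] ℂ) {C₀ : Set ℝ} (hC₀ : MeasurableSet C₀)
    {α : ℝ} (hα : α * μ.real C₀ < (f (indicatorL1 μ hC₀)).re) :
    ∃ B ⊆ C₀, MeasurableSet B ∧ 0 < μ B ∧ ∀ C (hC : MeasurableSet C), C ⊆ B →
      α * μ.real C ≤ (f (indicatorL1 μ hC)).re := by
  obtain ⟨g, hg, hgb, hgf⟩ := exists_density_scalar f
  have hgi : Integrable g μ := integrable_density hg hgb
  have hre : ∀ C (hC : MeasurableSet C), (f (indicatorL1 μ hC)).re = ∫ t in C, (g t).re ∂μ := by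
    intro C hC
    have h1 := integral_indicatorL1_smul (μ := μ) hC g
    rw [hgf, h1]
    exact (integral_re hgi.integrableOn).symm
  have hri : Integrable (fun t => (g t).re) μ := hgi.re
  have hm : MeasurableSet {t | α ≤ (g t).re} :=
    measurableSet_le measurable_const (measurable_re.comp hg.measurable)
  refine ⟨C₀ ∩ {t | α ≤ (g t).re}, inter_subset_left, hC₀.inter hm, ?_, fun C hC hCB => ?_⟩
  · by_contra hne
    have h0 : μ (C₀ ∩ {t | α ≤ (g t).re}) = 0 := le_antisymm (not_lt.1 hne) zero_le
    have h1 : ∫ t in C₀, (g t).re ∂μ ≤ ∫ t in C₀, α ∂μ := by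
      refine setIntegral_mono_on_ae hri.integrableOn (integrable_const _).integrableOn hC₀ ?_
      filter_upwards [measure_eq_zero_iff_ae_notMem.1 h0] with t ht htC
      by_contra hlt
      exact ht ⟨htC, (not_le.1 hlt).le⟩
    rw [← hre _ hC₀, setIntegral_const, smul_eq_mul, mul_comm] at h1
    linarith
  · rw [hre]
    have h1 : ∫ t in C, α ∂μ ≤ ∫ t in C, (g t).re ∂μ :=
      setIntegral_mono_on (integrable_const _).integrableOn hri.integrableOn hC
        fun t ht => (hCB ht).2
    rwa [setIntegral_const, smul_eq_mul, mul_comm] at h1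

theorem norm_le_of_forall_re_le {X : Type*} [NormedAddCommGroup X] [NormedSpace ℂ X]
    (f : StrongDual ℂ X) {K : ℝ} (hK : 0 ≤ K) (h : ∀ x, (f x).re ≤ K * ‖x‖) : ‖f‖ ≤ K := by
  refine f.opNorm_le_bound hK fun x => ?_
  by_cases h0 : f x = 0
  · rw [h0, norm_zero]; positivity
  have h1 := h ((star (f x) / ‖f x‖ : ℂ) • x)
  have hn : (‖f x‖ : ℂ) ≠ 0 := ofReal_ne_zero.2 (norm_ne_zero_iff.2 h0)
  have h2 : f ((star (f x) / ‖f x‖ : ℂ) • x) = (‖f x‖ : ℂ) := by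
    rw [map_smul, smul_eq_mul, div_mul_eq_mul_div, star_def, ← normSq_eq_conj_mul_self,
      normSq_eq_norm_sq]
    push_cast
    field_simp
  rw [h2, ofReal_re, norm_smul, norm_div, norm_star, norm_real, norm_norm,
    div_self (norm_ne_zero_iff.2 h0), one_mul] at h1
  exact h1

section Asplund

variable {X : Type*} [NormedAddCommGroup X] [NormedSpace ℂ X]

/-- Averages of an operator with values in the dual of an Asplund space are locally almost
constant. -/
theorem exists_local_approx_of_isAsplund (hX : IsAsplund X) (S : Lp ℂ 1 μ →L[ℂ] StrongDual ℂ X)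
    {ε : ℝ} (hε : 0 < ε) {A : Set ℝ} (hA : MeasurableSet A) (hμA : 0 < μ A) :
    ∃ B ⊆ A, MeasurableSet B ∧ 0 < μ B ∧ ∃ y : StrongDual ℂ X,
      ∀ C (hC : MeasurableSet C), C ⊆ B →
        ‖S (indicatorL1 μ hC) - (μ.real C : ℂ) • y‖ ≤ ε * μ.real C := by
  let ι := {C : Set ℝ // MeasurableSet C ∧ C ⊆ A ∧ 0 < μ C}
  have : Nonempty ι := ⟨⟨A, hA, Subset.rfl, hμA⟩⟩
  let a : ι → X → ℝ := fun C x => (μ.real C.1)⁻¹ * (S (indicatorL1 μ C.2.1) x).re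
  have hpos : ∀ C : ι, 0 < μ.real C.1 := fun C => ENNReal.toReal_pos C.2.2.2.ne' (measure_ne_top _ _)
  have hab : ∀ C x, a C x ≤ ‖S‖ * ‖x‖ := by
    intro C x
    rw [inv_mul_le_iff₀ (hpos C)]
    refine (re_le_norm _).trans ((ContinuousLinearMap.le_opNorm _ _).trans ?_)
    calc _ ≤ ‖S‖ * μ.real C.1 * ‖x‖ :=
          mul_le_mul_of_nonneg_right (norm_apply_indicatorL1_le S C.2.1) (norm_nonneg _)
      _ = _ := by ring
  have hadd : ∀ C x y, a C (x + y) = a C x + a C y := fun C x y => by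
    simp only [a, map_add, add_re, mul_add]
  have hsmul : ∀ C (r : ℝ) x, a C (r • x) = r * a C x := fun C r x => by
    simp only [a]
    rw [← Complex.coe_smul, map_smul, smul_eq_mul, re_ofReal_mul, mul_left_comm]
  -- `p` is the support function of the set of averages of `S` over subsets of `A`. Where `p` is
  -- Fréchet differentiable, slices of that set have small diameter.
  let p : X → ℝ := fun x => ⨆ C, a C x
  have hbdd : ∀ x, BddAbove (range fun C => a C x) := fun x => ⟨‖S‖ * ‖x‖, by
    rintro _ ⟨C, rfl⟩
    exact hab C x⟩
  have hle : ∀ C x, a C x ≤ p x := fun C x => le_ciSup (hbdd x) C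
  have hconv : ConvexOn ℝ univ p := by
    refine ⟨convex_univ, fun x _ y _ r s hr hs _ => ciSup_le fun C => ?_⟩
    rw [hadd, hsmul, hsmul, smul_eq_mul, smul_eq_mul]
    exact add_le_add (mul_le_mul_of_nonneg_left (hle C x) hr)
      (mul_le_mul_of_nonneg_left (hle C y) hs)
  have hlip : LipschitzWith ‖S‖₊ p := LipschitzWith.of_le_add_mul _ fun x y => ciSup_le fun C => by
    have h1 := hadd C y (x - y)
    rw [add_sub_cancel] at h1
    rw [h1, dist_eq_norm]
    exact add_le_add (hle C y) (hab C _)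
  obtain ⟨G, -, -, hG, hdiff⟩ := hX univ p isOpen_univ hconv hlip.continuous.continuousOn
  have hGne : G.Nonempty := by
    by_contra h
    rw [not_nonempty_iff_eq_empty] at h
    rw [h, closure_empty] at hG
    exact hG (mem_univ (0 : X))
  obtain ⟨x₀, hx₀⟩ := hGne
  have hd := (hdiff x₀ hx₀).hasFDerivAt
  set p' := fderiv ℝ p x₀
  have hε4 : 0 < ε / 4 := by positivity
  have hd' := hd.isLittleO.def hε4
  obtain ⟨δ', hδ', hball⟩ := Metric.eventually_nhds_iff.1 hd'
  set δ := δ' / 2 with hδd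
  have hδ : 0 < δ := half_pos hδ'
  -- Averages nearly attaining `p` at `x₀` are close to the derivative `p'`: for increments of norm
  -- `δ` the differentiability and the slice each cost `ε / 4`, and homogeneity gives the rest.
  have hslice : ∀ C : ι, p x₀ - ε / 4 * δ ≤ a C x₀ → ∀ h : X, a C h - p' h ≤ ε / 2 * ‖h‖ := by
    intro C hC
    have hsmall : ∀ h : X, ‖h‖ = δ → a C h - p' h ≤ ε / 2 * ‖h‖ := by
      intro h hh
      have h1 : dist (x₀ + h) x₀ < δ' := by
        rw [dist_eq_norm, add_sub_cancel_left, hh]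
        exact half_lt_self hδ'
      have h2 := hball h1
      rw [add_sub_cancel_left, Real.norm_eq_abs, hh] at h2
      have h3 := hle C (x₀ + h)
      rw [hadd] at h3
      have h4 := (abs_le.1 h2).2
      rw [hh]
      linarith
    intro h
    by_cases h0 : h = 0
    · subst h0
      simp [a]
    · have hn : 0 < ‖h‖ := norm_pos_iff.2 h0
      have h1 := hsmall ((δ / ‖h‖) • h) (by
        rw [norm_smul, Real.norm_of_nonneg (by positivity), div_mul_cancel₀ _ hn.ne'])
      rw [hsmul, map_smul, smul_eq_mul, norm_smul, Real.norm_of_nonneg (by positivity),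
        ← mul_sub, mul_left_comm] at h1
      exact le_of_mul_le_mul_left h1 (by positivity)
  obtain ⟨C₀, hC₀⟩ := exists_lt_of_lt_ciSup (show p x₀ - ε / 4 * δ < ⨆ C, a C x₀ from by
    have : 0 < ε / 4 * δ := by positivity
    change _ < p x₀
    linarith)
  let ev : Lp ℂ 1 μ →L[ℂ] ℂ := (ContinuousLinearMap.apply ℂ ℂ x₀).comp S
  -- Only `C₀` is known to be in the slice. The scalar density of `S` at `x₀` yields a part `B` of
  -- `C₀` all of whose subsets of positive measure have averages in the slice.
  obtain ⟨B, hBC, hB, hμB, hBs⟩ := exists_subset_forall_le_re ev C₀.2.1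
    (α := p x₀ - ε / 4 * δ) (by
      have := mul_lt_mul_of_pos_left hC₀ (hpos C₀)
      rw [mul_inv_cancel_left₀ (hpos C₀).ne', mul_comm] at this
      exact this)
  refine ⟨B, hBC.trans C₀.2.2.1, hB, hμB, ((μ.real C₀.1)⁻¹ : ℂ) • S (indicatorL1 μ C₀.2.1),
    fun C hC hCB => ?_⟩
  by_cases hμC : μ C = 0
  · have h0 : μ.real C = 0 := by simp [Measure.real, hμC]
    have := norm_apply_indicatorL1_le S hC
    rw [h0, mul_zero, norm_le_zero_iff] at this
    rw [h0, this, ofReal_zero, mul_zero]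
    refine le_of_eq (norm_eq_zero.2 ?_)
    ext x
    simp
  let C' : ι := ⟨C, hC, (hCB.trans hBC).trans C₀.2.2.1, pos_iff_ne_zero.2 hμC⟩
  have hs' : p x₀ - ε / 4 * δ ≤ a C' x₀ := by
    have := hBs C hC hCB
    rw [mul_comm, ← le_inv_mul_iff₀ (hpos C')] at this
    exact this
  have k1 := hslice C' hs'
  have k2 := hslice C₀ hC₀.le
  have k3 : ∀ h, a C' h - a C₀ h ≤ ε * ‖h‖ := by
    intro h
    have e1 := k1 h
    have e2 := k2 (-h)
    have e3 : a C₀ (-h) = -a C₀ h := by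
      have := hsmul C₀ (-1) h
      rwa [neg_one_smul, neg_one_mul] at this
    rw [e3, map_neg, norm_neg] at e2
    linarith
  refine norm_le_of_forall_re_le _ (by positivity) fun h => ?_
  have k4 := mul_le_mul_of_nonneg_left (k3 h) (hpos C').le
  have e4 : ((S (indicatorL1 μ hC) - (μ.real C : ℂ) • (((μ.real C₀.1)⁻¹ : ℂ) •
      S (indicatorL1 μ C₀.2.1))) h).re = μ.real C'.1 * (a C' h - a C₀ h) := by
    rw [mul_sub, show μ.real C'.1 * a C' h = (S (indicatorL1 μ hC) h).re from
      mul_inv_cancel_left₀ (hpos C').ne' _]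
    simp only [_root_.sub_apply, _root_.smul_apply, smul_eq_mul, sub_re,
      re_ofReal_mul, a]
    rw [← ofReal_inv, re_ofReal_mul]
  rw [e4]
  refine k4.trans (le_of_eq ?_)
  ring

end Asplund

section Reflexive

variable {Y : Type*} [NormedAddCommGroup Y] [NormedSpace ℂ Y]

/-- Bounded families in a reflexive space converge weakly along ultrafilters. -/
theorem IsReflexiveSpace.exists_tendsto (hY : IsReflexiveSpace Y) {ι : Type*} (U : Ultrafilter ι)
    {y : ι → Y} {M : ℝ} (hy : ∀ i, ‖y i‖ ≤ M) :
    ∃ y₀ : Y, ∀ φ : StrongDual ℂ Y, Tendsto (fun i => φ (y i)) U (𝓝 (φ y₀)) := by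
  let J : ι → WeakDual ℂ (StrongDual ℂ Y) := fun i =>
    StrongDual.toWeakDual (NormedSpace.inclusionInDoubleDual ℂ Y (y i))
  have hc := WeakDual.isCompact_closedBall (0 : StrongDual ℂ (StrongDual ℂ Y)) M
  obtain ⟨Φ, -, hΦ⟩ := hc.ultrafilter_le_nhds (U.map J) (by
    rw [le_principal_iff]
    refine Filter.mem_map.2 (univ_mem' fun i => ?_)
    refine (mem_closedBall_zero_iff (E := StrongDual ℂ (StrongDual ℂ Y))
      (a := NormedSpace.inclusionInDoubleDual ℂ Y (y i))).2 ?_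
    exact (NormedSpace.double_dual_bound ℂ Y (y i)).trans (hy i))
  obtain ⟨y₀, hy₀⟩ := hY (WeakDual.toStrongDual Φ)
  refine ⟨y₀, fun φ => ?_⟩
  have h1 : Tendsto (fun i => J i φ) U (𝓝 (Φ φ)) :=
    ((WeakDual.eval_continuous φ).tendsto Φ).comp hΦ
  have h2 : Φ φ = φ y₀ := (DFunLike.congr_fun hy₀ φ).symm
  rwa [h2] at h1

variable [CompleteSpace Y]

/-- Lebesgue differentiation of the scalar density of `φ ∘ S`, along balls of radius `1 / (k + 1)`.
-/
theorem ae_tendsto_average_apply (S : Lp ℂ 1 μ →L[ℂ] Y) (φ : StrongDual ℂ Y) {g : ℝ → ℂ}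
    (hg : Integrable g μ) (hgS : ∀ C (hC : MeasurableSet C), φ (S (indicatorL1 μ hC)) =
      ∫ t in C, g t ∂μ) :
    ∀ᵐ t ∂μ, Tendsto (fun k : ℕ => φ (((μ.real (Metric.closedBall t (1 / (k + 1))))⁻¹ : ℂ) •
      S (indicatorL1 μ (Metric.isClosed_closedBall (x := t) (ε := 1 / (k + 1))).measurableSet)))
      atTop (𝓝 (g t)) := by
  filter_upwards [(Besicovitch.vitaliFamily μ).ae_tendsto_average hg.locallyIntegrable] with t ht
  have h0 : Tendsto (fun k : ℕ => (1 : ℝ) / (k + 1)) atTop (𝓝[>] 0) :=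
    tendsto_nhdsWithin_iff.2 ⟨tendsto_one_div_add_atTop_nhds_zero_nat,
      Eventually.of_forall fun k => by rw [mem_Ioi]; positivity⟩
  refine (ht.comp ((Besicovitch.tendsto_filterAt μ t).comp h0)).congr fun k => ?_
  rw [Function.comp_apply, Function.comp_apply, setAverage_eq, map_smul, hgS, ← ofReal_inv,
    Complex.coe_smul]

/-- Averages of an operator with values in a reflexive space are locally almost constant. -/
theorem exists_local_approx_of_isReflexiveSpace (hY : IsReflexiveSpace Y) (S : Lp ℂ 1 μ →L[ℂ] Y)
    {ε : ℝ} (hε : 0 < ε) {A : Set ℝ} (hA : MeasurableSet A) (hμA : 0 < μ A) :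
    ∃ B ⊆ A, MeasurableSet B ∧ 0 < μ B ∧ ∃ y : Y,
      ∀ C (hC : MeasurableSet C), C ⊆ B →
        ‖S (indicatorL1 μ hC) - (μ.real C : ℂ) • y‖ ≤ ε * μ.real C := by
  have : Fact ((1 : ENNReal) ≠ ⊤) := ⟨ENNReal.one_ne_top⟩
  have hsep : TopologicalSpace.IsSeparable (range S) := TopologicalSpace.isSeparable_range S.continuous
  obtain ⟨D, hDc, hD⟩ := hsep
  have hDne : D.Nonempty := by
    by_contra h
    rw [not_nonempty_iff_eq_empty] at h
    rw [h, closure_empty] at hD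
    exact hD ⟨0, rfl⟩
  obtain ⟨d, rfl⟩ := hDc.exists_eq_range hDne
  have hcl : closure (range S) ⊆ closure (range d) := closure_minimal hD isClosed_closure
  -- The range of `S` is separable, so countably many functionals, norming the differences `d j - d
  -- i`, suffice to measure distances in it.
  choose φ hφ1 hφ using fun i j => exists_dual_vector'' ℂ (d j - d i)
  choose g hg hgb hgS using fun i j => exists_density_scalar ((φ i j).comp S)
  have hgi : ∀ i j, Integrable (g i j) μ := fun i j => integrable_density (hg i j) (hgb i j)
  have hgC : ∀ i j C (hC : MeasurableSet C), φ i j (S (indicatorL1 μ hC)) =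
      ∫ t in C, g i j t ∂μ := by
    intro i j C hC
    rw [← integral_indicatorL1_smul hC (g i j), ← hgS]
    rfl
  have hav : ∀ t : ℝ, ∀ k : ℕ, ‖((μ.real (Metric.closedBall t (1 / (k + 1))))⁻¹ : ℂ) •
      S (indicatorL1 μ (Metric.isClosed_closedBall (x := t) (ε := 1 / (k + 1))).measurableSet)‖ ≤
      ‖S‖ := by
    intro t k
    have h1 := norm_apply_indicatorL1_le S
      (Metric.isClosed_closedBall (x := t) (ε := 1 / ((k : ℝ) + 1))).measurableSet
    rw [norm_smul, norm_inv, norm_real, Real.norm_of_nonneg measureReal_nonneg]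
    rcases eq_or_lt_of_le (measureReal_nonneg (μ := μ) (s := Metric.closedBall t (1 / ((k : ℝ) + 1))))
      with h0 | h0
    · rw [← h0, inv_zero, zero_mul]
      exact norm_nonneg _
    · rw [inv_mul_le_iff₀ h0, mul_comm]
      exact h1
  -- A weak limit of the averages over shrinking balls plays the role of the value of the density at
  -- `t`. It stays in the closed range of `S` because closed convex sets are weakly closed.
  have hlim : ∀ t, ∃ y : Y, y ∈ closure (range S) ∧ ∀ i j,
      (Tendsto (fun k : ℕ => φ i j (((μ.real (Metric.closedBall t (1 / (k + 1))))⁻¹ : ℂ) •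
      S (indicatorL1 μ (Metric.isClosed_closedBall (x := t) (ε := 1 / (k + 1))).measurableSet)))
      atTop (𝓝 (g i j t)) → φ i j y = g i j t) := by
    intro t
    obtain ⟨y, hy⟩ := hY.exists_tendsto (hyperfilter ℕ) (hav t)
    refine ⟨y, ?_, fun i j h => ?_⟩
    · by_contra hne
      have hcv : Convex ℝ (S.range.restrictScalars ℝ : Set Y) := Submodule.convex _
      obtain ⟨f, u, hf1, hf2⟩ := RCLike.geometric_hahn_banach_closed_point (𝕜 := ℂ)
        (s := closure (range S)) hcv.closure isClosed_closure hne
      have h4 := (continuous_re.tendsto _).comp (hy f)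
      have h5 : (f y).re ≤ u := le_of_tendsto h4 (Eventually.of_forall fun k =>
        (hf1 _ (subset_closure ⟨_, map_smul S _ _⟩)).le)
      exact absurd hf2 (not_lt.2 h5)
    · exact tendsto_nhds_unique (hy (φ i j)) (h.mono_left (Nat.hyperfilter_le_atTop))
  choose y hycl hy using hlim
  -- The condition says, through countably many functionals, that the value at `t` is within `ε` of
  -- `d i`. It is measurable, and since `d` is dense the sets `B i` cover almost all of `A`.
  set B : ℕ → Set ℝ := fun i => A ∩ ⋂ j, {t | ‖g i j t - φ i j (d i)‖ ≤ ε} with hBdef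
  have hBm : ∀ i, MeasurableSet (B i) := fun i => hA.inter (MeasurableSet.iInter fun j =>
    measurableSet_le ((hg i j).sub stronglyMeasurable_const).norm.measurable measurable_const)
  have hcover : ∀ᵐ t ∂μ, t ∈ A → t ∈ ⋃ i, B i := by
    have h1 : ∀ᵐ t ∂μ, ∀ i j, φ i j (y t) = g i j t := by
      rw [ae_all_iff]; intro i
      rw [ae_all_iff]; intro j
      filter_upwards [ae_tendsto_average_apply S (φ i j) (hgi i j) (hgC i j)] with t ht
      exact hy t i j ht
    filter_upwards [h1] with t ht htA
    obtain ⟨_, ⟨i, rfl⟩, hi⟩ := Metric.mem_closure_iff.1 (hcl (hycl t)) ε hε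
    refine mem_iUnion.2 ⟨i, htA, mem_iInter.2 fun j => ?_⟩
    change ‖g i j t - φ i j (d i)‖ ≤ ε
    rw [← ht, ← map_sub]
    refine ((φ i j).le_of_opNorm_le (hφ1 i j) _).trans ?_
    rw [one_mul, ← dist_eq_norm]
    exact hi.le
  obtain ⟨i, hi⟩ : ∃ i, 0 < μ (B i) := by
    by_contra! hne
    have h0 : μ (⋃ i, B i) = 0 := measure_iUnion_null fun i => le_antisymm (hne i) zero_le
    have : μ A = 0 := by
      refine measure_mono_null_ae ?_ h0
      exact hcover
    exact hμA.ne' this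
  refine ⟨B i, inter_subset_left, hBm i, hi, d i, fun C hC hCB => ?_⟩
  by_cases hμC : μ C = 0
  · have h0 : μ.real C = 0 := by simp [Measure.real, hμC]
    have := norm_apply_indicatorL1_le S hC
    rw [h0, mul_zero, norm_le_zero_iff] at this
    rw [h0, this, ofReal_zero, zero_smul, sub_zero, norm_zero, mul_zero]
  have hpos : 0 < μ.real C := ENNReal.toReal_pos hμC (measure_ne_top _ _)
  set v : Y := ((μ.real C)⁻¹ : ℂ) • S (indicatorL1 μ hC) with hv
  have hvmem : v ∈ closure (range d) := hcl (subset_closure ⟨_, map_smul S _ _⟩)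
  have hφv : ∀ j, ‖φ i j (v - d i)‖ ≤ ε := by
    intro j
    have e : φ i j (v - d i) = ((μ.real C)⁻¹ : ℂ) * ∫ t in C, (g i j t - φ i j (d i)) ∂μ := by
      rw [integral_sub (hgi i j).integrableOn (integrable_const _).integrableOn, setIntegral_const,
        map_sub, hv, map_smul, hgC, smul_eq_mul, mul_sub, ← Complex.coe_smul, smul_eq_mul,
        ← mul_assoc, inv_mul_cancel₀ (ofReal_ne_zero.2 hpos.ne'), one_mul]
    have h1 : ‖∫ t in C, (g i j t - φ i j (d i)) ∂μ‖ ≤ ε * μ.real C :=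
      norm_setIntegral_le_of_norm_le_const (measure_lt_top _ _) fun t ht =>
        mem_iInter.1 (hCB ht).2 j
    rw [e, norm_mul, norm_inv, norm_real, Real.norm_of_nonneg hpos.le, inv_mul_le_iff₀ hpos, mul_comm]
    exact h1
  -- Some `d j` is within `η / 2` of the average `v`, and `φ i j` norms `d j - d i`, so the bounds
  -- tested by the functionals become a norm bound.
  have hvd : ‖v - d i‖ ≤ ε := by
    refine le_of_forall_pos_le_add fun η hη => ?_
    obtain ⟨_, ⟨j, rfl⟩, hj⟩ := Metric.mem_closure_iff.1 hvmem (η / 2) (half_pos hη)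
    rw [dist_eq_norm] at hj
    have h1 : ‖d j - d i‖ ≤ ‖φ i j (v - d i)‖ + ‖v - d j‖ := by
      have h2 : ((‖d j - d i‖ : ℝ) : ℂ) = φ i j (v - d i) - φ i j (v - d j) := by
        rw [← map_sub, sub_sub_sub_cancel_left]
        exact (hφ i j).symm
      have h3 := congrArg norm h2
      rw [norm_real, norm_norm] at h3
      rw [h3]
      refine (norm_sub_le _ _).trans (add_le_add le_rfl ?_)
      simpa using (φ i j).le_of_opNorm_le (hφ1 i j) (v - d j)
    have h4 : ‖v - d i‖ ≤ ‖v - d j‖ + ‖d j - d i‖ := by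
      have := norm_add_le (v - d j) (d j - d i)
      rwa [sub_add_sub_cancel] at this
    linarith [hφv j]
  have e : S (indicatorL1 μ hC) - (μ.real C : ℂ) • d i = (μ.real C : ℂ) • (v - d i) := by
    rw [smul_sub, hv, smul_smul, mul_inv_cancel₀ (ofReal_ne_zero.2 hpos.ne'), one_smul]
  rw [e, norm_smul, norm_real, Real.norm_of_nonneg hpos.le, mul_comm]
  exact mul_le_mul_of_nonneg_right hvd hpos.le

end Reflexive

end RadonNikodym

/-! ### Functionals on the Rochberg space as pairs of operators. -/

/-- The measure `(1 + t²)⁻ⁿ dt`. -/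
def stripMeasure (n : ℕ) : Measure ℝ :=
  volume.withDensity fun t => ((stripWeight n t).toNNReal : ENNReal)

theorem measurable_stripWeight_toNNReal (n : ℕ) : Measurable fun t => (stripWeight n t).toNNReal :=
  (continuous_stripWeight n).measurable.real_toNNReal

theorem integral_stripMeasure {V : Type*} [NormedAddCommGroup V] [NormedSpace ℝ V] (n : ℕ)
    (f : ℝ → V) : ∫ t, f t ∂(stripMeasure n) = ∫ t, stripWeight n t • f t := by
  rw [stripMeasure, integral_withDensity_eq_integral_smul (measurable_stripWeight_toNNReal n)]
  refine integral_congr_ae (ae_of_all _ fun t => ?_)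
  simp only [NNReal.smul_def, Real.coe_toNNReal _ (stripWeight_pos n t).le]

theorem isFiniteMeasure_stripMeasure {n : ℕ} (hn : 1 ≤ n) : IsFiniteMeasure (stripMeasure n) :=
  isFiniteMeasure_withDensity_ofReal (integrable_stripWeight hn).2

/-- The bound makes `l` well defined and continuous on the range of `J`; Hahn-Banach extends it
without increasing the norm. -/
theorem exists_clm_factor {V A : Type*} [AddCommGroup V] [Module ℂ V] [NormedAddCommGroup A]
    [NormedSpace ℂ A] (J : V →ₗ[ℂ] A) (l : V →ₗ[ℂ] ℂ) {C : ℝ} (hC : 0 ≤ C)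
    (h : ∀ v, ‖l v‖ ≤ C * ‖J v‖) : ∃ L : StrongDual ℂ A, (∀ v, L (J v) = l v) ∧ ‖L‖ ≤ C := by
  obtain ⟨g, hg, hgC⟩ := exists_clm_of_norm_le (e := J.rangeRestrict)
    J.surjective_rangeRestrict.denseRange (f := l) hC h
  obtain ⟨L, hL, hL'⟩ := exists_extension_norm_eq J.range g
  exact ⟨L, fun v => (hL (J.rangeRestrict v)).trans (hg v), hL'.trans_le hgC⟩

section Tensor

variable {μ : Measure ℝ} {X : Type*} [NormedAddCommGroup X] [NormedSpace ℂ X]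

/-- The map `u ↦ u x` from scalar to vector valued `L¹`. -/
def tensorL1 (μ : Measure ℝ) (x : X) (u : Lp ℂ 1 μ) : Lp X 1 μ :=
  ((ContinuousLinearMap.id ℂ ℂ).smulRight x).compLp u

theorem coeFn_tensorL1 (x : X) (u : Lp ℂ 1 μ) : tensorL1 μ x u =ᵐ[μ] fun t => u t • x :=
  ContinuousLinearMap.coeFn_compLp _ _

theorem norm_tensorL1_le (x : X) (u : Lp ℂ 1 μ) : ‖tensorL1 μ x u‖ ≤ ‖x‖ * ‖u‖ := by
  refine (ContinuousLinearMap.norm_compLp_le _ _).trans ?_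
  rw [ContinuousLinearMap.norm_smulRight_apply, ContinuousLinearMap.norm_id, one_mul]

/-- The operator `L¹ → X*` associated with a functional on vector valued `L¹`. -/
def dualOperator (L : StrongDual ℂ (Lp X 1 μ)) : Lp ℂ 1 μ →L[ℂ] StrongDual ℂ X :=
  LinearMap.mkContinuous₂ (LinearMap.mk₂ ℂ (fun u x => L (tensorL1 μ x u))
    (fun u v x => by
      rw [← map_add]; congr 1; ext1
      filter_upwards [coeFn_tensorL1 x (u + v), coeFn_tensorL1 x u, coeFn_tensorL1 x v,
        Lp.coeFn_add u v, Lp.coeFn_add (tensorL1 μ x u) (tensorL1 μ x v)] with t h1 h2 h3 h4 h5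
      rw [h1, h5, Pi.add_apply, h2, h3, h4, Pi.add_apply, add_smul])
    (fun a u x => by
      rw [← map_smul]; congr 1; ext1
      filter_upwards [coeFn_tensorL1 x (a • u), coeFn_tensorL1 x u,
        Lp.coeFn_smul a u, Lp.coeFn_smul a (tensorL1 μ x u)] with t h1 h2 h3 h4
      rw [h1, h4, Pi.smul_apply, h2, h3, Pi.smul_apply, smul_assoc])
    (fun u x y => by
      rw [← map_add]; congr 1; ext1
      filter_upwards [coeFn_tensorL1 (x + y) u, coeFn_tensorL1 x u, coeFn_tensorL1 y u,
        Lp.coeFn_add (tensorL1 μ x u) (tensorL1 μ y u)] with t h1 h2 h3 h4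
      rw [h1, h4, Pi.add_apply, h2, h3, smul_add])
    (fun a u x => by
      rw [← map_smul]; congr 1; ext1
      filter_upwards [coeFn_tensorL1 (a • x) u, coeFn_tensorL1 x u,
        Lp.coeFn_smul a (tensorL1 μ x u)] with t h1 h2 h3
      rw [h1, h3, Pi.smul_apply, h2, smul_comm])) ‖L‖ fun u x => by
    rw [LinearMap.mk₂_apply, mul_assoc, mul_comm ‖u‖]
    exact (L.le_opNorm _).trans (mul_le_mul_of_nonneg_left (norm_tensorL1_le x u) (norm_nonneg _))

theorem dualOperator_apply (L : StrongDual ℂ (Lp X 1 μ)) (u : Lp ℂ 1 μ) (x : X) :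
    dualOperator L u x = L (tensorL1 μ x u) := rfl

theorem norm_dualOperator_le (L : StrongDual ℂ (Lp X 1 μ)) : ‖dualOperator L‖ ≤ ‖L‖ :=
  LinearMap.mkContinuous₂_norm_le _ (norm_nonneg _) _

end Tensor

theorem integrable_boundedContinuous (μ : Measure ℝ) [IsFiniteMeasure μ] {X : Type*}
    [NormedAddCommGroup X] (b : ℝ →ᵇ X) : Integrable b μ :=
  (integrable_const ‖b‖).mono' b.continuous.aestronglyMeasurable (ae_of_all _ b.norm_coe_le_norm)

/-- A bounded continuous function as an element of `L¹`. -/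
def boundedToL1 (μ : Measure ℝ) [IsFiniteMeasure μ] {X : Type*} [NormedAddCommGroup X]
    [NormedSpace ℂ X] : (ℝ →ᵇ X) →ₗ[ℂ] Lp X 1 μ where
  toFun b := (integrable_boundedContinuous μ b).toL1 b
  map_add' _ _ := Integrable.toL1_add _ _ _ _
  map_smul' _ _ := Integrable.toL1_smul' _ _ _

namespace BanachCouple

variable {X₀ X₁ E : Type*}
  [NormedAddCommGroup X₀] [NormedSpace ℂ X₀] [NormedAddCommGroup X₁] [NormedSpace ℂ X₁]
  [NormedAddCommGroup E] [NormedSpace ℂ E]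
  {c : BanachCouple X₀ X₁ E}

/-- The constant function with value in the intersection. -/
def constLift (x : c.inter) : c.Calderon :=
  ofInter (fun _ => x) diffContOnCl_const ⟨‖x‖, fun _ _ => le_rfl⟩

theorem isInterLift_constLift (x : c.inter) : IsInterLift (constLift x) fun _ => x :=
  isInterLift_ofInter _ _

variable [CompleteSpace E]

theorem norm_apply_mk_le {n : ℕ} (hn : 1 ≤ n) {z : unitStrip}
    (l : StrongDual ℂ (Rochberg c.calderonZero n z)) (f : c.calderonZero) :
    ‖l (Rochberg.mk c.calderonZero n z f)‖ ≤ ‖l‖ * (jetConst hn z *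
      ((∫ t, stripWeight n t * ‖f.1.bdry₀ t‖) + ∫ t, stripWeight n t * ‖f.1.bdry₁ t‖)) := by
  refine (l.le_opNorm _).trans (mul_le_mul_of_nonneg_left ?_ (norm_nonneg _))
  simpa using norm_mk_le_integral hn z le_rfl f 0

theorem norm_boundedToL1_stripMeasure {n : ℕ} [IsFiniteMeasure (stripMeasure n)] {X : Type*}
    [NormedAddCommGroup X] [NormedSpace ℂ X] (b : ℝ →ᵇ X) :
    ‖boundedToL1 (stripMeasure n) b‖ = ∫ t, stripWeight n t * ‖b t‖ :=
  (L1.norm_of_fun_eq_integral_norm (integrable_boundedContinuous _ b)).trans (integral_stripMeasure n _)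

/-- A functional on the Rochberg space comes from operators with values in the dual spaces. -/
theorem exists_dualOperators {n : ℕ} (hn : 1 ≤ n) {z : unitStrip}
    (l : StrongDual ℂ (Rochberg c.calderonZero n z)) :
    ∃ (S₀ : Lp ℂ 1 (stripMeasure n) →L[ℂ] StrongDual ℂ X₀)
      (S₁ : Lp ℂ 1 (stripMeasure n) →L[ℂ] StrongDual ℂ X₁),
      ‖S₀‖ ≤ 2 * jetConst hn z * ‖l‖ ∧ ‖S₁‖ ≤ 2 * jetConst hn z * ‖l‖ ∧
      ∀ (x : c.inter) (φ : ℂ → ℂ) (A : ℝ) (hφ : IsStripMultiplier A φ)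
        (hmem : Calderon.mul φ hφ (constLift x) ∈ c.calderonZero)
        (u₀ u₁ : Lp ℂ 1 (stripMeasure n)),
        (u₀ =ᵐ[stripMeasure n] fun t => φ (t * I)) →
        (u₁ =ᵐ[stripMeasure n] fun t => φ (1 + t * I)) →
        l (Rochberg.mk c.calderonZero n z ⟨_, hmem⟩) =
          S₀ u₀ (c.interTo₀ x) + S₁ u₁ (c.interTo₁ x) := by
  have := isFiniteMeasure_stripMeasure hn
  have hJ := jetConst_pos hn z
  let B₀ : c.calderonZero →ₗ[ℂ] Lp X₀ 1 (stripMeasure n) := (boundedToL1 (stripMeasure n)).comp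
    ((LinearMap.fst ℂ _ _).comp ((Calderon.bdry c).comp c.calderonZero.subtype))
  let B₁ : c.calderonZero →ₗ[ℂ] Lp X₁ 1 (stripMeasure n) := (boundedToL1 (stripMeasure n)).comp
    ((LinearMap.snd ℂ _ _).comp ((Calderon.bdry c).comp c.calderonZero.subtype))
  -- By the weighted estimate `l` is continuous in the boundary values, measured in weighted `L¹`.
  -- The factor `2` compares the sum of the two integrals with the maximum norm of the product.
  obtain ⟨L, hL, hLn⟩ := exists_clm_factor (B₀.prod B₁)
    (l.toLinearMap.comp (Rochberg.mk c.calderonZero n z).toLinearMap)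
    (C := 2 * jetConst hn z * ‖l‖) (by positivity) fun f => by
      refine (norm_apply_mk_le hn l f).trans ?_
      have h0 : ∫ t, stripWeight n t * ‖f.1.bdry₀ t‖ ≤ ‖B₀.prod B₁ f‖ :=
        (norm_boundedToL1_stripMeasure f.1.bdry₀).symm.trans_le (le_max_left _ _)
      have h1 : ∫ t, stripWeight n t * ‖f.1.bdry₁ t‖ ≤ ‖B₀.prod B₁ f‖ :=
        (norm_boundedToL1_stripMeasure f.1.bdry₁).symm.trans_le (le_max_right _ _)
      calc _ ≤ ‖l‖ * (jetConst hn z * (‖B₀.prod B₁ f‖ + ‖B₀.prod B₁ f‖)) := by gcongr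
        _ = _ := by ring
  refine ⟨dualOperator (L.comp (ContinuousLinearMap.inl ℂ _ _)),
    dualOperator (L.comp (ContinuousLinearMap.inr ℂ _ _)), ?_, ?_, ?_⟩
  · refine (norm_dualOperator_le _).trans ((L.opNorm_comp_le _).trans ?_)
    refine le_trans (mul_le_of_le_one_right (norm_nonneg _) ?_) hLn
    exact ContinuousLinearMap.norm_inl_le_one ℂ _ _
  · refine (norm_dualOperator_le _).trans ((L.opNorm_comp_le _).trans ?_)
    refine le_trans (mul_le_of_le_one_right (norm_nonneg _) ?_) hLn
    exact ContinuousLinearMap.norm_inr_le_one ℂ _ _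
  · intro x φ A hφ hmem u₀ u₁ h₀ h₁
    have h := hL ⟨_, hmem⟩
    refine h.symm.trans ?_
    rw [dualOperator_apply, dualOperator_apply, ContinuousLinearMap.comp_apply,
      ContinuousLinearMap.comp_apply, ← map_add]
    congr 1
    refine Prod.ext ?_ ?_
    · rw [Prod.fst_add]
      change boundedToL1 (stripMeasure n) (Calderon.mul φ hφ (constLift x)).bdry₀ =
        tensorL1 _ _ _ + 0
      rw [add_zero]
      ext1
      filter_upwards [Integrable.coeFn_toL1
        (integrable_boundedContinuous (stripMeasure n)
          (Calderon.mul φ hφ (constLift x)).bdry₀),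
        coeFn_tensorL1 (c.interTo₀ x) u₀, h₀] with t e1 e2 e3
      rw [e2, e3]
      exact e1
    · rw [Prod.snd_add]
      change boundedToL1 (stripMeasure n) (Calderon.mul φ hφ (constLift x)).bdry₁ =
        0 + tensorL1 _ _ _
      rw [zero_add]
      ext1
      filter_upwards [Integrable.coeFn_toL1
        (integrable_boundedContinuous (stripMeasure n)
          (Calderon.mul φ hφ (constLift x)).bdry₁),
        coeFn_tensorL1 (c.interTo₁ x) u₁, h₁] with t e1 e2 e3
      rw [e2, e3]
      exact e1

end BanachCouple

/-! ### Gaussian kernels with a zero of order `n` at `z`. -/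

/-- The vertical line with real part `a`. -/
def stripLine (a s : ℝ) : ℂ := a + s * I

@[simp] theorem stripLine_zero (s : ℝ) : stripLine 0 s = s * I := by simp [stripLine]
@[simp] theorem stripLine_one (s : ℝ) : stripLine 1 s = 1 + s * I := by simp [stripLine]
@[simp] theorem re_stripLine (a s : ℝ) : (stripLine a s).re = a := by simp [stripLine]
@[simp] theorem im_stripLine (a s : ℝ) : (stripLine a s).im = s := by simp [stripLine]

@[fun_prop]
theorem continuous_stripLine (a : ℝ) : Continuous (stripLine a) := by unfold stripLine; fun_prop

theorem norm_sub_pow_le (n : ℕ) (z : ℂ) {w : ℂ} (hw : w ∈ closedUnitStrip) :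
    ‖(w - z) ^ n‖ ≤ (‖z‖ + 3) ^ n * (1 + w.im ^ 2) ^ n := by
  rw [norm_pow, ← mul_pow]
  refine pow_le_pow_left₀ (norm_nonneg _) ?_ n
  have h1 := norm_sub_le w z
  have h2 := norm_le_abs_re_add_abs_im w
  have h3 : |w.re| ≤ 1 := abs_le.2 ⟨by linarith [hw.1], hw.2⟩
  have h4 : |w.im| ≤ 1 + w.im ^ 2 := by
    rw [← sq_abs w.im]
    nlinarith [sq_nonneg (|w.im| - 1), abs_nonneg w.im]
  nlinarith [norm_nonneg z, sq_nonneg w.im]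

theorem norm_sub_pow_mul_stripWeight_le (n : ℕ) (z : ℂ) {w : ℂ} (hw : w ∈ closedUnitStrip) :
    ‖(w - z) ^ n‖ * stripWeight n w.im ≤ (‖z‖ + 3) ^ n := by
  rw [stripWeight, ← div_eq_mul_inv, div_le_iff₀ (by positivity)]
  exact norm_sub_pow_le n z hw

section LineKernel

variable {n : ℕ} {z : ℂ} {δ a : ℝ}

/-- The Gaussian kernel with a zero of order `n` at `z`. -/
def zeroKer (n : ℕ) (z : ℂ) (δ : ℝ) (w ζ : ℂ) : ℂ := (ζ - z) ^ n * gaussKer δ (ζ - w)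

theorem differentiable_zeroKer (n : ℕ) (z : ℂ) (δ : ℝ) (w : ℂ) :
    Differentiable ℂ (zeroKer n z δ w) := by unfold zeroKer; fun_prop

theorem differentiable_zeroKer_left (n : ℕ) (z : ℂ) (δ : ℝ) (ζ : ℂ) :
    Differentiable ℂ fun w => zeroKer n z δ w ζ := by unfold zeroKer; fun_prop

theorem exists_norm_zeroKer_le (hδ : 0 < δ) (n : ℕ) (z : ℂ) (R : ℝ) :
    ∃ C : ℝ, 0 < C ∧ ∀ w : ℂ, ‖w‖ ≤ R → ∀ ζ ∈ closedUnitStrip,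
      ‖zeroKer n z δ w ζ‖ ≤ C / (1 + ζ.im ^ 2) := by
  obtain ⟨C, hC, h⟩ := exists_norm_gaussKer_le hδ (n + 1) (R + 1)
  refine ⟨(‖z‖ + 3) ^ n * C, by positivity, fun w hw ζ hζ => ?_⟩
  have h1 : |(ζ - w).re| ≤ R + 1 := by
    rw [sub_re]
    refine (abs_sub _ _).trans ?_
    have := (abs_re_le_norm w).trans hw
    have : |ζ.re| ≤ 1 := abs_le.2 ⟨by linarith [hζ.1], hζ.2⟩
    linarith
  have h2 : |w.im| ≤ R + 1 := ((abs_im_le_norm w).trans hw).trans (by linarith)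
  rw [zeroKer, norm_mul]
  refine (mul_le_mul (norm_sub_pow_le n z hζ) (h ζ w h1 h2) (norm_nonneg _) (by positivity)).trans
    (le_of_eq ?_)
  field_simp
  ring

theorem mem_closedUnitStrip_stripLine (ha : a ∈ Icc (0 : ℝ) 1) (s : ℝ) :
    stripLine a s ∈ closedUnitStrip := by
  change (stripLine a s).re ∈ Icc (0 : ℝ) 1
  rwa [re_stripLine]

theorem exists_norm_zeroKer_stripLine_le (hδ : 0 < δ) (ha : a ∈ Icc (0 : ℝ) 1) (n : ℕ) (z : ℂ)
    (R : ℝ) : ∃ C : ℝ, 0 < C ∧ ∀ w : ℂ, ‖w‖ ≤ R → ∀ s,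
      ‖zeroKer n z δ w (stripLine a s)‖ ≤ C := by
  obtain ⟨C, hC, h⟩ := exists_norm_zeroKer_le hδ n z R
  refine ⟨C, hC, fun w hw s => (h w hw _ (mem_closedUnitStrip_stripLine ha s)).trans ?_⟩
  exact div_le_self hC.le (by nlinarith [sq_nonneg (stripLine a s).im])

theorem continuous_zeroKer_stripLine (n : ℕ) (z : ℂ) (δ a : ℝ) (w : ℂ) :
    Continuous fun s => zeroKer n z δ w (stripLine a s) :=
  (differentiable_zeroKer n z δ w).continuous.comp (continuous_stripLine a)

theorem integrable_zeroKer_stripLine (hn : 1 ≤ n) (hδ : 0 < δ) (ha : a ∈ Icc (0 : ℝ) 1) (z w : ℂ) :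
    Integrable (fun s => zeroKer n z δ w (stripLine a s)) (stripMeasure n) := by
  have := isFiniteMeasure_stripMeasure hn
  obtain ⟨C, hC, h⟩ := exists_norm_zeroKer_stripLine_le hδ ha n z ‖w‖
  exact (integrable_const C).mono' (continuous_zeroKer_stripLine n z δ a w).aestronglyMeasurable
    (ae_of_all _ (h w le_rfl))

/-- The Gaussian kernel with a zero of order `n` on a vertical line, as an element of `L¹`. -/
def zeroKerL1 (hn : 1 ≤ n) (hδ : 0 < δ) (ha : a ∈ Icc (0 : ℝ) 1) (z w : ℂ) :
    Lp ℂ 1 (stripMeasure n) := (integrable_zeroKer_stripLine hn hδ ha z w).toL1 _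

theorem coeFn_zeroKerL1 (hn : 1 ≤ n) (hδ : 0 < δ) (ha : a ∈ Icc (0 : ℝ) 1) (z w : ℂ) :
    zeroKerL1 hn hδ ha z w =ᵐ[stripMeasure n] fun s => zeroKer n z δ w (stripLine a s) :=
  Integrable.coeFn_toL1 _

/-- The weight cancels the growth of `(ζ - z) ^ n`, and the remaining Gaussian density has mass `1`.
For `w` on the line itself the exponential is `1`, so the bound is independent of `δ`; the uniform
bound on the approximating jets rests on this. -/
theorem norm_zeroKerL1_le (hn : 1 ≤ n) (hδ : 0 < δ) (ha : a ∈ Icc (0 : ℝ) 1) (z w : ℂ) :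
    ‖zeroKerL1 hn hδ ha z w‖ ≤ (‖z‖ + 3) ^ n * Real.exp ((a - w.re) ^ 2 / δ ^ 2) := by
  rw [zeroKerL1, L1.norm_of_fun_eq_integral_norm, integral_stripMeasure]
  have hi := (integrable_gaussDensity_shift hδ w.im).const_mul
    ((‖z‖ + 3) ^ n * Real.exp ((a - w.re) ^ 2 / δ ^ 2))
  refine (integral_mono_of_nonneg (ae_of_all _ fun s => ?_) hi (ae_of_all _ fun s => ?_)).trans
    (le_of_eq ?_)
  · exact smul_nonneg (stripWeight_pos n s).le (norm_nonneg _)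
  · have h1 := norm_sub_pow_mul_stripWeight_le n z (mem_closedUnitStrip_stripLine ha s)
    rw [im_stripLine] at h1
    have h2 : ‖gaussKer δ (stripLine a s - w)‖ =
        Real.exp ((a - w.re) ^ 2 / δ ^ 2) * (δ⁻¹ * gaussDensity ((s - w.im) / δ)) := by
      rw [norm_gaussKer hδ]
      simp
    have h3 : 0 ≤ ‖gaussKer δ (stripLine a s - w)‖ := norm_nonneg _
    simp only [smul_eq_mul, zeroKer, norm_mul]
    calc _ = ‖(stripLine a s - z) ^ n‖ * stripWeight n s * ‖gaussKer δ (stripLine a s - w)‖ := by ring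
      _ ≤ (‖z‖ + 3) ^ n * ‖gaussKer δ (stripLine a s - w)‖ := mul_le_mul_of_nonneg_right h1 h3
      _ = _ := by rw [h2]; ring
  · rw [integral_const_mul, integral_gaussDensity_shift hδ, mul_one]

theorem continuous_zeroKerL1 (hn : 1 ≤ n) (hδ : 0 < δ) (ha : a ∈ Icc (0 : ℝ) 1) (z : ℂ) :
    Continuous (zeroKerL1 hn hδ ha z) := by
  have := isFiniteMeasure_stripMeasure hn
  refine continuous_iff_continuousAt.2 fun w₀ => ?_
  refine tendsto_iff_norm_sub_tendsto_zero.2 ?_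
  have e : ∀ w, ‖zeroKerL1 hn hδ ha z w - zeroKerL1 hn hδ ha z w₀‖ =
      ∫ s, ‖zeroKer n z δ w (stripLine a s) - zeroKer n z δ w₀ (stripLine a s)‖ ∂stripMeasure n := by
    intro w
    rw [zeroKerL1, zeroKerL1, ← Integrable.toL1_sub, L1.norm_of_fun_eq_integral_norm]
    rfl
  simp only [e]
  obtain ⟨C, hC, h⟩ := exists_norm_zeroKer_stripLine_le hδ ha n z (‖w₀‖ + 1)
  have e0 : (0 : ℝ) = ∫ s, (0 : ℝ) ∂stripMeasure n := by simp
  rw [e0]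
  refine tendsto_integral_filter_of_dominated_convergence (fun _ => 2 * C) ?_ ?_
    (integrable_const _) (ae_of_all _ fun s => ?_)
  · exact Eventually.of_forall fun w => ((continuous_zeroKer_stripLine n z δ a w).sub
      (continuous_zeroKer_stripLine n z δ a w₀)).norm.aestronglyMeasurable
  · filter_upwards [Metric.ball_mem_nhds w₀ one_pos] with w hw
    refine ae_of_all _ fun s => ?_
    rw [norm_norm, two_mul]
    refine (norm_sub_le _ _).trans (add_le_add (h w ?_ s) (h w₀ (by linarith) s))
    rw [Metric.mem_ball, dist_eq_norm] at hw
    have := norm_sub_norm_le w w₀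
    linarith
  · have h1 : Continuous fun w => ‖zeroKer n z δ w (stripLine a s) -
        zeroKer n z δ w₀ (stripLine a s)‖ :=
      ((differentiable_zeroKer_left n z δ (stripLine a s)).continuous.sub continuous_const).norm
    simpa using h1.tendsto w₀

/-- Integrals over measurable sets separate the points of `L¹`, so analyticity needs to be checked
only for them, where it is differentiation under the integral. -/
theorem differentiable_zeroKerL1 (hn : 1 ≤ n) (hδ : 0 < δ) (ha : a ∈ Icc (0 : ℝ) 1) (z : ℂ) :
    Differentiable ℂ (zeroKerL1 hn hδ ha z) := by
  have := isFiniteMeasure_stripMeasure hn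
  rw [← differentiableOn_univ]
  have hst : ∀ C : {C : Set ℝ // MeasurableSet C},
      StronglyMeasurable (C.1.indicator fun _ => (1 : ℂ)) :=
    fun C => stronglyMeasurable_const.indicator C.2
  have hbd : ∀ (C : {C : Set ℝ // MeasurableSet C}) (t : ℝ),
      ‖C.1.indicator (fun _ => (1 : ℂ)) t‖ ≤ 1 := fun C t => by
    by_cases h : t ∈ C.1 <;> simp [h]
  refine differentiableOn_of_forall_clm
    (fun C : {C : Set ℝ // MeasurableSet C} => densityCLM (stripMeasure n) (hst C) (hbd C))
    (fun u hu => ?_) isOpen_univ (continuous_zeroKerL1 hn hδ ha z).continuousOn fun C => ?_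
  · refine (Lp.eq_zero_iff_ae_eq_zero).2 ?_
    refine Integrable.ae_eq_zero_of_forall_setIntegral_eq_zero (L1.integrable_coeFn u)
      fun s hs _ => ?_
    have := hu ⟨s, hs⟩
    rw [densityCLM_apply] at this
    rw [← this, ← integral_indicator hs]
    refine integral_congr_ae (ae_of_all _ fun t => ?_)
    by_cases h : t ∈ s <;> simp [h]
  · intro w₀ _
    obtain ⟨K, hK, h⟩ := exists_norm_zeroKer_stripLine_le hδ ha n z (‖w₀‖ + 1)
    have hd := differentiableAt_integral_of_dominated (μ := stripMeasure n)
      (F := fun w s => zeroKer n z δ w (stripLine a s) * C.1.indicator (fun _ => (1 : ℂ)) s)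
      (w₀ := w₀) one_pos (integrable_const K)
      (fun w _ => ((continuous_zeroKer_stripLine n z δ a w).aestronglyMeasurable).mul
        (hst C).aestronglyMeasurable)
      (fun s => ((differentiable_zeroKer_left n z δ (stripLine a s)).mul_const _).differentiableOn)
      (fun w hw s => by
        rw [Metric.mem_ball, dist_eq_norm] at hw
        have h1 := norm_sub_norm_le w w₀
        rw [norm_mul]
        exact (mul_le_mul (h w (by linarith) s) (hbd C s) (norm_nonneg _) hK.le).trans_eq (mul_one K))
    refine DifferentiableAt.differentiableWithinAt (hd.congr_of_eventuallyEq
      (Eventually.of_forall fun w => ?_))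
    refine (densityCLM_apply _ _ _).trans (integral_congr_ae ?_)
    filter_upwards [coeFn_zeroKerL1 hn hδ ha z w] with s hs
    rw [hs, smul_eq_mul]

end LineKernel

/-! ### Gaussian convolution in weighted `L¹`. -/

section WeightedApproximation

variable {V : Type*} [NormedAddCommGroup V] [NormedSpace ℂ V] [CompleteSpace V]

/-- Convolution with a Gaussian density. -/
def gaussConv (δ : ℝ) (κ : ℝ → V) (t : ℝ) : V := ∫ u, gaussDensity u • κ (t + δ * u)

/-- The weight is moderate: a translation by `δ u` costs only a polynomial factor in `u`, which the
Gaussian integrates, uniformly for `δ ≤ 1`. -/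
theorem stripWeight_le_mul (n : ℕ) {δ : ℝ} (h0 : 0 ≤ δ) (h1 : δ ≤ 1) (t u : ℝ) :
    stripWeight n t ≤ (2 * (1 + u ^ 2)) ^ n * stripWeight n (t + δ * u) := by
  have h : 1 + (t + δ * u) ^ 2 ≤ 2 * (1 + u ^ 2) * (1 + t ^ 2) := by
    have : (δ * u) ^ 2 ≤ u ^ 2 := by
      rw [mul_pow]
      exact mul_le_of_le_one_left (sq_nonneg u) (pow_le_one₀ h0 h1)
    nlinarith [sq_nonneg (t - δ * u), mul_nonneg (sq_nonneg t) (sq_nonneg u)]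
  have h2 := pow_le_pow_left₀ (by positivity) h n
  rw [mul_pow] at h2
  rw [stripWeight, stripWeight, ← div_eq_mul_inv, le_div_iff₀ (by positivity),
    inv_mul_le_iff₀ (by positivity)]
  linarith

theorem integrable_gaussDensity_mul_pow (n : ℕ) :
    Integrable fun u => gaussDensity u * (2 * (1 + u ^ 2)) ^ n := by
  have h := ((integrable_exp_neg_mul_sq (show (0 : ℝ) < 1 / 2 by norm_num)).const_mul
    ((√Real.pi)⁻¹ * (4 ^ n * n.factorial * Real.exp (1 / 2))))
  refine h.mono' (continuous_gaussDensity.mul (by fun_prop)).aestronglyMeasurable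
    (ae_of_all _ fun u => ?_)
  rw [Real.norm_of_nonneg (mul_nonneg (gaussDensity_nonneg u) (by positivity))]
  have h1 := Real.pow_div_factorial_le_exp ((1 + u ^ 2) / 2) (by positivity) n
  rw [div_le_iff₀ (by positivity)] at h1
  have h2 : (2 * (1 + u ^ 2)) ^ n = 4 ^ n * ((1 + u ^ 2) / 2) ^ n := by
    rw [← mul_pow]; ring
  have h3 : Real.exp (-(1 / 2) * u ^ 2) * Real.exp (1 / 2) =
      Real.exp ((1 + u ^ 2) / 2) * Real.exp (-u ^ 2) := by
    rw [← Real.exp_add, ← Real.exp_add]; congr 1; ring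
  calc gaussDensity u * (2 * (1 + u ^ 2)) ^ n
      = (√Real.pi)⁻¹ * 4 ^ n * (((1 + u ^ 2) / 2) ^ n * Real.exp (-u ^ 2)) := by
        rw [h2, gaussDensity]; ring
    _ ≤ (√Real.pi)⁻¹ * 4 ^ n * ((Real.exp ((1 + u ^ 2) / 2) * n.factorial) * Real.exp (-u ^ 2)) := by
        gcongr
    _ = (√Real.pi)⁻¹ * (4 ^ n * n.factorial) * (Real.exp ((1 + u ^ 2) / 2) * Real.exp (-u ^ 2)) := by
        ring
    _ = _ := by rw [← h3]; ring

theorem integrable_gaussConv {κ : ℝ → V} (hκ : StronglyMeasurable κ) {M : ℝ} (hM : ∀ t, ‖κ t‖ ≤ M)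
    (δ t : ℝ) : Integrable fun u => gaussDensity u • κ (t + δ * u) := by
  refine (integrable_gaussDensity.mul_const M).mono' (continuous_gaussDensity.aestronglyMeasurable.smul
    (hκ.comp_measurable (by fun_prop)).aestronglyMeasurable) (ae_of_all _ fun u => ?_)
  rw [norm_smul, Real.norm_of_nonneg (gaussDensity_nonneg u)]
  exact mul_le_mul_of_nonneg_left (hM _) (gaussDensity_nonneg u)

theorem stronglyMeasurable_gaussConv {κ : ℝ → V} (hκ : StronglyMeasurable κ) (δ : ℝ) :
    StronglyMeasurable (gaussConv δ κ) := by
  have h : StronglyMeasurable fun q : ℝ × ℝ => gaussDensity q.2 • κ (q.1 + δ * q.2) :=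
    (continuous_gaussDensity.comp continuous_snd).stronglyMeasurable.smul
      (hκ.comp_measurable (by fun_prop))
  exact h.integral_prod_right

theorem norm_gaussConv_le {κ : ℝ → V} {M : ℝ} (hM : ∀ t, ‖κ t‖ ≤ M) (δ t : ℝ) :
    ‖gaussConv δ κ t‖ ≤ M := by
  have h := norm_integral_le_of_norm_le (f := fun u => gaussDensity u • κ (t + δ * u))
    (integrable_gaussDensity.mul_const M) (ae_of_all _ fun u => by
      rw [norm_smul, Real.norm_of_nonneg (gaussDensity_nonneg u)]
      exact mul_le_mul_of_nonneg_left (hM _) (gaussDensity_nonneg u))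
  rwa [integral_mul_const, integral_gaussDensity, one_mul] at h

/-- Gaussian convolutions are bounded in weighted `L¹`. -/
theorem integral_stripWeight_gaussConv_le {n : ℕ} {κ : ℝ → V} (hκ : StronglyMeasurable κ)
    (hi : Integrable fun t => stripWeight n t * ‖κ t‖) {δ : ℝ} (h0 : 0 ≤ δ) (h1 : δ ≤ 1) :
    ∫ t, stripWeight n t * ‖gaussConv δ κ t‖ ≤
      (∫ u, gaussDensity u * (2 * (1 + u ^ 2)) ^ n) * ∫ t, stripWeight n t * ‖κ t‖ := by
  set N := ∫ t, stripWeight n t * ‖κ t‖ with hN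
  have hD := integrable_gaussDensity_mul_pow n
  have hD0 : ∀ u, 0 ≤ gaussDensity u * (2 * (1 + u ^ 2)) ^ n := fun u =>
    mul_nonneg (gaussDensity_nonneg u) (by positivity)
  have hw0 : ∀ t, 0 ≤ stripWeight n t * ‖κ t‖ := fun t =>
    mul_nonneg (stripWeight_pos n t).le (norm_nonneg _)
  have hk : Measurable fun t => ‖κ t‖ := hκ.norm.measurable
  have hpt : ∀ t, ENNReal.ofReal (stripWeight n t * ‖gaussConv δ κ t‖) ≤
      ∫⁻ u, ENNReal.ofReal (gaussDensity u * (2 * (1 + u ^ 2)) ^ n) *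
        ENNReal.ofReal (stripWeight n (t + δ * u) * ‖κ (t + δ * u)‖) := by
    intro t
    rw [ENNReal.ofReal_mul (stripWeight_pos n t).le, ofReal_norm]
    refine (mul_le_mul_right (enorm_integral_le_lintegral_enorm _) _).trans ?_
    rw [← lintegral_const_mul' _ _ ENNReal.ofReal_ne_top]
    refine lintegral_mono fun u => ?_
    rw [← ofReal_norm, ← ENNReal.ofReal_mul (stripWeight_pos n t).le,
      ← ENNReal.ofReal_mul (hD0 u)]
    refine ENNReal.ofReal_le_ofReal ?_
    rw [norm_smul, Real.norm_of_nonneg (gaussDensity_nonneg u)]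
    have := mul_le_mul_of_nonneg_right (stripWeight_le_mul n h0 h1 t u)
      (mul_nonneg (gaussDensity_nonneg u) (norm_nonneg (κ (t + δ * u))))
    refine this.trans (le_of_eq ?_)
    ring
  have hswap : ∫⁻ t, ENNReal.ofReal (stripWeight n t * ‖gaussConv δ κ t‖) ≤
      ENNReal.ofReal (∫ u, gaussDensity u * (2 * (1 + u ^ 2)) ^ n) * ENNReal.ofReal N := by
    refine (lintegral_mono hpt).trans ?_
    rw [lintegral_lintegral_swap]
    · have h2 : ∀ u : ℝ, ∫⁻ t, ENNReal.ofReal (gaussDensity u * (2 * (1 + u ^ 2)) ^ n) *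
          ENNReal.ofReal (stripWeight n (t + δ * u) * ‖κ (t + δ * u)‖) =
          ENNReal.ofReal (gaussDensity u * (2 * (1 + u ^ 2)) ^ n) * ENNReal.ofReal N := by
        intro u
        rw [lintegral_const_mul' _ _ ENNReal.ofReal_ne_top,
          lintegral_add_right_eq_self (fun t => ENNReal.ofReal (stripWeight n t * ‖κ t‖)) (δ * u),
          hN, ofReal_integral_eq_lintegral_ofReal hi (ae_of_all _ hw0)]
      simp only [h2]
      rw [lintegral_mul_const' _ _ ENNReal.ofReal_ne_top,
        ofReal_integral_eq_lintegral_ofReal hD (ae_of_all _ hD0)]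
    · refine Measurable.aemeasurable ?_
      have hk2 : Measurable fun p : ℝ × ℝ => ‖κ (p.1 + δ * p.2)‖ := hk.comp (by fun_prop)
      have hs : Measurable fun p : ℝ × ℝ => stripWeight n (p.1 + δ * p.2) :=
        (continuous_stripWeight n).measurable.comp (by fun_prop)
      have hg : Measurable fun p : ℝ × ℝ => gaussDensity p.2 * (2 * (1 + p.2 ^ 2)) ^ n :=
        (continuous_gaussDensity.measurable.comp measurable_snd).mul (by fun_prop)
      exact hg.ennreal_ofReal.mul (hs.mul hk2).ennreal_ofReal
  have hm : AEStronglyMeasurable (fun t => stripWeight n t * ‖gaussConv δ κ t‖) volume :=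
    ((continuous_stripWeight n).stronglyMeasurable.mul
      (stronglyMeasurable_gaussConv hκ δ).norm).aestronglyMeasurable
  rw [integral_eq_lintegral_of_nonneg_ae (ae_of_all _ fun t =>
    mul_nonneg (stripWeight_pos n t).le (norm_nonneg _)) hm]
  have hDn : 0 ≤ ∫ u, gaussDensity u * (2 * (1 + u ^ 2)) ^ n := integral_nonneg hD0
  rw [← ENNReal.ofReal_mul hDn] at hswap
  exact ENNReal.toReal_le_of_le_ofReal (mul_nonneg hDn (integral_nonneg hw0)) hswap

theorem integrable_stripWeight_mul_norm {n : ℕ} (hn : 1 ≤ n) {κ : ℝ → V}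
    (hκ : StronglyMeasurable κ) {M : ℝ} (hM : ∀ t, ‖κ t‖ ≤ M) :
    Integrable fun t => stripWeight n t * ‖κ t‖ := by
  refine ((integrable_stripWeight hn).mul_const M).mono'
    ((continuous_stripWeight n).aestronglyMeasurable.mul hκ.norm.aestronglyMeasurable)
    (ae_of_all _ fun t => ?_)
  rw [Real.norm_of_nonneg (mul_nonneg (stripWeight_pos n t).le (norm_nonneg _))]
  exact mul_le_mul_of_nonneg_left (hM t) (stripWeight_pos n t).le

/-- Gaussian convolutions approximate bounded functions in weighted `L¹`. -/
theorem exists_integral_gaussConv_sub_le {n : ℕ} (hn : 1 ≤ n) {κ : ℝ → V}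
    (hκ : StronglyMeasurable κ) {M : ℝ} (hM : ∀ t, ‖κ t‖ ≤ M) {ε : ℝ} (hε : 0 < ε) :
    ∃ δ₀ : ℝ, 0 < δ₀ ∧ ∀ δ, 0 < δ → δ < δ₀ →
      ∫ t, stripWeight n t * ‖gaussConv δ κ t - κ t‖ ≤ ε := by
  have := isFiniteMeasure_stripMeasure hn
  set D := ∫ u, gaussDensity u * (2 * (1 + u ^ 2)) ^ n with hD
  have hD0 : 0 ≤ D := integral_nonneg fun u => mul_nonneg (gaussDensity_nonneg u) (by positivity)
  set W := ∫ t, stripWeight n t with hW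
  have hW0 : 0 ≤ W := integral_nonneg fun t => (stripWeight_pos n t).le
  -- Replace `κ` by a continuous `k` of compact support. For `k` the convolutions converge
  -- uniformly, and the difference is controlled in weighted `L¹` with the constant `D + 1`.
  obtain ⟨k, hks, hkε, hkc, hki⟩ := (integrable_of_stronglyMeasurable_of_norm_le
    (μ := stripMeasure n) hκ hM).exists_hasCompactSupport_integral_sub_le
    (show 0 < ε / (2 * (D + 1)) by positivity)
  obtain ⟨M', hM'⟩ := hkc.bounded_above_of_compact_support hks
  obtain ⟨δ₀, hδ₀, hδ⟩ := exists_norm_integral_smul_sub_le gaussDensity_nonneg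
    integrable_gaussDensity integral_gaussDensity
    (hkc.uniformContinuous_of_tendsto_cocompact hks.is_zero_at_infty) hM'
    (show 0 < ε / (2 * (W + 1)) by positivity)
  refine ⟨min δ₀ 1, lt_min hδ₀ one_pos, fun δ h1 h2 => ?_⟩
  have hkm := hkc.stronglyMeasurable
  have hdm : StronglyMeasurable fun t => κ t - k t := hκ.sub hkm
  have hdM : ∀ t, ‖κ t - k t‖ ≤ M + M' := fun t =>
    (norm_sub_le _ _).trans (add_le_add (hM t) (hM' t))
  have hcd : ∀ t, gaussConv δ (fun t => κ t - k t) t = gaussConv δ κ t - gaussConv δ k t := by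
    intro t
    rw [gaussConv, gaussConv, gaussConv,
      ← integral_sub (integrable_gaussConv hκ hM δ t) (integrable_gaussConv hkm hM' δ t)]
    simp only [smul_sub]
  have i1 := integrable_stripWeight_mul_norm hn (stronglyMeasurable_gaussConv hdm δ)
    (norm_gaussConv_le hdM δ)
  have i2 := integrable_stripWeight_mul_norm hn hdm hdM
  have b1 := integral_stripWeight_gaussConv_le hdm i2 h1.le (h2.le.trans (min_le_right _ _))
  have b2 : ∫ t, stripWeight n t * ‖κ t - k t‖ ≤ ε / (2 * (D + 1)) := by
    rw [integral_stripMeasure] at hkε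
    exact hkε
  have i3 : Integrable fun t => stripWeight n t * (ε / (2 * (W + 1))) :=
    (integrable_stripWeight hn).mul_const _
  have hpt : ∀ t, stripWeight n t * ‖gaussConv δ κ t - κ t‖ ≤
      stripWeight n t * ‖gaussConv δ (fun t => κ t - k t) t‖ + stripWeight n t * ‖κ t - k t‖ +
        stripWeight n t * (ε / (2 * (W + 1))) := by
    intro t
    rw [← mul_add, ← mul_add]
    refine mul_le_mul_of_nonneg_left ?_ (stripWeight_pos n t).le
    have h3 := hδ δ h1 (h2.trans_le (min_le_left _ _)) t
    have e : gaussConv δ κ t - κ t = gaussConv δ (fun t => κ t - k t) t - (κ t - k t) +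
        (gaussConv δ k t - k t) := by rw [hcd]; abel
    rw [e]
    exact (norm_add_le _ _).trans (add_le_add (norm_sub_le _ _) h3)
  have hfin := integral_mono_of_nonneg (ae_of_all _ fun t =>
    mul_nonneg (stripWeight_pos n t).le (norm_nonneg _)) ((i1.add i2).add i3) (ae_of_all _ hpt)
  refine hfin.trans ?_
  have e1 : ∫ t, (stripWeight n t * ‖gaussConv δ (fun t => κ t - k t) t‖ +
      stripWeight n t * ‖κ t - k t‖ + stripWeight n t * (ε / (2 * (W + 1)))) =
      (∫ t, stripWeight n t * ‖gaussConv δ (fun t => κ t - k t) t‖) +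
      (∫ t, stripWeight n t * ‖κ t - k t‖) + W * (ε / (2 * (W + 1))) := by
    have j1 := integral_add (i1.add i2) i3
    have j2 := integral_add i1 i2
    simp only [Pi.add_apply] at j1
    rw [j1, j2, integral_mul_const]
  refine (le_of_eq e1).trans ?_
  have e2 : W * (ε / (2 * (W + 1))) ≤ ε / 2 := by
    rw [mul_div_assoc', div_le_div_iff₀ (by positivity) two_pos]
    nlinarith
  have e3 : (D + 1) * (ε / (2 * (D + 1))) = ε / 2 := by field_simp
  have e4 := mul_le_mul_of_nonneg_left b2 hD0
  nlinarith

end WeightedApproximation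

/-! ### Line integrals and Cauchy's formula on the strip. -/

section LineIntegrals

theorem integrable_of_norm_le_div_one_add_sq {V : Type*} [NormedAddCommGroup V] {f : ℝ → V}
    (hf : Continuous f) {C : ℝ} (hC : ∀ t, ‖f t‖ ≤ C / (1 + t ^ 2)) : Integrable f := by
  refine (integrable_inv_one_add_sq.const_mul C).mono' hf.aestronglyMeasurable (ae_of_all _ fun t => ?_)
  simpa [div_eq_mul_inv] using hC t

theorem one_add_abs_le_norm_add {a : ℂ} (ha : a.re ≠ 0) {u : ℂ} (hu : u = I ∨ u = -I) (t : ℝ) :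
    1 + |t| ≤ (1 + (1 + ‖a‖) / |a.re|) * ‖a + t * u‖ := by
  have hr : 0 < |a.re| := abs_pos.2 ha
  have hure : u.re = 0 := by rcases hu with rfl | rfl <;> simp
  have hun : ‖u‖ = 1 := by rcases hu with rfl | rfl <;> simp
  have h1 : |a.re| ≤ ‖a + t * u‖ := by
    refine le_trans (le_of_eq ?_) (abs_re_le_norm _)
    simp [hure]
  have h2 : |t| ≤ ‖a + t * u‖ + ‖a‖ := by
    have := norm_sub_le (a + t * u) a
    simpa [hun] using this
  have h3 : 1 ≤ ‖a + t * u‖ / |a.re| := (one_le_div hr).2 h1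
  have h4 : (1 + (1 + ‖a‖) / |a.re|) * ‖a + t * u‖ =
      ‖a + t * u‖ + (1 + ‖a‖) * (‖a + t * u‖ / |a.re|) := by ring
  rw [h4]
  nlinarith [norm_nonneg a]

theorem add_mul_ne_zero {a : ℂ} (ha : a.re ≠ 0) {u : ℂ} (hu : u = I ∨ u = -I) (t : ℝ) :
    a + t * u ≠ 0 := fun h => by
  have := one_add_abs_le_norm_add ha hu t
  rw [h, norm_zero, mul_zero] at this
  linarith [abs_nonneg t]

/-- Dividing by `t > 0` leaves `a / t + u`, which tends to `u`, away from the cut. The divergent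
`log t` cancels in differences. -/
theorem tendsto_log_add_mul_sub_log (a : ℂ) {u : ℂ} (hu : u ∈ slitPlane) :
    Tendsto (fun t : ℝ => log (a + t * u) - Real.log t) atTop (𝓝 (log u)) := by
  have h1 : Tendsto (fun t : ℝ => a * ((t⁻¹ : ℝ) : ℂ) + u) atTop (𝓝 u) := by
    have : Tendsto (fun t : ℝ => ((t⁻¹ : ℝ) : ℂ)) atTop (𝓝 ((0 : ℝ) : ℂ)) :=
      (continuous_ofReal.tendsto _).comp tendsto_inv_atTop_zero
    simpa using (this.const_mul a).add_const u
  refine ((continuousAt_clog hu).tendsto.comp h1).congr' ?_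
  filter_upwards [eventually_gt_atTop 0, h1.eventually_ne (slitPlane_ne_zero hu)] with t ht hne
  have e : a + t * u = t * (a * ((t⁻¹ : ℝ) : ℂ) + u) := by
    have : (t : ℂ) ≠ 0 := ofReal_ne_zero.2 ht.ne'
    push_cast
    field_simp
  simp only [Function.comp]
  rw [e, log_ofReal_mul ht hne, add_sub_cancel_left]

/-- A primitive is `log (a + t u) - log (b + t v)`; positive real parts keep both arguments off the
cut, and the two divergences at either end cancel. -/
theorem integral_div_add_sub_div_add {a b u v : ℂ} (ha : 0 < a.re) (hb : 0 < b.re)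
    (hu : u = I ∨ u = -I) (hv : v = I ∨ v = -I) :
    ∫ t : ℝ, (u / (a + t * u) - v / (b + t * v)) = log u - log v - (log (-u) - log (-v)) := by
  have hs : ∀ {u : ℂ}, (u = I ∨ u = -I) → u ∈ slitPlane ∧ -u ∈ slitPlane := by
    rintro u (rfl | rfl) <;> simp [mem_slitPlane_iff]
  have hd : ∀ {a u : ℂ}, 0 < a.re → (u = I ∨ u = -I) → ∀ t : ℝ,
      HasDerivAt (fun t : ℝ => log (a + t * u)) (u / (a + t * u)) t := by
    intro a u ha hu t
    have h1 : HasDerivAt (fun t : ℝ => a + t * u) u t := by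
      simpa using ((hasDerivAt_id t).ofReal_comp.mul_const u).const_add a
    refine h1.clog_real (Or.inl ?_)
    rcases hu with rfl | rfl <;> simpa using ha
  have htop : ∀ {u : ℂ} (a : ℂ), (u = I ∨ u = -I) →
      Tendsto (fun t : ℝ => log (a + t * u) - Real.log t) atTop (𝓝 (log u)) :=
    fun a hu => tendsto_log_add_mul_sub_log a (hs hu).1
  have hbot : ∀ {u : ℂ} (a : ℂ), (u = I ∨ u = -I) →
      Tendsto (fun t : ℝ => log (a + t * u) - Real.log t) atBot (𝓝 (log (-u))) := fun {u} a hu =>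
    ((tendsto_log_add_mul_sub_log a (hs hu).2).comp tendsto_neg_atBot_atTop).congr fun t => by
      simp [Function.comp, Real.log_neg_eq_log]
  have hne : ∀ {a u : ℂ}, 0 < a.re → (u = I ∨ u = -I) → ∀ t : ℝ, a + t * u ≠ 0 :=
    fun ha hu t => add_mul_ne_zero ha.ne' hu t
  have hnorm : ∀ {u : ℂ}, (u = I ∨ u = -I) → ‖u‖ = 1 := by rintro u (rfl | rfl) <;> simp
  refine integral_of_hasDerivAt_of_tendsto (fun t => (hd ha hu t).sub (hd hb hv t)) ?_
    (((hbot a hu).sub (hbot b hv)).congr fun t => by simp)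
    (((htop a hu).sub (htop b hv)).congr fun t => by simp)
  refine integrable_of_norm_le_div_one_add_sq (C := ‖u * b - v * a‖ *
    ((1 + (1 + ‖a‖) / |a.re|) * (1 + (1 + ‖b‖) / |b.re|))) ?_ fun t => ?_
  · exact (continuous_const.div (by fun_prop) (hne ha hu)).sub
      (continuous_const.div (by fun_prop) (hne hb hv))
  · have e : u / (a + t * u) - v / (b + t * v) =
        (u * b - v * a) / ((a + t * u) * (b + t * v)) := by
      have h1 := hne ha hu t
      have h2 := hne hb hv t
      rw [div_sub_div _ _ h1 h2]
      congr 1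
      ring
    have h1 := one_add_abs_le_norm_add ha.ne' hu t
    have h2 := one_add_abs_le_norm_add hb.ne' hv t
    have h3 : 1 + t ^ 2 ≤ (1 + |t|) * (1 + |t|) := by
      rw [← sq_abs]; nlinarith [abs_nonneg t]
    rw [e, norm_div, norm_mul (a + t * u), div_le_div_iff₀ (mul_pos (norm_pos_iff.2 (hne ha hu t))
      (norm_pos_iff.2 (hne hb hv t))) (by positivity), mul_assoc]
    refine mul_le_mul_of_nonneg_left (h3.trans ((mul_le_mul h1 h2 (by positivity)
      (by positivity)).trans (le_of_eq ?_))) (norm_nonneg _)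
    ring

theorem norm_inv_add_mul_I_le {a : ℂ} (ha : a.re ≠ 0) (t : ℝ) :
    ‖(a + t * I)⁻¹‖ ≤ (1 + (1 + ‖a‖) / |a.re|) / (1 + |t|) := by
  rw [norm_inv, inv_le_comm₀ (norm_pos_iff.2 (add_mul_ne_zero ha (Or.inl rfl) t)) (by positivity),
    inv_div, div_le_iff₀ (by positivity), mul_comm]
  exact one_add_abs_le_norm_add ha (Or.inl rfl) t

theorem integrable_inv_pow {a : ℂ} (ha : a.re ≠ 0) (m : ℕ) :
    Integrable fun t : ℝ => ((a + t * I) ^ (m + 2))⁻¹ := by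
  refine integrable_of_norm_le_div_one_add_sq (C := (1 + (1 + ‖a‖) / |a.re|) ^ (m + 2))
    (Continuous.inv₀ (by fun_prop) fun t =>
      pow_ne_zero _ (add_mul_ne_zero ha (Or.inl rfl) t)) fun t => ?_
  rw [← inv_pow, norm_pow]
  refine (pow_le_pow_left₀ (norm_nonneg _) (norm_inv_add_mul_I_le ha t) _).trans ?_
  rw [div_pow]
  refine div_le_div_of_nonneg_left (by positivity) (by positivity) ?_
  have h1 : 1 ≤ 1 + |t| := by linarith [abs_nonneg t]
  refine le_trans ?_ (pow_le_pow_right₀ h1 (Nat.le_add_left 2 m))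
  nlinarith [abs_nonneg t, sq_abs t]

theorem integral_inv_pow_eq_zero {a : ℂ} (ha : a.re ≠ 0) (m : ℕ) :
    ∫ t : ℝ, ((a + t * I) ^ (m + 2))⁻¹ = 0 := by
  have hne : ∀ t : ℝ, a + t * I ≠ 0 := add_mul_ne_zero ha (Or.inl rfl)
  have h0 : ∀ l : Filter ℝ, Tendsto (fun t : ℝ => |t|) l atTop →
      Tendsto (fun t : ℝ => -(((m : ℂ) + 1) * I)⁻¹ * ((a + t * I)⁻¹) ^ (m + 1)) l (𝓝 0) := by
    intro l hl
    have h1 : Tendsto (fun t : ℝ => (1 + (1 + ‖a‖) / |a.re|) / (1 + |t|)) l (𝓝 0) :=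
      tendsto_const_nhds.div_atTop (tendsto_atTop_add_const_left _ _ hl)
    have h2 := ((squeeze_zero_norm (norm_inv_add_mul_I_le ha) h1).pow (m + 1)).const_mul (-(((m : ℂ) + 1) * I)⁻¹)
    simpa using h2
  have hd : ∀ t : ℝ, HasDerivAt
      (fun t : ℝ => -(((m : ℂ) + 1) * I)⁻¹ * ((a + t * I)⁻¹) ^ (m + 1))
      (((a + t * I) ^ (m + 2))⁻¹) t := by
    intro t
    have h1 : HasDerivAt (fun t : ℝ => a + t * I) I t := by
      simpa using ((hasDerivAt_id t).ofReal_comp.mul_const I).const_add a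
    refine (((h1.fun_inv (hne t)).fun_pow (m + 1)).const_mul (-(((m : ℂ) + 1) * I)⁻¹)).congr_deriv ?_
    have h2 : (m : ℂ) + 1 ≠ 0 := Nat.cast_add_one_ne_zero m
    have h3 := hne t
    have h4 := I_ne_zero
    push_cast
    rw [inv_pow]
    field_simp
    ring
  have := integral_of_hasDerivAt_of_tendsto hd (integrable_inv_pow ha m) (h0 _ tendsto_abs_atBot_atTop)
    (h0 _ tendsto_abs_atTop_atTop)
  simpa using this

end LineIntegrals

section Residue

theorem DiffContOnCl.dslope_unitStrip {h : ℂ → ℂ} (hh : DiffContOnCl ℂ h unitStrip) (z : unitStrip) :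
    DiffContOnCl ℂ (dslope h z) unitStrip := by
  have hnz : (closedUnitStrip : Set ℂ) ∈ 𝓝 (z : ℂ) :=
    mem_of_superset (isOpen_unitStrip.mem_nhds z.2) unitStrip_subset
  refine ⟨(Complex.differentiableOn_dslope (isOpen_unitStrip.mem_nhds z.2)).2 hh.differentiableOn,
    closure_unitStrip ▸ (continuousOn_dslope hnz).2 ⟨hh.continuousOn_closedUnitStrip,
      (hh.analyticAt_unitStrip z.2).differentiableAt⟩⟩

theorem exists_norm_add_one_le (z : unitStrip) {r : ℝ} (hr : 0 < r) :
    ∃ D : ℝ, 0 < D ∧ ∀ w : ℂ, w ∉ Metric.closedBall (z : ℂ) r → ‖w + 1‖ ≤ D * ‖w - z‖ := by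
  refine ⟨1 + ‖(z : ℂ) + 1‖ / r, by positivity, fun w hw => ?_⟩
  rw [Metric.mem_closedBall, not_le, dist_eq_norm] at hw
  rw [add_mul, one_mul]
  calc ‖w + 1‖ = ‖(w - z) + (z + 1)‖ := by ring_nf
    _ ≤ ‖w - z‖ + ‖(z : ℂ) + 1‖ := norm_add_le _ _
    _ ≤ ‖w - z‖ + ‖(z : ℂ) + 1‖ / r * ‖w - z‖ := by
      gcongr
      rw [div_mul_eq_mul_div, le_div_iff₀ hr]
      exact mul_le_mul_of_nonneg_left hw.le (norm_nonneg _)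

/-- Away from `z` dividing by `w - z` is as good as dividing by `w + 1`, so the divided slope gains
one order of decay; near `z` compactness suffices. -/
theorem exists_norm_dslope_le {h : ℂ → ℂ} (hh : DiffContOnCl ℂ h unitStrip) (z : unitStrip) {C : ℝ}
    (k : ℕ) (hC : ∀ w ∈ closedUnitStrip, ‖h w - h z‖ ≤ C / ‖w + 1‖ ^ k) :
    ∃ C' : ℝ, ∀ w ∈ closedUnitStrip, ‖dslope h z w‖ ≤ C' / ‖w + 1‖ ^ (k + 1) := by
  obtain ⟨r, hr, hball⟩ := exists_closedBall_subset_unitStrip z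
  obtain ⟨D, hD, hfar⟩ := exists_norm_add_one_le z hr
  have hc : ContinuousOn (fun w => (w + 1) ^ (k + 1) * dslope h z w) closedUnitStrip :=
    (Continuous.continuousOn (by fun_prop)).mul (hh.dslope_unitStrip z).continuousOn_closedUnitStrip
  obtain ⟨B, hB⟩ := (isCompact_closedBall (z : ℂ) r).exists_bound_of_continuousOn
    (hc.mono (hball.trans unitStrip_subset))
  refine ⟨max B (D * C), fun w hw => ?_⟩
  have hp : 0 < ‖w + 1‖ := one_pos.trans_le (one_le_norm_add_one hw)
  rw [le_div_iff₀ (by positivity)]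
  by_cases hwb : w ∈ Metric.closedBall (z : ℂ) r
  · refine le_trans (le_of_eq ?_) ((hB w hwb).trans (le_max_left _ _))
    rw [norm_mul, norm_pow, mul_comm]
  · refine le_trans ?_ (le_max_right _ _)
    have hne : w ≠ z := fun h => hwb (h ▸ Metric.mem_closedBall_self hr.le)
    have hp' : 0 < ‖w - z‖ := norm_pos_iff.2 (sub_ne_zero.2 hne)
    have h1 := hC w hw
    rw [le_div_iff₀ (by positivity)] at h1
    rw [dslope_of_ne _ hne, slope_def_field, norm_div, div_mul_eq_mul_div, div_le_iff₀ hp', pow_succ]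
    calc ‖h w - h z‖ * (‖w + 1‖ ^ k * ‖w + 1‖) = ‖h w - h z‖ * ‖w + 1‖ ^ k * ‖w + 1‖ := by ring
      _ ≤ C * (D * ‖w - z‖) := mul_le_mul h1 (hfar w hwb) (norm_nonneg _)
          ((mul_nonneg (norm_nonneg _) (by positivity)).trans h1)
      _ = _ := by ring

theorem one_add_im_sq_le {w : ℂ} (hw : w ∈ closedUnitStrip) : 1 + w.im ^ 2 ≤ ‖w + 1‖ ^ 2 := by
  rw [← normSq_eq_norm_sq, normSq_apply]
  simp only [add_re, one_re, add_im, one_im, add_zero]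
  nlinarith [hw.1, sq_nonneg w.im]

theorem left_sub_ne_zero (z : unitStrip) (t : ℝ) : (t * I - z : ℂ) ≠ 0 := fun h => by
  have := congrArg re h
  simp at this
  linarith [z.2.1]

theorem right_sub_ne_zero (z : unitStrip) (t : ℝ) : (1 + t * I - z : ℂ) ≠ 0 := fun h => by
  have := congrArg re h
  simp at this
  linarith [z.2.2]

theorem exists_norm_inv_sub_le (z : unitStrip) : ∃ D : ℝ, 0 < D ∧
    ∀ t : ℝ, ‖(t * I - z : ℂ)⁻¹‖ ≤ D / ‖(t * I + 1 : ℂ)‖ ∧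
      ‖(1 + t * I - z : ℂ)⁻¹‖ ≤ D / ‖(1 + t * I + 1 : ℂ)‖ := by
  obtain ⟨r, hr, hball⟩ := exists_closedBall_subset_unitStrip z
  obtain ⟨D, hD, h⟩ := exists_norm_add_one_le z hr
  refine ⟨D, hD, fun t => ⟨?_, ?_⟩⟩
  · have h1 := h (t * I) fun hm => by simpa using (hball hm).1
    rw [norm_inv, le_div_iff₀ (one_pos.trans_le (one_le_norm_add_one (left_mem_closedUnitStrip t))),
      inv_mul_le_iff₀ (norm_pos_iff.2 (left_sub_ne_zero z t)), mul_comm ‖_‖ D]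
    exact h1
  · have h1 := h (1 + t * I) fun hm => by simpa using (hball hm).2
    rw [norm_inv, le_div_iff₀ (one_pos.trans_le (one_le_norm_add_one (right_mem_closedUnitStrip t))),
      inv_mul_le_iff₀ (norm_pos_iff.2 (right_sub_ne_zero z t)), mul_comm ‖_‖ D]
    exact h1

variable {h : ℂ → ℂ} {C : ℝ}

theorem integrable_div_sub (hh : DiffContOnCl ℂ h unitStrip)
    (hC : ∀ w ∈ closedUnitStrip, ‖h w‖ ≤ C / ‖w + 1‖) (z : unitStrip) (m : ℕ) :
    (Integrable fun t : ℝ => h (t * I) / (t * I - z) ^ (m + 1)) ∧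
      Integrable fun t : ℝ => h (1 + t * I) / (1 + t * I - z) ^ (m + 1) := by
  obtain ⟨D, hD, hinv⟩ := exists_norm_inv_sub_le z
  have key : ∀ (w : ℂ), w ∈ closedUnitStrip → ‖(w - z)⁻¹‖ ≤ D / ‖w + 1‖ →
      ‖h w / (w - z) ^ (m + 1)‖ ≤ C * D ^ (m + 1) / (1 + w.im ^ 2) := by
    intro w hw hi
    have h1 := one_le_norm_add_one hw
    have hp := one_pos.trans_le h1
    have hC0 : 0 ≤ C := by
      have := (norm_nonneg _).trans (hC w hw)
      rw [le_div_iff₀ hp, zero_mul] at this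
      exact this
    rw [div_eq_mul_inv, ← inv_pow, norm_mul, norm_pow]
    calc ‖h w‖ * ‖(w - z)⁻¹‖ ^ (m + 1) ≤ C / ‖w + 1‖ * (D / ‖w + 1‖) ^ (m + 1) := by
          gcongr
          exact hC w hw
      _ = C * D ^ (m + 1) / ‖w + 1‖ ^ (m + 2) := by rw [div_pow]; field_simp; ring
      _ ≤ C * D ^ (m + 1) / (1 + w.im ^ 2) := by
          refine div_le_div_of_nonneg_left (by positivity) (by positivity) ?_
          exact (one_add_im_sq_le hw).trans (pow_le_pow_right₀ h1 (Nat.le_add_left 2 m))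
  refine ⟨integrable_of_norm_le_div_one_add_sq (C := C * D ^ (m + 1))
    (hh.continuous_left.div (by fun_prop) fun t => pow_ne_zero _ (left_sub_ne_zero z t)) fun t => ?_,
    integrable_of_norm_le_div_one_add_sq (C := C * D ^ (m + 1))
    (hh.continuous_right.div (by fun_prop) fun t => pow_ne_zero _ (right_sub_ne_zero z t))
      fun t => ?_⟩
  · simpa using key _ (left_mem_closedUnitStrip t) (hinv t).1
  · simpa using key _ (right_mem_closedUnitStrip t) (hinv t).2

/-- The integrand is `1 / (w - z) - 1 / (w + 1)`. The left line separates the poles `z` and `-1`,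
while the right line has both on the same side; the logarithms of `±I` give the values. -/
theorem integral_inv_add_one_div_sub (z : unitStrip) :
    (∫ t : ℝ, ((z : ℂ) + 1) / (t * I + 1) / (t * I - z)) = -(2 * Real.pi) ∧
      (∫ t : ℝ, ((z : ℂ) + 1) / (1 + t * I + 1) / (1 + t * I - z)) = 0 := by
  constructor
  · have h1 := integral_div_add_sub_div_add (a := z) (b := 1) (u := -I) (v := I) z.2.1 (by simp)
      (Or.inr rfl) (Or.inl rfl)
    rw [neg_neg, log_neg_I, log_I] at h1
    have h2 : ∀ t : ℝ, -I / (z + t * -I) - I / (1 + t * I) =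
        I * (((z : ℂ) + 1) / (t * I + 1) / (t * I - z)) := by
      intro t
      have n1 := left_sub_ne_zero z t
      have n2 : (t * I + 1 : ℂ) ≠ 0 := add_one_ne_zero_of_mem (left_mem_closedUnitStrip t)
      have n3 : (z + t * -I : ℂ) ≠ 0 := fun h => n1 (by linear_combination -h)
      have n4 : (1 + t * I : ℂ) ≠ 0 := by rwa [add_comm]
      rw [div_div, div_sub_div _ _ n3 n4, mul_div_assoc', div_eq_div_iff (mul_ne_zero n3 n4)
        (mul_ne_zero n2 n1)]
      ring
    simp only [h2] at h1
    rw [integral_const_mul] at h1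
    have h3 := congrArg (fun x => -I * x) h1
    simp only [← mul_assoc, neg_mul, I_mul_I, neg_neg, one_mul] at h3
    rw [h3]
    linear_combination (-2 * (Real.pi : ℂ)) * -I_mul_I
  · have h1 := integral_div_add_sub_div_add (a := 1 - z) (b := 2) (u := I) (v := I)
      (by simpa using z.2.2) (by simp) (Or.inl rfl) (Or.inl rfl)
    have h2 : ∀ t : ℝ, I / (1 - z + t * I) - I / (2 + t * I) =
        I * (((z : ℂ) + 1) / (1 + t * I + 1) / (1 + t * I - z)) := by
      intro t
      have n1 := right_sub_ne_zero z t
      have n2 : (1 + t * I + 1 : ℂ) ≠ 0 := add_one_ne_zero_of_mem (right_mem_closedUnitStrip t)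
      have n3 : (1 - z + t * I : ℂ) ≠ 0 := fun h => n1 (by linear_combination h)
      have n4 : (2 + t * I : ℂ) ≠ 0 := fun h => n2 (by linear_combination h)
      rw [div_div, div_sub_div _ _ n3 n4, mul_div_assoc', div_eq_div_iff (mul_ne_zero n3 n4)
        (mul_ne_zero n2 n1)]
      ring
    simp only [h2] at h1
    rw [integral_const_mul] at h1
    simpa using h1

/-- Cauchy's formula on the strip, for Taylor coefficients. -/
theorem taylorCoeff_eq_integral (hh : DiffContOnCl ℂ h unitStrip)
    (hC : ∀ w ∈ closedUnitStrip, ‖h w‖ ≤ C / ‖w + 1‖) (z : unitStrip) (m : ℕ) :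
    2 * Real.pi * taylorCoeff m h z = (∫ t : ℝ, h (1 + t * I) / (1 + t * I - z) ^ (m + 1)) -
      ∫ t : ℝ, h (t * I) / (t * I - z) ^ (m + 1) := by
  induction m generalizing h C with
  | zero =>
    -- Subtracting `h z` times the reference function `r`, which is `1` at `z`, leaves a function
    -- vanishing at `z`. Its quotient by `w - z` decays to second order, so its integrals over the
    -- two lines agree.
    set r : ℂ → ℂ := fun w => ((z : ℂ) + 1) / (w + 1) with hr
    have hrd : DiffContOnCl ℂ r unitStrip := diffContOnCl_of_differentiableAt fun w hw =>
      (differentiableAt_const _).div (by fun_prop) (add_one_ne_zero_of_mem hw)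
    have hrb : ∀ w ∈ closedUnitStrip, ‖r w‖ ≤ ‖(z : ℂ) + 1‖ / ‖w + 1‖ := fun w hw => by
      rw [hr, norm_div]
    have hrz : r z = 1 := div_self (add_one_ne_zero_of_mem (unitStrip_subset z.2))
    set g : ℂ → ℂ := fun w => h w - h z * r w with hg
    have hgd : DiffContOnCl ℂ g unitStrip := hh.sub (hrd.const_smul (h z))
    have hgz : g z = 0 := by simp [hg, hrz]
    have hgb : ∀ w ∈ closedUnitStrip, ‖g w - g z‖ ≤ (C + ‖h z‖ * ‖(z : ℂ) + 1‖) / ‖w + 1‖ ^ 1 := by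
      intro w hw
      rw [hgz, sub_zero, pow_one, add_div, mul_div_assoc]
      refine (norm_sub_le _ _).trans (add_le_add (hC w hw) ?_)
      rw [norm_mul]
      exact mul_le_mul_of_nonneg_left (hrb w hw) (norm_nonneg _)
    obtain ⟨C', hC'⟩ := exists_norm_dslope_le hgd z 1 hgb
    have hC'0 : 0 ≤ C' := by
      have h1 := hC' 0 (by simp)
      simp at h1
      exact (norm_nonneg _).trans h1
    have hlr := integral_left_eq_integral_right (hgd.dslope_unitStrip z) fun w hw =>
      (hC' w hw).trans (div_le_div_of_nonneg_left hC'0 (by positivity) (one_add_im_sq_le hw))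
    have hsl : ∀ w : ℂ, w - z ≠ 0 → dslope g z w = h w / (w - z) - h z * (r w / (w - z)) := by
      intro w hw
      rw [dslope_of_ne _ (sub_ne_zero.1 hw), slope_def_field, hgz, sub_zero, hg]
      ring
    have i1 := integrable_div_sub hh hC z 0
    have i2 := integrable_div_sub hrd hrb z 0
    simp only [zero_add, pow_one] at i1 i2 ⊢
    simp only [hsl _ (left_sub_ne_zero z _), hsl _ (right_sub_ne_zero z _)] at hlr
    rw [integral_sub i1.1 (i2.1.const_mul _), integral_sub i1.2 (i2.2.const_mul _),
      integral_const_mul, integral_const_mul, (integral_inv_add_one_div_sub z).1,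
      (integral_inv_add_one_div_sub z).2] at hlr
    have e : taylorCoeff 0 h z = h z := by simp [taylorCoeff]
    rw [e]
    linear_combination hlr
  | succ m ih =>
    have hC0 : 0 ≤ C := by
      have h1 := (norm_nonneg _).trans (hC 0 (by simp))
      simpa using h1
    have hb : ∀ w ∈ closedUnitStrip, ‖h w‖ ≤ C := fun w hw =>
      (hC w hw).trans (div_le_self hC0 (one_le_norm_add_one hw))
    obtain ⟨C', hC'⟩ := exists_norm_dslope_le hh z (C := 2 * C) 0 fun w hw => by
      have h1 := norm_sub_le (h w) (h z)
      have h2 := hb w hw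
      have h3 := hb z (unitStrip_subset z.2)
      rw [pow_zero, div_one]
      linarith
    simp only [zero_add, pow_one] at hC'
    -- The divided slope decays even if `h - h z` does not. The constant `h z` only contributes
    -- integrals of `(w - z) ^ (-(m + 2))`, which vanish on each line.
    rw [taylorCoeff_succ_eq_dslope (hh.analyticAt_unitStrip z.2), ih (hh.dslope_unitStrip z) hC']
    have hsl : ∀ w : ℂ, w - z ≠ 0 → dslope h z w / (w - z) ^ (m + 1) =
        h w / (w - z) ^ (m + 2) - h z * ((w - z) ^ (m + 2))⁻¹ := by
      intro w hw
      rw [dslope_of_ne _ (sub_ne_zero.1 hw), slope_def_field]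
      field_simp
      ring
    simp only [hsl _ (left_sub_ne_zero z _), hsl _ (right_sub_ne_zero z _)]
    have i1 := integrable_div_sub hh hC z (m + 1)
    have e0 : ∀ t : ℝ, (t * I - z : ℂ) = -z + t * I := fun t => by ring
    have e1 : ∀ t : ℝ, (1 + t * I - z : ℂ) = 1 - z + t * I := fun t => by ring
    have n0 : (-(z : ℂ)).re ≠ 0 := by simpa using z.2.1.ne'
    have n1 : (1 - (z : ℂ)).re ≠ 0 := by simpa using (sub_pos.2 z.2.2).ne'
    have v0 := integral_inv_pow_eq_zero n0 m
    have v1 := integral_inv_pow_eq_zero n1 m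
    have j0 := integrable_inv_pow n0 m
    have j1 := integrable_inv_pow n1 m
    simp only [← e0] at v0 j0
    simp only [← e1] at v1 j1
    rw [integral_sub i1.2 (j1.const_mul _), integral_sub i1.1 (j0.const_mul _),
      integral_const_mul, integral_const_mul, v0, v1, mul_zero, sub_zero, sub_zero]

end Residue

/-! ### Gaussian averages of operators. -/

section KernelDensity

variable {Y : Type*} [NormedAddCommGroup Y] [NormedSpace ℂ Y] {n : ℕ} {z : ℂ} {a δ M : ℝ}
  {l : ℝ → Y}

/-- The density of the operator with kernel `zeroKer` on a vertical line. -/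
def kernelDensity (n : ℕ) (z : ℂ) (a : ℝ) (l : ℝ → Y) (s : ℝ) : Y :=
  ((stripLine a s - z) ^ n * (stripWeight n s : ℂ)) • l s

theorem norm_kernelDensity_le (ha : a ∈ Icc (0 : ℝ) 1) (hM : ∀ t, ‖l t‖ ≤ M) (n : ℕ) (z : ℂ)
    (s : ℝ) : ‖kernelDensity n z a l s‖ ≤ (‖z‖ + 3) ^ n * M := by
  have h1 := norm_sub_pow_mul_stripWeight_le n z (mem_closedUnitStrip_stripLine ha s)
  rw [im_stripLine] at h1
  rw [kernelDensity, norm_smul, norm_mul, Complex.norm_real, Real.norm_of_nonneg (stripWeight_pos n s).le]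
  exact mul_le_mul h1 (hM s) (norm_nonneg _) (by positivity)

theorem stronglyMeasurable_kernelDensity (hl : StronglyMeasurable l) (n : ℕ) (z : ℂ) (a : ℝ) :
    StronglyMeasurable (kernelDensity n z a l) := by
  have h : Continuous fun s => (stripLine a s - z) ^ n * (stripWeight n s : ℂ) :=
    (by fun_prop : Continuous fun s => (stripLine a s - z) ^ n).mul
      (continuous_ofReal.comp (continuous_stripWeight n))
  exact h.stronglyMeasurable.smul hl

/-- The zero of the kernel and the weight of the measure depend only on the integration variable and
are absorbed in the density; a pure Gaussian convolution remains. -/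
theorem apply_zeroKerL1_eq_gaussConv [CompleteSpace Y] (hn : 1 ≤ n) (hδ : 0 < δ)
    (ha : a ∈ Icc (0 : ℝ) 1) {S : Lp ℂ 1 (stripMeasure n) →L[ℂ] Y}
    (hS : ∀ u, S u = ∫ t, u t • l t ∂stripMeasure n) (t : ℝ) :
    S (zeroKerL1 hn hδ ha z (stripLine a t)) = gaussConv δ (kernelDensity n z a l) t := by
  rw [hS, gaussConv, ← integral_gaussKer_smul hδ]
  have h : ∫ s, zeroKerL1 hn hδ ha z (stripLine a t) s • l s ∂stripMeasure n =
      ∫ s, zeroKer n z δ (stripLine a t) (stripLine a s) • l s ∂stripMeasure n := by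
    refine integral_congr_ae ?_
    filter_upwards [coeFn_zeroKerL1 hn hδ ha z (stripLine a t)] with s hs
    rw [hs]
  rw [h, integral_stripMeasure]
  refine integral_congr_ae (ae_of_all _ fun s => ?_)
  have e : stripLine a s - stripLine a t = s * I - t * I := by simp [stripLine]
  simp only [zeroKer, kernelDensity, e, smul_smul]
  rw [← Complex.coe_smul, smul_smul]
  congr 1
  ring

theorem tendsto_integral_mul_gaussConv (hn : 1 ≤ n) {κ : ℝ → ℂ} (hκ : StronglyMeasurable κ)
    (hM : ∀ t, ‖κ t‖ ≤ M) {q : ℝ → ℂ} (hq : Continuous q) {C : ℝ}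
    (hC : ∀ t, ‖q t‖ ≤ C * stripWeight n t) {δ : ℕ → ℝ} (hδ : ∀ m, 0 < δ m)
    (hδ0 : Tendsto δ atTop (𝓝 0)) :
    Tendsto (fun m => ∫ t, q t * gaussConv (δ m) κ t) atTop (𝓝 (∫ t, q t * κ t)) := by
  have hC0 : 0 ≤ C := by
    have h1 := (norm_nonneg _).trans (hC 0)
    exact nonneg_of_mul_nonneg_left h1 (stripWeight_pos n 0)
  have hi : ∀ {k : ℝ → ℂ} {M : ℝ}, StronglyMeasurable k → (∀ t, ‖k t‖ ≤ M) →
      Integrable fun t => q t * k t := fun {k M} hk hM => by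
    refine (((integrable_stripWeight hn).const_mul C).mul_const M).mono'
      (hq.aestronglyMeasurable.mul hk.aestronglyMeasurable) (ae_of_all _ fun t => ?_)
    rw [norm_mul]
    exact mul_le_mul (hC t) (hM t) (norm_nonneg _) (mul_nonneg hC0 (stripWeight_pos n t).le)
  refine Metric.tendsto_atTop.2 fun ε hε => ?_
  obtain ⟨δ₀, hδ₀, h⟩ := exists_integral_gaussConv_sub_le hn hκ hM
    (show 0 < ε / (2 * (C + 1)) by positivity)
  obtain ⟨N, hN⟩ := (hδ0.eventually_lt_const hδ₀).exists_forall_of_atTop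
  refine ⟨N, fun m hm => ?_⟩
  rw [dist_eq_norm, ← integral_sub (hi (stronglyMeasurable_gaussConv hκ _) (norm_gaussConv_le hM _))
    (hi hκ hM)]
  have hdiff := integrable_stripWeight_mul_norm hn ((stronglyMeasurable_gaussConv hκ (δ m)).sub hκ)
    (fun t => (norm_sub_le _ _).trans (add_le_add (norm_gaussConv_le hM (δ m) t) (hM t)))
  refine (norm_integral_le_of_norm_le (hdiff.const_mul C) (ae_of_all _ fun t => ?_)).trans_lt ?_
  · rw [← mul_sub, norm_mul, ← mul_assoc]
    exact mul_le_mul_of_nonneg_right (hC t) (norm_nonneg _)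
  · rw [integral_const_mul]
    refine (mul_le_mul_of_nonneg_left (h (δ m) (hδ m) (hN m hm)) hC0).trans_lt ?_
    have e : (C + 1) * (ε / (2 * (C + 1))) = ε / 2 := by field_simp
    have := show 0 < ε / (2 * (C + 1)) by positivity
    nlinarith

end KernelDensity

/-- A monomial `(w - z) ^ k` cut off by a function that equals `1` up to the order `n` at `z`. -/
def cutMonomial (n : ℕ) (z : ℂ) (k : ℕ) (w : ℂ) : ℂ :=
  stripCut n z w ^ (2 * n) * stripMonomial n z k w

theorem differentiableAt_cutMonomial (n : ℕ) (z : ℂ) (k : ℕ) {w : ℂ} (hw : w ∈ closedUnitStrip) :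
    DifferentiableAt ℂ (cutMonomial n z k) w :=
  ((differentiableAt_stripCut n z hw).pow _).mul (differentiableAt_stripMonomial n z k hw)

/-- The factor `stripCut ^ (2 n)` supplies the weight, the monomial and `(w - z) ^ (-n)` being
bounded on the boundary lines. -/
theorem exists_norm_cutMonomial_le (n : ℕ) (z : unitStrip) : ∃ C : ℝ, 0 < C ∧ ∀ k < n,
    (∀ w ∈ closedUnitStrip, ‖cutMonomial n z k w‖ ≤ C / ‖w + 1‖) ∧
    (∀ t : ℝ, ‖cutMonomial n z k (t * I) / (t * I - z) ^ n‖ ≤ C * stripWeight n t) ∧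
    ∀ t : ℝ, ‖cutMonomial n z k (1 + t * I) / (1 + t * I - z) ^ n‖ ≤ C * stripWeight n t := by
  obtain ⟨C, hC, h⟩ := exists_norm_stripMonomial_le n z
  obtain ⟨B, hB, hb, h0, h1, -⟩ := exists_norm_stripCut_pow_le n z
  obtain ⟨D, hD, hd⟩ := exists_norm_inv_sub_le z
  have hpt : ∀ k < n, ∀ w ∈ closedUnitStrip, ∀ t : ℝ, ‖stripCut n z w ^ (2 * n)‖ ≤
      B * stripWeight n t → ‖(w - z)⁻¹‖ ≤ D / ‖w + 1‖ →
      ‖cutMonomial n z k w / (w - z) ^ n‖ ≤ B * C * (1 + D ^ n) * stripWeight n t := by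
    intro k hk w hw t hs hi
    have e1 := (h k hk w hw).trans (div_le_self hC.le (one_le_norm_add_one hw))
    have e2 := hi.trans (div_le_self hD.le (one_le_norm_add_one hw))
    have e3 := pow_le_pow_left₀ (norm_nonneg _) e2 n
    have hp := (stripWeight_pos n t).le
    rw [cutMonomial, div_eq_mul_inv, ← inv_pow, norm_mul, norm_mul, norm_pow (w - (z : ℂ))⁻¹]
    calc _ ≤ B * stripWeight n t * C * (1 + D ^ n) := by
          gcongr
          linarith
      _ = _ := by ring
  refine ⟨B * C * (1 + D ^ n), by positivity, fun k hk => ⟨fun w hw => ?_, fun t =>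
    hpt k hk _ (left_mem_closedUnitStrip t) t (h0 t) (hd t).1, fun t =>
    hpt k hk _ (right_mem_closedUnitStrip t) t (h1 t) (hd t).2⟩⟩
  rw [cutMonomial, norm_mul]
  refine (mul_le_mul (hb w hw) (h k hk w hw) (norm_nonneg _) hB.le).trans ?_
  rw [← mul_div_assoc]
  refine div_le_div_of_nonneg_right ?_ (norm_nonneg _)
  exact le_mul_of_one_le_right (by positivity) (by linarith [pow_pos hD n])

theorem taylorCoeff_cutMonomial {n : ℕ} {z : ℂ} (hz : z ∈ unitStrip) (k : ℕ) {i : ℕ}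
    (hi : i < n) : taylorCoeff i (cutMonomial n z k) z = if i = k then 1 else 0 := by
  obtain ⟨χ, hχ, h⟩ := exists_stripCut_pow_eq n (2 * n) hz
  rw [← taylorCoeff_stripMonomial hz k hi]
  exact taylorCoeff_smul_eq_of_eq_one_add hχ h
    ((diffContOnCl_of_differentiableAt fun w hw =>
      differentiableAt_stripMonomial n z k hw).analyticAt_unitStrip hz) hi

/-! ### Approximation of functionals by jets of the dual couple. -/

namespace BanachCouple

variable {X₀ X₁ E : Type*}
  [NormedAddCommGroup X₀] [NormedSpace ℂ X₀] [NormedAddCommGroup X₁] [NormedSpace ℂ X₁]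
  [NormedAddCommGroup E] [NormedSpace ℂ E]
  {c : BanachCouple X₀ X₁ E} {hc : c.IsRegular} {n : ℕ} {z : unitStrip}

/-- The operators `-S₀` and `S₁` agree on the kernels `zeroKer`. -/
def IsKernelPair (c : BanachCouple X₀ X₁ E) (hn : 1 ≤ n) (z : unitStrip)
    (S₀ : Lp ℂ 1 (stripMeasure n) →L[ℂ] StrongDual ℂ X₀)
    (S₁ : Lp ℂ 1 (stripMeasure n) →L[ℂ] StrongDual ℂ X₁) : Prop :=
  ∀ (δ : ℝ) (hδ : 0 < δ) (w : ℂ) (x : c.inter),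
    S₀ (zeroKerL1 hn hδ unitInterval.zero_mem z w) (c.interTo₀ x) +
      S₁ (zeroKerL1 hn hδ unitInterval.one_mem z w) (c.interTo₁ x) = 0

section KernelLift

variable {hn : 1 ≤ n} {S₀ : Lp ℂ 1 (stripMeasure n) →L[ℂ] StrongDual ℂ X₀}
  {S₁ : Lp ℂ 1 (stripMeasure n) →L[ℂ] StrongDual ℂ X₁}

theorem norm_smul_apply_zeroKerL1_le {Y : Type*} [NormedAddCommGroup Y] [NormedSpace ℂ Y]
    (S : Lp ℂ 1 (stripMeasure n) →L[ℂ] Y) {δ a : ℝ} (hδ : 0 < δ) (ha : a ∈ Icc (0 : ℝ) 1) {b : ℂ}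
    (hb : ‖b‖ ≤ 2 * Real.pi) (z : ℂ) (t : ℝ) :
    ‖b • S (zeroKerL1 hn hδ ha z (stripLine a t))‖ ≤ 2 * Real.pi * (‖S‖ * (‖z‖ + 3) ^ n) := by
  have h := norm_zeroKerL1_le hn hδ ha z (stripLine a t)
  rw [re_stripLine, sub_self, zero_pow two_ne_zero, zero_div, Real.exp_zero, mul_one] at h
  rw [norm_smul]
  exact mul_le_mul hb ((S.le_opNorm _).trans (mul_le_mul_of_nonneg_left h (norm_nonneg _)))
    (norm_nonneg _) Real.two_pi_pos.le

theorem norm_two_pi : ‖(2 * Real.pi : ℂ)‖ = 2 * Real.pi := by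
  rw [← ofReal_ofNat, ← ofReal_mul, Complex.norm_real, Real.norm_of_nonneg Real.two_pi_pos.le]

theorem continuous_apply_zeroKerL1 {Y : Type*} [NormedAddCommGroup Y] [NormedSpace ℂ Y]
    (S : Lp ℂ 1 (stripMeasure n) →L[ℂ] Y) {δ a : ℝ} (hδ : 0 < δ) (ha : a ∈ Icc (0 : ℝ) 1) (b z : ℂ) :
    Continuous fun t => b • S (zeroKerL1 hn hδ ha z (stripLine a t)) :=
  (S.continuous.comp ((continuous_zeroKerL1 hn hδ ha z).comp (continuous_stripLine a))).const_smul b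

/-- The analytic function with boundary values `-2π S₀ (K)` and `2π S₁ (K)`, where `K` is the
Gaussian kernel `zeroKer`. -/
def kernelLift (hc : c.IsRegular) (h : IsKernelPair c hn z S₀ S₁) {δ : ℝ} (hδ : 0 < δ) :
    (c.dual hc).Calderon :=
  Calderon.ofBdry
    -- The factor `2π` cancels the one in Cauchy's formula, and the opposite signs on the two lines
    -- are those of its two integrals.
    (fun w => (c.dual hc).i₀ (-(2 * Real.pi : ℂ) • S₀ (zeroKerL1 hn hδ unitInterval.zero_mem z w)))
    (Differentiable.diffContOnCl ((c.dual hc).i₀.differentiable.comp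
      ((S₀.differentiable.comp (differentiable_zeroKerL1 hn hδ unitInterval.zero_mem z)).const_smul
        (-(2 * Real.pi : ℂ)))))
    (by
      -- This bound deteriorates as `δ` tends to `0`, but it is only qualitative; the norm is
      -- computed from the boundary values, whose bound is uniform in `δ`.
      refine ⟨‖(c.dual hc).i₀‖ * (2 * Real.pi * (‖S₀‖ * ((‖(z : ℂ)‖ + 3) ^ n *
        Real.exp (1 / δ ^ 2)))), fun w hw => ((c.dual hc).i₀.le_opNorm _).trans
          (mul_le_mul_of_nonneg_left ?_ (norm_nonneg _))⟩
      rw [norm_smul, norm_neg, norm_two_pi]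
      refine mul_le_mul_of_nonneg_left ((S₀.le_opNorm _).trans (mul_le_mul_of_nonneg_left
        ((norm_zeroKerL1_le hn hδ unitInterval.zero_mem z w).trans ?_) (norm_nonneg _)))
        Real.two_pi_pos.le
      have h1 : w.re ^ 2 ≤ 1 := pow_le_one₀ hw.1.le hw.2.le
      rw [zero_sub, neg_sq]
      gcongr)
    (BoundedContinuousFunction.ofNormedAddCommGroup
      (fun t => -(2 * Real.pi : ℂ) • S₀ (zeroKerL1 hn hδ unitInterval.zero_mem z (stripLine 0 t)))
      (continuous_apply_zeroKerL1 S₀ hδ _ _ _) _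
      (norm_smul_apply_zeroKerL1_le S₀ hδ _ (by rw [norm_neg, norm_two_pi]) z))
    (BoundedContinuousFunction.ofNormedAddCommGroup
      (fun t => (2 * Real.pi : ℂ) • S₁ (zeroKerL1 hn hδ unitInterval.one_mem z (stripLine 1 t)))
      (continuous_apply_zeroKerL1 S₁ hδ _ _ _) _
      (norm_smul_apply_zeroKerL1_le S₁ hδ _ norm_two_pi.le z))
    (fun t => by
      rw [← stripLine_zero]
      rfl)
    (fun t => by
      rw [← stripLine_one]
      refine ContinuousLinearMap.ext fun x => ?_
      have := h δ hδ (stripLine 1 t) x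
      change -(2 * Real.pi : ℂ) * S₀ (zeroKerL1 hn hδ unitInterval.zero_mem z (stripLine 1 t))
        (c.interTo₀ x) = (2 * Real.pi : ℂ) *
          S₁ (zeroKerL1 hn hδ unitInterval.one_mem z (stripLine 1 t)) (c.interTo₁ x)
      linear_combination -(2 * Real.pi : ℂ) * this)

variable (h : IsKernelPair c hn z S₀ S₁) {δ : ℝ} (hδ : 0 < δ)

theorem norm_kernelLift_le {B : ℝ} (h0 : ‖S₀‖ ≤ B) (h1 : ‖S₁‖ ≤ B) :
    ‖kernelLift hc h hδ‖ ≤ 2 * Real.pi * (B * (‖(z : ℂ)‖ + 3) ^ n) := by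
  have hB : 0 ≤ B := (norm_nonneg S₀).trans h0
  have hp := Real.pi_pos
  refine Calderon.norm_le (by positivity) (fun t => ?_) fun t => ?_
  · refine (norm_smul_apply_zeroKerL1_le S₀ hδ _ (by rw [norm_neg, norm_two_pi]) z t).trans ?_
    gcongr
  · refine (norm_smul_apply_zeroKerL1_le S₁ hδ _ norm_two_pi.le z t).trans ?_
    gcongr

end KernelLift

variable [CompleteSpace X₀] [CompleteSpace X₁] [CompleteSpace E]

theorem isInterLift_mul_constLift {A : ℝ} {φ : ℂ → ℂ} (hφ : IsStripMultiplier A φ) (x : c.inter) :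
    IsInterLift (Calderon.mul φ hφ (constLift x)) fun w => φ w • x :=
  (isInterLift_constLift x).mul hφ

theorem taylorCoeff_smul_const {V : Type*} [NormedAddCommGroup V] [NormedSpace ℂ V] [CompleteSpace V]
    {φ : ℂ → ℂ} {z : ℂ} (hφ : AnalyticAt ℂ φ z) (x : V) (k : ℕ) :
    taylorCoeff k (fun w => φ w • x) z = taylorCoeff k φ z • x :=
  taylorCoeff_clm_comp ((ContinuousLinearMap.id ℂ ℂ).smulRight x) hφ k

theorem mk_mul_eq_interJet {A : ℝ} {φ : ℂ → ℂ} (hφ : IsStripMultiplier A φ) (x : c.inter)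
    (hmem : Calderon.mul φ hφ (constLift x) ∈ c.calderonZero) :
    Rochberg.mk c.calderonZero n z ⟨_, hmem⟩ =
      c.interJet n z fun j => taylorCoeff j φ z • x := by
  rw [(isInterLift_mul_constLift hφ x).mk_eq_interJet hmem]
  congr 1
  funext j
  exact taylorCoeff_smul_const (hφ.1.analyticAt_unitStrip z.2) x j

/-- The functional `l` is represented on the functions `φ • x` by the operators `S₀` and `S₁`. -/
def IsDualPair (l : StrongDual ℂ (Rochberg c.calderonZero n z))
    (S₀ : Lp ℂ 1 (stripMeasure n) →L[ℂ] StrongDual ℂ X₀)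
    (S₁ : Lp ℂ 1 (stripMeasure n) →L[ℂ] StrongDual ℂ X₁) : Prop :=
  ∀ (x : c.inter) (φ : ℂ → ℂ) (A : ℝ) (hφ : IsStripMultiplier A φ)
    (hmem : Calderon.mul φ hφ (constLift x) ∈ c.calderonZero)
    (u₀ u₁ : Lp ℂ 1 (stripMeasure n)),
    (u₀ =ᵐ[stripMeasure n] fun t => φ (t * I)) →
    (u₁ =ᵐ[stripMeasure n] fun t => φ (1 + t * I)) →
    l (Rochberg.mk c.calderonZero n z ⟨_, hmem⟩) =
      S₀ u₀ (c.interTo₀ x) + S₁ u₁ (c.interTo₁ x)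

/-- The function `ζ ↦ zeroKer n z δ w ζ • x` has a zero of order `n` at `z`, hence zero jet, and `l`
vanishes on it. -/
theorem IsDualPair.isKernelPair (hn : 1 ≤ n) {l : StrongDual ℂ (Rochberg c.calderonZero n z)}
    {S₀ : Lp ℂ 1 (stripMeasure n) →L[ℂ] StrongDual ℂ X₀}
    {S₁ : Lp ℂ 1 (stripMeasure n) →L[ℂ] StrongDual ℂ X₁}
    (hS : IsDualPair l S₀ S₁) : IsKernelPair c hn z S₀ S₁ := by
  intro δ hδ w x
  obtain ⟨C, hC, h⟩ := exists_norm_zeroKer_le hδ n z ‖w‖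
  have hb : ∀ ζ ∈ closedUnitStrip, ‖zeroKer n z δ w ζ‖ ≤ 3 * C / ‖ζ + 1‖ := by
    intro ζ hζ
    refine (h w le_rfl ζ hζ).trans ?_
    have h1 := one_pos.trans_le (one_le_norm_add_one hζ)
    have h2 : ‖ζ + 1‖ ≤ 3 * (1 + ζ.im ^ 2) := by
      have h3 := norm_le_abs_re_add_abs_im (ζ + 1)
      simp only [add_re, one_re, add_im, one_im, add_zero] at h3
      rw [abs_of_nonneg (by linarith [hζ.1])] at h3
      nlinarith [hζ.2, sq_abs ζ.im, sq_nonneg (|ζ.im| - 1)]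
    rw [div_le_div_iff₀ (by positivity) h1]
    nlinarith
  have hφ : IsStripMultiplier (3 * C) (zeroKer n z δ w) :=
    isStripMultiplier_of_norm_le_div (fun ζ _ => differentiable_zeroKer n z δ w ζ)
      (by positivity) hb
  have hmem := Calderon.mul_mem_calderonZero_of_tendsto hφ (tendsto_left_of_norm_le_div hb)
    (tendsto_right_of_norm_le_div hb) (constLift x)
  have h0 := coeFn_zeroKerL1 hn hδ unitInterval.zero_mem z w
  have h1 := coeFn_zeroKerL1 hn hδ unitInterval.one_mem z w
  simp only [stripLine_zero] at h0
  simp only [stripLine_one] at h1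
  rw [← hS x _ _ hφ hmem _ _ h0 h1, mk_mul_eq_interJet]
  have : (fun j : Fin n => taylorCoeff j (zeroKer n z δ w) z • x) = 0 := by
    funext j
    have hg : AnalyticAt ℂ (fun ζ => gaussKer δ (ζ - w)) z :=
      ((differentiable_gaussKer δ).comp (differentiable_id.sub_const w)).analyticAt _
    have := taylorCoeff_sub_pow_smul hg n j
    rw [if_pos j.2] at this
    change taylorCoeff j (fun ζ => (ζ - z) ^ n • gaussKer δ (ζ - w)) z • x = 0
    rw [this, zero_smul]
  rw [this, map_zero, map_zero]

end BanachCouple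

/-- A sequence of positive numbers tending to `0`. -/
def widthSeq (m : ℕ) : ℝ := 1 / ((m : ℝ) + 1)

theorem widthSeq_pos (m : ℕ) : 0 < widthSeq m := Nat.one_div_pos_of_nat

theorem tendsto_widthSeq : Tendsto widthSeq atTop (𝓝 0) := tendsto_one_div_add_atTop_nhds_zero_nat

/-- The weighted integrals of an operator against its Gaussian averages. -/
theorem tendsto_integral_mul_apply_zeroKerL1 {n : ℕ} (hn : 1 ≤ n) {z : ℂ}
    {a : ℝ} (ha : a ∈ Icc (0 : ℝ) 1) (S : StrongDual ℂ (Lp ℂ 1 (stripMeasure n))) {p : ℝ → ℂ}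
    (hne : ∀ t, stripLine a t - z ≠ 0) (hp : Continuous p) {C : ℝ}
    (hC : ∀ t, ‖p t / (stripLine a t - z) ^ n‖ ≤ C * stripWeight n t)
    {u : Lp ℂ 1 (stripMeasure n)} (hu : u =ᵐ[stripMeasure n] p) :
    Tendsto (fun m => ∫ t, p t / (stripLine a t - z) ^ n *
      S (zeroKerL1 hn (widthSeq_pos m) ha z (stripLine a t))) atTop (𝓝 (S u)) := by
  have := isFiniteMeasure_stripMeasure hn
  obtain ⟨l, hl, hlb, hS⟩ := exists_density_scalar S
  have h := tendsto_integral_mul_gaussConv hn (stronglyMeasurable_kernelDensity hl n z a)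
    (norm_kernelDensity_le ha hlb n z)
    (hp.div (by fun_prop) fun t => pow_ne_zero n (hne t)) hC widthSeq_pos tendsto_widthSeq
  -- Division by `(stripLine a t - z) ^ n` removes the zero built into `kernelDensity`, and its
  -- weight turns the Lebesgue integral into one for `stripMeasure n`.
  have e : S u = ∫ t, p t / (stripLine a t - z) ^ n * kernelDensity n z a l t := by
    rw [hS u, integral_congr_ae (g := fun t => p t • l t) (hu.mono fun t ht => by simp only [ht]),
      integral_stripMeasure]
    refine integral_congr_ae (ae_of_all _ fun t => ?_)
    have hz := pow_ne_zero n (hne t)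
    simp only [kernelDensity, ← Complex.coe_smul, smul_eq_mul]
    field_simp
  rw [e]
  refine h.congr fun m => ?_
  simp only [apply_zeroKerL1_eq_gaussConv hn (widthSeq_pos m) ha hS]
  rfl

namespace BanachCouple

variable {X₀ X₁ E : Type*}
  [NormedAddCommGroup X₀] [NormedSpace ℂ X₀] [NormedAddCommGroup X₁] [NormedSpace ℂ X₁]
  [NormedAddCommGroup E] [NormedSpace ℂ E]
  [CompleteSpace X₀] [CompleteSpace X₁] [CompleteSpace E]
  {c : BanachCouple X₀ X₁ E} {hc : c.IsRegular} {n : ℕ} {hn : 1 ≤ n} {z : unitStrip}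
  {S₀ : Lp ℂ 1 (stripMeasure n) →L[ℂ] StrongDual ℂ X₀}
  {S₁ : Lp ℂ 1 (stripMeasure n) →L[ℂ] StrongDual ℂ X₁}

/-- The jet of the function `kernelLift`. -/
def kernelJet (hc : c.IsRegular) (h : IsKernelPair c hn z S₀ S₁) {δ : ℝ} (hδ : 0 < δ) :
    Rochberg (c := c.dual hc) ⊤ n z :=
  Rochberg.mk ⊤ n z ⟨kernelLift hc h hδ, trivial⟩

/-- This is Cauchy's formula of order `n - 1` for the pairing of `kernelLift` with `cutMonomial n z
k • x`, a function whose jet has the single entry `x` at place `k`. -/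
theorem rochbergPairing_kernelJet_single (h : IsKernelPair c hn z S₀ S₁) {δ : ℝ} (hδ : 0 < δ)
    (k : Fin n) (x : c.inter) :
    rochbergPairing hc hn z (kernelJet hc h hδ) (c.interJet n z (Pi.single k x)) =
      (∫ t : ℝ, cutMonomial n z k (t * I) / (t * I - z) ^ n *
        S₀ (zeroKerL1 hn hδ unitInterval.zero_mem z (stripLine 0 t)) (c.interTo₀ x)) +
      ∫ t : ℝ, cutMonomial n z k (1 + t * I) / (1 + t * I - z) ^ n *
        S₁ (zeroKerL1 hn hδ unitInterval.one_mem z (stripLine 1 t)) (c.interTo₁ x) := by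
  obtain ⟨C, hC, hb⟩ := exists_norm_cutMonomial_le n z
  obtain ⟨hb, -, -⟩ := hb k k.2
  have hφ : IsStripMultiplier C (cutMonomial n z k) :=
    isStripMultiplier_of_norm_le_div (fun w hw => differentiableAt_cutMonomial n z k hw) hC.le hb
  have hlift := isInterLift_mul_constLift hφ x
  set G := kernelLift hc h hδ with hG
  have hj : ∀ j : Fin n, taylorCoeff j (fun w => cutMonomial n z k w • x) (z : ℂ) =
      (Pi.single k x : Fin n → c.inter) j := by
    intro j
    rw [taylorCoeff_smul_const (hφ.1.analyticAt_unitStrip z.2), taylorCoeff_cutMonomial z.2 k j.2]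
    by_cases hjk : j = k
    · subst hjk; simp
    · rw [if_neg fun h => hjk (Fin.ext h), Pi.single_eq_of_ne hjk, zero_smul]
  have h1 := taylorCoeff_pairing (z := z) hn G hlift.diffContOnCl
  simp only [hj] at h1
  rw [rochbergPairing_interJet, kernelJet, Rochberg.coord_mk]
  refine h1.symm.trans ?_
  obtain ⟨K, hK⟩ : ∃ K, ∀ w, ‖G.toFun w‖ ≤ K := ⟨_, G.norm_toFun_le⟩
  have hd := diffContOnCl_pairing G hlift
  have hres := taylorCoeff_eq_integral (C := K * (C * ‖x‖)) hd (fun w hw => by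
    refine ((G.toFun w).le_opNorm _).trans ?_
    rw [mul_div_assoc]
    refine mul_le_mul (hK w) ?_ (norm_nonneg _) ((norm_nonneg (G.toFun w)).trans (hK w))
    rw [norm_smul, mul_div_right_comm]
    exact mul_le_mul_of_nonneg_right (hb w hw) (norm_nonneg _)) z (n - 1)
  rw [Nat.sub_add_cancel hn] at hres
  have e0 : ∀ t : ℝ, G.toFun (t * I) (cutMonomial n z k (t * I) • x) / (t * I - z) ^ n =
      -(2 * Real.pi : ℂ) * (cutMonomial n z k (t * I) / (t * I - z) ^ n *
        S₀ (zeroKerL1 hn hδ unitInterval.zero_mem z (stripLine 0 t)) (c.interTo₀ x)) := by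
    intro t
    rw [G.toFun_left, map_smul]
    change cutMonomial n z k (t * I) * (-(2 * Real.pi : ℂ) *
      S₀ (zeroKerL1 hn hδ unitInterval.zero_mem z (stripLine 0 t)) (c.interTo₀ x)) / _ = _
    ring
  have e1 : ∀ t : ℝ, G.toFun (1 + t * I) (cutMonomial n z k (1 + t * I) • x) /
      (1 + t * I - z) ^ n = (2 * Real.pi : ℂ) * (cutMonomial n z k (1 + t * I) /
        (1 + t * I - z) ^ n *
        S₁ (zeroKerL1 hn hδ unitInterval.one_mem z (stripLine 1 t)) (c.interTo₁ x)) := by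
    intro t
    rw [G.toFun_right, map_smul]
    change cutMonomial n z k (1 + t * I) * ((2 * Real.pi : ℂ) *
      S₁ (zeroKerL1 hn hδ unitInterval.one_mem z (stripLine 1 t)) (c.interTo₁ x)) / _ = _
    ring
  simp only [e0, e1] at hres
  rw [integral_const_mul, integral_const_mul] at hres
  have hpi : (2 * Real.pi : ℂ) ≠ 0 := by
    exact_mod_cast Real.two_pi_pos.ne'
  refine mul_left_cancel₀ hpi (hres.trans ?_)
  ring

/-- By linearity a single entry `x` at place `k` suffices. As the width tends to `0` the two
boundary integrals converge to the values of `S₀` and `S₁` on the boundary functions of `cutMonomial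
n z k`, whose sum is `l` of the same tuple. -/
theorem tendsto_rochbergPairing_kernelJet_interJet {l : StrongDual ℂ (Rochberg c.calderonZero n z)}
    (hS : IsDualPair l S₀ S₁) (d : Fin n → c.inter) :
    Tendsto (fun m => rochbergPairing hc hn z
      (kernelJet hc (hS.isKernelPair hn) (widthSeq_pos m)) (c.interJet n z d))
      atTop (𝓝 (l (c.interJet n z d))) := by
  have hsingle : ∀ (k : Fin n) (x : c.inter), Tendsto (fun m => rochbergPairing hc hn z
      (kernelJet hc (hS.isKernelPair hn) (widthSeq_pos m)) (c.interJet n z (Pi.single k x)))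
      atTop (𝓝 (l (c.interJet n z (Pi.single k x)))) := by
    intro k x
    have := isFiniteMeasure_stripMeasure hn
    obtain ⟨C, hC, hb⟩ := exists_norm_cutMonomial_le n z
    obtain ⟨hb, hb0, hb1⟩ := hb k k.2
    have hφ : IsStripMultiplier C (cutMonomial n z k) :=
      isStripMultiplier_of_norm_le_div (fun w hw => differentiableAt_cutMonomial n z k hw) hC.le hb
    have hmem := Calderon.mul_mem_calderonZero_of_tendsto hφ (tendsto_left_of_norm_le_div hb)
      (tendsto_right_of_norm_le_div hb) (constLift x)
    have hc0 := hφ.1.continuous_left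
    have hc1 := hφ.1.continuous_right
    have i0 : Integrable (fun t : ℝ => cutMonomial n z k (t * I)) (stripMeasure n) :=
      (integrable_const C).mono' hc0.aestronglyMeasurable
        (ae_of_all _ fun t => hφ.2 _ (left_mem_closedUnitStrip t))
    have i1 : Integrable (fun t : ℝ => cutMonomial n z k (1 + t * I)) (stripMeasure n) :=
      (integrable_const C).mono' hc1.aestronglyMeasurable
        (ae_of_all _ fun t => hφ.2 _ (right_mem_closedUnitStrip t))
    have h := hS x _ _ hφ hmem _ _ i0.coeFn_toL1 i1.coeFn_toL1
    rw [mk_mul_eq_interJet] at h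
    have hj : (fun j : Fin n => taylorCoeff j (cutMonomial n z k) z • x) = Pi.single k x := by
      funext j
      rw [taylorCoeff_cutMonomial z.2 k j.2]
      by_cases hjk : j = k
      · subst hjk; simp
      · rw [if_neg fun h => hjk (Fin.ext h), Pi.single_eq_of_ne hjk, zero_smul]
    rw [hj] at h
    rw [h]
    simp only [rochbergPairing_kernelJet_single]
    have t0 := tendsto_integral_mul_apply_zeroKerL1 hn (z := z) unitInterval.zero_mem
      ((ContinuousLinearMap.apply ℂ ℂ (c.interTo₀ x)).comp S₀)
      (p := fun t : ℝ => cutMonomial n z k (t * I))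
      (fun t => by simpa using left_sub_ne_zero z t) hc0 (by simpa using hb0) i0.coeFn_toL1
    have t1 := tendsto_integral_mul_apply_zeroKerL1 hn (z := z) unitInterval.one_mem
      ((ContinuousLinearMap.apply ℂ ℂ (c.interTo₁ x)).comp S₁)
      (p := fun t : ℝ => cutMonomial n z k (1 + t * I))
      (fun t => by simpa using right_sub_ne_zero z t) hc1 (by simpa using hb1) i1.coeFn_toL1
    refine (t0.add t1).congr fun m => ?_
    simp only [ContinuousLinearMap.comp_apply, ContinuousLinearMap.apply_apply, stripLine_zero,
      stripLine_one]
  have hsum := tendsto_finsetSum Finset.univ fun k _ => hsingle k (d k)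
  simp only [← map_sum, Finset.univ_sum_single] at hsum
  exact hsum

theorem norm_kernelJet_le (h : IsKernelPair c hn z S₀ S₁) {δ : ℝ} (hδ : 0 < δ) {B : ℝ}
    (h0 : ‖S₀‖ ≤ B) (h1 : ‖S₁‖ ≤ B) :
    ‖kernelJet hc h hδ‖ ≤ 2 * Real.pi * (B * (‖(z : ℂ)‖ + 3) ^ n) :=
  (Rochberg.norm_mk_le _).trans (norm_kernelLift_le h hδ h0 h1)

theorem tendsto_apply_of_denseRange {V A : Type*} [NormedAddCommGroup A] [NormedSpace ℂ A]
    {e : V → A} (he : DenseRange e) {T : ℕ → StrongDual ℂ A} {l : StrongDual ℂ A} {K : ℝ}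
    (hT : ∀ m, ‖T m‖ ≤ K) (h : ∀ v, Tendsto (fun m => T m (e v)) atTop (𝓝 (l (e v)))) (x : A) :
    Tendsto (fun m => T m x) atTop (𝓝 (l x)) := by
  have hK : 0 ≤ K := (norm_nonneg _).trans (hT 0)
  refine Metric.tendsto_atTop.2 fun ε hε => ?_
  obtain ⟨v, hv⟩ := he.exists_dist_lt x (show 0 < ε / (2 * (K + ‖l‖ + 1)) by positivity)
  obtain ⟨N, hN⟩ := Metric.tendsto_atTop.1 (h v) (ε / 2) (by positivity)
  refine ⟨N, fun m hm => ?_⟩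
  have e1 : T m x - l x = (T m - l) (x - e v) + (T m (e v) - l (e v)) := by
    simp only [_root_.sub_apply, map_sub]
    ring
  have h1 := (T m - l).le_opNorm (x - e v)
  have h2 : ‖T m - l‖ ≤ K + ‖l‖ := (norm_sub_le _ _).trans (by linarith [hT m])
  have h3 := hN m hm
  rw [dist_eq_norm] at h3 hv ⊢
  rw [e1]
  refine (norm_add_le _ _).trans_lt ?_
  have h4 : ‖T m - l‖ * ‖x - e v‖ ≤ (K + ‖l‖ + 1) * (ε / (2 * (K + ‖l‖ + 1))) :=
    mul_le_mul (by linarith) hv.le (norm_nonneg _) (by positivity)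
  have h5 : (K + ‖l‖ + 1) * (ε / (2 * (K + ‖l‖ + 1))) = ε / 2 := by field_simp
  linarith

/-- The constant in the duality estimates. -/
def pairingConst (hn : 1 ≤ n) (z : unitStrip) : ℝ :=
  2 * Real.pi * (2 * jetConst hn z * (‖(z : ℂ)‖ + 3) ^ n)

theorem pairingConst_pos (hn : 1 ≤ n) (z : unitStrip) : 0 < pairingConst hn z := by
  have := jetConst_pos hn z
  have := Real.pi_pos
  unfold pairingConst
  positivity

/-- Functionals on the Rochberg space are pointwise limits of bounded sequences in the Rochberg
space of the dual couple. -/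
theorem exists_tendsto_rochbergPairing (hc : c.IsRegular) (hn : 1 ≤ n)
    (l : StrongDual ℂ (Rochberg c.calderonZero n z)) :
    ∃ ξ : ℕ → Rochberg (c := c.dual hc) ⊤ n z, (∀ m, ‖ξ m‖ ≤ pairingConst hn z * ‖l‖) ∧
      ∀ x, Tendsto (fun m => rochbergPairing hc hn z (ξ m) x) atTop (𝓝 (l x)) := by
  obtain ⟨S₀, S₁, h0, h1, hS⟩ := exists_dualOperators hn l
  have hS : IsDualPair l S₀ S₁ := hS
  have hle : ∀ m, ‖kernelJet hc (hS.isKernelPair hn) (widthSeq_pos m)‖ ≤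
      pairingConst hn z * ‖l‖ := fun m =>
    (norm_kernelJet_le _ (widthSeq_pos m) h0 h1).trans (le_of_eq (by rw [pairingConst]; ring))
  refine ⟨fun m => kernelJet hc (hS.isKernelPair hn) (widthSeq_pos m), hle,
    tendsto_apply_of_denseRange (denseRange_interJet n z) (fun m =>
      ((rochbergPairing hc hn z).le_opNorm _).trans
        (mul_le_mul_of_nonneg_left (hle m) (norm_nonneg _)))
      (tendsto_rochbergPairing_kernelJet_interJet hS)⟩

theorem bddAbove_rochbergPairing (hc : c.IsRegular) (hn : 1 ≤ n)
    (x : Rochberg c.calderonZero n z) :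
    ∀ r ∈ {r : ℝ | ∃ ξ, ‖ξ‖ ≤ 1 ∧ r = ‖rochbergPairing hc hn z ξ x‖},
      r ≤ 1 / Metric.infDist (z : ℂ) (frontier unitStrip) ^ (n - 1) * ‖x‖ := by
  rintro r ⟨ξ, hξ, rfl⟩
  refine ((rochbergPairing hc hn z ξ).le_opNorm x).trans
    (mul_le_mul_of_nonneg_right ?_ (norm_nonneg _))
  refine (((rochbergPairing hc hn z).le_opNorm ξ).trans ?_).trans (norm_rochbergPairing_le (c := c) (hc := hc) hn z)
  exact mul_le_of_le_one_right (norm_nonneg _) hξ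

/-- A norming functional of `x` is a pointwise limit of pairings with elements of norm at most
`pairingConst hn z`. -/
theorem le_sSup_rochbergPairing (hc : c.IsRegular) (hn : 1 ≤ n)
    (x : Rochberg c.calderonZero n z) :
    (pairingConst hn z)⁻¹ * ‖x‖ ≤ sSup {r : ℝ | ∃ ξ, ‖ξ‖ ≤ 1 ∧ r = ‖rochbergPairing hc hn z ξ x‖} := by
  have hK := pairingConst_pos hn z
  obtain ⟨l, hl1, hlx⟩ := exists_dual_vector'' ℂ x
  obtain ⟨ξ, hξ, hlim⟩ := exists_tendsto_rochbergPairing hc hn l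
  have hb : ∀ m, ‖rochbergPairing hc hn z (ξ m) x‖ ≤ pairingConst hn z *
      sSup {r : ℝ | ∃ ξ, ‖ξ‖ ≤ 1 ∧ r = ‖rochbergPairing hc hn z ξ x‖} := by
    intro m
    have h1 : ‖((pairingConst hn z)⁻¹ : ℂ) • ξ m‖ ≤ 1 := by
      rw [norm_smul, norm_inv, Complex.norm_real, Real.norm_of_nonneg hK.le, inv_mul_le_iff₀ hK]
      exact (hξ m).trans (mul_le_mul_of_nonneg_left hl1 hK.le)
    have h2 := le_csSup ⟨_, bddAbove_rochbergPairing hc hn x⟩ ⟨_, h1, rfl⟩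
    rw [map_smul, _root_.smul_apply, norm_smul, norm_inv, Complex.norm_real,
      Real.norm_of_nonneg hK.le, inv_mul_le_iff₀ hK] at h2
    exact h2
  have h3 := le_of_tendsto' (hlim x).norm hb
  rw [hlx] at h3
  rw [inv_mul_le_iff₀ hK]
  simpa using h3

end BanachCouple

/-! ### Norm convergence of the approximating jets when a density exists. -/

/-- Operators on `L¹` given by a bounded density. -/
def HasDensity {μ : Measure ℝ} {Y : Type*} [NormedAddCommGroup Y] [NormedSpace ℂ Y]
    (S : Lp ℂ 1 μ →L[ℂ] Y) : Prop :=
  ∃ l : ℝ → Y, StronglyMeasurable l ∧ (∀ t, ‖l t‖ ≤ ‖S‖) ∧ ∀ u : Lp ℂ 1 μ, S u = ∫ t, u t • l t ∂μ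

/-- The Gaussian convolutions of the kernel density converge to it in weighted `L¹`. The tolerance
`ε` is divided among two comparisons, each multiplied by `2π`. -/
theorem HasDensity.exists_integral_sub_le {n : ℕ} (hn : 1 ≤ n) {z : ℂ} {a : ℝ}
    (ha : a ∈ Icc (0 : ℝ) 1) {Y : Type*} [NormedAddCommGroup Y] [NormedSpace ℂ Y] [CompleteSpace Y]
    {S : Lp ℂ 1 (stripMeasure n) →L[ℂ] Y} (hS : HasDensity S) {b : ℂ} (hb : ‖b‖ = 2 * Real.pi)
    {ε : ℝ} (hε : 0 < ε) :
    ∃ N : ℕ, ∀ m ≥ N, ∀ m' ≥ N,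
      ∫ t, stripWeight n t * ‖b • S (zeroKerL1 hn (widthSeq_pos m) ha z (stripLine a t)) -
        b • S (zeroKerL1 hn (widthSeq_pos m') ha z (stripLine a t))‖ ≤ ε := by
  obtain ⟨l, hl, hlb, hS⟩ := hS
  have hκ := stronglyMeasurable_kernelDensity hl n z a
  have hM := norm_kernelDensity_le ha hlb n z
  obtain ⟨δ₀, hδ₀, h⟩ := exists_integral_gaussConv_sub_le hn hκ hM
    (show 0 < ε / (2 * (2 * Real.pi)) by have := Real.pi_pos; positivity)
  obtain ⟨N, hN⟩ := (tendsto_widthSeq.eventually_lt_const hδ₀).exists_forall_of_atTop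
  refine ⟨N, fun m hm m' hm' => ?_⟩
  simp only [apply_zeroKerL1_eq_gaussConv hn (widthSeq_pos _) ha hS]
  set κ := kernelDensity n z a l
  have hi : ∀ m, Integrable fun t => stripWeight n t * ‖gaussConv (widthSeq m) κ t - κ t‖ :=
    fun m => integrable_stripWeight_mul_norm hn ((stronglyMeasurable_gaussConv hκ _).sub hκ)
      (fun t => (norm_sub_le _ _).trans (add_le_add (norm_gaussConv_le hM _ t) (hM t)))
  have h1 := h _ (widthSeq_pos m) (hN m hm)
  have h2 := h _ (widthSeq_pos m') (hN m' hm')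
  have h3 : ∫ t, stripWeight n t * ‖b • gaussConv (widthSeq m) κ t -
      b • gaussConv (widthSeq m') κ t‖ ≤
      ∫ t, 2 * Real.pi * (stripWeight n t * ‖gaussConv (widthSeq m) κ t - κ t‖ +
        stripWeight n t * ‖gaussConv (widthSeq m') κ t - κ t‖) := by
    refine integral_mono_of_nonneg (ae_of_all _ fun t =>
      mul_nonneg (stripWeight_pos n t).le (norm_nonneg _)) (((hi m).add (hi m')).const_mul _)
      (ae_of_all _ fun t => ?_)
    have e : gaussConv (widthSeq m) κ t - gaussConv (widthSeq m') κ t =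
      (gaussConv (widthSeq m) κ t - κ t) - (gaussConv (widthSeq m') κ t - κ t) := by abel
    have h4 := norm_sub_le (gaussConv (widthSeq m) κ t - κ t) (gaussConv (widthSeq m') κ t - κ t)
    rw [← e] at h4
    have h5 := mul_le_mul_of_nonneg_left h4
      (mul_nonneg Real.two_pi_pos.le (stripWeight_pos n t).le)
    simp only [← smul_sub, norm_smul, hb]
    refine le_trans (le_of_eq ?_) (h5.trans (le_of_eq ?_)) <;> ring
  refine h3.trans ?_
  rw [integral_const_mul, integral_add (hi m) (hi m')]
  refine (mul_le_mul_of_nonneg_left (add_le_add h1 h2) Real.two_pi_pos.le).trans (le_of_eq ?_)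
  have := Real.pi_ne_zero
  field_simp
  ring

namespace BanachCouple

variable {X₀ X₁ E : Type*}
  [NormedAddCommGroup X₀] [NormedSpace ℂ X₀] [NormedAddCommGroup X₁] [NormedSpace ℂ X₁]
  [NormedAddCommGroup E] [NormedSpace ℂ E]
  [CompleteSpace X₀] [CompleteSpace X₁] [CompleteSpace E]
  {c : BanachCouple X₀ X₁ E} {hc : c.IsRegular} {n : ℕ} {hn : 1 ≤ n} {z : unitStrip}
  {S₀ : Lp ℂ 1 (stripMeasure n) →L[ℂ] StrongDual ℂ X₀}
  {S₁ : Lp ℂ 1 (stripMeasure n) →L[ℂ] StrongDual ℂ X₁}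

/-- One line is enough: the norm of a jet is at most a small multiple of the uniformly bounded norm
of the function plus a constant times the weighted integral over the line on which the density
exists. -/
theorem cauchySeq_kernelJet (h : IsKernelPair c hn z S₀ S₁)
    (hd : HasDensity S₀ ∨ HasDensity S₁) :
    CauchySeq fun m => kernelJet hc h (widthSeq_pos m) := by
  set B := 2 * Real.pi * (max ‖S₀‖ ‖S₁‖ * (‖(z : ℂ)‖ + 3) ^ n) with hB
  have hle : ∀ m, ‖kernelLift hc h (widthSeq_pos m)‖ ≤ B := fun m =>
    norm_kernelLift_le h _ (le_max_left _ _) (le_max_right _ _)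
  have hB0 : 0 ≤ B := (norm_nonneg _).trans (hle 0)
  have hdiff : ∀ m m', ‖kernelLift hc h (widthSeq_pos m) - kernelLift hc h (widthSeq_pos m')‖ ≤
      2 * B := fun m m' => (norm_sub_le _ _).trans (by linarith [hle m, hle m'])
  refine Metric.cauchySeq_iff.2 fun ε hε => ?_
  have hε' : 0 < ε / (2 * (2 * B + 1)) := by positivity
  -- The tolerances are chosen so that the two terms are at most `ε / 2` and `ε / 4`.
  have hfin : ∀ {C r x : ℝ}, 0 ≤ C → x ≤ ε / (2 * (2 * B + 1)) * r + C * (ε / (4 * (C + 1))) →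
      r ≤ 2 * B → x < ε := by
    intro C r x hC hx hr
    have e1 : ε / (2 * (2 * B + 1)) * (2 * B + 1) = ε / 2 := by field_simp
    have e2 : (ε / (4 * (C + 1))) * (C + 1) = ε / 4 := by field_simp
    have e3 : 0 < ε / (4 * (C + 1)) := by positivity
    have e4 := mul_le_mul_of_nonneg_left hr hε'.le
    nlinarith
  rcases hd with hd | hd
  · obtain ⟨C, hC, hmk⟩ := exists_norm_mk_le_left (c := c.dual hc) hn z hε'
    obtain ⟨N, hN⟩ := hd.exists_integral_sub_le hn (z := z) unitInterval.zero_mem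
      (b := -(2 * Real.pi : ℂ)) (by rw [norm_neg, norm_two_pi])
      (show 0 < ε / (4 * (C + 1)) by positivity)
    refine ⟨N, fun m hm m' hm' => ?_⟩
    have h1 := hmk (ℱ := ⊤) le_top (⟨kernelLift hc h (widthSeq_pos m), trivial⟩ -
      ⟨kernelLift hc h (widthSeq_pos m'), trivial⟩)
    rw [map_sub] at h1
    rw [dist_eq_norm]
    exact hfin hC (h1.trans (add_le_add le_rfl (mul_le_mul_of_nonneg_left (hN m hm m' hm') hC)))
      (hdiff m m')
  · obtain ⟨C, hC, hmk⟩ := exists_norm_mk_le_right (c := c.dual hc) hn z hε'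
    obtain ⟨N, hN⟩ := hd.exists_integral_sub_le hn (z := z) unitInterval.one_mem
      (b := (2 * Real.pi : ℂ)) norm_two_pi (show 0 < ε / (4 * (C + 1)) by positivity)
    refine ⟨N, fun m hm m' hm' => ?_⟩
    have h1 := hmk (ℱ := ⊤) le_top (⟨kernelLift hc h (widthSeq_pos m), trivial⟩ -
      ⟨kernelLift hc h (widthSeq_pos m'), trivial⟩)
    rw [map_sub] at h1
    rw [dist_eq_norm]
    exact hfin hC (h1.trans (add_le_add le_rfl (mul_le_mul_of_nonneg_left (hN m hm m' hm') hC)))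
      (hdiff m m')

/-- The limit of the approximating jets pairs with tuples from the intersection as `l` does, and
these are dense. -/
theorem rochbergPairing_surjective_of_hasDensity (hc : c.IsRegular) (hn : 1 ≤ n) (z : unitStrip)
    (hd : (∀ S : Lp ℂ 1 (stripMeasure n) →L[ℂ] StrongDual ℂ X₀, HasDensity S) ∨
      ∀ S : Lp ℂ 1 (stripMeasure n) →L[ℂ] StrongDual ℂ X₁, HasDensity S) :
    Function.Surjective (rochbergPairing hc hn z) := by
  intro l
  obtain ⟨S₀, S₁, -, -, hS⟩ := exists_dualOperators hn l
  have hS : IsDualPair l S₀ S₁ := hS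
  obtain ⟨ξ, hξ⟩ := cauchySeq_tendsto_of_complete (cauchySeq_kernelJet (hc := hc)
    (hS.isKernelPair hn) (hd.imp (fun h => h S₀) fun h => h S₁))
  refine ⟨ξ, DFunLike.coe_injective ((denseRange_interJet n z).equalizer
    (rochbergPairing hc hn z ξ).continuous l.continuous (funext fun d => ?_))⟩
  have h1 := ((ContinuousLinearMap.apply ℂ ℂ (c.interJet n z d)).continuous.tendsto _).comp
    (((rochbergPairing hc hn z).continuous.tendsto ξ).comp hξ)
  exact tendsto_nhds_unique h1 (tendsto_rochbergPairing_kernelJet_interJet hS d)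

theorem hasDensity_of_isAsplund {X : Type*} [NormedAddCommGroup X] [NormedSpace ℂ X]
    (hX : IsAsplund X) (hn : 1 ≤ n) (S : Lp ℂ 1 (stripMeasure n) →L[ℂ] StrongDual ℂ X) :
    HasDensity S :=
  have := isFiniteMeasure_stripMeasure hn
  exists_density_of_local_approx S fun _ hε _ hA hμA => exists_local_approx_of_isAsplund hX S hε hA hμA

theorem isInvertible_of_bijective {A B : Type*} [NormedAddCommGroup A] [NormedSpace ℂ A]
    [CompleteSpace A] [NormedAddCommGroup B] [NormedSpace ℂ B] [CompleteSpace B] {T : A →L[ℂ] B}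
    (hi : Function.Injective T) (hs : Function.Surjective T) : T.IsInvertible :=
  ⟨ContinuousLinearEquiv.ofBijective T (LinearMap.ker_eq_bot.2 hi) (LinearMap.range_eq_top.2 hs),
    ContinuousLinearEquiv.coe_ofBijective _ _ _⟩

end BanachCouple

/-! ### Weak limits and a criterion for reflexivity. -/

section Goldstine

variable {Z : Type*} [NormedAddCommGroup Z] [NormedSpace ℂ Z]

/-- On finitely many functionals, an element of the bidual agrees approximately with an element of
the space. -/
theorem exists_norm_apply_sub_lt (Φ : StrongDual ℂ (StrongDual ℂ Z)) (F : Finset (StrongDual ℂ Z))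
    {ε : ℝ} (hε : 0 < ε) :
    ∃ x : Z, ‖x‖ ≤ ‖Φ‖ + 1 ∧ ∀ φ ∈ F, ‖φ x - Φ φ‖ < ε := by
  classical
  set R := ‖Φ‖ + 1 with hR
  have hR0 : 0 < R := by positivity
  let L : Z →L[ℂ] (F → ℂ) := ContinuousLinearMap.pi fun φ => φ.1
  set s : Set (F → ℂ) := closure (L '' Metric.closedBall 0 R) with hs
  have hconv : Convex ℝ s :=
    ((convex_closedBall (0 : Z) R).linear_image (L.toLinearMap.restrictScalars ℝ)).closure
  by_cases hmem : (fun φ : F => Φ φ.1) ∈ s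
  · obtain ⟨y, ⟨x, hx, rfl⟩, hy⟩ := Metric.mem_closure_iff.1 hmem ε hε
    refine ⟨x, by simpa using hx, fun φ hφ => ?_⟩
    have h1 := (dist_le_pi_dist (fun φ : F => Φ φ.1) (L x) ⟨φ, hφ⟩).trans_lt hy
    rw [dist_comm, dist_eq_norm] at h1
    exact h1
  · exfalso
    -- A separating functional `g` makes `g ∘ L` a combination of the given functionals, of norm at
    -- most `u / R`. So `Φ` takes there a value of real part at most `‖Φ‖ u / R ≤ u`, contrary to
    -- the separation.
    obtain ⟨g, u, h1, h2⟩ := RCLike.geometric_hahn_banach_closed_point (𝕜 := ℂ) hconv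
      isClosed_closure hmem
    have hu : ∀ x : Z, ‖x‖ ≤ R → (g (L x)).re < u := fun x hx =>
      h1 _ (subset_closure ⟨x, by simpa using hx, rfl⟩)
    have hu0 : 0 < u := by simpa using hu 0 (by simpa using hR0.le)
    have hgL : ‖g.comp L‖ ≤ u / R := by
      refine norm_le_of_forall_re_le _ (by positivity) fun x => ?_
      by_cases hx : x = 0
      · simp [hx]
      have hx' : 0 < ‖x‖ := norm_pos_iff.2 hx
      have h3 := hu ((R / ‖x‖ : ℝ) • x) (by
        rw [norm_smul, Real.norm_of_nonneg (by positivity), div_mul_cancel₀ _ hx'.ne'])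
      rw [← Complex.coe_smul, map_smul, map_smul, smul_eq_mul, re_ofReal_mul] at h3
      rw [ContinuousLinearMap.comp_apply, div_mul_eq_mul_div, le_div_iff₀ hR0]
      rw [div_mul_eq_mul_div, div_lt_iff₀ hx'] at h3
      linarith
    have hΦ : Φ (g.comp L) = g fun φ : F => Φ φ.1 := by
      have h3 : g.comp L = ∑ φ : F, g (fun j => if φ = j then 1 else 0) • φ.1 := by
        ext x
        rw [ContinuousLinearMap.comp_apply, ← ContinuousLinearMap.coe_coe g,
          LinearMap.pi_apply_eq_sum_univ, _root_.sum_apply]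
        refine Finset.sum_congr rfl fun φ _ => ?_
        rw [smul_eq_mul, mul_comm]
        rfl
      rw [h3, map_sum, ← ContinuousLinearMap.coe_coe g, LinearMap.pi_apply_eq_sum_univ]
      refine Finset.sum_congr rfl fun φ _ => ?_
      rw [map_smul, smul_eq_mul, smul_eq_mul, mul_comm]
    have h3 : u < (Φ (g.comp L)).re := by rw [hΦ]; exact h2
    have h4 : (Φ (g.comp L)).re ≤ ‖Φ‖ * (u / R) :=
      (re_le_norm _).trans ((Φ.le_opNorm _).trans (mul_le_mul_of_nonneg_left hgL (norm_nonneg _)))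
    have h5 : ‖Φ‖ * (u / R) ≤ u := by
      rw [mul_div_assoc', div_le_iff₀ hR0]
      nlinarith [norm_nonneg Φ]
    linarith

/-- Elements of the bidual are weak* limits of bounded families. -/
theorem exists_ultrafilter_tendsto (Φ : StrongDual ℂ (StrongDual ℂ Z)) :
    ∃ (U : Ultrafilter (Finset (StrongDual ℂ Z) × ℕ)) (x : Finset (StrongDual ℂ Z) × ℕ → Z),
      (∀ i, ‖x i‖ ≤ ‖Φ‖ + 1) ∧ ∀ φ : StrongDual ℂ Z, Tendsto (fun i => φ (x i)) U (𝓝 (Φ φ)) := by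
  classical
  choose x hx hxφ using fun i : Finset (StrongDual ℂ Z) × ℕ =>
    exists_norm_apply_sub_lt Φ i.1 (widthSeq_pos i.2)
  refine ⟨Ultrafilter.of atTop, x, hx, fun φ => Tendsto.mono_left ?_ (Ultrafilter.of_le atTop)⟩
  refine tendsto_iff_norm_sub_tendsto_zero.2 (squeeze_zero' (Eventually.of_forall fun _ =>
    norm_nonneg _) ?_ (tendsto_widthSeq.comp (tendsto_snd.mono_left (prod_atTop_atTop_eq.symm.le))))
  filter_upwards [eventually_ge_atTop (({φ} : Finset (StrongDual ℂ Z)), 0)] with i hi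
  exact (hxφ i φ (hi.1 (Finset.mem_singleton_self φ))).le

theorem IsReflexiveSpace.strongDual (hZ : IsReflexiveSpace Z) :
    IsReflexiveSpace (StrongDual ℂ Z) := by
  intro Φ
  refine ⟨Φ.comp (NormedSpace.inclusionInDoubleDual ℂ Z), ContinuousLinearMap.ext fun z => ?_⟩
  obtain ⟨x, rfl⟩ := hZ z
  rfl

/-- The canonical image of a Banach space in its bidual is isometric, hence closed, so approximation
in norm is enough. -/
theorem isReflexiveSpace_of_forall_exists [CompleteSpace Z]
    (h : ∀ (Φ : StrongDual ℂ (StrongDual ℂ Z)) (ε : ℝ), 0 < ε →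
      ∃ x : Z, ∀ φ : StrongDual ℂ Z, ‖Φ φ - φ x‖ ≤ ε * ‖φ‖) : IsReflexiveSpace Z := by
  have his : Isometry (NormedSpace.inclusionInDoubleDual ℂ Z) :=
    (NormedSpace.inclusionInDoubleDualLi ℂ (E := Z)).isometry
  have hcl : IsClosed (range (NormedSpace.inclusionInDoubleDual ℂ Z)) :=
    his.isClosedEmbedding.isClosed_range
  intro Φ
  have hΦ : Φ ∈ closure (range (NormedSpace.inclusionInDoubleDual ℂ Z)) := by
    refine (Metric.mem_closure_iff (α := StrongDual ℂ (StrongDual ℂ Z))).2 fun ε hε => ?_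
    obtain ⟨x, hx⟩ := h Φ (ε / 2) (by positivity)
    refine ⟨_, ⟨x, rfl⟩, ?_⟩
    refine lt_of_eq_of_lt (dist_eq_norm (E := StrongDual ℂ (StrongDual ℂ Z)) _ _) ?_
    exact (ContinuousLinearMap.opNorm_le_bound _ (by positivity) hx).trans_lt (half_lt_self hε)
  rwa [hcl.closure_eq] at hΦ

end Goldstine

section WeakCompactness

theorem isClosed_setOf_tendsto_apply {ι A : Type*} [NormedAddCommGroup A] [NormedSpace ℂ A]
    {𝓕 : Filter ι} {T : ι → StrongDual ℂ A} {l : StrongDual ℂ A} {K : ℝ} (hT : ∀ i, ‖T i‖ ≤ K) :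
    IsClosed {x : A | Tendsto (fun i => T i x) 𝓕 (𝓝 (l x))} := by
  rcases isEmpty_or_nonempty ι with h | ⟨⟨i₀⟩⟩
  · have : 𝓕 = ⊥ := Filter.filter_eq_bot_of_isEmpty 𝓕
    simp [this]
  have hK : 0 ≤ K := (norm_nonneg _).trans (hT i₀)
  refine isClosed_of_closure_subset fun x hx => ?_
  refine Metric.tendsto_nhds.2 fun ε hε => ?_
  obtain ⟨v, hv, hxv⟩ := Metric.mem_closure_iff.1 hx (ε / (2 * (K + ‖l‖ + 1))) (by positivity)
  filter_upwards [Metric.tendsto_nhds.1 hv (ε / 2) (by positivity)] with i h3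
  have e1 : T i x - l x = (T i - l) (x - v) + (T i v - l v) := by
    simp only [_root_.sub_apply, map_sub]
    ring
  have h1 := (T i - l).le_opNorm (x - v)
  have h2 : ‖T i - l‖ ≤ K + ‖l‖ := (norm_sub_le _ _).trans (by linarith [hT i])
  rw [dist_eq_norm] at h3 hxv ⊢
  rw [e1]
  refine (norm_add_le _ _).trans_lt ?_
  have h4 : ‖T i - l‖ * ‖x - v‖ ≤ (K + ‖l‖ + 1) * (ε / (2 * (K + ‖l‖ + 1))) :=
    mul_le_mul (by linarith) hxv.le (norm_nonneg _) (by positivity)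
  have h5 : (K + ‖l‖ + 1) * (ε / (2 * (K + ‖l‖ + 1))) = ε / 2 := by field_simp
  linarith

variable {μ : Measure ℝ} [IsFiniteMeasure μ] {Y : Type*} [NormedAddCommGroup Y] [NormedSpace ℂ Y]

theorem Lp.induction_tensorL1 {motive : Lp Y 1 μ → Prop}
    (h : ∀ (x : Y) (s : Set ℝ) (hs : MeasurableSet s), motive (tensorL1 μ x (indicatorL1 μ hs)))
    (hadd : ∀ f g, motive f → motive g → motive (f + g)) (hcl : IsClosed {f | motive f})
    (f : Lp Y 1 μ) : motive f := by
  induction f using Lp.induction ENNReal.one_ne_top with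
  | @indicatorConst a s hs hμs =>
    have e : (Lp.simpleFunc.indicatorConst 1 hs hμs.ne a : Lp Y 1 μ) =
        tensorL1 μ a (indicatorL1 μ hs) := by
      rw [Lp.simpleFunc.coe_indicatorConst]
      ext1
      filter_upwards [coeFn_tensorL1 a (indicatorL1 μ hs),
        indicatorConstLp_coeFn (p := 1) (hs := hs) (hμs := measure_ne_top μ _) (c := (1 : ℂ)),
        indicatorConstLp_coeFn (p := 1) (hs := hs) (hμs := hμs.ne) (c := a)] with t h1 h2 h3
      rw [h1, h3, indicatorL1, h2]
      by_cases ht : t ∈ s <;> simp [ht]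
    rw [e]
    exact h a s hs
  | add hf hg _ h1 h2 => exact hadd _ _ h1 h2
  | isClosed => exact hcl

variable {A : Type*} [NormedAddCommGroup A] [NormedSpace ℂ A]

theorem integrable_bilin_of_bounded (b : A →L[ℂ] Y →L[ℂ] ℂ) {k : ℝ → A} (hk : StronglyMeasurable k)
    {M : ℝ} (hM : ∀ t, ‖k t‖ ≤ M) (f : Lp Y 1 μ) : Integrable (fun t => b (k t) (f t)) μ := by
  refine ((L1.integrable_coeFn f).norm.const_mul (‖b‖ * M)).mono'
    (b.aestronglyMeasurable_comp₂ hk.aestronglyMeasurable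
      (L1.integrable_coeFn f).aestronglyMeasurable) (ae_of_all _ fun t => ?_)
  exact (b.le_opNorm₂ _ _).trans (by gcongr; exact hM t)

/-- The functional on `L¹` given by a bounded function and a bilinear form. -/
def bilinL1 (μ : Measure ℝ) [IsFiniteMeasure μ] (b : A →L[ℂ] Y →L[ℂ] ℂ) {k : ℝ → A}
    (hk : StronglyMeasurable k) {M : ℝ} (hM : ∀ t, ‖k t‖ ≤ M) : StrongDual ℂ (Lp Y 1 μ) :=
  LinearMap.mkContinuous
    { toFun := fun f => ∫ t, b (k t) (f t) ∂μ
      map_add' := fun f g => by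
        rw [← integral_add (integrable_bilin_of_bounded b hk hM f)
          (integrable_bilin_of_bounded b hk hM g)]
        refine integral_congr_ae ?_
        filter_upwards [Lp.coeFn_add f g] with t ht
        rw [ht, Pi.add_apply, map_add]
      map_smul' := fun a f => by
        rw [RingHom.id_apply, ← integral_smul]
        refine integral_congr_ae ?_
        filter_upwards [Lp.coeFn_smul a f] with t ht
        rw [ht, Pi.smul_apply, map_smul] }
    (‖b‖ * M) fun f => by
      refine (norm_integral_le_of_norm_le ((L1.integrable_coeFn f).norm.const_mul (‖b‖ * M))
        (ae_of_all _ fun t => ?_)).trans (le_of_eq ?_)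
      · exact (b.le_opNorm₂ _ _).trans (by gcongr; exact hM t)
      · rw [integral_const_mul, L1.norm_eq_integral_norm]

theorem bilinL1_apply (b : A →L[ℂ] Y →L[ℂ] ℂ) {k : ℝ → A} (hk : StronglyMeasurable k) {M : ℝ}
    (hM : ∀ t, ‖k t‖ ≤ M) (f : Lp Y 1 μ) : bilinL1 μ b hk hM f = ∫ t, b (k t) (f t) ∂μ := rfl

theorem norm_bilinL1_le (b : A →L[ℂ] Y →L[ℂ] ℂ) {k : ℝ → A} (hk : StronglyMeasurable k) {M : ℝ}
    (hM : ∀ t, ‖k t‖ ≤ M) : ‖bilinL1 μ b hk hM‖ ≤ ‖b‖ * M := by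
  have hM0 : 0 ≤ M := (norm_nonneg _).trans (hM 0)
  exact LinearMap.mkContinuous_norm_le _ (by positivity) _

theorem bilinL1_tensorL1 [CompleteSpace A] (b : A →L[ℂ] Y →L[ℂ] ℂ) {k : ℝ → A}
    (hk : StronglyMeasurable k) {M : ℝ} (hM : ∀ t, ‖k t‖ ≤ M) (x : Y) (u : Lp ℂ 1 μ) :
    bilinL1 μ b hk hM (tensorL1 μ x u) = b (∫ t, u t • k t ∂μ) x := by
  have h := (b.flip x).integral_comp_comm (integrable_smul_of_bounded hk hM u)
  rw [ContinuousLinearMap.flip_apply] at h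
  rw [← h, bilinL1_apply]
  refine integral_congr_ae ?_
  filter_upwards [coeFn_tensorL1 x u] with t ht
  rw [ht, map_smul, map_smul, ContinuousLinearMap.flip_apply]

variable [CompleteSpace Y]

theorem hasDensity_of_isReflexiveSpace (hY : IsReflexiveSpace Y) (S : Lp ℂ 1 μ →L[ℂ] Y) :
    HasDensity S :=
  exists_density_of_local_approx S fun _ hε _ hA hμA =>
    exists_local_approx_of_isReflexiveSpace hY S hε hA hμA

/-- Bounded families of bounded functions with values in a reflexive space have weak limits in
`L¹`. -/
theorem exists_tendsto_apply_of_isReflexiveSpace (hY : IsReflexiveSpace Y) {ι : Type*}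
    (U : Ultrafilter ι) {F : ι → ℝ → Y} (hF : ∀ i, StronglyMeasurable (F i)) {M : ℝ}
    (hM : ∀ i t, ‖F i t‖ ≤ M) {f : ι → Lp Y 1 μ} (hf : ∀ i, f i =ᵐ[μ] F i) :
    ∃ H : Lp Y 1 μ, ∀ Ψ : StrongDual ℂ (Lp Y 1 μ), Tendsto (fun i => Ψ (f i)) U (𝓝 (Ψ H)) := by
  have := U.neBot
  obtain ⟨i₀⟩ : Nonempty ι := U.1.nonempty_of_neBot
  have hM0 : 0 ≤ M := (norm_nonneg _).trans (hM i₀ 0)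
  let D : ι → Lp ℂ 1 μ →L[ℂ] Y := fun i => densityCLM μ (hF i) (hM i)
  have hD : ∀ i u, ‖D i u‖ ≤ M * ‖u‖ := fun i u =>
    (D i).le_of_opNorm_le (LinearMap.mkContinuous_norm_le _ hM0 _) u
  choose y hy using fun u => hY.exists_tendsto U (y := fun i => D i u) fun i => hD i u
  -- The weak limit of the operators with densities `F i`. Reflexivity supplies the limit for each
  -- argument and then a density of the limit operator, which is the candidate `H`.
  let S : Lp ℂ 1 μ →L[ℂ] Y := LinearMap.mkContinuous
    { toFun := y
      map_add' := fun u v => by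
        refine (SeparatingDual.eq_iff_forall_dual_eq (R := ℂ)).2 fun φ => tendsto_nhds_unique (hy _ φ) ?_
        rw [map_add]
        exact ((hy u φ).add (hy v φ)).congr fun i => by rw [map_add, map_add]
      map_smul' := fun a u => by
        refine (SeparatingDual.eq_iff_forall_dual_eq (R := ℂ)).2 fun φ => tendsto_nhds_unique (hy _ φ) ?_
        rw [map_smul]
        exact ((hy u φ).const_smul a).congr fun i => by rw [map_smul, map_smul] } M fun u => by
    refine NormedSpace.norm_le_dual_bound ℂ _ (by positivity) fun φ => ?_
    refine le_of_tendsto' (hy u φ).norm fun i => (φ.le_opNorm _).trans ?_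
    rw [mul_comm]
    exact mul_le_mul_of_nonneg_right (hD i u) (norm_nonneg _)
  obtain ⟨h, hh, hhb, hS⟩ := hasDensity_of_isReflexiveSpace hY S
  refine ⟨(integrable_of_stronglyMeasurable_of_norm_le hh hhb).toL1 h, fun Ψ => ?_⟩
  -- The dual of a reflexive space is reflexive, so a functional on `L¹` with values in `Y` is
  -- itself given by a bounded density `ψ` with values in `Y*`.
  obtain ⟨ψ, hψ, hψb, hΨ⟩ := hasDensity_of_isReflexiveSpace hY.strongDual (dualOperator Ψ)
  have hΨ' : ∀ g : Lp Y 1 μ, Ψ g =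
      bilinL1 μ (ContinuousLinearMap.id ℂ (StrongDual ℂ Y)) hψ hψb g := by
    refine Lp.induction_tensorL1 (fun x s hs => ?_) (fun f g hf hg => ?_)
      (isClosed_eq Ψ.continuous (ContinuousLinearMap.continuous _))
    · rw [bilinL1_tensorL1, ← hΨ]
      rfl
    · rw [map_add, map_add, hf, hg]
  set ψ₁ : Lp (StrongDual ℂ Y) 1 μ :=
    (integrable_of_stronglyMeasurable_of_norm_le hψ hψb).toL1 ψ with hψ₁
  have heq : ∀ {k : ℝ → Y} (hk : StronglyMeasurable k) {K : ℝ} (hK : ∀ t, ‖k t‖ ≤ K)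
      {g : Lp Y 1 μ}, g =ᵐ[μ] k →
      Ψ g = bilinL1 μ (NormedSpace.inclusionInDoubleDual ℂ Y) hk hK ψ₁ := by
    intro k hk K hK g hg
    rw [hΨ', bilinL1_apply, bilinL1_apply]
    refine integral_congr_ae ?_
    filter_upwards [hg, Integrable.coeFn_toL1 (integrable_of_stronglyMeasurable_of_norm_le hψ hψb)]
      with t h1 h2
    rw [h1, hψ₁, h2]
    rfl
  -- The roles are exchanged: the integrals are regarded as functionals of `χ`, bounded uniformly in
  -- `i`, so convergence is needed only for indicator functions times vectors, where it defines `S`.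
  have hlim : ∀ χ : Lp (StrongDual ℂ Y) 1 μ, Tendsto
      (fun i => bilinL1 μ (NormedSpace.inclusionInDoubleDual ℂ Y) (hF i) (hM i) χ) U
      (𝓝 (bilinL1 μ (NormedSpace.inclusionInDoubleDual ℂ Y) hh hhb χ)) := by
    refine Lp.induction_tensorL1 (fun φ s hs => ?_) (fun f g hf hg => ?_)
      (isClosed_setOf_tendsto_apply fun i => norm_bilinL1_le _ (hF i) (hM i))
    · simp only [bilinL1_tensorL1]
      rw [← hS]
      exact hy (indicatorL1 μ hs) φ
    · simp only [map_add]
      exact hf.add hg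
  rw [heq hh hhb (Integrable.coeFn_toL1 _)]
  exact (hlim ψ₁).congr fun i => (heq (hF i) (hM i) (hf i)).symm

/-- A criterion for reflexivity: the quotient norm is controlled, up to a small multiple of the norm,
by an `L¹` norm with values in a reflexive space. -/
theorem isReflexiveSpace_of_norm_le {V Z : Type*} [NormedAddCommGroup V] [NormedSpace ℂ V]
    [NormedAddCommGroup Z] [NormedSpace ℂ Z] [CompleteSpace Z] (hY : IsReflexiveSpace Y)
    (Q : V →L[ℂ] Z) (hQ : ∀ x : Z, ∃ v, Q v = x ∧ ‖v‖ ≤ ‖x‖ + 1) (B : V →ₗ[ℂ] (ℝ →ᵇ Y))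
    (hB : ∀ v t, ‖B v t‖ ≤ ‖v‖)
    (h : ∀ ε : ℝ, 0 < ε → ∃ C : ℝ, 0 ≤ C ∧ ∀ v, ‖Q v‖ ≤ ε * ‖v‖ + C * ‖boundedToL1 μ (B v)‖) :
    IsReflexiveSpace Z := by
  refine isReflexiveSpace_of_forall_exists fun Φ ε' hε' => ?_
  obtain ⟨U, x, hx, hxΦ⟩ := exists_ultrafilter_tendsto Φ
  choose v hvx hv using fun i => hQ (x i)
  -- The elements `x i` have norm at most `‖Φ‖ + 1`, and lifting them to `V` costs another `1`.
  set R := ‖Φ‖ + 2 with hR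
  have hR0 : 0 < R := by positivity
  have hvR : ∀ i, ‖v i‖ ≤ R := fun i => (hv i).trans (by linarith [hx i])
  let J : V →ₗ[ℂ] Lp Y 1 μ := (boundedToL1 μ).comp B
  obtain ⟨H, hH⟩ := exists_tendsto_apply_of_isReflexiveSpace (μ := μ) hY U
    (fun i => (B (v i)).continuous.stronglyMeasurable) (fun i t => (hB (v i) t).trans (hvR i))
    (f := fun i => J (v i)) fun i =>
      Integrable.coeFn_toL1 (integrable_boundedContinuous μ (B (v i)))
  -- The weak limit lies in the norm closure of the convex set of images of the ball of radius `R`.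
  have hmem : H ∈ closure (J '' Metric.closedBall 0 R) := by
    by_contra hcon
    obtain ⟨Ψ, u, h1, h2⟩ := RCLike.geometric_hahn_banach_closed_point (𝕜 := ℂ)
      ((convex_closedBall (0 : V) R).linear_image (J.restrictScalars ℝ)).closure
      isClosed_closure hcon
    have h3 := (continuous_re.tendsto _).comp (hH Ψ)
    refine h2.not_ge (le_of_tendsto' h3 fun i => (h1 _ (subset_closure ⟨v i, ?_, rfl⟩)).le)
    simpa using hvR i
  -- The final error is `2 ε · 2 R + 2 ε` times `‖φ‖`.
  set ε := ε' / (4 * R + 2) with hε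
  have hε0 : 0 < ε := by positivity
  obtain ⟨C, hC, hle⟩ := h ε hε0
  obtain ⟨-, ⟨v₀, hv₀, rfl⟩, hd⟩ := Metric.mem_closure_iff.1 hmem (ε / (C + 1)) (by positivity)
  rw [dist_eq_norm] at hd
  have hv₀R : ‖v₀‖ ≤ R := by simpa using hv₀
  refine ⟨Q v₀, fun φ => ?_⟩
  -- After scaling by `C / ε` the hypothesis reads `‖Q w‖ ≤ 2 ε ‖J' w‖`, so `φ ∘ Q` extends to a
  -- functional of norm at most `2 ε ‖φ‖` on the product. Its part on `V` stays small on bounded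
  -- sets, and its part on `L¹` passes to the weak limit `H`, close to `J v₀`.
  let J' : V →ₗ[ℂ] V × Lp Y 1 μ := LinearMap.id.prod (((C / ε : ℝ) : ℂ) • J)
  have hnC : ‖((C / ε : ℝ) : ℂ)‖ = C / ε := by
    rw [Complex.norm_real, Real.norm_of_nonneg (by positivity)]
  obtain ⟨L, hL, hLn⟩ := exists_clm_factor J' (φ.toLinearMap.comp Q.toLinearMap)
    (C := 2 * ε * ‖φ‖) (by positivity) fun w => by
      have h1 : ‖w‖ ≤ ‖J' w‖ := le_max_left _ _
      have h2 : C / ε * ‖J w‖ ≤ ‖J' w‖ := by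
        rw [← hnC, ← norm_smul]
        exact le_max_right _ _
      have h3 : C * ‖J w‖ ≤ ε * ‖J' w‖ := by
        rw [div_mul_eq_mul_div, div_le_iff₀ hε0] at h2
        linarith
      refine (φ.le_opNorm (Q w)).trans ?_
      have h4 : ‖Q w‖ ≤ 2 * ε * ‖J' w‖ := (hle w).trans
        (show ε * ‖w‖ + C * ‖J w‖ ≤ _ by linarith [mul_le_mul_of_nonneg_left h1 hε0.le])
      calc ‖φ‖ * ‖Q w‖ ≤ ‖φ‖ * (2 * ε * ‖J' w‖) := mul_le_mul_of_nonneg_left h4 (norm_nonneg _)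
        _ = _ := by ring
  let L₂ : StrongDual ℂ (Lp Y 1 μ) := L.comp (ContinuousLinearMap.inr ℂ V (Lp Y 1 μ))
  have hL₂ : ‖L₂‖ ≤ 2 * ε * ‖φ‖ := (ContinuousLinearMap.opNorm_comp_le _ _).trans
    ((mul_le_of_le_one_right (norm_nonneg _)
      (ContinuousLinearMap.norm_inr_le_one ℂ _ _)).trans hLn)
  have hsplit : ∀ i, φ (x i) - φ (Q v₀) = L (v i - v₀, 0) +
      ((C / ε : ℝ) : ℂ) * (L₂ (J (v i)) - L₂ (J v₀)) := by
    intro i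
    have h1 := hL (v i - v₀)
    rw [← hvx i, ← map_sub, ← map_sub]
    refine h1.symm.trans ?_
    rw [← map_sub, ← map_sub, ← smul_eq_mul, ← map_smul]
    change L (v i - v₀, ((C / ε : ℝ) : ℂ) • J (v i - v₀)) =
      L (v i - v₀, 0) + L (0, ((C / ε : ℝ) : ℂ) • J (v i - v₀))
    rw [← map_add, Prod.mk_add_mk, add_zero, zero_add]
  have hlim : Tendsto (fun i => ‖φ (x i) - φ (Q v₀) -
      ((C / ε : ℝ) : ℂ) * (L₂ (J (v i)) - L₂ (J v₀))‖) U
      (𝓝 ‖Φ φ - φ (Q v₀) - ((C / ε : ℝ) : ℂ) * (L₂ H - L₂ (J v₀))‖) :=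
    (((hxΦ φ).sub_const _).sub (((hH L₂).sub_const _).const_mul _)).norm
  have h1 : ‖Φ φ - φ (Q v₀) - ((C / ε : ℝ) : ℂ) * (L₂ H - L₂ (J v₀))‖ ≤ 2 * ε * ‖φ‖ * (2 * R) := by
    refine le_of_tendsto' hlim fun i => ?_
    rw [hsplit i, add_sub_cancel_right]
    refine (L.le_opNorm _).trans (mul_le_mul hLn ?_ (norm_nonneg _) (by positivity))
    rw [Prod.norm_mk, norm_zero, max_eq_left (norm_nonneg _), two_mul]
    exact (norm_sub_le _ _).trans (add_le_add (hvR i) hv₀R)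
  have h2 : ‖((C / ε : ℝ) : ℂ) * (L₂ H - L₂ (J v₀))‖ ≤ 2 * ε * ‖φ‖ := by
    rw [norm_mul, hnC, ← map_sub]
    have h3 := (L₂.le_opNorm (H - J v₀)).trans (mul_le_mul hL₂ hd.le (norm_nonneg _) (by positivity))
    calc C / ε * ‖L₂ (H - J v₀)‖ ≤ C / ε * (2 * ε * ‖φ‖ * (ε / (C + 1))) := by gcongr
      _ = 2 * ε * ‖φ‖ * (C / (C + 1)) := by field_simp
      _ ≤ 2 * ε * ‖φ‖ := mul_le_of_le_one_right (by positivity)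
          ((div_le_one (by positivity)).2 (by linarith))
  have h3 := norm_add_le (Φ φ - φ (Q v₀) - ((C / ε : ℝ) : ℂ) * (L₂ H - L₂ (J v₀)))
    (((C / ε : ℝ) : ℂ) * (L₂ H - L₂ (J v₀)))
  rw [sub_add_cancel] at h3
  have h4 : ε * (4 * R + 2) = ε' := div_mul_cancel₀ _ (by positivity)
  calc _ ≤ 2 * ε * ‖φ‖ * (2 * R) + 2 * ε * ‖φ‖ := h3.trans (add_le_add h1 h2)
    _ = ε * (4 * R + 2) * ‖φ‖ := by ring
    _ = ε' * ‖φ‖ := by rw [h4]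

end WeakCompactness

/-! ### Estimates along interior lines and surjectivity criteria. -/

theorem taylorCoeff_comp_add_mul {f : ℂ → ℂ} {p q w₀ : ℂ} (hq : q ≠ 0)
    (hf : AnalyticAt ℂ f (p + q * w₀)) (k : ℕ) :
    taylorCoeff k (fun w => f (p + q * w)) w₀ = q ^ k * taylorCoeff k f (p + q * w₀) := by
  induction k generalizing f with
  | zero => simp [taylorCoeff]
  | succ k ih =>
    have hA : ∀ {g : ℂ → ℂ}, AnalyticAt ℂ g (p + q * w₀) →
        AnalyticAt ℂ (fun w => g (p + q * w)) w₀ := fun {g} hg =>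
      AnalyticAt.fun_comp hg (by fun_prop)
    have e : dslope (fun w => f (p + q * w)) w₀ =
        fun w => q • dslope f (p + q * w₀) (p + q * w) := by
      funext w
      by_cases hw : w = w₀
      · subst hw
        have h1 : HasDerivAt (fun w => p + q * w) q w := by
          simpa using ((hasDerivAt_id w).const_mul q).const_add p
        rw [dslope_same, dslope_same, smul_eq_mul]
        exact ((hf.differentiableAt.hasDerivAt.comp w h1).deriv).trans (mul_comm _ _)
      · have hw' : p + q * w ≠ p + q * w₀ := by simp [hq, hw]
        have h1 : w - w₀ ≠ 0 := sub_ne_zero.2 hw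
        rw [dslope_of_ne _ hw, dslope_of_ne _ hw', slope_def_field, slope_def_field, smul_eq_mul,
          add_sub_add_left_eq_sub, ← mul_sub]
        field_simp
    rw [taylorCoeff_succ_eq_dslope (hA hf), e, taylorCoeff_const_smul (hA hf.dslope_same),
      ih hf.dslope_same, taylorCoeff_succ_eq_dslope hf, smul_eq_mul, pow_succ']
    ring

/-- The couple consisting of two copies of the scalar field. -/
def scalarCouple : BanachCouple ℂ ℂ ℂ where
  i₀ := ContinuousLinearMap.id ℂ ℂ
  i₁ := ContinuousLinearMap.id ℂ ℂ
  injective₀ := Function.injective_id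
  injective₁ := Function.injective_id

theorem BanachCouple.norm_coord_le {X₀ X₁ E : Type*}
    [NormedAddCommGroup X₀] [NormedSpace ℂ X₀] [NormedAddCommGroup X₁] [NormedSpace ℂ X₁]
    [NormedAddCommGroup E] [NormedSpace ℂ E] [CompleteSpace E] {c : BanachCouple X₀ X₁ E}
    {ℱ : Submodule ℂ c.Calderon} {n : ℕ} {z : unitStrip} (w : Rochberg ℱ n z) (i : Fin n) :
    ‖w.coord i‖ ≤ max ‖c.i₀‖ ‖c.i₁‖ / Metric.infDist (z : ℂ) (frontier unitStrip) ^ (i : ℕ) *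
      ‖w‖ := by
  have hR := infDist_frontier_pos z
  have hA : 0 ≤ max ‖c.i₀‖ ‖c.i₁‖ := (norm_nonneg c.i₀).trans (le_max_left _ _)
  set D := max ‖c.i₀‖ ‖c.i₁‖ / Metric.infDist (z : ℂ) (frontier unitStrip) ^ (i : ℕ)
  have hD : 0 ≤ D := by positivity
  refine le_of_forall_pos_le_add fun ε hε => ?_
  obtain ⟨f, rfl, hf⟩ := Rochberg.exists_mk_eq w (show 0 < ε / (D + 1) by positivity)
  have h1 := norm_taylorCoeff_le_div_infDist_pow f.1.diffContOnCl
    (fun w _ => f.1.norm_toFun_le w) z i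
  have e : (ε / (D + 1)) * (D + 1) = ε := div_mul_cancel₀ _ (by positivity)
  have h2 : 0 < ε / (D + 1) := by positivity
  have h3 := mul_le_mul_of_nonneg_left hf.le hD
  rw [Rochberg.coord_mk]
  refine (h1.trans (le_of_eq (mul_div_right_comm _ _ _))).trans (h3.trans ?_)
  nlinarith

/-- Taylor coefficients are controlled by the values on one boundary line, up to a small multiple of
the supremum. -/
theorem exists_norm_taylorCoeff_le_bdry {n : ℕ} (hn : 1 ≤ n) (z : unitStrip) {ε : ℝ} (hε : 0 < ε) :
    ∃ C : ℝ, 0 ≤ C ∧ ∀ h : ℂ → ℂ, DiffContOnCl ℂ h unitStrip → ∀ M : ℝ,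
      (∀ w ∈ closedUnitStrip, ‖h w‖ ≤ M) →
      ‖taylorCoeff (n - 1) h z‖ ≤ ε * M + C * ∫ t : ℝ, stripWeight n t * ‖h (t * I)‖ ∧
      ‖taylorCoeff (n - 1) h z‖ ≤ ε * M + C * ∫ t : ℝ, stripWeight n t * ‖h (1 + t * I)‖ := by
  -- For the couple of scalars a Taylor coefficient is a coordinate of the jet, and `D` bounds that
  -- coordinate by the norm of the jet, to which the one-line estimates apply.
  set D := max ‖scalarCouple.i₀‖ ‖scalarCouple.i₁‖ /
    Metric.infDist (z : ℂ) (frontier unitStrip) ^ (n - 1) with hDdef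
  have hR := infDist_frontier_pos z
  have hD : 0 ≤ D := div_nonneg ((norm_nonneg _).trans (le_max_left _ _)) (by positivity)
  have hε' : 0 < ε / (D + 1) := by positivity
  obtain ⟨C₀, hC₀, h0⟩ := BanachCouple.exists_norm_mk_le_left (c := scalarCouple) hn z hε'
  obtain ⟨C₁, hC₁, h1⟩ := BanachCouple.exists_norm_mk_le_right (c := scalarCouple) hn z hε'
  refine ⟨D * max C₀ C₁, by positivity, fun h hh M hM => ?_⟩
  have hM0 : 0 ≤ M := (norm_nonneg _).trans (hM 0 (by simp))
  let f : scalarCouple.Calderon := BanachCouple.Calderon.ofBdry h hh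
    ⟨M, fun w hw => hM w (unitStrip_subset hw)⟩
    (BoundedContinuousFunction.ofNormedAddCommGroup (fun t : ℝ => h (t * I)) hh.continuous_left M
      fun t => hM _ (left_mem_closedUnitStrip t))
    (BoundedContinuousFunction.ofNormedAddCommGroup (fun t : ℝ => h (1 + t * I))
      hh.continuous_right M fun t => hM _ (right_mem_closedUnitStrip t))
    (fun _ => rfl) fun _ => rfl
  have hf : ‖f‖ ≤ M := BanachCouple.Calderon.norm_le hM0
    (fun t => hM _ (left_mem_closedUnitStrip t)) fun t => hM _ (right_mem_closedUnitStrip t)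
  have htc : taylorCoeff (n - 1) h z = (BanachCouple.Rochberg.mk (⊤ : Submodule ℂ
      scalarCouple.Calderon) n z ⟨f, trivial⟩).coord ⟨n - 1, by omega⟩ := by
    rw [BanachCouple.Rochberg.coord_mk]
    refine taylorCoeff_congr ?_ _
    filter_upwards [isOpen_unitStrip.mem_nhds z.2] with w hw
    exact (BanachCouple.Calderon.toFun_ofBdry (unitStrip_subset hw)).symm
  have hkey : ∀ {x C N : ℝ}, x ≤ ε / (D + 1) * ‖f‖ + C * N → C ≤ max C₀ C₁ → 0 ≤ N →
      D * x ≤ ε * M + D * max C₀ C₁ * N := by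
    intro x C N hx hC hN
    have e : ε / (D + 1) * (D + 1) = ε := div_mul_cancel₀ _ (by positivity)
    have e1 : D * (ε / (D + 1)) ≤ ε := by nlinarith
    have e2 := mul_le_mul e1 hf (norm_nonneg f) hε.le
    have e3 := mul_le_mul_of_nonneg_left (mul_le_mul_of_nonneg_right hC hN) hD
    have e4 := mul_le_mul_of_nonneg_left hx hD
    linarith
  have hN : ∀ u : ℝ → ℂ, 0 ≤ ∫ t, stripWeight n t * ‖u t‖ := fun u =>
    integral_nonneg fun t => mul_nonneg (stripWeight_pos n t).le (norm_nonneg _)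
  have hco := BanachCouple.norm_coord_le (BanachCouple.Rochberg.mk (⊤ : Submodule ℂ
    scalarCouple.Calderon) n z ⟨f, trivial⟩) ⟨n - 1, by omega⟩
  rw [htc]
  exact ⟨hco.trans (hkey (h0 le_top ⟨f, trivial⟩) (le_max_left _ _) (hN _)),
    hco.trans (hkey (h1 le_top ⟨f, trivial⟩) (le_max_right _ _) (hN _))⟩

theorem integral_stripWeight_comp_mul_le (n : ℕ) {L : ℝ} (hL : 0 < L) (hL1 : L ≤ 1) (hn : 1 ≤ n)
    {u : ℝ → ℝ} (hu : Continuous u) {M : ℝ} (h0 : ∀ t, 0 ≤ u t) (hM : ∀ t, u t ≤ M) :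
    ∫ t, stripWeight n t * u (L * t) ≤ L⁻¹ * ∫ t, stripWeight n t * u t := by
  have h1 := Measure.integral_comp_mul_left (fun s => stripWeight n (L⁻¹ * s) * u s) L
  simp only [inv_mul_cancel_left₀ hL.ne', abs_inv, abs_of_pos hL, smul_eq_mul] at h1
  rw [h1]
  refine mul_le_mul_of_nonneg_left ?_ (by positivity)
  refine integral_mono_of_nonneg (ae_of_all _ fun t => mul_nonneg (stripWeight_pos n _).le (h0 t))
    (integrable_stripWeight_mul hn hu h0 hM) (ae_of_all _ fun t => ?_)
  refine mul_le_mul_of_nonneg_right ?_ (h0 t)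
  refine inv_anti₀ (by positivity) (pow_le_pow_left₀ (by positivity) ?_ n)
  have : 1 ≤ L⁻¹ ^ 2 := one_le_pow₀ ((one_le_inv₀ hL).2 hL1)
  rw [mul_pow]
  nlinarith [sq_nonneg t]

/-- The line through `ζ` cuts the strip, and `z` lies in one of the two pieces. The map `w ↦ p + L
w` carries the unit strip onto that piece and one boundary line onto the line through `ζ`, so the
boundary estimate applies after rescaling. -/
theorem exists_norm_taylorCoeff_le_of_re_ne {n : ℕ} (hn : 1 ≤ n) {z ζ : unitStrip}
    (hne : (z : ℂ).re ≠ (ζ : ℂ).re) {ε : ℝ} (hε : 0 < ε) :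
    ∃ C : ℝ, 0 ≤ C ∧ ∀ h : ℂ → ℂ, DiffContOnCl ℂ h unitStrip → ∀ M : ℝ,
      (∀ w ∈ closedUnitStrip, ‖h w‖ ≤ M) →
      ‖taylorCoeff (n - 1) h z‖ ≤ ε * M + C * ∫ t : ℝ, stripWeight n t * ‖h (ζ + t * I)‖ := by
  have key : ∀ (p : ℂ) (L : ℝ), 0 < L → 0 ≤ p.re → p.re + L ≤ 1 → p.re < (z : ℂ).re →
      (z : ℂ).re < p.re + L → (p = ζ ∨ p + L = ζ) →
      ∃ C : ℝ, 0 ≤ C ∧ ∀ h : ℂ → ℂ, DiffContOnCl ℂ h unitStrip → ∀ M : ℝ,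
      (∀ w ∈ closedUnitStrip, ‖h w‖ ≤ M) →
      ‖taylorCoeff (n - 1) h z‖ ≤ ε * M + C * ∫ t : ℝ, stripWeight n t * ‖h (ζ + t * I)‖ := by
    intro p L hL hp0 hp1 hz0 hz1 hcase
    have hL' : (L : ℂ) ≠ 0 := ofReal_ne_zero.2 hL.ne'
    have hL1 : L ≤ 1 := by linarith
    have hre : ∀ w : ℂ, (p + L * w).re = p.re + L * w.re := fun w => by simp
    have hz₀ : ((z : ℂ) - p) / L ∈ unitStrip := by
      have h1 : (((z : ℂ) - p) / L).re = ((z : ℂ).re - p.re) / L := by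
        rw [div_ofReal_re, sub_re]
      refine ⟨?_, ?_⟩
      · rw [h1]; exact div_pos (by linarith) hL
      · rw [h1, div_lt_one hL]; linarith
    set z₀ : unitStrip := ⟨_, hz₀⟩ with hz₀d
    have hpz : p + L * (z₀ : ℂ) = z := by
      rw [hz₀d]
      field_simp
      ring
    obtain ⟨C, hC, hb⟩ := exists_norm_taylorCoeff_le_bdry hn z₀ (show 0 < ε * L ^ (n - 1) by positivity)
    refine ⟨(L ^ (n - 1))⁻¹ * (C * L⁻¹), by positivity, fun h hh M hM => ?_⟩
    have hmaps : MapsTo (fun w : ℂ => p + L * w) unitStrip unitStrip := fun w hw => by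
      change (p + L * w).re ∈ Ioo (0 : ℝ) 1
      rw [hre]
      have h1 := mul_pos hL hw.1
      have h2 := mul_lt_mul_of_pos_left hw.2 hL
      exact ⟨by linarith, by linarith⟩
    have hmapsC : MapsTo (fun w : ℂ => p + L * w) closedUnitStrip closedUnitStrip := fun w hw => by
      change (p + L * w).re ∈ Icc (0 : ℝ) 1
      rw [hre]
      have h1 := mul_nonneg hL.le hw.1
      have h2 := mul_le_mul_of_nonneg_left hw.2 hL.le
      exact ⟨by linarith, by linarith⟩
    have hH : DiffContOnCl ℂ (fun w => h (p + L * w)) unitStrip :=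
      ⟨hh.differentiableOn.comp (Differentiable.differentiableOn (by fun_prop)) hmaps, by
        rw [closure_unitStrip]
        exact hh.continuousOn_closedUnitStrip.comp (Continuous.continuousOn (by fun_prop)) hmapsC⟩
    obtain ⟨b0, b1⟩ := hb _ hH M fun w hw => hM _ (hmapsC hw)
    rw [taylorCoeff_comp_add_mul hL' (by rw [hpz]; exact hh.analyticAt_unitStrip z.2), hpz,
      norm_mul, norm_pow, Complex.norm_real, Real.norm_of_nonneg hL.le] at b0 b1
    have hζ : ∀ t : ℝ, (ζ + t * I : ℂ) ∈ closedUnitStrip := fun t => by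
      change (ζ + t * I : ℂ).re ∈ Icc (0 : ℝ) 1
      simpa using ⟨ζ.2.1.le, ζ.2.2.le⟩
    have hint := integral_stripWeight_comp_mul_le n hL hL1 hn (u := fun t : ℝ => ‖h (ζ + t * I)‖)
      (hh.continuousOn_closedUnitStrip.comp_continuous (by fun_prop) hζ).norm
      (fun t => norm_nonneg _) (fun t => hM _ (hζ t))
    have hfin : L ^ (n - 1) * ‖taylorCoeff (n - 1) h z‖ ≤ ε * L ^ (n - 1) * M +
        C * ∫ t, stripWeight n t * ‖h (ζ + (L * t : ℝ) * I)‖ := by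
      rcases hcase with hcase | hcase
      · refine b0.trans (le_of_eq ?_)
        have e : ∀ t : ℝ, p + L * (t * I) = ζ + (L * t : ℝ) * I := fun t => by
          rw [hcase]; push_cast; ring
        simp only [e]
      · refine b1.trans (le_of_eq ?_)
        have e : ∀ t : ℝ, p + L * (1 + t * I) = ζ + (L * t : ℝ) * I := fun t => by
          rw [← hcase]; push_cast; ring
        simp only [e]
    have hfin2 := hfin.trans (add_le_add_right (mul_le_mul_of_nonneg_left hint hC) _)
    have hLn : 0 < L ^ (n - 1) := by positivity
    rw [← le_div_iff₀' hLn] at hfin2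
    refine hfin2.trans (le_of_eq ?_)
    generalize (∫ t : ℝ, stripWeight n t * ‖h (ζ + t * I)‖) = N
    field_simp
  rcases lt_or_gt_of_ne hne with hlt | hgt
  · refine key (ζ - (ζ : ℂ).re) (ζ : ℂ).re ζ.2.1 (by simp) (by simpa using ζ.2.2.le)
      (by simpa using z.2.1) (by simpa using hlt) (Or.inr (by ring))
  · exact key ζ (1 - (ζ : ℂ).re) (by linarith [ζ.2.2]) ζ.2.1.le (by linarith) hgt
      (by linarith [z.2.2]) (Or.inl rfl)

/-- Taylor coefficients are controlled by the values on one line, up to a small multiple of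
the supremum. -/
theorem exists_norm_taylorCoeff_le_line {n : ℕ} (hn : 1 ≤ n) (z ζ : unitStrip) {ε : ℝ}
    (hε : 0 < ε) :
    ∃ C : ℝ, 0 ≤ C ∧ ∀ h : ℂ → ℂ, DiffContOnCl ℂ h unitStrip → ∀ M : ℝ,
      (∀ w ∈ closedUnitStrip, ‖h w‖ ≤ M) →
      ‖taylorCoeff (n - 1) h z‖ ≤ ε * M + C * ∫ t : ℝ, stripWeight n t * ‖h (ζ + t * I)‖ := by
  by_cases hne : (z : ℂ).re ≠ (ζ : ℂ).re
  · exact exists_norm_taylorCoeff_le_of_re_ne hn hne hε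
  rw [not_not] at hne
  obtain ⟨r, hr, hball⟩ := exists_closedBall_subset_unitStrip z
  set ρ := r / 2 with hρ
  have hρ0 : 0 < ρ := by positivity
  -- If `z` is on the line through `ζ`, the previous case is applied at `z + η`. By the Schwarz
  -- lemma `h (w + η) - h w` is at most `2 M η / ρ` near `z`, and `η` is chosen so that its Taylor
  -- coefficient is at most `ε M / 2`.
  set η := min (ρ / 2) (ε / 2 * (ρ ^ (n - 1) * (ρ / 2))) with hη
  have hη0 : 0 < η := by positivity
  have hηρ : η < ρ := (min_le_left _ _).trans_lt (half_lt_self hρ0)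
  have hz' : (z + η : ℂ) ∈ unitStrip := hball (by
    rw [Metric.mem_closedBall, dist_eq_norm, add_sub_cancel_left, Complex.norm_real,
      Real.norm_of_nonneg hη0.le]
    linarith)
  obtain ⟨C, hC, hb⟩ := exists_norm_taylorCoeff_le_of_re_ne hn (z := ⟨_, hz'⟩) (ζ := ζ)
    (by simp [hne, hη0.ne']) (half_pos hε)
  refine ⟨C, hC, fun h hh M hM => ?_⟩
  have hM0 : 0 ≤ M := (norm_nonneg _).trans (hM 0 (by simp))
  have h1 := hb h hh M hM
  have hsub : ∀ w ∈ Metric.closedBall (z : ℂ) ρ, Metric.ball w ρ ⊆ unitStrip := fun w hw v hv =>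
    hball (by
      rw [Metric.mem_closedBall] at hw ⊢
      rw [Metric.mem_ball] at hv
      have := dist_triangle v w z
      linarith)
  have hmem : ∀ w ∈ Metric.closedBall (z : ℂ) ρ, w + η ∈ Metric.ball w ρ := fun w _ => by
    rw [Metric.mem_ball, dist_eq_norm, add_sub_cancel_left, Complex.norm_real,
      Real.norm_of_nonneg hη0.le]
    exact hηρ
  have hd : DiffContOnCl ℂ (fun w => h (w + η) - h w) (Metric.ball (z : ℂ) ρ) := by
    refine DifferentiableOn.diffContOnCl fun w hw => ?_
    have hw' : w ∈ Metric.closedBall (z : ℂ) ρ := Metric.closure_ball_subset_closedBall hw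
    have d1 := (hh.analyticAt_unitStrip (hsub w hw' (hmem w hw'))).differentiableAt
    have d2 := (hh.analyticAt_unitStrip (hsub w hw' (Metric.mem_ball_self hρ0))).differentiableAt
    exact ((d1.comp w (differentiableAt_id.add_const _)).sub d2).differentiableWithinAt
  have h2 := norm_taylorCoeff_le (C := 2 * M / ρ * η) hρ0 hd (fun w hw => by
    have hw' := Metric.sphere_subset_closedBall hw
    have := Complex.dist_le_div_mul_dist_of_mapsTo_ball (f := h) (c := w) (R₁ := ρ) (R₂ := 2 * M)
      (hh.differentiableOn.mono (hsub w hw')) (fun v hv => by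
        rw [Metric.mem_closedBall, dist_eq_norm]
        have e1 := hM v (unitStrip_subset (hsub w hw' hv))
        have e2 := hM w (unitStrip_subset (hsub w hw' (Metric.mem_ball_self hρ0)))
        exact (norm_sub_le _ _).trans (by linarith)) (hmem w hw')
    rwa [dist_eq_norm, dist_eq_norm, add_sub_cancel_left, Complex.norm_real,
      Real.norm_of_nonneg hη0.le] at this) (n - 1)
  have a1 : AnalyticAt ℂ (fun w => h (w + η)) z :=
    AnalyticAt.fun_comp (hh.analyticAt_unitStrip hz') (by fun_prop)
  rw [taylorCoeff_sub a1 (hh.analyticAt_unitStrip z.2)] at h2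
  have e : taylorCoeff (n - 1) (fun w => h (w + η)) z = taylorCoeff (n - 1) h (z + η) := by
    simp [taylorCoeff, iteratedDeriv_comp_add_const]
  rw [e] at h2
  have h3 : 2 * M / ρ * η / ρ ^ (n - 1) ≤ ε / 2 * M := by
    have h4 : η ≤ ε / 2 * (ρ ^ (n - 1) * (ρ / 2)) := min_le_right _ _
    rw [div_le_iff₀ (by positivity), div_mul_eq_mul_div, div_le_iff₀ hρ0]
    nlinarith
  have h5 := norm_sub_norm_le (taylorCoeff (n - 1) h (z : ℂ)) (taylorCoeff (n - 1) h (z + η))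
  rw [norm_sub_rev] at h5
  have h6 : ‖taylorCoeff (n - 1) h (z + η)‖ ≤ ε / 2 * M +
    C * ∫ t : ℝ, stripWeight n t * ‖h (ζ + t * I)‖ := h1
  linarith

/-- Each correction halves the remainder, and the corrections are dominated by a geometric series.
-/
theorem surjective_of_forall_approx {A B : Type*} [NormedAddCommGroup A] [NormedSpace ℂ A]
    [CompleteSpace A] [NormedAddCommGroup B] [NormedSpace ℂ B] (T : A →L[ℂ] B) {K : ℝ}
    (h : ∀ l : B, ∃ ξ : A, ‖ξ‖ ≤ K * ‖l‖ ∧ ‖l - T ξ‖ ≤ 2⁻¹ * ‖l‖) : Function.Surjective T := by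
  intro l
  choose g hg hgl using h
  let s : ℕ → B := fun k => (fun l => l - T (g l))^[k] l
  have hs : ∀ k, s (k + 1) = s k - T (g (s k)) := fun k => Function.iterate_succ_apply' _ _ _
  have hsn : ∀ k, ‖s k‖ ≤ ‖l‖ * (2⁻¹ : ℝ) ^ k := by
    intro k
    induction k with
    | zero => simp [s]
    | succ k ih =>
      rw [hs, pow_succ]
      linarith [hgl (s k)]
  have hgeo : Summable fun k : ℕ => (2⁻¹ : ℝ) ^ k :=
    summable_geometric_of_lt_one (by norm_num) (by norm_num)
  have hsum : Summable fun k => g (s k) := by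
    refine Summable.of_norm_bounded (g := fun k => |K| * (‖l‖ * (2⁻¹ : ℝ) ^ k))
      ((hgeo.mul_left _).mul_left _) fun k => (hg _).trans ?_
    exact mul_le_mul (le_abs_self K) (hsn k) (norm_nonneg _) (abs_nonneg _)
  have h0 : Tendsto s atTop (𝓝 0) := by
    refine squeeze_zero_norm hsn ?_
    simpa using hgeo.tendsto_atTop_zero.const_mul ‖l‖
  have hpart : ∀ m, T (∑ k ∈ Finset.range m, g (s k)) = l - s m := by
    intro m
    induction m with
    | zero => simp [s]
    | succ m ih =>
      rw [Finset.sum_range_succ, map_add, ih, hs]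
      abel
  refine ⟨∑' k, g (s k), tendsto_nhds_unique ((T.continuous.tendsto _).comp
    hsum.hasSum.tendsto_sum_nat) ?_⟩
  simpa [Function.comp_def, hpart] using h0.const_sub l

/-- An operator into the dual of a reflexive space is onto if every functional is the weak* limit of
a sequence of images of a controlled size. -/
theorem surjective_of_isReflexiveSpace {A Z : Type*} [NormedAddCommGroup A] [NormedSpace ℂ A]
    [CompleteSpace A] [NormedAddCommGroup Z] [NormedSpace ℂ Z] (hZ : IsReflexiveSpace Z)
    (T : A →L[ℂ] StrongDual ℂ Z) {K : ℝ}
    (h : ∀ l : StrongDual ℂ Z, ∃ ξ : ℕ → A, (∀ m, ‖ξ m‖ ≤ K * ‖l‖) ∧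
      ∀ x, Tendsto (fun m => T (ξ m) x) atTop (𝓝 (l x))) : Function.Surjective T := by
  refine surjective_of_forall_approx T (K := K) fun l => ?_
  obtain ⟨ξ, hξ, hlim⟩ := h l
  rcases eq_or_ne l 0 with rfl | hl
  · exact ⟨0, by simp⟩
  -- By reflexivity every functional on the dual is an evaluation, so `l` is a weak limit of points
  -- of a convex set and belongs to its norm closure.
  have hmem : l ∈ closure (T '' Metric.closedBall 0 (K * ‖l‖)) := by
    by_contra hcon
    obtain ⟨Ψ, u, h1, h2⟩ := RCLike.geometric_hahn_banach_closed_point (𝕜 := ℂ)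
      ((convex_closedBall (0 : A) (K * ‖l‖)).linear_image
        (T.toLinearMap.restrictScalars ℝ)).closure isClosed_closure hcon
    obtain ⟨x, rfl⟩ := hZ Ψ
    have h3 := (continuous_re.tendsto _).comp (hlim x)
    refine h2.not_ge (le_of_tendsto' h3 fun i => (h1 _ (subset_closure ⟨ξ i, ?_, rfl⟩)).le)
    simpa using hξ i
  obtain ⟨-, ⟨v, hv, rfl⟩, hd⟩ := Metric.mem_closure_iff.1 hmem (2⁻¹ * ‖l‖)
    (by have := norm_pos_iff.2 hl; positivity)
  exact ⟨v, by simpa using hv, by rw [← dist_eq_norm]; exact hd.le⟩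

namespace BanachCouple

variable {X₀ X₁ E : Type*}
  [NormedAddCommGroup X₀] [NormedSpace ℂ X₀] [NormedAddCommGroup X₁] [NormedSpace ℂ X₁]
  [NormedAddCommGroup E] [NormedSpace ℂ E]
  {c : BanachCouple X₀ X₁ E}

/-! ### Reflexivity of the intermediate and Rochberg spaces. -/

section Translate

theorem add_mul_I_mem_iff {w : ℂ} {t : ℝ} : w + t * I ∈ closedUnitStrip ↔ w ∈ closedUnitStrip := by
  simp

/-- The translate `w ↦ f (w + it)`. -/
def Calderon.translate (t : ℝ) (f : c.Calderon) : c.Calderon :=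
  ofBdry (fun w => f.toFun (w + t * I))
    ⟨f.diffContOnCl.differentiableOn.comp (Differentiable.differentiableOn (by fun_prop))
      fun w hw => by simpa using hw, by
      rw [closure_unitStrip]
      exact f.diffContOnCl.continuousOn_closedUnitStrip.comp
        (Continuous.continuousOn (by fun_prop)) fun w hw => add_mul_I_mem_iff.2 hw⟩
    ⟨max ‖c.i₀‖ ‖c.i₁‖ * ‖f‖, fun w _ => f.norm_toFun_le _⟩
    (f.bdry₀.compContinuous ⟨fun u => u + t, by fun_prop⟩)
    (f.bdry₁.compContinuous ⟨fun u => u + t, by fun_prop⟩)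
    (fun u => by
      rw [← add_mul, ← ofReal_add, f.toFun_left]
      rfl)
    fun u => by
      rw [add_assoc, ← add_mul, ← ofReal_add, f.toFun_right]
      rfl

namespace Calderon

theorem toFun_translate (t : ℝ) (f : c.Calderon) (w : ℂ) :
    (f.translate t).toFun w = f.toFun (w + t * I) := by
  by_cases hw : w ∈ closedUnitStrip
  · exact toFun_ofBdry hw
  · rw [toFun_off _ hw, toFun_off _ (by rwa [add_mul_I_mem_iff])]

theorem norm_translate_le (t : ℝ) (f : c.Calderon) : ‖f.translate t‖ ≤ ‖f‖ :=
  norm_le (norm_nonneg f) (fun _ => f.norm_bdry₀_le _) fun _ => f.norm_bdry₁_le _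

/-- The boundary functions are uniformly continuous because they vanish at infinity; so values along
a line depend continuously on the point in the norm of the intermediate space. -/
theorem continuous_translate {f : c.Calderon} (hf : f ∈ c.calderonZero) :
    Continuous fun t => f.translate t := by
  have h0 : UniformContinuous f.bdry₀ :=
    f.bdry₀.continuous.uniformContinuous_of_tendsto_cocompact hf.1
  have h1 : UniformContinuous f.bdry₁ :=
    f.bdry₁.continuous.uniformContinuous_of_tendsto_cocompact hf.2
  refine Metric.continuous_iff.2 fun t ε hε => ?_
  obtain ⟨δ₀, hδ₀, h0⟩ := Metric.uniformContinuous_iff.1 h0 (ε / 2) (half_pos hε)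
  obtain ⟨δ₁, hδ₁, h1⟩ := Metric.uniformContinuous_iff.1 h1 (ε / 2) (half_pos hε)
  refine ⟨min δ₀ δ₁, lt_min hδ₀ hδ₁, fun s hs => ?_⟩
  rw [dist_eq_norm]
  refine lt_of_le_of_lt (norm_le (half_pos hε).le (fun u => ?_) fun u => ?_) (half_lt_self hε)
  · have := h0 (a := u + s) (b := u + t) (by
      rw [dist_add_left]
      exact hs.trans_le (min_le_left _ _))
    rw [dist_eq_norm] at this
    exact this.le
  · have := h1 (a := u + s) (b := u + t) (by
      rw [dist_add_left]
      exact hs.trans_le (min_le_right _ _))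
    rw [dist_eq_norm] at this
    exact this.le

end Calderon

end Translate

variable [CompleteSpace X₀] [CompleteSpace X₁] [CompleteSpace E]

theorem Calderon.taylor_one_eq (f : c.Calderon) (ζ : unitStrip) (i : Fin 1) :
    c.taylor 1 ζ f i = f.toFun ζ := by
  simp [Subsingleton.elim i 0, taylor]

/-- The values at `ζ` of the functions of the dual Calderón space are bounded functionals in the norm
of the intermediate space at `ζ`. -/
theorem exists_norm_apply_le (ζ : unitStrip) : ∃ K : ℝ, 0 < K ∧
    ∀ {c : BanachCouple X₀ X₁ E} {hc : c.IsRegular} (g : (c.dual hc).Calderon) (x : c.inter)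
      (w : c.Intermediate ζ), w.coord 0 = c.interTo x → ‖g.toFun ζ x‖ ≤ K * ‖g‖ * ‖w‖ := by
  obtain ⟨K, hK, hle⟩ := exists_norm_stripCut_le 1 (ζ : ℂ)
  refine ⟨K, hK, fun {c hc} g x w hw => le_of_forall_pos_le_add fun ε hε => ?_⟩
  -- The factor `stripCut 1 ζ` equals `1` at `ζ` and brings any representative into `𝒞₀`, at the
  -- cost of the constant `K`; then the case `n = 1` of the pairing estimate applies.
  have hφ : IsStripMultiplier K (stripCut 1 (ζ : ℂ)) :=
    isStripMultiplier_of_norm_le_div (fun w hw => differentiableAt_stripCut 1 _ hw) hK.le hle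
  have hε' : 0 < ε / (K * ‖g‖ + 1) := by positivity
  obtain ⟨f, rfl, hf⟩ := Rochberg.exists_mk_eq w hε'
  obtain ⟨χ, hχ, h1⟩ := exists_stripCut_pow_eq 1 1 ζ.2
  simp only [pow_one (stripCut _ _ _)] at h1
  have h2 := norm_sum_pairing_le le_rfl g
    (Calderon.mul_mem_calderonZero_of_tendsto hφ (tendsto_left_of_norm_le_div hle)
      (tendsto_right_of_norm_le_div hle) f.1) (d := fun _ : Fin 1 => x) (z := ζ) fun j => by
      rw [Calderon.taylor_mul_of_eq_one_add hφ f.1 hχ h1, ← hw, Subsingleton.elim j 0,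
        Rochberg.coord_mk]
  simp only [Finset.univ_unique, Finset.sum_singleton, Calderon.taylor_one_eq, Nat.sub_self,
    pow_zero, div_one] at h2
  have h3 := mul_le_mul_of_nonneg_left (Calderon.norm_mul_le hφ f.1) (norm_nonneg g)
  have h4 := mul_le_mul_of_nonneg_left hf.le (mul_nonneg hK.le (norm_nonneg g))
  have e : ε / (K * ‖g‖ + 1) * (K * ‖g‖ + 1) = ε := div_mul_cancel₀ _ (by positivity)
  have e2 : ‖f.1‖ = ‖f‖ := rfl
  rw [e2] at h3
  calc ‖g.toFun ζ x‖ ≤ ‖g‖ * (K * ‖f‖) := h2.trans h3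
    _ = K * ‖g‖ * ‖f‖ := by ring
    _ ≤ K * ‖g‖ * (‖Rochberg.mk ⊤ 1 ζ f‖ + ε / (K * ‖g‖ + 1)) := h4
    _ ≤ _ := by nlinarith

/-- The value of a function at `ζ + it`, as an element of the intermediate space. -/
def lineValue (c : BanachCouple X₀ X₁ E) (ζ : unitStrip) (f : c.Calderon) (t : ℝ) :
    c.Intermediate ζ :=
  Rochberg.mk ⊤ 1 ζ ⟨f.translate t, trivial⟩

theorem coord_lineValue (ζ : unitStrip) (f : c.Calderon) (t : ℝ) (i : Fin 1) :
    (c.lineValue ζ f t).coord i = f.toFun (ζ + t * I) := by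
  rw [lineValue, Rochberg.coord_mk, Calderon.taylor_one_eq, Calderon.toFun_translate]

/-- The values of a function on the line through `ζ`, as elements of the intermediate space. -/
def lineMap (c : BanachCouple X₀ X₁ E) (ζ : unitStrip) :
    c.calderonZero →ₗ[ℂ] (ℝ →ᵇ c.Intermediate ζ) where
  toFun f := BoundedContinuousFunction.ofNormedAddCommGroup (c.lineValue ζ f.1)
    ((Rochberg.mk ⊤ 1 ζ).continuous.comp
      ((Calderon.continuous_translate f.2).subtype_mk fun _ => trivial)) ‖f‖
    fun t => (Rochberg.norm_mk_le _).trans (f.1.norm_translate_le t)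
  map_add' f g := by
    refine BoundedContinuousFunction.ext fun t => Rochberg.coord_injective (funext fun i => ?_)
    change (c.lineValue ζ (f.1 + g.1) t).coord i =
      (c.lineValue ζ f.1 t).coord i + (c.lineValue ζ g.1 t).coord i
    simp only [coord_lineValue]
    rfl
  map_smul' a f := by
    refine BoundedContinuousFunction.ext fun t => Rochberg.coord_injective (funext fun i => ?_)
    change (c.lineValue ζ (a • f.1) t).coord i = a • (c.lineValue ζ f.1 t).coord i
    simp only [coord_lineValue]
    rfl

theorem coord_lineMap (ζ : unitStrip) (f : c.calderonZero) (t : ℝ) (i : Fin 1) :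
    (c.lineMap ζ f t).coord i = f.1.toFun (ζ + t * I) :=
  coord_lineValue ζ f.1 t i

theorem norm_lineMap_le (ζ : unitStrip) (f : c.calderonZero) (t : ℝ) :
    ‖c.lineMap ζ f t‖ ≤ ‖f‖ :=
  (Rochberg.norm_mk_le _).trans (f.1.norm_translate_le t)

theorem norm_boundedToL1_le {n : ℕ} [IsFiniteMeasure (stripMeasure n)] {X : Type*}
    [NormedAddCommGroup X] [NormedSpace ℂ X] (hn : 1 ≤ n) (b : ℝ →ᵇ X) {M : ℝ}
    (hb : ∀ t, ‖b t‖ ≤ M) :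
    ‖boundedToL1 (stripMeasure n) b‖ ≤ (∫ t, stripWeight n t) * M := by
  rw [norm_boundedToL1_stripMeasure, ← integral_mul_const]
  exact integral_mono (integrable_stripWeight_mul hn b.continuous.norm (fun _ => norm_nonneg _) hb)
    ((integrable_stripWeight hn).mul_const M)
    fun t => mul_le_mul_of_nonneg_left (hb t) (stripWeight_pos n t).le

/-- The criterion is applied to the boundary values on the line with reflexive range space; the
one-line estimate for `n = 1` is its hypothesis. -/
theorem isReflexiveSpace_intermediate (ζ : unitStrip)
    (h : IsReflexiveSpace X₀ ∨ IsReflexiveSpace X₁) : IsReflexiveSpace (c.Intermediate ζ) := by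
  have := isFiniteMeasure_stripMeasure le_rfl
  have hQ : ∀ x : c.Intermediate ζ, ∃ v, Rochberg.mk ⊤ 1 ζ v = x ∧ ‖v‖ ≤ ‖x‖ + 1 := fun x =>
    (Rochberg.exists_mk_eq x one_pos).imp fun v hv => ⟨hv.1, hv.2.le⟩
  rcases h with h | h
  · refine isReflexiveSpace_of_norm_le (μ := stripMeasure 1) h (Rochberg.mk ⊤ 1 ζ) hQ
      ((LinearMap.fst ℂ _ _).comp ((Calderon.bdry c).comp (Submodule.subtype ⊤)))
      (fun v t => v.1.norm_bdry₀_le t) fun ε hε => ?_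
    obtain ⟨C, hC, hle⟩ := exists_norm_mk_le_left (c := c) le_rfl ζ hε
    refine ⟨C, hC, fun v => (hle le_top v).trans (le_of_eq ?_)⟩
    rw [norm_boundedToL1_stripMeasure]
    rfl
  · refine isReflexiveSpace_of_norm_le (μ := stripMeasure 1) h (Rochberg.mk ⊤ 1 ζ) hQ
      ((LinearMap.snd ℂ _ _).comp ((Calderon.bdry c).comp (Submodule.subtype ⊤)))
      (fun v t => v.1.norm_bdry₁_le t) fun ε hε => ?_
    obtain ⟨C, hC, hle⟩ := exists_norm_mk_le_right (c := c) le_rfl ζ hε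
    refine ⟨C, hC, fun v => (hle le_top v).trans (le_of_eq ?_)⟩
    rw [norm_boundedToL1_stripMeasure]
    rfl

/-- The pairing is a Taylor coefficient of `⟨g, F⟩`, which the line estimate controls by the values
on the line through `ζ`. There the bound for functionals at `ζ`, applied to translates of `g` and
`f`, gives the norm of `f` in the intermediate space. -/
theorem exists_norm_rochbergPairing_mk_le (hc : c.IsRegular) {n : ℕ} (hn : 1 ≤ n)
    (z ζ : unitStrip) {ε : ℝ} (hε : 0 < ε) :
    ∃ C : ℝ, 0 ≤ C ∧ ∀ (g : (⊤ : Submodule ℂ (c.dual hc).Calderon)) (f : c.calderonZero)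
      (F : ℂ → c.inter), IsInterLift f.1 F →
      ‖rochbergPairing hc hn z (Rochberg.mk ⊤ n z g) (Rochberg.mk c.calderonZero n z f)‖ ≤
        ‖g‖ * (ε * ‖f‖ + C * ∫ t, stripWeight n t * ‖c.lineMap ζ f t‖) := by
  obtain ⟨K, hK, hle⟩ := exists_norm_apply_le (X₀ := X₀) (X₁ := X₁) (E := E) ζ
  obtain ⟨C, hC, hb⟩ := exists_norm_taylorCoeff_le_line hn z ζ hε
  refine ⟨C * K, by positivity, fun g f F hF => ?_⟩
  have e : Rochberg.mk c.calderonZero n z f = _ := hF.mk_eq_interJet f.2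
  rw [e, rochbergPairing_interJet, Rochberg.coord_mk,
    ← taylorCoeff_pairing hn g.1 hF.diffContOnCl]
  refine (hb _ (diffContOnCl_pairing g.1 hF) (‖g‖ * ‖f‖) fun w hw => norm_pairing_le g.1 hF hw).trans ?_
  have hpt : ∀ t : ℝ, ‖g.1.toFun (ζ + t * I) (F (ζ + t * I))‖ ≤ K * ‖g‖ * ‖c.lineMap ζ f t‖ := by
    intro t
    rw [← Calderon.toFun_translate]
    refine (hle (g.1.translate t) _ (c.lineMap ζ f t) ?_).trans ?_
    · rw [coord_lineMap, hF.toFun_eq _ (add_mul_I_mem_iff.2 (unitStrip_subset ζ.2))]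
    · exact mul_le_mul_of_nonneg_right (mul_le_mul_of_nonneg_left (g.1.norm_translate_le t) hK.le)
        (norm_nonneg _)
  have hint : ∫ t : ℝ, stripWeight n t * ‖g.1.toFun (ζ + t * I) (F (ζ + t * I))‖ ≤
      ∫ t : ℝ, K * ‖g‖ * (stripWeight n t * ‖c.lineMap ζ f t‖) := by
    refine integral_mono_of_nonneg (ae_of_all _ fun t =>
      mul_nonneg (stripWeight_pos n t).le (norm_nonneg _))
      ((integrable_stripWeight_mul hn (c.lineMap ζ f).continuous.norm (fun _ => norm_nonneg _)
        (norm_lineMap_le ζ f)).const_mul _) (ae_of_all _ fun t => ?_)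
    refine (mul_le_mul_of_nonneg_left (hpt t) (stripWeight_pos n t).le).trans (le_of_eq ?_)
    ring
  rw [integral_const_mul] at hint
  refine (add_le_add_right (mul_le_mul_of_nonneg_left hint hC) _).trans (le_of_eq ?_)
  ring

/-- Since `T_n` norms the Rochberg space, the pairing estimate becomes a norm estimate for functions
with values in the intersection. These are dense in `𝒞₀` and both sides are continuous. -/
theorem exists_norm_mk_le_lineMap (hc : c.IsRegular) {n : ℕ} (hn : 1 ≤ n)
    [IsFiniteMeasure (stripMeasure n)] (z ζ : unitStrip) {ε : ℝ} (hε : 0 < ε) :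
    ∃ C : ℝ, 0 ≤ C ∧ ∀ f : c.calderonZero, ‖Rochberg.mk c.calderonZero n z f‖ ≤
      ε * ‖f‖ + C * ‖boundedToL1 (stripMeasure n) (c.lineMap ζ f)‖ := by
  have hk := pairingConst_pos hn z
  obtain ⟨C, hC, hb⟩ := exists_norm_rochbergPairing_mk_le hc hn z ζ
    (show 0 < ε / (2 * pairingConst hn z) by positivity)
  refine ⟨pairingConst hn z * (2 * C), by positivity, fun f => ?_⟩
  let J : c.calderonZero →L[ℂ] Lp (c.Intermediate ζ) 1 (stripMeasure n) :=
    LinearMap.mkContinuous ((boundedToL1 (stripMeasure n)).comp (c.lineMap ζ))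
      (∫ t, stripWeight n t) fun f => norm_boundedToL1_le hn _ (norm_lineMap_le ζ f)
  have hcl : IsClosed {f : c.calderonZero | ‖Rochberg.mk c.calderonZero n z f‖ ≤
      ε * ‖f‖ + pairingConst hn z * (2 * C) * ‖J f‖} :=
    isClosed_le (Rochberg.mk c.calderonZero n z).continuous.norm
      ((continuous_const.mul continuous_norm).add (continuous_const.mul J.continuous.norm))
  suffices hsub : {f : c.calderonZero | ∃ F, IsInterLift f.1 F} ⊆ {f : c.calderonZero |
      ‖Rochberg.mk c.calderonZero n z f‖ ≤ ε * ‖f‖ + pairingConst hn z * (2 * C) * ‖J f‖} by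
    refine closure_minimal hsub hcl (Metric.mem_closure_iff.2 fun δ hδ => ?_)
    obtain ⟨g, G, hG, hg, hle⟩ := exists_isInterLift_norm_sub_le f.2 (half_pos hδ)
    refine ⟨⟨g, hg⟩, ⟨G, hG⟩, ?_⟩
    rw [dist_eq_norm]
    exact lt_of_le_of_lt hle (half_lt_self hδ)
  rintro f ⟨F, hF⟩
  have h1 := le_sSup_rochbergPairing hc hn (Rochberg.mk c.calderonZero n z f)
  rw [inv_mul_le_iff₀ hk] at h1
  refine h1.trans ?_
  have h2 : sSup {r : ℝ | ∃ ξ, ‖ξ‖ ≤ 1 ∧ r = ‖rochbergPairing hc hn z ξ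
      (Rochberg.mk c.calderonZero n z f)‖} ≤
      2 * (ε / (2 * pairingConst hn z) * ‖f‖ + C * ‖J f‖) := by
    refine csSup_le ⟨_, 0, by simp, rfl⟩ ?_
    rintro r ⟨ξ, hξ, rfl⟩
    obtain ⟨g, rfl, hg⟩ := Rochberg.exists_mk_eq ξ one_pos
    have h3 := hb g f F hF
    rw [← norm_boundedToL1_stripMeasure] at h3
    -- The representative `g` has norm below `‖ξ‖ + 1 ≤ 2`.
    exact h3.trans (mul_le_mul_of_nonneg_right (by linarith) (by positivity))
  refine (mul_le_mul_of_nonneg_left h2 hk.le).trans (le_of_eq ?_)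
  field_simp

theorem isReflexiveSpace_rochberg (hc : c.IsRegular) {n : ℕ} (hn : 1 ≤ n) (z : unitStrip)
    {ζ : unitStrip} (h : IsReflexiveSpace (c.Intermediate ζ)) :
    IsReflexiveSpace (Rochberg c.calderonZero n z) := by
  have := isFiniteMeasure_stripMeasure hn
  exact isReflexiveSpace_of_norm_le (μ := stripMeasure n) h (Rochberg.mk c.calderonZero n z)
    (fun x => (Rochberg.exists_mk_eq x one_pos).imp fun v hv => ⟨hv.1, hv.2.le⟩) (c.lineMap ζ)
    (norm_lineMap_le ζ) fun ε hε => exists_norm_mk_le_lineMap hc hn z ζ hε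

/-- Reflexivity of the Rochberg space turns the bounded weak* approximation of functionals into weak
approximation, which gives surjectivity. -/
theorem isInvertible_rochbergPairing_of_isReflexiveSpace (hc : c.IsRegular) {n : ℕ} (hn : 1 ≤ n)
    (z : unitStrip) {ζ : unitStrip} (h : IsReflexiveSpace (c.Intermediate ζ)) :
    (rochbergPairing hc hn z).IsInvertible :=
  isInvertible_of_bijective (rochbergPairing_injective hn z)
    (surjective_of_isReflexiveSpace (isReflexiveSpace_rochberg hc hn z h) _
      (exists_tendsto_rochbergPairing hc hn))

theorem isInvertible_rochbergPairing_of_isAsplund (hc : c.IsRegular) {n : ℕ} (hn : 1 ≤ n)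
    (z : unitStrip) (h : IsAsplund X₀ ∨ IsAsplund X₁) : (rochbergPairing hc hn z).IsInvertible :=
  isInvertible_of_bijective (rochbergPairing_injective hn z)
    (rochbergPairing_surjective_of_hasDensity hc hn z
      (h.imp (fun h S => hasDensity_of_isAsplund h hn S) fun h S => hasDensity_of_isAsplund h hn S))

end BanachCouple

/-! ### The theorem. -/

theorem mainTheorem8 (n : ℕ) (hn : 1 ≤ n) (z : unitStrip) :
    ∃ k K : ℝ, 0 < k ∧ 0 < K ∧
    ∀ {X₀ X₁ E : Type*}
      [NormedAddCommGroup X₀] [NormedSpace ℂ X₀] [CompleteSpace X₀]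
      [NormedAddCommGroup X₁] [NormedSpace ℂ X₁] [CompleteSpace X₁]
      [NormedAddCommGroup E] [NormedSpace ℂ E] [CompleteSpace E]
      (c : BanachCouple X₀ X₁ E) (hc : c.IsRegular),
      (∃ T : BanachCouple.Rochberg (c := c.dual hc) ⊤ n z →L[ℂ]
          StrongDual ℂ (BanachCouple.Rochberg c.calderonZero n z),
        c.IsRochbergPairing hc n z T ∧
        (∀ T', c.IsRochbergPairing hc n z T' → T' = T) ∧
        ‖T‖ ≤ 1 / Metric.infDist (z : ℂ) (frontier unitStrip) ^ (n - 1) ∧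
        (∀ x : BanachCouple.Rochberg c.calderonZero n z,
          k * ‖x‖ ≤ sSup {r : ℝ | ∃ ξ, ‖ξ‖ ≤ 1 ∧ r = ‖T ξ x‖} ∧
          sSup {r : ℝ | ∃ ξ, ‖ξ‖ ≤ 1 ∧ r = ‖T ξ x‖} ≤ K * ‖x‖) ∧
        ((∃ ζ : unitStrip, IsReflexiveSpace (c.Intermediate ζ)) → T.IsInvertible) ∧
        (IsAsplund X₀ ∨ IsAsplund X₁ → T.IsInvertible)) ∧
      (IsReflexiveSpace X₀ ∨ IsReflexiveSpace X₁ →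
        ∃ ζ : unitStrip, IsReflexiveSpace (c.Intermediate ζ)) := by
  have hR := infDist_frontier_pos z
  -- Both constants come from scalar constructions depending only on `n` and `z`, so they serve all
  -- couples at once.
  refine ⟨(BanachCouple.pairingConst hn z)⁻¹, 1 / Metric.infDist (z : ℂ) (frontier unitStrip) ^ (n - 1),
    inv_pos.2 (BanachCouple.pairingConst_pos hn z), by positivity, ?_⟩
  intro X₀ X₁ E _ _ _ _ _ _ _ _ _ c hc
  refine ⟨⟨BanachCouple.rochbergPairing hc hn z, BanachCouple.isRochbergPairing_rochbergPairing hn z,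
    fun T' hT' => hT'.eq_rochbergPairing hn, BanachCouple.norm_rochbergPairing_le hn z,
    fun x => ⟨BanachCouple.le_sSup_rochbergPairing hc hn x,
      csSup_le ⟨_, 0, by simp, rfl⟩ (BanachCouple.bddAbove_rochbergPairing hc hn x)⟩,
    fun ⟨ζ, hζ⟩ => BanachCouple.isInvertible_rochbergPairing_of_isReflexiveSpace hc hn z hζ,
    BanachCouple.isInvertible_rochbergPairing_of_isAsplund hc hn z⟩,
    -- Every point of the strip would do as `ζ`.
    fun h => ⟨z, BanachCouple.isReflexiveSpace_intermediate z h⟩⟩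

end
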